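/- For strings $S_1,S_2$ of length $n$ over the alphabet $\Sigma=\{1,\dots,\sigma\}$, let $\mathsf{Ham}(S_1,S_2)$ be the number of positions at which they differ, let $\mathsf{cyc}$ be the cyclic shift of a string by one position to the left, and let $\mathsf{sh}(S_1,S_2)=\min\{\mathsf{Ham}(S_1,\mathsf{cyc}^m(S_2)) : m\in\mathbb{Z}\}$ be the shift distance. Let $\omega$ be a public random string, an infinite sequence of independent fair coin flips. **Statement.** There exist a single program $P$ for the word RAM and constants $a,C,d\in\mathbb{N}$ and $c>0$ such that for all integers $1\le k\le n$ and all $\sigma\ge 0$ there exist randomized functions (functions depending measurably on $\omega$) $$\mathtt{sk}:\Sigma^n\to\{0,1\}^*,\qquad \mathtt{dec}:\{0,1\}^*\times\{0,1\}^*\to\mathbb{N}$$ with the following properties. 1. (Exact $k$-mismatch shift-distance sketch.) For every $S_1,S_2\in\Sigma^n$, with probability at least $1-n^{-c}$: if $\mathsf{sh}(S_1,S_2)\le k$, then $\mathtt{dec}(\mathtt{sk}(S_1),\mathtt{sk}(S_2))=\mathsf{sh}(S_1,S_2)$; otherwise, $\mathtt{dec}(\mathtt{sk}(S_1),\mathtt{sk}(S_2))>k$.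 2. (Size $\tilde O(k)$.) For every $S\in\Sigma^n$, with probability at least $1-n^{-c}$, $|\mathtt{sk}(S)|\le C\,k\,(\lfloor\log_2 n\rfloor+1)^d$. 3. (Decoding time $\tilde O(k^2)$.) For every $S_1,S_2\in\Sigma^n$ and every $\omega$, the program $P$, run on a word RAM with words of $a(\lfloor\log_2 n\rfloor+1)$ bits and with read access to $\omega$, given $n$, $k$, $\mathtt{sk}(S_1)$ and $\mathtt{sk}(S_2)$ together with the lengths of the two sketches, halts with the output $\mathtt{dec}(\mathtt{sk}(S_1),\mathtt{sk}(S_2))$ after at most $C\,k^2\,(\lfloor\log_2 n\rfloor+1)^d$ steps. Here the word RAM has unit-cost arithmetic, comparison and bitwise operations on words, unit-cost loads and stores in random-access memory, and unit-cost tests; the sketches are placed in memory with one bit per cell, and the rest of the memory is initially zero. No bound is put on the time for computing $\mathtt{sk}$. -/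

import Mathlib

namespace ShiftSketch

/-! ### Strings, rotations, and the shift distance -/

/-- The set of strings of length `n` over an alphabet with `σ` characters. -/
abbrev Str (n σ : ℕ) : Type := Fin n → Fin σ

/-- The cyclic shift by one position to the left, `S[1] S[2] ⋯ S[n] ↦ S[2] ⋯ S[n] S[1]`, as a
permutation of the set of strings, so that `cyc ^ m` makes sense for every integer `m`. -/
def cyc {n σ : ℕ} : Equiv.Perm (Str n σ) :=
  (finRotate n).symm.arrowCongr (Equiv.refl (Fin σ))

theorem cyc_apply {n σ : ℕ} (S : Str n σ) (i : Fin n) : cyc S i = S (finRotate n i) := rfl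

/-- The shift distance: the minimum over `m : ℤ` of the Hamming distance of `S₁` and
`cyc ^ m` applied to `S₂` (an infimum of a nonempty set of natural numbers is its minimum). -/
noncomputable def sh {n σ : ℕ} (S₁ S₂ : Str n σ) : ℕ :=
  ⨅ m : ℤ, hammingDist S₁ ((cyc ^ m) S₂)

/-! ### Public randomness -/

/-- The public random string: an infinite sequence of bits. -/
abbrev Coins : Type := ℕ → Bool

/-- The law of the public random string: independent fair coin flips. -/
noncomputable def coinMeasure : MeasureTheory.Measure Coins :=
  MeasureTheory.Measure.infinitePi fun _ : ℕ => (PMF.uniformOfFintype Bool).toMeasure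

/-- The event `E` has probability at least `1 - n ^ (-c)`, expressed by bounding the
probability of its complement. -/
def WithHighProb (c : ℝ) (n : ℕ) (E : Coins → Prop) : Prop :=
  coinMeasure {ω | ¬ E ω} ≤ ENNReal.ofReal ((n : ℝ) ^ (-c))

/-! ### Sketches -/

/-- `(sk, dec)` is an exact `k`-mismatch shift distance sketch for the set of all strings of length
`n` over `σ` characters, with error probability at most `n ^ (-c)`. Both `sk` and `dec` are
randomized functions, that is, function-valued random variables on the public random string. -/
structure IsESDS (c : ℝ) {n σ : ℕ} (k : ℕ) (sk : Coins → Str n σ → List Bool)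
    (dec : Coins → List Bool → List Bool → ℕ) : Prop where
  measurable_sk : ∀ (S : Str n σ) (x : List Bool), MeasurableSet {ω | sk ω S = x}
  measurable_dec : ∀ (x y : List Bool) (v : ℕ), MeasurableSet {ω | dec ω x y = v}
  correct : ∀ S₁ S₂ : Str n σ, WithHighProb c n fun ω =>
    (sh S₁ S₂ ≤ k → dec ω (sk ω S₁) (sk ω S₂) = sh S₁ S₂) ∧
    (k < sh S₁ S₂ → k < dec ω (sk ω S₁) (sk ω S₂))

/-- The sketch has size `s`: every string has, with high probability, a sketch of at most
`s` bits. -/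
def HasSize (c : ℝ) {n σ : ℕ} (sk : Coins → Str n σ → List Bool) (s : ℕ) : Prop :=
  ∀ S : Str n σ, WithHighProb c n fun ω => (sk ω S).length ≤ s

/-! ### The word RAM

A word RAM with `w`-bit words, in structured form: programs are built from unit-cost instructions by
sequencing, branching and looping. The machine has registers, a random-access memory, and
read access to the public random string. A program is a finite object that does not depend on
the word size or on the input. -/

/-- Unit-cost binary operations on words. -/
inductive Op : Type
  | add | sub | mul | div | mod | lt | eq | and | or | xor | shl | shr

/-- The value of an operation on natural numbers, before reduction to a word. Subtraction is
truncated at `0`, comparisons return `0` or `1`, division by `0` returns `0`. -/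
def Op.eval : Op → ℕ → ℕ → ℕ
  | add, a, b => a + b
  | sub, a, b => a - b
  | mul, a, b => a * b
  | div, a, b => a / b
  | mod, a, b => a % b
  | lt, a, b => if a < b then 1 else 0
  | eq, a, b => if a = b then 1 else 0
  | and, a, b => a &&& b
  | or, a, b => a ||| b
  | xor, a, b => a ^^^ b
  | shl, a, b => a <<< b
  | shr, a, b => a >>> b

/-- Instructions; the arguments `d`, `a`, `b` are names of registers. -/
inductive Instr : Type
  /-- `R[d] := v` -/
  | const (d v : ℕ)
  /-- `R[d] := R[a] o R[b]` -/
  | op (o : Op) (d a b : ℕ)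
  /-- `R[d] := M[R[a]]` -/
  | load (d a : ℕ)
  /-- `M[R[a]] := R[b]` -/
  | store (a b : ℕ)
  /-- `R[d] :=` the bit of the public random string at position `R[a]` -/
  | coin (d a : ℕ)

/-- The contents of the registers and of the memory. -/
structure State : Type where
  reg : ℕ → ℕ
  mem : ℕ → ℕ

/-- The effect of one instruction on a machine with `w`-bit words: whatever is computed is
reduced modulo `2 ^ w`. -/
def Instr.step (w : ℕ) (ω : Coins) : Instr → State → State
  | const d v, s => { s with reg := Function.update s.reg d (v % 2 ^ w) }
  | op o d a b, s => { s with reg := Function.update s.reg d (o.eval (s.reg a) (s.reg b) % 2 ^ w) }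
  | load d a, s => { s with reg := Function.update s.reg d (s.mem (s.reg a)) }
  | store a b, s => { s with mem := Function.update s.mem (s.reg a) (s.reg b) }
  | coin d a, s => { s with reg := Function.update s.reg d ((ω (s.reg a)).toNat % 2 ^ w) }

/-- Structured programs. Tests ask whether a register is nonzero. -/
inductive Prog : Type
  | instr (i : Instr)
  | seq (p q : Prog)
  | ite (r : ℕ) (p q : Prog)
  | loop (r : ℕ) (p : Prog)

/-- `Exec w ω p s u t`: started in state `s`, the program `p` halts in state `u` after exactly `t`
steps, where each instruction and each evaluation of a test is one step. -/
inductive Exec (w : ℕ) (ω : Coins) : Prog → State → State → ℕ → Prop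
  | instr (i : Instr) (s : State) : Exec w ω (.instr i) s (i.step w ω s) 1
  | seq {p q : Prog} {s u v : State} {t₁ t₂ : ℕ} :
      Exec w ω p s u t₁ → Exec w ω q u v t₂ → Exec w ω (.seq p q) s v (t₁ + t₂)
  | ite_true {r : ℕ} {p q : Prog} {s u : State} {t : ℕ} :
      s.reg r ≠ 0 → Exec w ω p s u t → Exec w ω (.ite r p q) s u (t + 1)
  | ite_false {r : ℕ} {p q : Prog} {s u : State} {t : ℕ} :
      s.reg r = 0 → Exec w ω q s u t → Exec w ω (.ite r p q) s u (t + 1)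
  | loop_done {r : ℕ} {p : Prog} {s : State} :
      s.reg r = 0 → Exec w ω (.loop r p) s s 1
  | loop_step {r : ℕ} {p : Prog} {s u v : State} {t₁ t₂ : ℕ} :
      s.reg r ≠ 0 → Exec w ω p s u t₁ → Exec w ω (.loop r p) u v t₂ →
        Exec w ω (.loop r p) s v (t₁ + t₂ + 1)

/-- The initial state of a decoder: the parameters `n`, `k` and the lengths of the two sketches
`x`, `y` are in registers `0`, `1`, `2`, `3`, and the memory holds the bits of `x` followed by the
bits of `y`, one bit per cell. All other registers and memory cells are `0`. -/
def initState (w n k : ℕ) (x y : List Bool) : State where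
  reg := fun i => (([n, k, x.length, y.length] : List ℕ).getD i 0) % 2 ^ w
  mem := fun i => ((x ++ y).getD i false).toNat % 2 ^ w

/-- The program `P`, on a machine with `w`-bit words, evaluates `dec` on sketches of strings in at
most `T` steps; the result is in register `0`. -/
def HasDecodingTime (P : Prog) (w : ℕ) {n σ : ℕ} (k : ℕ) (sk : Coins → Str n σ → List Bool)
    (dec : Coins → List Bool → List Bool → ℕ) (T : ℕ) : Prop :=
  ∀ (ω : Coins) (S₁ S₂ : Str n σ), ∃ (u : State) (t : ℕ),
    Exec w ω P (initState w n k (sk ω S₁) (sk ω S₂)) u t ∧ t ≤ T ∧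
      u.reg 0 = dec ω (sk ω S₁) (sk ω S₂)

end ShiftSketch

/-!
Two strings are compared through *anchors*. The encoder samples positions with probability about
`1 / (16 * k)` from the public coins and looks at the contents of all rotations of its string at the
sampled positions. Rotations of two strings that have the same content are at distance at most
`capa n k = Õ(k)`, and if some rotations of the two strings are at distance at most `k`, then many
contents are common. Selecting contents (with multiplicity) with probability about `1 / (4 * n)`,
again from public coins, yields one common content with constant probability (`le_pr_anchor`). Each
string is rotated to a position with the selected content, its anchor. With `O(log n)` independent
repetitions, one of them brings the two strings within distance `capa n k` with high probability, so
that a rotation of least distance becomes a *near-period*, a rotation that changes either of the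
anchored strings in few positions. The characters are first hashed to `O(log n)` bits.

Distances up to `capa n k` are computed from `Õ(k)` fingerprints: positions are hashed to buckets,
each bucket is split into residue classes modulo `p + 1` for all small `p`, and a fingerprint is the
sum of random values of the characters in a class. Counting the classes whose fingerprints differ
never gives more than the distance (`est_le`), and with high probability not less (`pr_est_lt_le`):
few mismatches share a bucket, and some modulus separates them (`exists_mod_injOn`). Fingerprints
are additive, so those of a rotation are found from those of the string and the places where it
changes (`cell_shift_add`).

It remains to try all near-periods in the time allowed. There are two cases.

* If there are at most `Õ(k)` near-periods, then all of them are subset sums of `O(log n)` of them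
  (`exists_generators`). The sketch lists the changes under these generators, and the subsets. The
  decoder updates the fingerprints for each subset, in time `Õ(k)`, and takes the estimate.
* If there are more, then no rotation changes a moderate number of positions (`card_per_le`,
  `per_gap`), so the near-periods form a subgroup of `ZMod n` (`exists_addSubgroup_of_gap`), and the
  string is invariant under it up to `Õ(k)` exceptions (`exists_template`). The distances for the
  rotations in the subgroup are then determined by the distance for the rotation by `0` and by the
  pairs of exceptions (`hammingDist_eq_of_lists`). There are `Õ(k ^ 2)` pairs, and offsets that are
  not the offset of a pair all give the same distance (`forall_cand_iff`).

Unless an estimate fails, no value that the decoder finds is below the shift distance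
(`repBound_of_forall`), and a repetition with good anchors attains it (`le_of_repBound`).

The decoder is written in a small imperative language, with a compiler to the word RAM. Its
semantics uses unbounded numbers; a static check bounds all values by powers of `2 ^ lg n`, so that
words of `O(log n)` bits do not overflow (`St.exec_compile`). Another static computation bounds the
time by a polynomial in `k` and `lg n` (`St.cost_le`). The function `dec` is the semantics of this
program on the coins that the machine can address; it depends on finitely many coins and hence
measurably on them, and probabilities are computed by counting (`coinMeasure_eq_pr`).
-/

namespace ShiftSketch

/-! ### A small imperative language over the word RAM -/

/-- Expressions over variables, with memory and coin access. `clamp a b` is `a % (b + 1)`. -/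
inductive Ex : Type
  | var (x : ℕ)
  | lit (v : ℕ)
  | op (o : Op) (a b : Ex)
  | clamp (a b : Ex)
  | load (a : Ex)
  | coin (a : Ex)

/-- Statements. `loop x N p` runs `p` for `x = 0, …, R[N] - 1`. -/
inductive St : Type
  | assign (x : ℕ) (e : Ex)
  | store (a e : Ex)
  | seq (p q : St)
  | ite (e : Ex) (p q : St)
  | loop (x N : ℕ) (p : St)

/-- Assign `v` to variable `x`. -/
def State.set (s : State) (x v : ℕ) : State := { s with reg := Function.update s.reg x v }

/-- Write `v` to memory cell `a`. -/
def State.write (s : State) (a v : ℕ) : State := { s with mem := Function.update s.mem a v }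

/-- The value of an expression, over unbounded natural numbers. -/
def Ex.eval (ω : Coins) : Ex → State → ℕ
  | var x, s => s.reg x
  | lit v, _ => v
  | op o a b, s => o.eval (a.eval ω s) (b.eval ω s)
  | clamp a b, s => a.eval ω s % (b.eval ω s + 1)
  | load a, s => s.mem (a.eval ω s)
  | coin a, s => (ω (a.eval ω s)).toNat

/-- The states at the heads of the iterations of a counting loop with counter `x`. -/
def iter (f : State → State) (x : ℕ) (s : State) : ℕ → State
  | 0 => s
  | i + 1 => f ((iter f x s i).set x i)

/-- The effect of a statement, over unbounded natural numbers. -/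
def St.run (ω : Coins) : St → State → State
  | assign x e, s => s.set x (e.eval ω s)
  | store a e, s => s.write (a.eval ω s) (e.eval ω s)
  | seq p q, s => q.run ω (p.run ω s)
  | ite e p q, s => if e.eval ω s ≠ 0 then p.run ω s else q.run ω s
  | loop x N p, s => (iter (p.run ω) x s (s.reg N)).set x (s.reg N)

/-- Variables are registers below `tmpBase`; the registers above serve as evaluation stack. -/
def tmpBase : ℕ := 1000

/-- Code that leaves the value of an expression in stack register `t`. -/
def Ex.compile : Ex → ℕ → Prog
  | var x, t => .instr (.op .or (tmpBase + t) x x)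
  | lit v, t => .instr (.const (tmpBase + t) v)
  | op o a b, t => .seq (a.compile t) (.seq (b.compile (t + 1))
      (.instr (.op o (tmpBase + t) (tmpBase + t) (tmpBase + t + 1))))
  | clamp a b, t => .seq (a.compile t) (.seq (b.compile (t + 1)) (.seq
      (.instr (.const (tmpBase + t + 2) 1)) (.seq
      (.instr (.op .add (tmpBase + t + 1) (tmpBase + t + 1) (tmpBase + t + 2)))
      (.instr (.op .mod (tmpBase + t) (tmpBase + t) (tmpBase + t + 1))))))
  | load a, t => .seq (a.compile t) (.instr (.load (tmpBase + t) (tmpBase + t)))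
  | coin a, t => .seq (a.compile t) (.instr (.coin (tmpBase + t) (tmpBase + t)))

/-- Translation of statements to RAM programs. -/
def St.compile : St → Prog
  | assign x e => .seq (e.compile 0) (.instr (.op .or x tmpBase tmpBase))
  | store a e => .seq (a.compile 0) (.seq (e.compile 1) (.instr (.store tmpBase (tmpBase + 1))))
  | seq p q => .seq p.compile q.compile
  | ite e p q => .seq (e.compile 0) (.ite tmpBase p.compile q.compile)
  | loop x N p => .seq (.instr (.const x 0)) (.seq (.instr (.op .lt tmpBase x N))
      (.loop tmpBase (.seq p.compile (.seq (.instr (.const tmpBase 1))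
        (.seq (.instr (.op .add x x tmpBase)) (.instr (.op .lt tmpBase x N)))))))

/-- Running time of the code of an expression. -/
def Ex.cost : Ex → ℕ
  | var _ => 1
  | lit _ => 1
  | op _ a b => a.cost + (b.cost + 1)
  | clamp a b => a.cost + (b.cost + (1 + (1 + 1)))
  | load a => a.cost + 1
  | coin a => a.cost + 1

/-- A bound on the running time of the code of a statement, when each loop bound `N` has the value
`ρ N` throughout. -/
def St.cost (ρ : ℕ → ℕ) : St → ℕ
  | assign _ e => e.cost + 1
  | store a e => a.cost + e.cost + 1
  | seq p q => p.cost ρ + q.cost ρ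
  | ite e p q => e.cost + 1 + (p.cost ρ + q.cost ρ)
  | loop _ N p => ρ N * (p.cost ρ + 4) + 3

/-- If `a < 2 ^ (i * l)` and `b < 2 ^ (j * l)`, then `o.eval a b < 2 ^ (o.deg i j * l)`; the value
for `shl` is a junk value that `Ex.ok` rejects. -/
def Op.deg (o : Op) (i j : ℕ) : ℕ :=
  match o with
  | .add => max i j + 1
  | .sub => i
  | .mul => i + j
  | .div => i
  | .mod => i
  | .lt => 1
  | .eq => 1
  | .and => i
  | .or => max i j
  | .xor => max i j
  | .shl => 0
  | .shr => i

/-- If variable `x` is below `2 ^ (Γ x * l)` and all memory cells are below `2 ^ (D * l)`, then the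
expression is below `2 ^ (deg * l)`. -/
def Ex.deg (Γ : ℕ → ℕ) (D : ℕ) : Ex → ℕ
  | var x => Γ x
  | lit v => Nat.log2 v + 1
  | op o a b => o.deg (a.deg Γ D) (b.deg Γ D)
  | clamp _ b => b.deg Γ D
  | load _ => D
  | coin _ => 1

/-- The expression uses only variables, and all intermediate values have degree at most `A`. -/
def Ex.ok (Γ : ℕ → ℕ) (D A : ℕ) : Ex → Bool
  | var x => decide (x < tmpBase) && decide (Γ x ≤ A)
  | lit v => decide (Nat.log2 v + 1 ≤ A)
  | op o a b => a.ok Γ D A && b.ok Γ D A && decide ((op o a b).deg Γ D ≤ A) &&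
      (match o with | .shl => false | _ => true)
  | clamp a b => a.ok Γ D A && b.ok Γ D A && decide (b.deg Γ D + 1 ≤ A)
  | load a => a.ok Γ D A && decide (D ≤ A)
  | coin a => a.ok Γ D A && decide (1 ≤ A)

/-- The variables that a statement may write. -/
def St.writes : St → List ℕ
  | assign x _ => [x]
  | store _ _ => []
  | seq p q => p.writes ++ q.writes
  | ite _ p q => p.writes ++ q.writes
  | loop x _ p => x :: p.writes

/-- The static check: no overflow occurs, only variables in `W` are written, and loop bounds and
loop counters are not modified by loop bodies. -/
def St.ok (Γ : ℕ → ℕ) (D A : ℕ) (W : List ℕ) : St → Bool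
  | assign x e => decide (x < tmpBase) && e.ok Γ D A && decide (e.deg Γ D ≤ Γ x) && W.contains x
  | store a e => a.ok Γ D A && e.ok Γ D A && decide (e.deg Γ D ≤ D)
  | seq p q => p.ok Γ D A W && q.ok Γ D A W
  | ite e p q => e.ok Γ D A && p.ok Γ D A W && q.ok Γ D A W
  | loop x N p => decide (x < tmpBase) && decide (N < tmpBase) && decide (Γ N ≤ Γ x) &&
      decide (Γ N ≤ A) && decide (1 ≤ A) && W.contains x && !(W.contains N) &&
      !(p.writes.contains x) && p.ok Γ D A W

/-- The values of variables and memory cells obey the degrees. -/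
structure State.Fits (Γ : ℕ → ℕ) (D l : ℕ) (s : State) : Prop where
  reg : ∀ x, x < tmpBase → s.reg x < 2 ^ (Γ x * l)
  mem : ∀ a, s.mem a < 2 ^ (D * l)

/-- The degree of an operation bounds its result; truncated subtraction, division and remainder do
not increase their first argument. -/
theorem Op.eval_lt {o : Op} {a b i j l : ℕ} (hl : 1 ≤ l) (ha : a < 2 ^ (i * l))
    (hb : b < 2 ^ (j * l)) (ho : o ≠ .shl) :
    o.eval a b < 2 ^ (o.deg i j * l) := by
  have h2 : (2:ℕ) ≤ 2 ^ l := by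
    calc (2:ℕ) = 2 ^ 1 := rfl
      _ ≤ 2 ^ l := Nat.pow_le_pow_right (by norm_num) hl
  have ha' : a < 2 ^ (max i j * l) := ha.trans_le
    (Nat.pow_le_pow_right (by norm_num) (Nat.mul_le_mul_right _ (le_max_left _ _)))
  have hb' : b < 2 ^ (max i j * l) := hb.trans_le
    (Nat.pow_le_pow_right (by norm_num) (Nat.mul_le_mul_right _ (le_max_right _ _)))
  cases o <;> simp only [Op.eval, Op.deg]
  · rw [add_mul, one_mul, pow_add]
    nlinarith
  · omega
  · rw [add_mul, pow_add]
    exact Nat.mul_lt_mul'' ha hb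
  · exact (Nat.div_le_self _ _).trans_lt ha
  · exact (Nat.mod_le _ _).trans_lt ha
  · rw [one_mul]; split_ifs <;> omega
  · rw [one_mul]; split_ifs <;> omega
  · exact (Nat.and_le_left).trans_lt ha
  · exact Nat.or_lt_two_pow ha' hb'
  · exact Nat.xor_lt_two_pow ha' hb'
  · exact absurd rfl ho
  · rw [Nat.shiftRight_eq_div_pow]
    exact (Nat.div_le_self _ _).trans_lt ha

/-- A checked expression has a value within its degree, hence one that fits into a word. -/
theorem Ex.eval_lt {Γ : ℕ → ℕ} {D A l : ℕ} {s : State} (ω : Coins) (hl : 1 ≤ l)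
    (hs : s.Fits Γ D l) : ∀ {e : Ex}, e.ok Γ D A = true →
      e.eval ω s < 2 ^ (e.deg Γ D * l) ∧ e.deg Γ D ≤ A := by
  intro e
  have h2 : (2:ℕ) ≤ 2 ^ (1 * l) := by
    calc (2:ℕ) = 2 ^ 1 := rfl
      _ ≤ 2 ^ (1 * l) := Nat.pow_le_pow_right (by norm_num) (by omega)
  induction e with
  | var x =>
    intro h
    simp only [Ex.ok, Bool.and_eq_true, decide_eq_true_eq] at h
    exact ⟨hs.reg x h.1, h.2⟩
  | lit v =>
    intro h
    simp only [Ex.ok, decide_eq_true_eq] at h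
    refine ⟨?_, h⟩
    refine (Nat.lt_log2_self (n := v)).trans_le (Nat.pow_le_pow_right (by norm_num) ?_)
    exact Nat.le_mul_of_pos_right _ hl
  | op o a b iha ihb =>
    intro h
    simp only [Ex.ok, Bool.and_eq_true, decide_eq_true_eq] at h
    obtain ⟨⟨⟨h1, h2⟩, h3⟩, h4⟩ := h
    refine ⟨?_, h3⟩
    have := Op.eval_lt (o := o) hl (iha h1).1 (ihb h2).1 (by rintro rfl; simp at h4)
    simp only [Ex.eval, Ex.deg]
    exact this
  | clamp a b iha ihb =>
    intro h
    simp only [Ex.ok, Bool.and_eq_true, decide_eq_true_eq] at h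
    simp only [Ex.eval, Ex.deg]
    refine ⟨?_, by omega⟩
    have h1 : a.eval ω s % (b.eval ω s + 1) < b.eval ω s + 1 := Nat.mod_lt _ (Nat.succ_pos _)
    have h2 := (ihb h.1.2).1
    omega
  | load a iha =>
    intro h
    simp only [Ex.ok, Bool.and_eq_true, decide_eq_true_eq] at h
    exact ⟨hs.mem _, h.2⟩
  | coin a iha =>
    intro h
    simp only [Ex.ok, Bool.and_eq_true, decide_eq_true_eq] at h
    refine ⟨?_, h.2⟩
    simp only [Ex.eval, Ex.deg]
    have := Bool.toNat_lt (ω (a.eval ω s))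
    omega

/-- A machine state represents a state of the language: they agree on variables and memory. -/
structure Sim (s u : State) : Prop where
  reg : ∀ x, x < tmpBase → u.reg x = s.reg x
  mem : u.mem = s.mem

/-- The code of a checked expression leaves its value in stack register `t` and changes no register
below. The value may refer to coins `ω'` that agree with the coins of the machine only on the
addresses that fit into a word: larger addresses do not occur. -/
theorem Ex.exec_compile {Γ : ℕ → ℕ} {D A l w : ℕ} {s : State} {ω ω' : Coins} (hl : 1 ≤ l)
    (hw : A * l ≤ w) (hω : ∀ i < 2 ^ w, ω' i = ω i) (hs : s.Fits Γ D l) :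
    ∀ {e : Ex}, e.ok Γ D A = true → ∀ (t : ℕ) (u : State), Sim s u → ∃ v,
      Exec w ω (e.compile t) u v e.cost ∧ Sim s v ∧ v.reg (tmpBase + t) = e.eval ω' s ∧
        ∀ x < tmpBase + t, v.reg x = u.reg x := by
  intro e
  have hb : ∀ {e : Ex}, e.ok Γ D A = true → e.eval ω' s < 2 ^ w := fun h => by
    obtain ⟨h1, h2⟩ := Ex.eval_lt ω' hl hs h
    exact h1.trans_le (Nat.pow_le_pow_right (by norm_num) ((Nat.mul_le_mul_right _ h2).trans hw))
  have hsim : ∀ {u : State} {t v : ℕ}, Sim s u →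
      Sim s { u with reg := Function.update u.reg (tmpBase + t) v } := by
    intro u t v hu
    refine ⟨fun x hx => ?_, hu.mem⟩
    have : x ≠ tmpBase + t := by omega
    simp [this, hu.reg x hx]
  have hfr : ∀ {u : State} {t v : ℕ}, ∀ x < tmpBase + t,
      Function.update u.reg (tmpBase + t) v x = u.reg x := by
    intro u t v x hx
    have : x ≠ tmpBase + t := by omega
    simp [this]
  induction e with
  | var x =>
    intro h t u hu
    have hx := h
    simp only [Ex.ok, Bool.and_eq_true, decide_eq_true_eq] at hx
    refine ⟨_, Exec.instr _ _, hsim (t := t) hu, ?_, hfr (t := t)⟩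
    have := hb h
    simp only [Ex.eval] at this ⊢
    simp [Instr.step, Op.eval, hu.reg x hx.1, Nat.mod_eq_of_lt this]
  | lit v =>
    intro h t u hu
    refine ⟨_, Exec.instr _ _, hsim (t := t) hu, ?_, hfr (t := t)⟩
    have := hb h
    simp only [Ex.eval] at this ⊢
    simp [Instr.step, Nat.mod_eq_of_lt this]
  | op o a b iha ihb =>
    intro h t u hu
    have hx := h
    simp only [Ex.ok, Bool.and_eq_true, decide_eq_true_eq] at hx
    obtain ⟨v1, e1, s1, r1, f1⟩ := iha hx.1.1.1 t u hu
    obtain ⟨v2, e2, s2, r2, f2⟩ := ihb hx.1.1.2 (t + 1) v1 s1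
    refine ⟨_, (Exec.seq e1 (Exec.seq e2 (Exec.instr _ _))), hsim (t := t) s2, ?_, ?_⟩
    · have := hb h
      simp only [Ex.eval] at this ⊢
      have h3 : v2.reg (tmpBase + t) = a.eval ω' s := by rw [f2 _ (by omega), r1]
      rw [← add_assoc] at r2
      simp [Instr.step, h3, r2, Nat.mod_eq_of_lt this]
    · intro x hx
      refine (hfr (t := t) x hx).trans ?_
      rw [f2 x (by omega), f1 x hx]
  | clamp a b iha ihb =>
    intro h t u hu
    have hx := h
    simp only [Ex.ok, Bool.and_eq_true, decide_eq_true_eq] at hx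
    obtain ⟨v1, e1, s1, r1, f1⟩ := iha hx.1.1 t u hu
    obtain ⟨v2, e2, s2, r2, f2⟩ := ihb hx.1.2 (t + 1) v1 s1
    have hb1 : b.eval ω' s + 1 < 2 ^ w := by
      have h1 := (Ex.eval_lt ω' hl hs hx.1.2).1
      have h3 : b.eval ω' s + 1 < 2 ^ ((b.deg Γ D + 1) * l) := by
        have : (2:ℕ) ≤ 2 ^ l := by
          calc (2:ℕ) = 2 ^ 1 := rfl
            _ ≤ 2 ^ l := Nat.pow_le_pow_right (by norm_num) hl
        rw [add_mul, one_mul, pow_add]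
        nlinarith
      exact h3.trans_le (Nat.pow_le_pow_right (by norm_num)
        ((Nat.mul_le_mul_right _ hx.2).trans hw))
    have h11 : 1 < 2 ^ w := by omega
    have ha1 := hb hx.1.1
    have h3 : v2.reg (tmpBase + t) = a.eval ω' s := by rw [f2 _ (by omega), r1]
    rw [← add_assoc] at r2
    refine ⟨_, (Exec.seq e1 (Exec.seq e2 (Exec.seq (Exec.instr _ _) (Exec.seq (Exec.instr _ _)
      (Exec.instr _ _))))), hsim (t := t) ?_, ?_, ?_⟩
    · exact hsim (t := t + 1) (hsim (t := t + 2) s2)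
    · have h4 : a.eval ω' s % (b.eval ω' s + 1) < 2 ^ w := (Nat.mod_le _ _).trans_lt ha1
      simp [Instr.step, Op.eval, Ex.eval, h3, r2, Nat.mod_eq_of_lt h11, Nat.mod_eq_of_lt hb1,
        Nat.mod_eq_of_lt h4]
    · intro x hx
      have n1 : x ≠ tmpBase + t := by omega
      have n2 : x ≠ tmpBase + t + 1 := by omega
      have n3 : x ≠ tmpBase + t + 2 := by omega
      simp [Instr.step, n1, n2, n3, f2 x (by omega), f1 x hx]
  | load a iha =>
    intro h t u hu
    have hx := h
    simp only [Ex.ok, Bool.and_eq_true, decide_eq_true_eq] at hx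
    obtain ⟨v1, e1, s1, r1, f1⟩ := iha hx.1 t u hu
    refine ⟨_, (Exec.seq e1 (Exec.instr _ _)), hsim (t := t) s1, ?_, ?_⟩
    · simp [Instr.step, Ex.eval, r1, s1.mem]
    · intro x hx
      exact (hfr (t := t) x hx).trans (f1 x hx)
  | coin a iha =>
    intro h t u hu
    have hx := h
    simp only [Ex.ok, Bool.and_eq_true, decide_eq_true_eq] at hx
    obtain ⟨v1, e1, s1, r1, f1⟩ := iha hx.1 t u hu
    refine ⟨_, (Exec.seq e1 (Exec.instr _ _)), hsim (t := t) s1, ?_, ?_⟩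
    · have := hb h
      simp only [Ex.eval] at this ⊢
      have h4 := hω _ (hb hx.1)
      simp [Instr.step, r1, ← h4, Nat.mod_eq_of_lt this]
    · intro x hx
      exact (hfr (t := t) x hx).trans (f1 x hx)

theorem iter_frame {f : State → State} {x y : ℕ} {s : State} (hxy : y ≠ x)
    (hf : ∀ s, (f s).reg y = s.reg y) (i : ℕ) : (iter f x s i).reg y = s.reg y := by
  induction i with
  | zero => rfl
  | succ i ih => simp [iter, hf, State.set, hxy, ih]

/-- Variables that a statement does not write keep their values. -/
theorem St.run_frame (ω : Coins) {y : ℕ} : ∀ {p : St}, y ∉ p.writes → ∀ s,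
    (p.run ω s).reg y = s.reg y := by
  intro p
  induction p with
  | assign x e =>
    intro h s
    have : y ≠ x := by simpa [St.writes] using h
    simp [St.run, State.set, this]
  | store a e => intro h s; rfl
  | seq p q ihp ihq =>
    intro h s
    simp only [St.writes, List.mem_append, not_or] at h
    simp [St.run, ihq h.2, ihp h.1]
  | ite e p q ihp ihq =>
    intro h s
    simp only [St.writes, List.mem_append, not_or] at h
    simp only [St.run]
    split_ifs
    · exact ihp h.1 s
    · exact ihq h.2 s
  | loop x N p ih =>
    intro h s
    simp only [St.writes, List.mem_cons, not_or] at h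
    simp [St.run, State.set, h.1, iter_frame h.1 (ih h.2)]

theorem State.Fits.set {Γ : ℕ → ℕ} {D l x v : ℕ} {s : State} (hs : s.Fits Γ D l)
    (hv : v < 2 ^ (Γ x * l)) : (s.set x v).Fits Γ D l := by
  refine ⟨fun y hy => ?_, hs.mem⟩
  by_cases h : y = x
  · subst h; simpa [State.set] using hv
  · simpa [State.set, h] using hs.reg y hy

theorem State.Fits.write {Γ : ℕ → ℕ} {D l a v : ℕ} {s : State} (hs : s.Fits Γ D l)
    (hv : v < 2 ^ (D * l)) : (s.write a v).Fits Γ D l := by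
  refine ⟨hs.reg, fun b => ?_⟩
  by_cases h : b = a
  · subst h; simpa [State.write] using hv
  · simpa [State.write, h] using hs.mem b

theorem Sim.set {s u : State} (h : Sim s u) (x v : ℕ) :
    Sim (s.set x v) { u with reg := Function.update u.reg x v } := by
  refine ⟨fun y hy => ?_, h.mem⟩
  by_cases h' : y = x
  · subst h'; simp [State.set]
  · simp [State.set, h', h.reg y hy]

/-- Writing to the evaluation stack does not affect the represented state. -/
theorem Sim.tmp {s u : State} (h : Sim s u) (t v : ℕ) :
    Sim s { u with reg := Function.update u.reg (tmpBase + t) v } := by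
  refine ⟨fun y hy => ?_, h.mem⟩
  have : y ≠ tmpBase + t := by omega
  simp [this, h.reg y hy]

/-- The code of a checked statement computes its effect, without overflow and within the static
time bound. -/
theorem St.exec_compile {Γ ρ : ℕ → ℕ} {D A l w : ℕ} {ω ω' : Coins} {W : List ℕ} (hl : 1 ≤ l)
    (hw : A * l ≤ w) (hω : ∀ i < 2 ^ w, ω' i = ω i) :
    ∀ {p : St}, p.ok Γ D A W = true → ∀ (s u : State), s.Fits Γ D l →
      (∀ N ∉ W, s.reg N = ρ N) → Sim s u → ∃ v t,
      Exec w ω p.compile u v t ∧ t ≤ p.cost ρ ∧ Sim (p.run ω' s) v ∧ (p.run ω' s).Fits Γ D l ∧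
        ∀ N ∉ W, (p.run ω' s).reg N = ρ N := by
  intro p
  have hpw : ∀ {d : ℕ}, d ≤ A → 2 ^ (d * l) ≤ 2 ^ w := fun h =>
    Nat.pow_le_pow_right (by norm_num) ((Nat.mul_le_mul_right _ h).trans hw)
  have hdd : ∀ {d d' : ℕ}, d ≤ d' → 2 ^ (d * l) ≤ 2 ^ (d' * l) := fun h =>
    Nat.pow_le_pow_right (by norm_num) (Nat.mul_le_mul_right _ h)
  have hset : ∀ {s : State} {x v : ℕ}, x ∈ W → (∀ N ∉ W, s.reg N = ρ N) →
      ∀ N ∉ W, (s.set x v).reg N = ρ N := by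
    intro s x v hx h N hN
    have : N ≠ x := by rintro rfl; exact hN hx
    simp [State.set, this, h N hN]
  induction p with
  | assign x e =>
    intro h s u hs hρ hu
    simp only [St.ok, Bool.and_eq_true, decide_eq_true_eq, List.contains_eq_mem] at h
    obtain ⟨⟨⟨h1, h2⟩, h3⟩, h4⟩ := h
    obtain ⟨v, e1, s1, r1, f1⟩ := Ex.exec_compile hl hw hω hs h2 0 u hu
    obtain ⟨b1, b2⟩ := Ex.eval_lt ω' hl hs h2
    have b3 := b1.trans_le (hpw b2)
    refine ⟨_, _, Exec.seq e1 (Exec.instr _ _), le_rfl, ?_, hs.set (b1.trans_le (hdd h3)),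
      hset h4 hρ⟩
    simp only [add_zero] at r1
    simp only [Instr.step, Op.eval, Nat.or_self, r1, Nat.mod_eq_of_lt b3]
    exact s1.set _ _
  | store a e =>
    intro h s u hs hρ hu
    simp only [St.ok, Bool.and_eq_true, decide_eq_true_eq] at h
    obtain ⟨⟨h1, h2⟩, h3⟩ := h
    obtain ⟨v1, e1, s1, r1, f1⟩ := Ex.exec_compile hl hw hω hs h1 0 u hu
    obtain ⟨v2, e2, s2, r2, f2⟩ := Ex.exec_compile hl hw hω hs h2 1 v1 s1
    obtain ⟨b1, b2⟩ := Ex.eval_lt ω' hl hs h2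
    refine ⟨_, _, Exec.seq e1 (Exec.seq e2 (Exec.instr _ _)), by simp only [St.cost]; omega, ?_,
      hs.write (b1.trans_le (hdd h3)), hρ⟩
    have r3 : v2.reg tmpBase = a.eval ω' s := by
      rw [f2 _ (by omega)]; simpa using r1
    refine ⟨s2.reg, ?_⟩
    simp only [Instr.step, r2, r3, s2.mem]
    rfl
  | seq p q ihp ihq =>
    intro h s u hs hρ hu
    simp only [St.ok, Bool.and_eq_true] at h
    obtain ⟨v1, t1, e1, c1, s1, g1, k1⟩ := ihp h.1 s u hs hρ hu
    obtain ⟨v2, t2, e2, c2, s2, g2, k2⟩ := ihq h.2 _ v1 g1 k1 s1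
    exact ⟨v2, _, Exec.seq e1 e2, by simp only [St.cost]; omega, s2, g2, k2⟩
  | ite e p q ihp ihq =>
    intro h s u hs hρ hu
    simp only [St.ok, Bool.and_eq_true] at h
    obtain ⟨v, e1, s1, r1, f1⟩ := Ex.exec_compile hl hw hω hs h.1.1 0 u hu
    rw [add_zero] at r1
    by_cases hc : e.eval ω' s ≠ 0
    · obtain ⟨v1, t1, e2, c1, s2, g1, k1⟩ := ihp h.1.2 s v hs hρ s1
      refine ⟨v1, _, Exec.seq e1 (Exec.ite_true (by rw [r1]; exact hc) e2),
        by simp only [St.cost]; omega, ?_⟩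
      simp only [St.run, if_pos hc]
      exact ⟨s2, g1, k1⟩
    · obtain ⟨v1, t1, e2, c1, s2, g1, k1⟩ := ihq h.2 s v hs hρ s1
      refine ⟨v1, _, Exec.seq e1 (Exec.ite_false (by rw [r1]; simpa using hc) e2),
        by simp only [St.cost]; omega, ?_⟩
      simp only [St.run, if_neg hc]
      exact ⟨s2, g1, k1⟩
  | loop x N p ih =>
    intro h s u hs hρ hu
    simp only [St.ok, Bool.and_eq_true, decide_eq_true_eq, List.contains_eq_mem,
      Bool.not_eq_true', decide_eq_false_iff_not] at h
    obtain ⟨⟨⟨⟨⟨⟨⟨⟨hx, hN⟩, hNx⟩, hNA⟩, hA⟩, hxW⟩, hNW⟩, hxp⟩, hp⟩ := h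
    have hNx' : N ≠ x := by rintro rfl; exact hNW hxW
    set n := s.reg N with hn
    have hnρ : n = ρ N := hρ N hNW
    have hnl : n < 2 ^ (Γ N * l) := hs.reg N hN
    have hnw : n < 2 ^ w := hnl.trans_le (hpw hNA)
    have hnx : n < 2 ^ (Γ x * l) := hnl.trans_le (hdd hNx)
    have h1w : 1 < 2 ^ w := by
      have := hpw hA
      have h2 : (2:ℕ) ≤ 2 ^ (1 * l) := by
        calc (2:ℕ) = 2 ^ 1 := rfl
          _ ≤ 2 ^ (1 * l) := Nat.pow_le_pow_right (by norm_num) (by omega)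
      omega
    -- the states at the loop head
    have key : ∀ m, ∀ i, i + m = n → ∀ (σ u : State), σ.Fits Γ D l → (∀ N ∉ W, σ.reg N = ρ N) →
        σ = iter (p.run ω') x s i → Sim (σ.set x i) u →
        u.reg tmpBase = (if i < n then 1 else 0) → ∃ v t,
        Exec w ω (.loop tmpBase (.seq p.compile (.seq (.instr (.const tmpBase 1))
        (.seq (.instr (.op .add x x tmpBase)) (.instr (.op .lt tmpBase x N)))))) u v t ∧
        t ≤ m * (p.cost ρ + 4) + 1 ∧ Sim ((iter (p.run ω') x s n).set x n) v ∧
        ((iter (p.run ω') x s n).set x n).Fits Γ D l ∧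
        ∀ N ∉ W, ((iter (p.run ω') x s n).set x n).reg N = ρ N := by
      intro m
      induction m with
      | zero =>
        intro i hi σ u hσ hσρ hσi hu ht
        have hin : i = n := by omega
        subst hin
        rw [if_neg (lt_irrefl _)] at ht
        refine ⟨u, 1, Exec.loop_done ht, by omega, ?_, ?_, ?_⟩
        · rw [← hσi]; exact hu
        · rw [← hσi]; exact hσ.set hnx
        · rw [← hσi]; exact hset hxW hσρ
      | succ m ihm =>
        intro i hi σ u hσ hσρ hσi hu ht
        have hin : i < n := by omega
        rw [if_pos hin] at ht
        have hσx : (σ.set x i).Fits Γ D l := hσ.set (hin.trans hnx)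
        obtain ⟨v1, t1, e1, c1, s1, g1, k1⟩ := ih hp (σ.set x i) u hσx (hset hxW hσρ) hu
        have hi1 : iter (p.run ω') x s (i + 1) = p.run ω' (σ.set x i) := by
          rw [iter, hσi]
        set σ' := p.run ω' (σ.set x i) with hσ'
        have hxx : v1.reg x = i := by
          rw [s1.reg x hx, hσ', St.run_frame ω' hxp]
          simp [State.set]
        have hNN : v1.reg N = n := by
          rw [s1.reg N hN, k1 N hNW, hnρ]
        have hTx : tmpBase ≠ x := by omega
        have hTN : tmpBase ≠ N := by omega
        have hsmall : i + 1 < 2 ^ w := by omega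
        obtain ⟨v2, t2, e2, c2, rest⟩ := ihm (i + 1) (by omega) σ'
          ((Instr.op .lt tmpBase x N).step w ω ((Instr.op .add x x tmpBase).step w ω
            ((Instr.const tmpBase 1).step w ω v1))) g1 k1 hi1.symm
          (by
            have h1 : Sim σ' ((Instr.const tmpBase 1).step w ω v1) := s1.tmp 0 _
            have h2 := (h1.set x (i + 1)).tmp 0 (if i + 1 < n then 1 else 0)
            convert h2 using 1
            simp only [Instr.step, Op.eval, add_zero]
            congr 2
            · funext y
              by_cases hy : y = x
              · subst hy
                simp [hTx.symm, hxx, Nat.mod_eq_of_lt h1w, Nat.mod_eq_of_lt hsmall]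
              · simp [hy]
            · have h5 : (if i + 1 < n then 1 else 0) < 2 ^ w := by split_ifs <;> omega
              simp [hTx.symm, hTN.symm, hxx, hNN, hNx', Nat.mod_eq_of_lt h1w,
                Nat.mod_eq_of_lt hsmall]
              split_ifs <;> simp [Nat.mod_eq_of_lt h1w])
          (by
            simp [Instr.step, Op.eval, hTx.symm, hTN.symm, hxx, hNN, hNx', Nat.mod_eq_of_lt h1w,
                Nat.mod_eq_of_lt hsmall]
            split_ifs <;> simp [Nat.mod_eq_of_lt h1w])
        refine ⟨v2, _, Exec.loop_step (by rw [ht]; exact one_ne_zero)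
          (Exec.seq e1 (Exec.seq (Exec.instr _ _) (Exec.seq (Exec.instr _ _) (Exec.instr _ _))))
          e2, ?_, rest⟩
        nlinarith
    have hTx : tmpBase ≠ x := by omega
    have hu0 : Sim (s.set x 0) ((Instr.const x 0).step w ω u) := by
      have := hu.set x 0
      simpa [Instr.step] using this
    obtain ⟨v, t, e1, c1, rest⟩ := key n 0 (by omega) s
      ((Instr.op .lt tmpBase x N).step w ω ((Instr.const x 0).step w ω u)) hs hρ rfl
      (hu0.tmp 0 _)
      (by
        simp [Instr.step, Op.eval, hNx', hu.reg N hN, ← hn]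
        split_ifs <;> simp [Nat.mod_eq_of_lt h1w])
    refine ⟨v, _, Exec.seq (Exec.instr _ _) (Exec.seq (Exec.instr _ _) e1), ?_, rest⟩
    simp only [St.cost, ← hnρ]
    omega

/-- The rule for counting loops. -/
theorem St.loop_inv (ω : Coins) {x N : ℕ} {p : St} {s : State} (I : ℕ → State → Prop)
    (h0 : I 0 s) (hstep : ∀ i < s.reg N, ∀ u, I i u → I (i + 1) (p.run ω (u.set x i)))  :
    ∃ u, I (s.reg N) u ∧ (St.loop x N p).run ω s = u.set x (s.reg N) := by
  refine ⟨iter (p.run ω) x s (s.reg N), ?_, rfl⟩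
  have : ∀ i ≤ s.reg N, I i (iter (p.run ω) x s i) := by
    intro i
    induction i with
    | zero => intro _; exact h0
    | succ i ih => intro hi; exact hstep i hi _ (ih (by omega))
  exact this _ le_rfl

/-! ### Near-periods of a string -/

section NearPeriods

variable {A : Type} [AddCommGroup A] [Fintype A] [DecidableEq A] {α : Type} [DecidableEq α]

/-- The rotation of a string, indexed by a finite abelian group, by `m`. -/
def shift (m : A) (U : A → α) : A → α := fun i => U (i + m)

theorem shift_shift (a b : A) (U : A → α) : shift a (shift b U) = shift (a + b) U := by
  funext i; simp [shift, add_assoc]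

theorem shift_zero (U : A → α) : shift 0 U = U := by
  funext i; simp [shift]

theorem hammingDist_shift (m : A) (U V : A → α) :
    hammingDist (shift m U) (shift m V) = hammingDist U V := by
  unfold hammingDist shift
  exact Finset.card_bij (fun i _ => i + m) (by simp) (by simp) (fun j hj => ⟨j - m, by simpa using hj⟩)

/-- The number of positions at which a string differs from its rotation by `g`. -/
def per (U : A → α) (g : A) : ℕ := hammingDist U (shift g U)

theorem per_zero (U : A → α) : per U 0 = 0 := by simp [per, shift_zero]

theorem per_neg (U : A → α) (g : A) : per U (-g) = per U g := by
  unfold per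
  rw [← hammingDist_shift g U (shift (-g) U), shift_shift, add_neg_cancel, shift_zero,
    hammingDist_comm]

theorem per_add_le (U : A → α) (g h : A) : per U (g + h) ≤ per U g + per U h := by
  unfold per
  calc hammingDist U (shift (g + h) U)
      ≤ hammingDist U (shift g U) + hammingDist (shift g U) (shift (g + h) U) :=
        hammingDist_triangle _ _ _
    _ = _ := by rw [← shift_shift, hammingDist_shift]

theorem per_shift (U : A → α) (r g : A) : per (shift r U) g = per U g := by
  unfold per
  rw [shift_shift, add_comm, ← shift_shift, hammingDist_shift]

/-- Near-periods of two strings that have similar rotations are similar. -/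
theorem per_le_per_add {U V : A → α} {m : A} {k : ℕ} (h : hammingDist U (shift m V) ≤ k) (g : A) :
    per U g ≤ per V g + 2 * k := by
  unfold per
  calc hammingDist U (shift g U)
      ≤ hammingDist U (shift m V) + hammingDist (shift m V) (shift g U) :=
        hammingDist_triangle _ _ _
    _ ≤ hammingDist U (shift m V) + (hammingDist (shift m V) (shift g (shift m V)) +
        hammingDist (shift g (shift m V)) (shift g U)) := by
        gcongr; exact hammingDist_triangle _ _ _
    _ ≤ k + (hammingDist V (shift g V) + k) := by
        rw [hammingDist_shift g (shift m V) U, hammingDist_comm _ U]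
        have : hammingDist (shift m V) (shift g (shift m V)) = hammingDist V (shift g V) :=
          per_shift V m g
        rw [this]
        omega
    _ = _ := by ring

/-- If some rotation changes a string in many positions, then few rotations change it in few
positions: a rotation `m` with few changes maps most of the set of breaks of `g` to itself, and only
few rotations can do so. -/
theorem card_per_le (U : A → α) {g : A} {κ : ℕ} (h1 : 4 * κ ≤ per U g) (h0 : 0 < per U g) :
    (Finset.univ.filter fun m => per U m ≤ κ).card ≤ 2 * per U g := by
  classical
  set X : Finset A := Finset.univ.filter fun i => U i ≠ U (i + g) with hX
  have hXc : X.card = per U g := rfl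
  set G := Finset.univ.filter fun m => per U m ≤ κ with hG
  have key : ∀ m ∈ G, X.card ≤ 2 * (X.filter fun i => i + m ∈ X).card := by
    intro m hm
    have hm' : per U m ≤ κ := by simpa [hG] using hm
    set Y : Finset A := Finset.univ.filter fun i => U i ≠ U (i + m) with hY
    have hYc : Y.card ≤ κ := hm'
    -- If neither `i` nor `i + g` is changed by the rotation by `m`, then the break at `i` is moved to a
    -- break at `i + m`.
    have hsub : X.filter (fun i => i + m ∉ X) ⊆ Y ∪ Y.image (fun i => i - g) := by
      intro i hi
      simp only [hX, hY, Finset.mem_filter, Finset.mem_univ, true_and, not_not, Finset.mem_union,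
        Finset.mem_image] at hi ⊢
      by_cases hc : U i = U (i + m)
      · right
        refine ⟨i + g, ?_, by simp⟩
        intro h
        apply hi.1
        rw [hc, hi.2, h]
        congr 1; abel
      · exact Or.inl hc
    have h2 := Finset.card_le_card hsub
    have h3 := Finset.card_union_le Y (Y.image (fun i => i - g))
    have h4 : (Y.image (fun i => i - g)).card ≤ Y.card := Finset.card_image_le
    have h5 := Finset.card_filter_add_card_filter_not (s := X) (fun i => i + m ∈ X)
    omega
  -- Double counting of the pairs of breaks that are `m` apart.
  have hsum : ∑ m ∈ G, (X.filter fun i => i + m ∈ X).card ≤ X.card * X.card := by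
    calc ∑ m ∈ G, (X.filter fun i => i + m ∈ X).card
        ≤ ∑ m : A, (X.filter fun i => i + m ∈ X).card :=
          Finset.sum_le_sum_of_subset (Finset.subset_univ _)
      _ = ∑ m : A, ∑ i ∈ X, if i + m ∈ X then 1 else 0 := by simp only [Finset.card_filter]
      _ = ∑ i ∈ X, ∑ m : A, if i + m ∈ X then 1 else 0 := Finset.sum_comm
      _ = ∑ i ∈ X, ∑ m : A, if m ∈ X then 1 else 0 := by
          refine Finset.sum_congr rfl fun i _ => ?_
          exact Equiv.sum_comp (Equiv.addLeft i) (fun m => if m ∈ X then 1 else 0)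
      _ = X.card * X.card := by simp
  have h6 : G.card * X.card ≤ 2 * (X.card * X.card) := by
    calc G.card * X.card = ∑ m ∈ G, X.card := by simp
      _ ≤ ∑ m ∈ G, 2 * (X.filter fun i => i + m ∈ X).card := Finset.sum_le_sum key
      _ = 2 * ∑ m ∈ G, (X.filter fun i => i + m ∈ X).card := by rw [Finset.mul_sum]
      _ ≤ _ := by omega
  rw [← hXc] at h0 ⊢
  nlinarith

/-- If a string has many near-periods, then its near-periods are separated from the other
rotations by a gap. -/
theorem per_gap (U : A → α) {κ : ℕ} (hκ : 0 < κ)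
    (h : 16 * κ < (Finset.univ.filter fun m => per U m ≤ κ).card) (g : A) :
    per U g < 4 * κ ∨ 8 * κ < per U g := by
  by_contra hc
  push Not at hc
  have := card_per_le U hc.1 (by omega)
  omega

/-- By the gap and subadditivity, the near-periods form a subgroup. -/
theorem exists_addSubgroup_of_gap (U : A → α) {κ : ℕ} (hκ : 0 < κ)
    (h : ∀ g, per U g < 4 * κ ∨ 8 * κ < per U g) :
    ∃ H : AddSubgroup A, ∀ g, g ∈ H ↔ per U g < 4 * κ := by
  refine ⟨{ carrier := {g | per U g < 4 * κ}, add_mem' := ?_, zero_mem' := ?_, neg_mem' := ?_ },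
    fun g => Iff.rfl⟩
  · intro a b ha hb
    simp only [Set.mem_ofPred_eq] at *
    have := per_add_le U a b
    rcases h (a + b) with h | h <;> omega
  · simp [per_zero, hκ]
  · intro a ha
    simpa [per_neg] using ha

/-- A string all of whose rotations in a subgroup are close to it is close to a string that is
invariant under the subgroup; the latter is found by averaging over coset representatives. -/
theorem exists_template (U : A → α) (H : AddSubgroup A) {c : ℕ} (hB : ∀ h ∈ H, per U h ≤ c) :
    ∃ Q : A → α, (∀ h ∈ H, ∀ i, Q (i + h) = Q i) ∧ (∀ i, ∃ j, Q i = U j) ∧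
      (Finset.univ.filter fun i => U i ≠ Q i).card ≤ c := by
  classical
  let rep : A → A := fun i => ((i : A ⧸ H)).out
  have hrep : ∀ i, rep i - i ∈ H := by
    intro i
    have : ((rep i : A) : A ⧸ H) = (i : A ⧸ H) := Quotient.out_eq' _
    rw [QuotientAddGroup.eq_iff_sub_mem] at this
    exact this
  let T : Finset A := Finset.univ.filter (· ∈ H)
  have hT : T.Nonempty := ⟨0, by simp [T]⟩
  have hsum : ∑ t ∈ T, (Finset.univ.filter fun i => U i ≠ U (rep i + t)).card ≤ T.card * c := by
    calc ∑ t ∈ T, (Finset.univ.filter fun i => U i ≠ U (rep i + t)).card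
        = ∑ t ∈ T, ∑ i : A, if U i ≠ U (rep i + t) then 1 else 0 := by
          simp only [Finset.card_filter]
      _ = ∑ i : A, ∑ t ∈ T, if U i ≠ U (rep i + t) then 1 else 0 := Finset.sum_comm
      _ = ∑ i : A, ∑ t ∈ T, if U i ≠ U (i + t) then 1 else 0 := by
          refine Finset.sum_congr rfl fun i _ => ?_
          refine Finset.sum_bij' (fun t _ => t + (rep i - i)) (fun t _ => t - (rep i - i))
            ?_ ?_ ?_ ?_ ?_
          · intro t ht
            simp only [T, Finset.mem_filter, Finset.mem_univ, true_and] at ht ⊢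
            exact H.add_mem ht (hrep i)
          · intro t ht
            simp only [T, Finset.mem_filter, Finset.mem_univ, true_and] at ht ⊢
            exact H.sub_mem ht (hrep i)
          · intro t _; simp
          · intro t _; simp
          · intro t _
            have : i + (t + (rep i - i)) = rep i + t := by abel
            rw [this]
      _ = ∑ t ∈ T, ∑ i : A, if U i ≠ U (i + t) then 1 else 0 := Finset.sum_comm
      _ = ∑ t ∈ T, per U t := by
          refine Finset.sum_congr rfl fun t _ => ?_
          unfold per hammingDist shift
          rw [Finset.card_filter]
      _ ≤ ∑ t ∈ T, c := Finset.sum_le_sum fun t ht => hB t (by simpa [T] using ht)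
      _ = T.card * c := by simp
  obtain ⟨t, ht, htc⟩ : ∃ t ∈ T, (Finset.univ.filter fun i => U i ≠ U (rep i + t)).card ≤ c := by
    by_contra hcon
    push Not at hcon
    have h1 : ∑ t ∈ T, (c + 1) ≤
        ∑ t ∈ T, (Finset.univ.filter fun i => U i ≠ U (rep i + t)).card :=
      Finset.sum_le_sum hcon
    simp only [Finset.sum_const, smul_eq_mul] at h1
    have := hT.card_pos
    nlinarith
  refine ⟨fun i => U (rep i + t), fun h hh i => ?_, fun i => ⟨_, rfl⟩, htc⟩
  have : rep (i + h) = rep i := by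
    simp only [rep]
    congr 1
    rw [QuotientAddGroup.eq_iff_sub_mem]
    simpa using hh
  simp [this]

/-- A symmetric set in an abelian group has a short list of elements such that every element of the
set is the sum of a sublist: take a maximal set with distinct subset sums, and its negatives. -/
theorem exists_generators (G : Finset A) (h0 : (0 : A) ∈ G) (hneg : ∀ g ∈ G, -g ∈ G) :
    ∃ gen : ℕ → A, (∀ t, gen t ∈ G) ∧ ∀ m ∈ G, ∃ mask < 2 ^ (2 * Nat.log 2 (Fintype.card A)),
      m = ∑ t ∈ Finset.range (2 * Nat.log 2 (Fintype.card A)),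
        if mask.testBit t then gen t else 0 := by
  classical
  let S : Finset (Finset A) := G.powerset.filter fun Λ =>
    Set.InjOn (fun P : Finset A => ∑ x ∈ P, x) (Λ.powerset : Set (Finset A))
  have hS : S.Nonempty := ⟨∅, by
    simp only [S, Finset.mem_filter, Finset.mem_powerset, Finset.empty_subset, true_and]
    intro P hP N hN _
    have h1 : P = ∅ := by simpa using hP
    have h2 : N = ∅ := by simpa using hN
    rw [h1, h2]⟩
  obtain ⟨Λ, hΛ, hmax⟩ := S.exists_max_image Finset.card hS
  simp only [S, Finset.mem_filter, Finset.mem_powerset] at hΛ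
  obtain ⟨hΛG, hinj⟩ := hΛ
  have hcard : 2 ^ Λ.card ≤ Fintype.card A := by
    rw [← Finset.card_powerset, ← Finset.card_image_of_injOn hinj]
    exact Finset.card_le_univ _
  set r := Nat.log 2 (Fintype.card A) with hr
  have hΛr : Λ.card ≤ r := Nat.le_log_of_pow_le (by norm_num) hcard
  let e := Λ.equivFin
  let gen : ℕ → A := fun t =>
    if h : t / 2 < Λ.card then (if t % 2 = 0 then (e.symm ⟨t / 2, h⟩ : A) else -(e.symm ⟨t / 2, h⟩ : A))
    else 0
  have hidx : ∀ x (hx : x ∈ Λ), ((e ⟨x, hx⟩ : Fin _) : ℕ) < Λ.card := fun x hx => (e ⟨x, hx⟩).2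
  -- every difference of sums of two disjoint subsets of `Λ` is a sum of a sublist
  have hrepr : ∀ P N : Finset A, P ⊆ Λ → N ⊆ Λ → ∃ mask < 2 ^ (2 * r),
      ∑ x ∈ P, x - ∑ x ∈ N, x = ∑ t ∈ Finset.range (2 * r),
        if mask.testBit t then gen t else 0 := by
    intro P N hP hN
    let p : ℕ → Bool := fun t => decide (∃ h : t / 2 < Λ.card,
      if t % 2 = 0 then (e.symm ⟨t / 2, h⟩ : A) ∈ P else (e.symm ⟨t / 2, h⟩ : A) ∈ N)
    refine ⟨Nat.ofBits fun t : Fin (2 * r) => p t, Nat.ofBits_lt_two_pow _, ?_⟩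
    have hbit : ∀ t ∈ Finset.range (2 * r), (if (Nat.ofBits fun t : Fin (2 * r) => p t).testBit t
        then gen t else 0) = if p t then gen t else 0 := by
      intro t ht
      rw [Nat.testBit_ofBits_lt _ _ (Finset.mem_range.1 ht)]
    rw [Finset.sum_congr rfl hbit]
    have hsplit : ∀ F : ℕ → A, ∑ t ∈ Finset.range (2 * r), F t =
        ∑ t ∈ Finset.range r, (F (2 * t) + F (2 * t + 1)) := by
      intro F
      induction r with
      | zero => simp
      | succ r ih => rw [Nat.mul_succ, Finset.sum_range_succ, Finset.sum_range_succ, ih,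
          Finset.sum_range_succ]; abel
    rw [hsplit, Finset.sum_add_distrib]
    have hsub : ∀ F : ℕ → A, (∀ t, ¬ t < Λ.card → F t = 0) →
        ∑ t ∈ Finset.range r, F t = ∑ x ∈ Λ.attach, F (e x) := by
      intro F hF
      rw [← Finset.sum_subset (Finset.range_subset_range.2 hΛr)
        (fun t _ ht => hF t (by simpa using ht)), Finset.sum_range]
      exact (Equiv.sum_comp e (fun t : Fin Λ.card => F t)).symm
    rw [hsub _ (fun t ht => by simp [gen, ht]), hsub _ (fun t ht => by
      have : (2 * t + 1) / 2 = t := by omega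
      simp [gen, this, ht])]
    have hP' : ∑ x ∈ P, x = ∑ x ∈ Λ.attach, if (x : A) ∈ P then (x : A) else 0 := by
      rw [Finset.sum_attach Λ (fun x => if x ∈ P then x else 0), ← Finset.sum_filter]
      congr 1
      ext x; simp only [Finset.mem_filter]; exact ⟨fun h => ⟨hP h, h⟩, fun h => h.2⟩
    have hN' : ∑ x ∈ N, x = ∑ x ∈ Λ.attach, if (x : A) ∈ N then (x : A) else 0 := by
      rw [Finset.sum_attach Λ (fun x => if x ∈ N then x else 0), ← Finset.sum_filter]
      congr 1
      ext x; simp only [Finset.mem_filter]; exact ⟨fun h => ⟨hN h, h⟩, fun h => h.2⟩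
    rw [hP', hN', sub_eq_add_neg, ← Finset.sum_neg_distrib]
    congr 1
    · refine Finset.sum_congr rfl fun x _ => ?_
      have : (e x : ℕ) < Λ.card := (e x).2
      simp [p, gen]
    · refine Finset.sum_congr rfl fun x _ => ?_
      have h1 : (2 * (e x : ℕ) + 1) / 2 = e x := by omega
      have h2 : (2 * (e x : ℕ) + 1) % 2 = 1 := by omega
      by_cases h : (x : A) ∈ N
      · simp [p, gen, h1, h2, h]
      · simp [p, gen, h1, h2, h]
  refine ⟨gen, fun t => ?_, fun m hm => ?_⟩
  · simp only [gen]
    split_ifs with h1 h2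
    · exact hΛG (e.symm ⟨t / 2, h1⟩).2
    · exact hneg _ (hΛG (e.symm ⟨t / 2, h1⟩).2)
    · exact h0
  · by_cases hmΛ : m ∈ Λ
    · obtain ⟨mask, h1, h2⟩ := hrepr {m} ∅ (by simpa using hmΛ) (by simp)
      exact ⟨mask, h1, by simpa using h2⟩
    · have hnot : ¬ Set.InjOn (fun P : Finset A => ∑ x ∈ P, x)
          ((insert m Λ).powerset : Set (Finset A)) := by
        intro hi
        have := hmax (insert m Λ) (by
          simp only [S, Finset.mem_filter, Finset.mem_powerset]
          exact ⟨Finset.insert_subset hm hΛG, hi⟩)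
        rw [Finset.card_insert_of_notMem hmΛ] at this
        omega
      simp only [Set.InjOn, Finset.mem_coe, Finset.mem_powerset] at hnot
      push Not at hnot
      obtain ⟨P, hP, N, hN, hsum, hne⟩ := hnot
      have herase : ∀ {P : Finset A}, P ⊆ insert m Λ → P.erase m ⊆ Λ := by
        intro P hP x hx
        have := hP (Finset.mem_of_mem_erase hx)
        rcases Finset.mem_insert.1 this with h | h
        · exact absurd h (Finset.ne_of_mem_erase hx)
        · exact h
      -- By maximality, two subset sums of `insert m Λ` are equal; solving for `m` gives a difference of
      -- sums of subsets of `Λ`.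
      have main : ∀ P N : Finset A, P ⊆ insert m Λ → N ⊆ insert m Λ → m ∈ P → m ∉ N →
          ∑ x ∈ P, x = ∑ x ∈ N, x → ∃ mask < 2 ^ (2 * r),
          m = ∑ t ∈ Finset.range (2 * r), if mask.testBit t then gen t else 0 := by
        intro P N hP hN hmP hmN hs
        obtain ⟨mask, h1, h2⟩ := hrepr N (P.erase m)
          (by have := herase hN; rwa [Finset.erase_eq_of_notMem hmN] at this) (herase hP)
        refine ⟨mask, h1, ?_⟩
        rw [← h2, ← hs, ← Finset.add_sum_erase P _ hmP]
        simp
      by_cases hmP : m ∈ P <;> by_cases hmN : m ∈ N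
      · exfalso
        apply hne
        have h3 : P.erase m = N.erase m := by
          apply hinj (Finset.mem_coe.2 (Finset.mem_powerset.2 (herase hP)))
            (Finset.mem_coe.2 (Finset.mem_powerset.2 (herase hN)))
          have h4 := Finset.add_sum_erase P (fun x => x) hmP
          have h5 := Finset.add_sum_erase N (fun x => x) hmN
          simp only at h4 h5 ⊢
          have h6 : m + ∑ x ∈ P.erase m, x = m + ∑ x ∈ N.erase m, x := by rw [h4, h5]; exact hsum
          exact add_left_cancel h6
        rw [← Finset.insert_erase hmP, h3, Finset.insert_erase hmN]
      · exact main P N hP hN hmP hmN hsum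
      · exact main N P hN hP hmN hmP hsum.symm
      · exfalso
        apply hne
        apply hinj ?_ ?_ hsum
        · have := herase hP; rw [Finset.erase_eq_of_notMem hmP] at this; exact Finset.mem_powerset.2 this
        · have := herase hN; rw [Finset.erase_eq_of_notMem hmN] at this; exact Finset.mem_powerset.2 this

/-- `1` if two characters differ, else `0`. -/
def neq (a b : ℕ) : ℕ := if a ≠ b then 1 else 0

/-- The arrays `pos`, `val`, `tm` of length `E` list the positions at which `U` differs from `Q`,
with the two characters; padding entries have `val = tm`. The property is stated for sums, as it is
used. -/
def Lists (U Q : A → ℕ) (E : ℕ) (pos : ℕ → A) (val tm : ℕ → ℕ) : Prop :=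
  ∀ F : A → ℕ → ℕ → ℤ, (∀ i a, F i a a = 0) →
    ∑ x ∈ Finset.range E, F (pos x) (val x) (tm x) = ∑ i, F i (U i) (Q i)

/-- The change of the Hamming distance when an exception is aligned with an exception. -/
def beta (a q b q' : ℕ) : ℤ := neq a b + neq q q' - neq a q' - neq q b

/-- On a subgroup `H`, the distance of `U₁` and the rotation of `U₂` by `m ∈ H` is determined up to
a constant by the pairs of exceptions that are `m` apart. -/
theorem hammingDist_eq_of_lists {U₁ U₂ Q₁ Q₂ : A → ℕ} {E₁ E₂ : ℕ} {pos₁ pos₂ : ℕ → A}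
    {val₁ val₂ tm₁ tm₂ : ℕ → ℕ} (h1 : Lists U₁ Q₁ E₁ pos₁ val₁ tm₁)
    (h2 : Lists U₂ Q₂ E₂ pos₂ val₂ tm₂) {m : A} (hQ1 : ∀ i, Q₁ (i + m) = Q₁ i)
    (hQ2 : ∀ i, Q₂ (i + m) = Q₂ i) :
    (hammingDist U₁ (shift m U₂) : ℤ) =
      (hammingDist U₁ U₂ : ℤ)
      + (∑ x ∈ Finset.range E₁, ∑ y ∈ Finset.range E₂,
        if pos₂ y - pos₁ x = m then beta (val₁ x) (tm₁ x) (val₂ y) (tm₂ y) else 0)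
      - (∑ x ∈ Finset.range E₁, ∑ y ∈ Finset.range E₂,
        if pos₂ y - pos₁ x = 0 then beta (val₁ x) (tm₁ x) (val₂ y) (tm₂ y) else 0) := by
  have hbeta : ∀ m : A, (∑ x ∈ Finset.range E₁, ∑ y ∈ Finset.range E₂,
      if pos₂ y - pos₁ x = m then beta (val₁ x) (tm₁ x) (val₂ y) (tm₂ y) else 0) =
      ∑ i, beta (U₁ i) (Q₁ i) (U₂ (i + m)) (Q₂ (i + m)) := by
    intro m
    have s1 : ∀ x, (∑ y ∈ Finset.range E₂,
      if pos₂ y - pos₁ x = m then beta (val₁ x) (tm₁ x) (val₂ y) (tm₂ y) else 0) =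
      beta (val₁ x) (tm₁ x) (U₂ (pos₁ x + m)) (Q₂ (pos₁ x + m)) := by
      intro x
      rw [h2 (fun j b q' => if j - pos₁ x = m then beta (val₁ x) (tm₁ x) b q' else 0)
        (fun j a => by split_ifs <;> simp [beta])]
      have : ∀ j, (j - pos₁ x = m) ↔ (j = pos₁ x + m) := fun j => by
        rw [sub_eq_iff_eq_add, add_comm]
      simp [this]
    rw [Finset.sum_congr rfl fun x _ => s1 x]
    exact h1 (fun i a q => beta a q (U₂ (i + m)) (Q₂ (i + m))) (fun i a => by simp [beta])
  have hham : ∀ V : A → ℕ, (hammingDist U₁ V : ℤ) = ∑ i, (neq (U₁ i) (V i) : ℤ) := by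
    intro V
    simp [hammingDist, neq, Finset.card_filter]
  rw [hbeta, hbeta, hham, hham]
  simp only [beta, shift, add_zero, Finset.sum_add_distrib, Finset.sum_sub_distrib, hQ2]
  have : ∑ i, (neq (Q₁ i) (U₂ (i + m)) : ℤ) = ∑ i, (neq (Q₁ i) (U₂ i) : ℤ) := by
    rw [← Equiv.sum_comp (Equiv.addRight m) (fun i => (neq (Q₁ i) (U₂ i) : ℤ))]
    simp [hQ1]
  rw [this]
  ring

/-- Lists of the exceptions exist, with length any bound `E` on their number; apart from the
padding, their entries are characters of the two strings. -/
theorem exists_lists (U Q : A → ℕ) {E : ℕ}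
    (h : (Finset.univ.filter fun i => U i ≠ Q i).card ≤ E) :
    ∃ (pos : ℕ → A) (val tm : ℕ → ℕ), Lists U Q E pos val tm ∧
      ∀ x, (∃ i, val x = U i ∧ tm x = Q i) ∨ (val x = 0 ∧ tm x = 0) := by
  classical
  set X := Finset.univ.filter fun i => U i ≠ Q i with hX
  let e := X.equivFin
  let pos : ℕ → A := fun x => if h : x < X.card then e.symm ⟨x, h⟩ else 0
  refine ⟨pos, fun x => if x < X.card then U (pos x) else 0,
    fun x => if x < X.card then Q (pos x) else 0, fun F hF => ?_, fun x => ?_⟩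
  · rw [← Finset.sum_subset (Finset.range_subset_range.2 h) (fun x _ hx => by
      have : ¬ x < X.card := by simpa using hx
      simp [this, hF]), Finset.sum_range]
    calc ∑ x : Fin X.card, F (pos x) (if (x : ℕ) < X.card then U (pos x) else 0)
          (if (x : ℕ) < X.card then Q (pos x) else 0)
        = ∑ x : Fin X.card, F (e.symm x) (U (e.symm x)) (Q (e.symm x)) := by
          refine Finset.sum_congr rfl fun x _ => ?_
          simp [pos]
      _ = ∑ x : X, F x (U x) (Q x) :=
          Equiv.sum_comp e.symm (fun x : X => F x (U x) (Q x))
      _ = ∑ x ∈ X, F x (U x) (Q x) := Finset.sum_coe_sort X (fun x => F x (U x) (Q x))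
      _ = ∑ i, F i (U i) (Q i) := by
          refine Finset.sum_subset (Finset.subset_univ _) fun i _ hi => ?_
          have : U i = Q i := by simpa [hX] using hi
          rw [this, hF]
  · by_cases hx : x < X.card
    · exact Or.inl ⟨pos x, by simp [hx]⟩
    · exact Or.inr (by simp [hx])

end NearPeriods

/-! ### Finite probability -/

section FiniteProbability

open Classical in
/-- The probability of an event under the uniform distribution on a finite type. -/
noncomputable def pr {Ω : Type} [Fintype Ω] (p : Ω → Prop) : ℝ :=
  ((Finset.univ.filter p).card : ℝ) / Fintype.card Ω

variable {Ω Ω' : Type} [Fintype Ω] [Fintype Ω']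

theorem pr_eq (p : Ω → Prop) [DecidablePred p] :
    pr p = ((Finset.univ.filter p).card : ℝ) / Fintype.card Ω := by
  unfold pr
  congr! 3
  ext x; simp only [Finset.mem_filter]

theorem pr_nonneg (p : Ω → Prop) : 0 ≤ pr p := by unfold pr; positivity

theorem pr_mono {p q : Ω → Prop} (h : ∀ x, p x → q x) : pr p ≤ pr q := by
  classical
  simp only [pr_eq]
  gcongr
  exact h _

theorem pr_or_le (p q : Ω → Prop) : pr (fun x => p x ∨ q x) ≤ pr p + pr q := by
  classical
  simp only [pr_eq]
  rw [← add_div]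
  gcongr
  rw [Finset.filter_or]
  exact_mod_cast Finset.card_union_le _ _

theorem pr_exists_le {ι : Type} (s : Finset ι) (p : ι → Ω → Prop) :
    pr (fun x => ∃ i ∈ s, p i x) ≤ ∑ i ∈ s, pr (p i) := by
  classical
  induction s using Finset.induction_on with
  | empty => simp [pr]
  | insert a s ha ih =>
    rw [Finset.sum_insert ha]
    refine (pr_mono (q := fun x => p a x ∨ ∃ i ∈ s, p i x) fun x hx => ?_).trans
      ((pr_or_le _ _).trans (by gcongr))
    simpa using hx

theorem pr_exists_le_card_mul {ι : Type} (s : Finset ι) (p : ι → Ω → Prop) {ε : ℝ}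
    (h : ∀ i ∈ s, pr (p i) ≤ ε) : pr (fun x => ∃ i ∈ s, p i x) ≤ s.card * ε := by
  refine (pr_exists_le s p).trans ((Finset.sum_le_sum h).trans ?_)
  simp

theorem pr_not [Nonempty Ω] (p : Ω → Prop) : pr (fun x => ¬ p x) = 1 - pr p := by
  classical
  simp only [pr_eq]
  have h : (0:ℝ) < Fintype.card Ω := by exact_mod_cast Fintype.card_pos
  rw [eq_sub_iff_add_eq, ← add_div, div_eq_one_iff_eq h.ne']
  have := Finset.card_filter_add_card_filter_not (s := (Finset.univ : Finset Ω)) p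
  rw [Finset.card_univ] at this
  push_cast [← this]
  ring

theorem pr_equiv (e : Ω ≃ Ω') (p : Ω' → Prop) : pr (fun x => p (e x)) = pr p := by
  classical
  simp only [pr_eq]
  rw [Fintype.card_congr e]
  congr 2
  exact Finset.card_bij (fun x _ => e x) (by simp) (by simp)
    (fun y hy => ⟨e.symm y, by simpa using hy⟩)

theorem pr_prod (p : Ω × Ω' → Prop) :
    pr p = (∑ a : Ω, pr fun b => p (a, b)) / Fintype.card Ω := by
  classical
  simp only [pr_eq]
  rw [← Finset.sum_div, div_div, Fintype.card_prod, mul_comm]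
  push_cast
  congr 1
  rw [← Nat.cast_sum]
  congr 1
  simp only [Finset.card_filter, Fintype.sum_prod_type]

/-- A bound for the probability of every section of an event bounds its probability. -/
theorem pr_prod_le [Nonempty Ω] {p : Ω × Ω' → Prop} {ε : ℝ}
    (h : ∀ a, pr (fun b => p (a, b)) ≤ ε) : pr p ≤ ε := by
  have hc : (0:ℝ) < Fintype.card Ω := by exact_mod_cast Fintype.card_pos
  rw [pr_prod, div_le_iff₀ hc]
  refine (Finset.sum_le_sum fun a _ => h a).trans ?_
  simp [mul_comm]

/-- If with probability at least `ε` the section of an event has probability at least `δ`, then the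
event has probability at least `ε * δ`. -/
theorem le_pr_prod {p : Ω × Ω' → Prop} {q : Ω → Prop} {ε δ : ℝ} (hδ : 0 ≤ δ) (hq : ε ≤ pr q)
    (h : ∀ a, q a → δ ≤ pr (fun b => p (a, b))) : ε * δ ≤ pr p := by
  classical
  rw [pr_prod]
  calc ε * δ ≤ pr q * δ := by gcongr
    _ = (∑ a : Ω, if q a then δ else 0) / Fintype.card Ω := by
        simp only [pr_eq]
        rw [← Finset.sum_filter]
        simp
        ring
    _ ≤ _ := by
        gcongr with a
        split_ifs with ha
        · exact h a ha
        · exact pr_nonneg _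

theorem pr_fst [Nonempty Ω'] (p : Ω → Prop) : pr (fun x : Ω × Ω' => p x.1) = pr p := by
  classical
  simp only [pr_eq]
  have : (Finset.univ.filter fun x : Ω × Ω' => p x.1) =
      (Finset.univ.filter p) ×ˢ (Finset.univ : Finset Ω') := by
    ext x; simp
  rw [this, Finset.card_product, Fintype.card_prod, Finset.card_univ]
  have hc : (Fintype.card Ω' : ℝ) ≠ 0 := by exact_mod_cast Fintype.card_ne_zero
  push_cast
  exact mul_div_mul_right _ _ hc

/-- Independent repetitions. -/
theorem pr_pi_forall {ι : Type} [Fintype ι] [DecidableEq ι] (p : Ω → Prop) :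
    pr (fun f : ι → Ω => ∀ i, p (f i)) = pr p ^ Fintype.card ι := by
  classical
  simp only [pr_eq]
  have : (Finset.univ.filter fun f : ι → Ω => ∀ i, p (f i)) =
      Fintype.piFinset fun _ => Finset.univ.filter p := by
    ext f; simp
  rw [this, Fintype.card_piFinset, Fintype.card_fun, div_pow]
  simp

variable {X Y : Type} [Fintype X] [DecidableEq X] [Fintype Y]

open Classical in
/-- The values of a uniformly random function are independent. -/
theorem pr_fun_forall [Nonempty Y] (D : Finset X) (p : X → Y → Prop) :
    pr (fun f : X → Y => ∀ x ∈ D, p x (f x)) = ∏ x ∈ D, pr (p x) := by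
  simp only [pr_eq]
  have : (Finset.univ.filter fun f : X → Y => ∀ x ∈ D, p x (f x)) =
      Fintype.piFinset fun x => if x ∈ D then Finset.univ.filter (p x) else Finset.univ := by
    ext f
    simp only [Finset.mem_filter, Finset.mem_univ, true_and, Fintype.mem_piFinset]
    refine forall_congr' fun x => ?_
    by_cases hx : x ∈ D <;> simp [hx]
  have hY : (Fintype.card Y : ℝ) ≠ 0 := by exact_mod_cast Fintype.card_ne_zero
  rw [this, Fintype.card_piFinset, Fintype.card_fun]
  rw [Finset.prod_div_distrib, Finset.prod_const]
  have h1 : ∀ x, (if x ∈ D then Finset.univ.filter (p x) else Finset.univ).card =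
      if x ∈ D then (Finset.univ.filter (p x)).card else Fintype.card Y := fun x => by
    split_ifs <;> simp
  simp only [h1]
  rw [Finset.prod_ite]
  have h2 : Finset.univ.filter (· ∈ D) = D := by ext; simp
  have h3 : (Finset.univ.filter (· ∉ D)).card = Fintype.card X - D.card := by
    rw [← Finset.card_compl]; congr 1; ext; simp
  rw [h2, Finset.prod_const, h3]
  have h4 : D.card ≤ Fintype.card X := Finset.card_le_univ D
  push_cast
  rw [div_eq_div_iff (pow_ne_zero _ hY) (pow_ne_zero _ hY), mul_assoc, ← pow_add,
    Nat.sub_add_cancel h4]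

/-- An event that, whatever the other values of a random function are, holds for at most one value
at the point `x₀`. -/
theorem pr_fun_le_of_unique (x₀ : X) {p : (X → Y) → Prop} [Nonempty Y]
    (h : ∀ f y y', p (Function.update f x₀ y) → p (Function.update f x₀ y') → y = y') :
    pr p ≤ 1 / Fintype.card Y := by
  classical
  simp only [pr_eq]
  have hY : (0:ℝ) < Fintype.card Y := by exact_mod_cast Fintype.card_pos
  have hXY : (0:ℝ) < Fintype.card (X → Y) := by exact_mod_cast Fintype.card_pos
  rw [div_le_div_iff₀ hXY hY, one_mul]
  have hinj : ((Finset.univ.filter p) ×ˢ (Finset.univ : Finset Y)).card ≤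
      (Finset.univ : Finset (X → Y)).card := by
    refine Finset.card_le_card_of_injOn (fun z => Function.update z.1 x₀ z.2) (by simp) ?_
    rintro ⟨f, y⟩ hf ⟨f', y'⟩ hf' heq
    simp only [Finset.coe_product, Set.mem_prod, Finset.mem_coe, Finset.mem_filter,
      Finset.mem_univ, true_and, and_true] at hf hf'
    simp only at heq
    have hy : y = y' := by simpa using congrFun heq x₀
    have hoff : ∀ x, x ≠ x₀ → f x = f' x := fun x hx => by
      have := congrFun heq x
      simpa [hx] using this
    have hf2 : f = Function.update f' x₀ (f x₀) := by
      funext x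
      by_cases hx : x = x₀
      · subst hx; simp
      · simp [hx, hoff x hx]
    have hx0 : f x₀ = f' x₀ := by
      refine h f' _ _ ?_ ?_
      · rw [← hf2]; exact hf
      · rw [Function.update_eq_self]; exact hf'
    have : f = f' := by
      rw [hf2, hx0, Function.update_eq_self]
    rw [this, hy]
  rw [Finset.card_product, Finset.card_univ, Finset.card_univ] at hinj
  exact_mod_cast hinj

end FiniteProbability

/-! ### Coins as a finite probability space -/

instance : MeasureTheory.IsProbabilityMeasure coinMeasure := by
  unfold coinMeasure; infer_instance

/-- Events that depend on finitely many coins have their counting probability. -/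
theorem coinMeasure_eq_pr {I : Type} [Fintype I] [DecidableEq I] (code : I → ℕ)
    (hc : Function.Injective code) (φ : (I → Bool) → Prop) :
    coinMeasure {ω | φ fun i => ω (code i)} = ENNReal.ofReal (pr φ) := by
  classical
  have hone : ∀ f : I → Bool, coinMeasure {ω | (fun i => ω (code i)) = f} =
      (2⁻¹ : ENNReal) ^ Fintype.card I := by
    intro f
    have hset : {ω : Coins | (fun i => ω (code i)) = f} =
        Set.pi ((Finset.univ.image code : Finset ℕ) : Set ℕ)
          (fun j => {b : Bool | ∀ i, code i = j → b = f i}) := by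
      ext ω
      simp only [Set.mem_ofPred_eq, Set.mem_pi, Finset.coe_image, Finset.coe_univ, Set.image_univ,
        Set.mem_range, forall_exists_index, forall_apply_eq_imp_iff]
      constructor
      · rintro rfl i j hj
        simp [hj]
      · intro h
        funext i
        exact h i i rfl
    rw [hset, coinMeasure, MeasureTheory.Measure.infinitePi_pi _ (fun _ _ => MeasurableSet.of_discrete)]
    rw [Finset.prod_image (fun a _ b _ h => hc h)]
    have : ∀ i : I, (PMF.uniformOfFintype Bool).toMeasure
        {b : Bool | ∀ j, code j = code i → b = f j} = 2⁻¹ := by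
      intro i
      have : {b : Bool | ∀ j, code j = code i → b = f j} = {f i} := by
        ext b
        simp only [Set.mem_ofPred_eq, Set.mem_singleton_iff]
        exact ⟨fun h => h i rfl, fun h j hj => by rw [hc hj]; exact h⟩
      rw [this, PMF.toMeasure_apply_singleton _ _ (MeasurableSet.of_discrete)]
      simp
    simp [this]
  have hU : {ω : Coins | φ fun i => ω (code i)} =
      ⋃ f ∈ Finset.univ.filter φ, {ω | (fun i => ω (code i)) = f} := by
    ext ω; simp
  rw [hU, MeasureTheory.measure_biUnion_finset]
  · simp only [hone, Finset.sum_const, nsmul_eq_mul]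
    simp only [pr_eq]
    rw [Fintype.card_fun, Fintype.card_bool, ENNReal.ofReal_div_of_pos (by positivity)]
    rw [ENNReal.ofReal_natCast, div_eq_mul_inv]
    congr 1
    push_cast
    rw [ENNReal.ofReal_pow (by norm_num), ENNReal.inv_pow]
    norm_num
  · intro f _ g _ hfg
    simp only [Function.onFun]
    rw [Set.disjoint_left]
    intro ω h1 h2
    simp only [Set.mem_ofPred_eq] at h1 h2
    exact hfg (h1.symm.trans h2)
  · intro f _
    have hm : Measurable fun (ω : Coins) (i : I) => ω (code i) :=
      measurable_pi_lambda _ fun i => measurable_pi_apply _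
    exact hm (MeasurableSet.of_discrete (s := ({f} : Set (I → Bool))))

/-! ### Bits and numbers -/

/-- The number with the binary digits `f 0, …, f (b - 1)`, most significant first. -/
def bitsVal (f : ℕ → Bool) : ℕ → ℕ
  | 0 => 0
  | b + 1 => 2 * bitsVal f b + (f b).toNat

theorem bitsVal_lt (f : ℕ → Bool) (b : ℕ) : bitsVal f b < 2 ^ b := by
  induction b with
  | zero => simp [bitsVal]
  | succ b ih =>
    have := Bool.toNat_lt (f b)
    rw [bitsVal, pow_succ]; omega

theorem bitsVal_congr {f g : ℕ → Bool} : ∀ {b : ℕ}, (∀ t < b, f t = g t) → bitsVal f b = bitsVal g b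
  | 0, _ => rfl
  | b + 1, h => by
    rw [bitsVal, bitsVal, bitsVal_congr fun t ht => h t (by omega), h b (by omega)]

theorem bitsVal_inj {f g : ℕ → Bool} : ∀ {b : ℕ}, bitsVal f b = bitsVal g b → ∀ t < b, f t = g t
  | 0, _ => by simp
  | b + 1, h => by
    rw [bitsVal, bitsVal] at h
    have h1 := Bool.toNat_lt (f b)
    have h2 := Bool.toNat_lt (g b)
    intro t ht
    rcases Nat.lt_succ_iff_lt_or_eq.1 ht with ht | rfl
    · exact bitsVal_inj (by omega) t ht
    · have : (f t).toNat = (g t).toNat := by omega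
      exact (by revert this; cases f t <;> cases g t <;> simp)

theorem bitsVal_testBit (x : ℕ) : ∀ b, bitsVal (fun t => x.testBit (b - 1 - t)) b = x % 2 ^ b := by
  intro b
  induction b generalizing x with
  | zero => simp [bitsVal, Nat.mod_one]
  | succ b ih =>
    rw [bitsVal]
    have h1 : bitsVal (fun t => x.testBit (b + 1 - 1 - t)) b =
        bitsVal (fun t => (x / 2).testBit (b - 1 - t)) b := by
      refine bitsVal_congr fun t ht => ?_
      rw [Nat.testBit_div_two]
      congr 1; omega
    rw [h1, ih, pow_succ, mul_comm (2 ^ b) 2, Nat.mod_mul]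
    have : b + 1 - 1 - b = 0 := by omega
    simp only [this, Nat.testBit_zero]
    have := Nat.mod_two_eq_zero_or_one x
    rcases this with h | h <;> simp [h] <;> ring

/-- The number with the binary digits `x 0, …, x (b - 1)`. -/
def vecVal {b : ℕ} (x : Fin b → Bool) : ℕ :=
  bitsVal (fun t => if h : t < b then x ⟨t, h⟩ else false) b

theorem vecVal_lt {b : ℕ} (x : Fin b → Bool) : vecVal x < 2 ^ b := bitsVal_lt _ _

theorem vecVal_injective {b : ℕ} : Function.Injective (vecVal (b := b)) := by
  intro x y h
  funext t
  have := bitsVal_inj h t t.2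
  simpa using this

theorem vecVal_apply (f : ℕ → Bool) (b : ℕ) : vecVal (fun t : Fin b => f t) = bitsVal f b := by
  refine bitsVal_congr fun t ht => ?_
  simp [ht]

theorem card_bitVec (b : ℕ) : Fintype.card (Fin b → Bool) = 2 ^ b := by simp

/-! ### Estimating the Hamming distance from hashed cells -/

/-- A set of at most `ℓ` numbers below `2 ^ l` is injective modulo some `p + 1 ≤ P`: otherwise the
product of all differences would be a multiple of every number up to `P`, hence of a central
binomial coefficient. -/
theorem exists_mod_injOn {Y : Finset ℕ} {l ℓ P : ℕ} (hY : ∀ y ∈ Y, y < 2 ^ l) (hc : Y.card ≤ ℓ)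
    (hP : 2 * (l * ℓ ^ 2 + 4) ≤ P) : ∃ p < P, Set.InjOn (fun y => y % (p + 1)) (Y : Set ℕ) := by
  by_contra hcon
  push Not at hcon
  set Z := (Y ×ˢ Y).filter fun z => z.1 < z.2 with hZ
  set Δ := ∏ z ∈ Z, (z.2 - z.1) with hΔ
  have hΔ0 : Δ ≠ 0 := by
    rw [hΔ, Finset.prod_ne_zero_iff]
    intro z hz
    have := (Finset.mem_filter.1 hz).2
    omega
  have hΔle : Δ ≤ 2 ^ (l * ℓ ^ 2) := by
    calc Δ ≤ ∏ z ∈ Z, 2 ^ l := by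
          refine Finset.prod_le_prod' fun z hz => ?_
          have := Finset.mem_filter.1 hz
          have h2 := hY z.2 (Finset.mem_product.1 this.1).2
          omega
      _ = (2 ^ l) ^ Z.card := by simp
      _ ≤ (2 ^ l) ^ (ℓ ^ 2) := by
          refine Nat.pow_le_pow_right (by positivity) ?_
          calc Z.card ≤ (Y ×ˢ Y).card := Finset.card_filter_le _ _
            _ = Y.card ^ 2 := by rw [Finset.card_product, sq]
            _ ≤ ℓ ^ 2 := Nat.pow_le_pow_left hc 2
      _ = _ := by rw [← pow_mul]
  have hdvd : ∀ q, 1 ≤ q → q ≤ P → q ∣ Δ := by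
    intro q h1 h2
    have := hcon (q - 1) (by omega)
    rw [Nat.sub_add_cancel h1, Set.InjOn] at this
    push Not at this
    obtain ⟨a, ha, b, hb, hab, hne⟩ := this
    have main : ∀ a b, a ∈ Y → b ∈ Y → a % q = b % q → a < b → q ∣ Δ := by
      intro a b ha hb hab hlt
      have h3 : q ∣ b - a := (Nat.modEq_iff_dvd' hlt.le).1 hab
      exact h3.trans (Finset.dvd_prod_of_mem (fun z : ℕ × ℕ => z.2 - z.1)
        (a := (a, b)) (by simp [hZ, ha, hb, hlt]))
    rcases lt_or_gt_of_ne hne with h | h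
    · exact main a b ha hb hab h
    · exact main b a hb ha hab.symm h
  -- The differences of elements of `Y` multiply to `Δ ≤ 2 ^ (m - 4)`, but every `q ≤ 2 * m` divides `Δ`,
  -- and hence so does the central binomial coefficient of `m`, since its prime powers are at most `2 * m`.
  set m := l * ℓ ^ 2 + 4 with hm
  have hcb : m.centralBinom ∣ Δ := by
    rw [Nat.dvd_iff_prime_pow_dvd_dvd]
    intro p j hp hpj
    rcases Nat.eq_zero_or_pos j with rfl | hj
    · simp
    refine hdvd _ (Nat.pos_of_ne_zero (pow_ne_zero _ hp.ne_zero)) ?_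
    have hle : j ≤ m.centralBinom.factorization p :=
      (hp.pow_dvd_iff_le_factorization (Nat.centralBinom_ne_zero m)).1 hpj
    calc p ^ j ≤ p ^ (m.centralBinom.factorization p) := Nat.pow_le_pow_right hp.pos hle
      _ ≤ 2 * m := by
        rw [Nat.centralBinom]
        exact Nat.pow_factorization_choose_le (by omega)
      _ ≤ P := hP
  have h1 := Nat.le_of_dvd (Nat.pos_of_ne_zero hΔ0) hcb
  have h2 := Nat.four_pow_lt_mul_centralBinom m (by omega)
  have h3 : m < 2 ^ m := Nat.lt_two_pow_self
  have h4 : 4 ^ m < 2 ^ m * 2 ^ m := by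
    calc 4 ^ m < m * m.centralBinom := h2
      _ ≤ 2 ^ m * 2 ^ (l * ℓ ^ 2) := Nat.mul_le_mul h3.le (h1.trans hΔle)
      _ ≤ 2 ^ m * 2 ^ m := Nat.mul_le_mul le_rfl (Nat.pow_le_pow_right (by norm_num) (by omega))
  rw [← mul_pow] at h4
  norm_num at h4

section Estimator

variable {n : ℕ} [NeZero n]

/-- The fingerprint of the characters of `U` at the positions in bucket `b` that are congruent to
`s` modulo `p + 1`: a sum of hash values modulo `2 ^ F`. -/
def cell (F : ℕ) (h : ZMod n → ℕ → ℕ) (bk : ZMod n → ℕ) (U : ZMod n → ℕ) (b p s : ℕ) : ℕ :=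
  (∑ i ∈ Finset.univ.filter fun i : ZMod n => bk i = b ∧ i.val % (p + 1) = s, h i (U i)) % 2 ^ F

/-- The estimate for the Hamming distance: for each bucket, the largest number of residue classes
for one modulus in which the fingerprints differ. -/
def est (B P : ℕ) (φ ψ : ℕ → ℕ → ℕ → ℕ) : ℕ :=
  ∑ b ∈ Finset.range B, (Finset.range P).sup fun p =>
    ((Finset.range P).filter fun s => φ b p s ≠ ψ b p s).card

/-- The estimate never exceeds the distance: fingerprints in a residue class of a bucket differ only
if it contains a mismatch, and each mismatch lies in one bucket and, for a given modulus, in one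
class. -/
theorem est_le (F B P : ℕ) (h : ZMod n → ℕ → ℕ) (bk : ZMod n → ℕ) (U V : ZMod n → ℕ) :
    est B P (cell F h bk U) (cell F h bk V) ≤ hammingDist U V := by
  classical
  set X := Finset.univ.filter fun i => U i ≠ V i with hX
  calc est B P (cell F h bk U) (cell F h bk V)
      ≤ ∑ b ∈ Finset.range B, (X.filter fun i => bk i = b).card := by
        refine Finset.sum_le_sum fun b _ => Finset.sup_le fun p _ => ?_
        refine (Finset.card_le_card ?_).trans
          (Finset.card_image_le (s := X.filter fun i => bk i = b) (f := fun i => i.val % (p + 1)))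
        intro s hs
        simp only [Finset.mem_filter, Finset.mem_image] at hs ⊢
        by_contra hcon
        push Not at hcon
        apply hs.2
        unfold cell
        congr 1
        refine Finset.sum_congr rfl fun i hi => ?_
        simp only [Finset.mem_filter, Finset.mem_univ, true_and] at hi
        by_cases hne : U i = V i
        · rw [hne]
        · exact absurd hi.2 (hcon i ⟨by simp [hX, hne], hi.1⟩)
    _ = (X.filter fun i => bk i ∈ Finset.range B).card :=
        Finset.sum_card_fiberwise_eq_card_filter _ _ _
    _ ≤ X.card := Finset.card_filter_le _ _
    _ = hammingDist U V := rfl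

/-- The estimate counts all positions in a set `X` of mismatches, if at most `ℓ` of them lie in any
bucket and every mismatch is detected by all the fingerprints that cover it: in each bucket, some
modulus separates the elements of `X`. -/
theorem le_est {F B P l ℓ : ℕ} {h : ZMod n → ℕ → ℕ} {bk : ZMod n → ℕ} {U V : ZMod n → ℕ}
    (hbk : ∀ i, bk i < B) (hn : n ≤ 2 ^ l) (hP : 2 * (l * ℓ ^ 2 + 4) ≤ P)
    (hsep : ∀ i, U i ≠ V i → ∀ p < P, cell F h bk U (bk i) p (i.val % (p + 1)) ≠
      cell F h bk V (bk i) p (i.val % (p + 1)))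
    {X : Finset (ZMod n)} (hX : ∀ i ∈ X, U i ≠ V i)
    (hload : ∀ b, (X.filter fun i => bk i = b).card ≤ ℓ) :
    X.card ≤ est B P (cell F h bk U) (cell F h bk V) := by
  classical
  rw [Finset.card_eq_sum_card_fiberwise (f := bk) (t := Finset.range B)
    (fun i _ => by simpa using hbk i)]
  refine Finset.sum_le_sum fun b _ => ?_
  obtain ⟨p, hp, hinj⟩ := exists_mod_injOn (Y := (X.filter fun i => bk i = b).image ZMod.val)
    (l := l) (ℓ := ℓ) (P := P) (by
      intro y hy
      obtain ⟨i, _, rfl⟩ := Finset.mem_image.1 hy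
      exact (ZMod.val_lt i).trans_le hn) (Finset.card_image_le.trans (hload b)) hP
  refine le_trans ?_ (Finset.le_sup (f := fun p => ((Finset.range P).filter fun s =>
    cell F h bk U b p s ≠ cell F h bk V b p s).card) (Finset.mem_range.2 hp))
  refine Finset.card_le_card_of_injOn (fun i => i.val % (p + 1)) ?_ ?_
  · intro i hi
    simp only [Finset.coe_filter, Set.mem_ofPred_eq] at hi
    simp only [Finset.coe_filter, Finset.mem_range, Set.mem_ofPred_eq]
    refine ⟨(Nat.mod_lt _ (Nat.succ_pos p)).trans_le hp, ?_⟩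
    rw [← hi.2]
    exact hsep i (hX i hi.1) p hp
  · intro i hi j hj hij
    apply ZMod.val_injective n
    exact hinj (Finset.mem_coe.2 (Finset.mem_image_of_mem _ hi))
      (Finset.mem_coe.2 (Finset.mem_image_of_mem _ hj)) hij

/-- The hash values given by a table of random bits; characters from `V` on get a junk value. -/
def hashOf {V F : ℕ} (H : ZMod n × Fin V → Fin F → Bool) (i : ZMod n) (a : ℕ) : ℕ :=
  if ha : a < V then vecVal (H (i, ⟨a, ha⟩)) else 0

/-- A fingerprint that covers a mismatch `i₀` fails to detect it with probability `1 / 2 ^ F`: only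
one value of the hash of `U i₀` at `i₀` makes the fingerprints equal, whatever the other hash values
are. -/
theorem pr_cell_eq_le {V F : ℕ} (bk : ZMod n → ℕ) {U U' : ZMod n → ℕ} (hU : ∀ i, U i < V)
    {b p s : ℕ} {i₀ : ZMod n} (h0 : U i₀ ≠ U' i₀) (hb : bk i₀ = b) (hs : i₀.val % (p + 1) = s) :
    pr (fun H : ZMod n × Fin V → Fin F → Bool =>
      cell F (hashOf H) bk U b p s = cell F (hashOf H) bk U' b p s) ≤ 1 / 2 ^ F := by
  classical
  have hcard : ((Fintype.card (Fin F → Bool) : ℕ) : ℝ) = 2 ^ F := by simp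
  rw [← hcard]
  refine pr_fun_le_of_unique (i₀, ⟨U i₀, hU i₀⟩) ?_
  intro H y y' hy hy'
  set C := Finset.univ.filter fun i : ZMod n => bk i = b ∧ i.val % (p + 1) = s with hC
  have hmem : i₀ ∈ C := by simp [hC, hb, hs]
  have e1 : ∀ z, ∑ i ∈ C, hashOf (Function.update H (i₀, ⟨U i₀, hU i₀⟩) z) i (U i) =
      vecVal z + ∑ i ∈ C.erase i₀, hashOf H i (U i) := by
    intro z
    rw [← Finset.add_sum_erase C _ hmem]
    congr 1
    · simp [hashOf, hU i₀]
    · refine Finset.sum_congr rfl fun i hi => ?_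
      have := Finset.ne_of_mem_erase hi
      simp [hashOf, this]
  have e2 : ∀ z, ∑ i ∈ C, hashOf (Function.update H (i₀, ⟨U i₀, hU i₀⟩) z) i (U' i) =
      ∑ i ∈ C, hashOf H i (U' i) := by
    intro z
    refine Finset.sum_congr rfl fun i hi => ?_
    unfold hashOf
    split_ifs with hlt
    · have : ((i, ⟨U' i, hlt⟩) : ZMod n × Fin V) ≠ (i₀, ⟨U i₀, hU i₀⟩) := by
        intro heq
        simp only [Prod.mk.injEq, Fin.mk.injEq] at heq
        obtain ⟨rfl, h2⟩ := heq
        exact h0 h2.symm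
      rw [Function.update_of_ne this]
    · rfl
  unfold cell at hy hy'
  rw [← hC, e1, e2] at hy hy'
  have h3 : (vecVal y + ∑ i ∈ C.erase i₀, hashOf H i (U i)) ≡
      (vecVal y' + ∑ i ∈ C.erase i₀, hashOf H i (U i)) [MOD 2 ^ F] := hy.trans hy'.symm
  have h4 := Nat.ModEq.add_right_cancel' _ h3
  have h5 := Nat.ModEq.eq_of_lt_of_lt h4 (vecVal_lt y) (vecVal_lt y')
  exact vecVal_injective h5

/-- Random buckets, at least twice as many as there are elements, have small load. -/
theorem pr_load_le {β ℓ : ℕ} (X : Finset (ZMod n)) (hX : 2 * X.card ≤ 2 ^ β) :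
    pr (fun f : ZMod n → Fin β → Bool =>
      ¬ ∀ b, (X.filter fun i => vecVal (f i) = b).card ≤ ℓ) ≤ 2 ^ β / 2 ^ (ℓ + 1) := by
  classical
  have h1 : pr (fun f : ZMod n → Fin β → Bool =>
      ¬ ∀ b, (X.filter fun i => vecVal (f i) = b).card ≤ ℓ) ≤
      pr (fun f : ZMod n → Fin β → Bool => ∃ z ∈ (X.powersetCard (ℓ + 1)) ×ˢ
        (Finset.univ : Finset (Fin β → Bool)), ∀ i ∈ z.1, f i = z.2) := by
    refine pr_mono fun f hf => ?_
    push Not at hf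
    obtain ⟨b, hb⟩ := hf
    obtain ⟨Y, hY, hYc⟩ := Finset.exists_subset_card_eq (Nat.succ_le_of_lt hb)
    have hne : Y.Nonempty := by rw [← Finset.card_pos]; omega
    obtain ⟨i₀, hi₀⟩ := hne
    -- An overfull bucket contains a set of `ℓ + 1` elements.
    refine ⟨(Y, f i₀), ?_, ?_⟩
    · simp only [Finset.mem_product, Finset.mem_powersetCard, Finset.mem_univ, and_true]
      exact ⟨hY.trans (Finset.filter_subset _ _), hYc⟩
    · intro i hi
      apply vecVal_injective
      rw [(Finset.mem_filter.1 (hY hi)).2, (Finset.mem_filter.1 (hY hi₀)).2]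
  refine h1.trans ((pr_exists_le_card_mul _ _ (ε := (1 / 2 ^ β) ^ (ℓ + 1)) ?_).trans ?_)
  · rintro ⟨Y, c⟩ hz
    simp only [Finset.mem_product, Finset.mem_powersetCard, Finset.mem_univ, and_true] at hz
    rw [pr_fun_forall Y (fun _ y => y = c)]
    have : pr (fun y : Fin β → Bool => y = c) = 1 / 2 ^ β := by
      rw [pr_eq]
      simp [Finset.filter_eq']
    simp [this, hz.2]
  · rw [Finset.card_product, Finset.card_powersetCard, Finset.card_univ, card_bitVec]
    have h2 : ((X.card.choose (ℓ + 1) : ℕ) : ℝ) ≤ (2 ^ β / 2) ^ (ℓ + 1) := by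
      calc ((X.card.choose (ℓ + 1) : ℕ) : ℝ) ≤ ((X.card ^ (ℓ + 1) : ℕ) : ℝ) := by
            exact_mod_cast Nat.choose_le_pow _ _
        _ = (X.card : ℝ) ^ (ℓ + 1) := by push_cast; rfl
        _ ≤ _ := by
            gcongr
            rw [le_div_iff₀ (by norm_num)]
            exact_mod_cast (by omega : X.card * 2 ≤ 2 ^ β)
    push_cast
    calc ((X.card.choose (ℓ + 1) : ℕ) : ℝ) * 2 ^ β * (1 / 2 ^ β) ^ (ℓ + 1)
        ≤ (2 ^ β / 2) ^ (ℓ + 1) * 2 ^ β * (1 / 2 ^ β) ^ (ℓ + 1) := by gcongr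
      _ = 2 ^ β / 2 ^ (ℓ + 1) := by
          rw [div_pow, div_pow, one_pow]
          field_simp

/-- With high probability the estimate is not too small, up to the capacity `N`. -/
theorem pr_est_lt_le {V F β P l ℓ N : ℕ} {U U' : ZMod n → ℕ} (hU : ∀ i, U i < V)
    (hn : n ≤ 2 ^ l) (hP : 2 * (l * ℓ ^ 2 + 4) ≤ P) (hN : 2 * N ≤ 2 ^ β) :
    pr (fun x : (ZMod n → Fin β → Bool) × (ZMod n × Fin V → Fin F → Bool) =>
      est (2 ^ β) P (cell F (hashOf x.2) (fun i => vecVal (x.1 i)) U)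
        (cell F (hashOf x.2) (fun i => vecVal (x.1 i)) U') < min (hammingDist U U') N) ≤
      2 ^ β / 2 ^ (ℓ + 1) + 2 ^ β * P ^ 2 / 2 ^ F := by
  classical
  set D := Finset.univ.filter fun i => U i ≠ U' i with hD
  -- It suffices to count `min (hammingDist U U') N` of the mismatches, which fit into the buckets.
  obtain ⟨X, hXD, hXc⟩ := Finset.exists_subset_card_eq
    (show min (hammingDist U U') N ≤ D.card from min_le_left _ _)
  have hXne : ∀ i ∈ X, U i ≠ U' i := fun i hi => by simpa [hD] using hXD hi
  have h1 := pr_or_le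
    (fun x : (ZMod n → Fin β → Bool) × (ZMod n × Fin V → Fin F → Bool) =>
      ¬ ∀ b, (X.filter fun i => vecVal (x.1 i) = b).card ≤ ℓ)
    (fun x => ∃ z ∈ Finset.range (2 ^ β) ×ˢ Finset.range P ×ˢ Finset.range P,
      (∃ i, U i ≠ U' i ∧ vecVal (x.1 i) = z.1 ∧ i.val % (z.2.1 + 1) = z.2.2) ∧
      cell F (hashOf x.2) (fun i => vecVal (x.1 i)) U z.1 z.2.1 z.2.2 =
        cell F (hashOf x.2) (fun i => vecVal (x.1 i)) U' z.1 z.2.1 z.2.2)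
  refine (pr_mono fun x hx => ?_).trans (h1.trans (add_le_add ?_ ?_))
  · by_contra hcon
    push Not at hcon
    obtain ⟨hload, hcell⟩ := hcon
    have := le_est (F := F) (B := 2 ^ β) (P := P) (l := l) (ℓ := ℓ) (h := hashOf x.2)
      (bk := fun i => vecVal (x.1 i)) (U := U) (V := U') (fun i => vecVal_lt _) hn hP
      (fun i hi p hp => hcell (vecVal (x.1 i), p, i.val % (p + 1))
        (by
          simp only [Finset.mem_product, Finset.mem_range]
          exact ⟨vecVal_lt _, hp, (Nat.mod_lt _ (Nat.succ_pos p)).trans_le hp⟩) ⟨i, hi, rfl, rfl⟩)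
      hXne hload
    omega
  · rw [pr_fst (fun f : ZMod n → Fin β → Bool =>
      ¬ ∀ b, (X.filter fun i => vecVal (f i) = b).card ≤ ℓ)]
    refine pr_load_le X ?_
    have : X.card ≤ N := by rw [hXc]; exact min_le_right _ _
    omega
  · refine pr_prod_le fun f => ?_
    refine (pr_exists_le_card_mul _ _ (ε := 1 / 2 ^ F) ?_).trans ?_
    · rintro ⟨b, p, s⟩ _
      by_cases hex : ∃ i, U i ≠ U' i ∧ vecVal (f i) = b ∧ i.val % (p + 1) = s
      · obtain ⟨i, h1, h2, h3⟩ := hex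
        exact (pr_mono (q := fun H : ZMod n × Fin V → Fin F → Bool =>
          cell F (hashOf H) (fun i => vecVal (f i)) U b p s =
            cell F (hashOf H) (fun i => vecVal (f i)) U' b p s) fun H hH => hH.2).trans
          (pr_cell_eq_le _ hU h1 h2 h3)
      · refine le_trans (le_of_eq ?_) (by positivity : (0:ℝ) ≤ 1 / 2 ^ F)
        simp only [hex, false_and]
        simp [pr]
    · simp only [Finset.card_product, Finset.card_range]
      push_cast
      apply le_of_eq
      ring

end Estimator

/-! ### Anchors -/

section Anchors

variable {A : Type} [AddCommGroup A] [Fintype A] [DecidableEq A] {α : Type} [DecidableEq α]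
  [Fintype α]

/-- The characters of the rotation by `r` at the sampled positions. -/
def content (T : A → Bool) (S : A → α) (r : A) : A → Option α :=
  fun i => if T i then some (S (i + r)) else none

/-- The number of rotations with a given content. -/
def mult (T : A → Bool) (S : A → α) (q : A → Option α) : ℕ :=
  (Finset.univ.filter fun r => content T S r = q).card

/-- Each content, with as many copies as its multiplicity. -/
def keys (T : A → Bool) (S : A → α) : Finset ((A → Option α) × Fin (Fintype.card A)) :=
  Finset.univ.filter fun x => (x.2 : ℕ) < mult T S x.1

open Classical in
/-- A rotation whose content has a selected copy; `0` if there is none. -/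
noncomputable def anchor (T : A → Bool) (ρ : (A → Option α) × Fin (Fintype.card A) → Bool)
    (S : A → α) : A :=
  if h : ∃ r, ∃ j, (content T S r, j) ∈ keys T S ∧ ρ (content T S r, j) = true then h.choose else 0

theorem mult_le (T : A → Bool) (S : A → α) (q : A → Option α) : mult T S q ≤ Fintype.card A :=
  Finset.card_le_univ _

theorem sum_mult (T : A → Bool) (S : A → α) : ∑ q, mult T S q = Fintype.card A := by
  unfold mult
  rw [← Finset.card_eq_sum_card_fiberwise (f := content T S) (fun _ _ => Finset.mem_univ _)]
  rfl

theorem card_lt_filter {N w : ℕ} (hw : w ≤ N) :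
    (Finset.univ.filter fun j : Fin N => (j : ℕ) < w).card = w := by
  rw [Fin.card_filter_val_lt]; exact min_eq_right hw

/-- There are as many keys as rotations, so a key that is selected with probability `Θ(1 / n)` is
the only one with constant probability. -/
theorem card_keys (T : A → Bool) (S : A → α) : (keys T S).card = Fintype.card A := by
  refine Eq.trans ?_ (sum_mult T S)
  unfold keys
  rw [Finset.card_filter, Fintype.sum_prod_type]
  refine Finset.sum_congr rfl fun q _ => ?_
  rw [← Finset.card_filter]
  exact card_lt_filter (mult_le T S q)

/-- Rotations that agree on the sampled positions give common keys. -/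
theorem card_le_keys_inter (T : A → Bool) (S S' : A → α) (m : A) :
    (Finset.univ.filter fun r => content T S r = content T S' (r + m)).card ≤
      (keys T S ∩ keys T S').card := by
  have h1 : keys T S ∩ keys T S' =
      Finset.univ.filter fun x => (x.2 : ℕ) < min (mult T S x.1) (mult T S' x.1) := by
    ext x; simp [keys]
  have h2 : (Finset.univ.filter fun x : (A → Option α) × Fin (Fintype.card A) =>
      (x.2 : ℕ) < min (mult T S x.1) (mult T S' x.1)).card = ∑ q, min (mult T S q) (mult T S' q) := by
    rw [Finset.card_filter, Fintype.sum_prod_type]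
    refine Finset.sum_congr rfl fun q _ => ?_
    rw [← Finset.card_filter]
    exact card_lt_filter (w := min (mult T S q) (mult T S' q))
      ((min_le_left _ _).trans (mult_le T S q))
  rw [h1, h2]
  rw [Finset.card_eq_sum_card_fiberwise (f := content T S) (t := Finset.univ)
    (fun _ _ => Finset.mem_univ _)]
  refine Finset.sum_le_sum fun q _ => ?_
  refine le_min ?_ ?_
  · refine Finset.card_le_card fun r hr => ?_
    simp only [Finset.mem_filter, Finset.mem_univ, true_and] at hr ⊢
    exact hr.2
  · refine Finset.card_le_card_of_injOn (fun r => r + m) ?_ (by intro a _ b _ h; simpa using h)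
    intro r hr
    simp only [Finset.coe_filter, Finset.mem_filter, Finset.mem_univ, true_and,
      Set.mem_ofPred_eq] at hr ⊢
    rw [← hr.1, hr.2]

/-- If exactly one key of either string is selected, and it is a common key, then the two anchors
have the same content. -/
theorem content_anchor_eq {T : A → Bool} {ρ : (A → Option α) × Fin (Fintype.card A) → Bool}
    {S S' : A → α} {x : (A → Option α) × Fin (Fintype.card A)} (hx : x ∈ keys T S ∩ keys T S')
    (hρ : ρ x = true) (hu : ∀ y ∈ keys T S ∪ keys T S', y ≠ x → ρ y = false) :
    content T S (anchor T ρ S) = content T S' (anchor T ρ S') := by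
  have main : ∀ R : A → α, x ∈ keys T R → (∀ y ∈ keys T R, y ≠ x → ρ y = false) →
      content T R (anchor T ρ R) = x.1 := by
    intro R hxR huR
    have hpos : 0 < mult T R x.1 := by
      have := (Finset.mem_filter.1 hxR).2
      omega
    obtain ⟨r, hr⟩ := Finset.card_pos.1 hpos
    have hr' : content T R r = x.1 := by simpa using hr
    have hex : ∃ r, ∃ j, (content T R r, j) ∈ keys T R ∧ ρ (content T R r, j) = true :=
      ⟨r, x.2, by rw [hr']; exact hxR, by rw [hr']; exact hρ⟩
    have hch : anchor T ρ R = hex.choose := by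
      unfold anchor; rw [dif_pos hex]
    rw [hch]
    obtain ⟨j, h1, h2⟩ := hex.choose_spec
    by_contra hne
    have := huR _ h1 (fun h => hne (by rw [← h]))
    rw [this] at h2
    exact absurd h2 (by simp)
  rw [Finset.mem_inter] at hx
  rw [main S hx.1 fun y hy => hu y (Finset.mem_union_left _ hy),
    main S' hx.2 fun y hy => hu y (Finset.mem_union_right _ hy)]

/-- All bits are `0`. -/
def allZero {e : ℕ} (x : Fin e → Bool) : Bool := decide (∀ t, x t = false)

theorem pr_allZero (e : ℕ) : pr (fun x : Fin e → Bool => allZero x = true) = 1 / 2 ^ e := by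
  rw [pr_eq]
  have : (Finset.univ.filter fun x : Fin e → Bool => allZero x = true) = {fun _ => false} := by
    ext x
    simp only [allZero, decide_eq_true_eq, Finset.mem_filter, Finset.mem_univ, true_and,
      Finset.mem_singleton]
    exact ⟨fun h => funext h, fun h => by simp [h]⟩
  rw [this]
  simp

theorem pr_not_allZero (e : ℕ) :
    pr (fun x : Fin e → Bool => allZero x = false) = 1 - 1 / 2 ^ e := by
  rw [← pr_allZero, ← pr_not]
  simp

/-- The probability that exactly one key is selected, and that it is a common key. -/
theorem le_pr_select {K : Type} [Fintype K] [DecidableEq K] {e : ℕ} (X Y : Finset K)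
    (hXY : X ⊆ Y) (hY : 2 * Y.card ≤ 2 ^ e) :
    (X.card : ℝ) / (2 * 2 ^ e) ≤ pr (fun f : K → Fin e → Bool =>
      ∃ x ∈ X, allZero (f x) = true ∧ ∀ y ∈ Y, y ≠ x → allZero (f y) = false) := by
  classical
  set p : K → (K → Fin e → Bool) → Prop := fun x f =>
    allZero (f x) = true ∧ ∀ y ∈ Y, y ≠ x → allZero (f y) = false with hp
  -- the events for distinct common keys are disjoint
  have hdisj : pr (fun f : K → Fin e → Bool => ∃ x ∈ X, p x f) = ∑ x ∈ X, pr (p x) := by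
    simp only [pr_eq]
    rw [← Finset.sum_div]
    congr 1
    rw [← Nat.cast_sum]
    congr 1
    rw [← Finset.card_biUnion]
    · congr 1
      ext f; simp
    · intro x hx y hy hxy
      simp only [Function.onFun]
      rw [Finset.disjoint_left]
      intro f h1 h2
      simp only [Finset.mem_filter, Finset.mem_univ, true_and] at h1 h2
      have := h1.2 y (hXY hy) hxy.symm
      rw [h2.1] at this
      exact absurd this (by simp)
  rw [hdisj]
  have hone : ∀ x ∈ X, 1 / (2 * 2 ^ e) ≤ pr (p x) := by
    intro x hx
    have hxY := hXY hx
    have : pr (p x) = pr (fun f : K → Fin e → Bool => ∀ y ∈ Y,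
        (if y = x then allZero (f y) = true else allZero (f y) = false)) := by
      congr 1
      funext f
      simp only [hp, eq_iff_iff]
      constructor
      · rintro ⟨h1, h2⟩ y hy
        split_ifs with h
        · rw [h]; exact h1
        · exact h2 y hy h
      · intro h
        refine ⟨by simpa using h x hxY, fun y hy hyx => by simpa [hyx] using h y hy⟩
    rw [this, pr_fun_forall Y (fun y z => if y = x then allZero z = true else allZero z = false)]
    rw [← Finset.mul_prod_erase Y _ hxY]
    have h2 : ∏ y ∈ Y.erase x, pr (fun z : Fin e → Bool =>
        if y = x then allZero z = true else allZero z = false) =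
        (1 - 1 / 2 ^ e) ^ (Y.card - 1) := by
      rw [Finset.prod_congr rfl (g := fun _ => (1 - 1 / 2 ^ e : ℝ)), Finset.prod_const,
        Finset.card_erase_of_mem hxY]
      intro y hy
      rw [← pr_not_allZero]
      simp [Finset.ne_of_mem_erase hy]
    rw [h2]
    simp only [if_true]
    rw [pr_allZero]
    -- Bernoulli's inequality.
    have h3 : (1:ℝ) / 2 ≤ (1 - 1 / 2 ^ e) ^ (Y.card - 1) := by
      have h4 : (1:ℝ) + (Y.card - 1 : ℕ) * (-(1 / 2 ^ e)) ≤ (1 + -(1 / 2 ^ e)) ^ (Y.card - 1) := by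
        apply one_add_mul_le_pow
        have : (1:ℝ) / 2 ^ e ≤ 1 := by
          rw [div_le_one (by positivity)]
          exact one_le_pow₀ (by norm_num)
        linarith
      have h5 : ((Y.card - 1 : ℕ) : ℝ) * (1 / 2 ^ e) ≤ 1 / 2 := by
        rw [mul_one_div, div_le_iff₀ (by positivity)]
        have : ((Y.card - 1 : ℕ) : ℝ) * 2 ≤ 2 ^ e := by
          exact_mod_cast (by omega : (Y.card - 1) * 2 ≤ 2 ^ e)
        linarith
      rw [← sub_eq_add_neg] at h4
      linarith
    calc (1:ℝ) / (2 * 2 ^ e) = 1 / 2 ^ e * (1 / 2) := by ring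
      _ ≤ _ := by gcongr
  calc (X.card : ℝ) / (2 * 2 ^ e) = ∑ x ∈ X, (1:ℝ) / (2 * 2 ^ e) := by simp [div_eq_mul_inv]
    _ ≤ _ := Finset.sum_le_sum hone

/-- Rotations at large distance have different contents on a random sample, with high
probability. -/
theorem pr_sep_le (S S' : A → α) {K l e : ℕ} (hl : Fintype.card A < 2 ^ l)
    (hK : 10 * l * 2 ^ e ≤ K) :
    pr (fun f : A → Fin e → Bool => ¬ ∀ r r', content (fun i => allZero (f i)) S r =
      content (fun i => allZero (f i)) S' r' → hammingDist (shift r S) (shift r' S') ≤ K) ≤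
      1 / 4 := by
  classical
  have hnpos : 0 < Fintype.card A := Fintype.card_pos
  have hl1 : 1 ≤ l := by
    rcases Nat.eq_zero_or_pos l with rfl | h
    · simp at hl
    · exact h
  have h1 : ∀ z ∈ (Finset.univ : Finset (A × A)), pr (fun f : A → Fin e → Bool =>
      content (fun i => allZero (f i)) S z.1 = content (fun i => allZero (f i)) S' z.2 ∧
        ¬ hammingDist (shift z.1 S) (shift z.2 S') ≤ K) ≤ (1 / 2) ^ (10 * l) := by
    rintro ⟨r, r'⟩ _
    by_cases hK' : hammingDist (shift r S) (shift r' S') ≤ K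
    · simp only [hK', not_true, and_false]
      simp [pr]
    set D := Finset.univ.filter fun i => shift r S i ≠ shift r' S' i with hD
    have hDc : D.card = hammingDist (shift r S) (shift r' S') := rfl
    have h2 : pr (fun f : A → Fin e → Bool => ∀ i ∈ D, allZero (f i) = false) =
        (1 - 1 / 2 ^ e) ^ D.card := by
      rw [pr_fun_forall D (fun _ z => allZero z = false)]
      simp [pr_not_allZero]
    refine (pr_mono (q := fun f : A → Fin e → Bool => ∀ i ∈ D, allZero (f i) = false)
      fun f hf i hi => ?_).trans ?_
    · by_contra hne
      have hT : allZero (f i) = true := by simpa using hne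
      have h3 := congrFun hf.1 i
      simp only [content, hT, if_true, Option.some.injEq] at h3
      exact (Finset.mem_filter.1 hi).2 h3
    · rw [h2]
      have he1 : (1:ℝ) / 2 ^ e ≤ 1 := by
        rw [div_le_one (by positivity)]
        exact one_le_pow₀ (by norm_num)
      have h0 : (0:ℝ) ≤ 1 - 1 / 2 ^ e := by linarith
      calc (1 - 1 / 2 ^ e : ℝ) ^ D.card ≤ (1 - 1 / 2 ^ e) ^ (2 ^ e * (10 * l)) := by
            refine pow_le_pow_of_le_one h0 (by simp) ?_
            have : 2 ^ e * (10 * l) = 10 * l * 2 ^ e := by ring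
            rw [this, hDc]
            exact hK.trans (not_le.1 hK').le
        _ = ((1 - 1 / 2 ^ e) ^ (2 ^ e)) ^ (10 * l) := by rw [pow_mul]
        _ ≤ (1 / 2) ^ (10 * l) := by
            gcongr
            -- Bernoulli: `(1 + 2 ^ (-e)) ^ (2 ^ e) ≥ 2`
            have h4 : (1:ℝ) + (2 ^ e : ℕ) * (1 / 2 ^ e) ≤ (1 + 1 / 2 ^ e) ^ (2 ^ e) :=
              one_add_mul_le_pow (by
                have : (0:ℝ) ≤ 1 / 2 ^ e := by positivity
                linarith) _
            have h5 : ((2 ^ e : ℕ) : ℝ) * (1 / 2 ^ e) = 1 := by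
              push_cast; field_simp
            rw [h5] at h4
            have h6 : (1 - 1 / 2 ^ e : ℝ) ^ (2 ^ e) * (1 + 1 / 2 ^ e) ^ (2 ^ e) ≤ 1 := by
              rw [← mul_pow]
              apply pow_le_one₀
              · have : (0:ℝ) ≤ 1 / 2 ^ e := by positivity
                nlinarith
              · nlinarith [sq_nonneg ((1:ℝ) / 2 ^ e)]
            have h7 : (0:ℝ) ≤ (1 - 1 / 2 ^ e : ℝ) ^ (2 ^ e) := pow_nonneg h0 _
            nlinarith
  have h2 : pr (fun f : A → Fin e → Bool => ¬ ∀ r r', content (fun i => allZero (f i)) S r =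
      content (fun i => allZero (f i)) S' r' → hammingDist (shift r S) (shift r' S') ≤ K) ≤
      pr (fun f : A → Fin e → Bool => ∃ z ∈ (Finset.univ : Finset (A × A)),
        content (fun i => allZero (f i)) S z.1 = content (fun i => allZero (f i)) S' z.2 ∧
        ¬ hammingDist (shift z.1 S) (shift z.2 S') ≤ K) := by
    refine pr_mono fun f hf => ?_
    push Not at hf
    obtain ⟨r, r', h3, h4⟩ := hf
    exact ⟨(r, r'), Finset.mem_univ _, h3, not_le.2 h4⟩
  refine h2.trans ((pr_exists_le_card_mul _ _ h1).trans ?_)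
  rw [Finset.card_univ, Fintype.card_prod]
  set n := Fintype.card A with hn
  have h3 : ((n * n : ℕ) : ℝ) ≤ 2 ^ (2 * l) := by
    have : n * n ≤ 2 ^ (2 * l) := by
      rw [two_mul, pow_add]
      exact Nat.mul_le_mul hl.le hl.le
    exact_mod_cast this
  calc ((n * n : ℕ) : ℝ) * (1 / 2) ^ (10 * l) ≤ 2 ^ (2 * l) * (1 / 2) ^ (10 * l) := by gcongr
    _ = (1 / 2) ^ (8 * l) := by
        rw [show 10 * l = 2 * l + 8 * l by ring, pow_add, ← mul_assoc, ← mul_pow]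
        norm_num
    _ ≤ (1 / 2) ^ 2 := pow_le_pow_of_le_one (by norm_num) (by norm_num) (by omega)
    _ = 1 / 4 := by norm_num

/-- With constant probability, most rotations have no mismatch at a position of a random sample. -/
theorem pr_bad_le {S S' : A → α} {m : A} {k e : ℕ} (hm : hammingDist S (shift m S') ≤ k)
    (he : 8 * k ≤ 2 ^ e) :
    pr (fun f : A → Fin e → Bool => ¬ 2 * (Finset.univ.filter fun r =>
      content (fun i => allZero (f i)) S r ≠ content (fun i => allZero (f i)) S' (r + m)).card ≤
        Fintype.card A) ≤ 1 / 4 := by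
  classical
  set n := Fintype.card A with hn
  have hnpos : 0 < n := Fintype.card_pos
  let bad : (A → Fin e → Bool) → A → Prop := fun f r =>
    content (fun i => allZero (f i)) S r ≠ content (fun i => allZero (f i)) S' (r + m)
  change pr (fun f => ¬ 2 * (Finset.univ.filter fun r => bad f r).card ≤ n) ≤ 1 / 4
  -- The rotation by `r` is bad if one of its at most `k` mismatches is sampled.
  have h1 : ∀ r, pr (fun f => bad f r) ≤ 1 / 8 := by
    intro r
    set D := Finset.univ.filter fun i => shift r S i ≠ shift r (shift m S') i with hD
    have hDc : D.card ≤ k := by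
      have : D.card = hammingDist (shift r S) (shift r (shift m S')) := rfl
      rw [this, hammingDist_shift]; exact hm
    refine (pr_mono (q := fun f : A → Fin e → Bool => ∃ i ∈ D, allZero (f i) = true)
      fun f hf => ?_).trans ((pr_exists_le_card_mul (ε := 1 / 2 ^ e) _ _ fun i _ => ?_).trans ?_)
    · by_contra hcon
      push Not at hcon
      apply hf
      funext i
      unfold content
      split_ifs with hT
      · by_contra hne
        refine hcon i ?_ hT
        refine Finset.mem_filter.2 ⟨Finset.mem_univ _, fun h => hne ?_⟩
        have h' : S (i + r) = S' (i + r + m) := h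
        rw [h', add_assoc]
      · rfl
    · have := pr_fun_forall {i} (fun _ (z : Fin e → Bool) => allZero z = true)
      simp only [Finset.mem_singleton, forall_eq, Finset.prod_singleton] at this
      rw [this, pr_allZero]
    · rw [mul_one_div, div_le_iff₀ (by positivity)]
      have : (8 * D.card : ℕ) ≤ ((2 ^ e : ℕ)) := by omega
      have : (8 * D.card : ℝ) ≤ 2 ^ e := by exact_mod_cast this
      linarith
  -- Markov's inequality
  have h2 : (∑ f : A → Fin e → Bool, ((Finset.univ.filter fun r => bad f r).card : ℝ)) ≤
      n * (1 / 8) * Fintype.card (A → Fin e → Bool) := by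
    have h3 : (∑ f : A → Fin e → Bool, ((Finset.univ.filter fun r => bad f r).card : ℝ)) =
        ∑ r : A, ((Finset.univ.filter fun f => bad f r).card : ℝ) := by
      simp only [Finset.card_filter]
      push_cast
      exact Finset.sum_comm
    rw [h3]
    have hc : (0:ℝ) < Fintype.card (A → Fin e → Bool) := by exact_mod_cast Fintype.card_pos
    calc ∑ r : A, ((Finset.univ.filter fun f => bad f r).card : ℝ)
        ≤ ∑ r : A, (1 / 8) * (Fintype.card (A → Fin e → Bool) : ℝ) := by
          refine Finset.sum_le_sum fun r _ => ?_
          have := h1 r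
          rw [pr_eq, div_le_iff₀ hc] at this
          exact this
      _ = _ := by simp [hn]; ring
  rw [pr_eq]
  have hc : (0:ℝ) < Fintype.card (A → Fin e → Bool) := by exact_mod_cast Fintype.card_pos
  rw [div_le_iff₀ hc]
  set Z := Finset.univ.filter fun f : A → Fin e → Bool =>
    ¬ 2 * (Finset.univ.filter fun r => bad f r).card ≤ n with hZ
  have h4 : (Z.card : ℝ) * (n / 2) ≤
      ∑ f : A → Fin e → Bool, ((Finset.univ.filter fun r => bad f r).card : ℝ) := by
    calc (Z.card : ℝ) * (n / 2) = ∑ f ∈ Z, ((n : ℝ) / 2) := by simp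
      _ ≤ ∑ f ∈ Z, ((Finset.univ.filter fun r => bad f r).card : ℝ) := by
          refine Finset.sum_le_sum fun f hf => ?_
          have h5 := (Finset.mem_filter.1 hf).2
          push Not at h5
          have : (n : ℝ) < 2 * ((Finset.univ.filter fun r => bad f r).card : ℝ) := by
            exact_mod_cast h5
          linarith
      _ ≤ _ := Finset.sum_le_sum_of_subset_of_nonneg (Finset.subset_univ _)
          fun _ _ _ => by positivity
  have hn' : (0:ℝ) < n := by exact_mod_cast hnpos
  have h6 := h4.trans h2
  have h7 : (n:ℝ) * (Z.card : ℝ) ≤ n * (1 / 4 * (Fintype.card (A → Fin e → Bool) : ℝ)) := by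
    linarith
  exact le_of_mul_le_mul_left h7 hn'

/-- Strings with similar rotations get, with constant probability, anchors that align them up to
distance `K`. -/
theorem le_pr_anchor {S S' : A → α} {m : A} {k K l e : ℕ} (hm : hammingDist S (shift m S') ≤ k)
    (he : 8 * k ≤ 2 ^ e) (hl : Fintype.card A < 2 ^ l) (hl2 : 2 ^ l ≤ 2 * Fintype.card A)
    (hK : 10 * l * 2 ^ e ≤ K) :
    1 / 64 ≤ pr (fun x : (A → Fin e → Bool) ×
        ((A → Option α) × Fin (Fintype.card A) → Fin (l + 2) → Bool) =>
      hammingDist (shift (anchor (fun i => allZero (x.1 i)) (fun z => allZero (x.2 z)) S) S)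
        (shift (anchor (fun i => allZero (x.1 i)) (fun z => allZero (x.2 z)) S') S') ≤ K) := by
  classical
  let sep : (A → Fin e → Bool) → Prop := fun f => ∀ r r', content (fun i => allZero (f i)) S r =
    content (fun i => allZero (f i)) S' r' → hammingDist (shift r S) (shift r' S') ≤ K
  let few : (A → Fin e → Bool) → Prop := fun f => 2 * (Finset.univ.filter fun r =>
      content (fun i => allZero (f i)) S r ≠ content (fun i => allZero (f i)) S' (r + m)).card ≤
        Fintype.card A
  have hgood : 1 / 2 ≤ pr (fun f => sep f ∧ few f) := by
    have h1 := pr_not (fun f => sep f ∧ few f)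
    have h2 : pr (fun f => ¬ (sep f ∧ few f)) ≤ 1 / 4 + 1 / 4 :=
      (pr_mono fun f hf => not_and_or.1 hf).trans ((pr_or_le (fun f => ¬ sep f)
        (fun f => ¬ few f)).trans (add_le_add (pr_sep_le S S' hl hK) (pr_bad_le hm he)))
    linarith
  refine le_trans (by norm_num) (le_pr_prod (ε := 1 / 2) (δ := 1 / 32) (by norm_num) hgood
    fun f hf => ?_)
  set T : A → Bool := fun i => allZero (f i) with hT
  have hu := Finset.card_union_le (keys T S) (keys T S')
  rw [card_keys T S, card_keys T S'] at hu
  have h1 := le_pr_select (e := l + 2) (keys T S ∩ keys T S') (keys T S ∪ keys T S')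
    (Finset.inter_subset_left.trans Finset.subset_union_left) (by
      have : 2 ^ (l + 2) = 2 ^ l * 4 := by rw [pow_add]; norm_num
      omega)
  refine le_trans ?_ (h1.trans (pr_mono fun ρ hρ => ?_))
  · have h2 := card_le_keys_inter T S S' m
    have h3 := Finset.card_filter_add_card_filter_not (s := (Finset.univ : Finset A))
      (fun r => content T S r = content T S' (r + m))
    rw [Finset.card_univ] at h3
    have h4 : Fintype.card A ≤ 2 * (keys T S ∩ keys T S').card := by
      have h5 : 2 * (Finset.univ.filter fun r => ¬ content T S r = content T S' (r + m)).card ≤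
        Fintype.card A := hf.2
      omega
    rw [le_div_iff₀ (by positivity)]
    have h5 : (Fintype.card A : ℝ) ≤ 2 * ((keys T S ∩ keys T S').card : ℝ) := by exact_mod_cast h4
    have h6 : (2:ℝ) ^ l ≤ 2 * Fintype.card A := by exact_mod_cast hl2
    rw [pow_add]
    linarith
  · obtain ⟨x, hx, hx1, hx2⟩ := hρ
    exact hf.1 _ _ (content_anchor_eq (ρ := fun z => allZero (ρ z)) hx hx1 hx2)

end Anchors

/-! ### The decoding program -/

/- The variables of the decoding program. Initially `x_n`, `x_k`, `x_len1`, `x_len2` hold the input;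
`x_n` also receives the output. From `x_lg` to `x_acc`: the number of digits of `n`, the number of
bits in a word of a sketch, powers of `2 * n`, of which the largest is `x_big`, and where the words
of the two sketches start (`x_Z0`, `x_Z1`), with auxiliary variables.

From `x_R` to `x_NC`, the header of the sketch: the numbers of repetitions, masks, generators,
breaks of a generator, buckets, moduli, exceptions, and multiples of `d` to be tried; the capacity
of the estimates; the number and the number of bits of hash values; the number of bits of a bucket;
the number of characters; the first coin for buckets; where the working cells and the tables start;
and the number of cells. As they are part of the sketch, the decoder need not compute them.

The remaining variables are local to the main part.

Results that are accumulated in loops are clamped at `x_big`, which they never exceed: this lets the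
static check bound them. -/
notation "x_n" => 0
notation "x_k" => 1
notation "x_len1" => 2
notation "x_len2" => 3
notation "x_lg" => 4
notation "x_W" => 5
notation "x_b1" => 6
notation "x_b2" => 7
notation "x_b3" => 8
notation "x_b4" => 9
notation "x_b5" => 10
notation "x_b6" => 11
notation "x_big" => 12
notation "x_Z0" => 13
notation "x_Z1" => 14
notation "x_NW" => 15
notation "x_word" => 16
notation "x_bit" => 17
notation "x_acc" => 18
notation "x_R" => 20
notation "x_L" => 21
notation "x_NG" => 22
notation "x_KC" => 23
notation "x_B" => 24
notation "x_P" => 25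
notation "x_E" => 26
notation "x_E2" => 27
notation "x_KP" => 28
notation "x_MF" => 29
notation "x_FW" => 30
notation "x_beta" => 31
notation "x_VV" => 32
notation "x_CB" => 33
notation "x_WB" => 34
notation "x_TB" => 35
notation "x_NC" => 36
notation "x_best" => 37
notation "x_tau" => 38
notation "x_e" => 39
notation "x_c" => 40
notation "x_g" => 41
notation "x_q" => 42
notation "x_p" => 43
notation "x_b" => 44
notation "x_s" => 45
notation "x_t" => 46
notation "x_x" => 47
notation "x_y" => 48
notation "x_m" => 49
notation "x_mask" => 50
notation "x_idx" => 51
notation "x_j" => 52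
notation "x_i" => 53
notation "x_old" => 54
notation "x_new" => 55
notation "x_hb" => 56
notation "x_ho" => 57
notation "x_hn" => 58
notation "x_addr" => 59
notation "x_est" => 60
notation "x_mx" => 61
notation "x_cnt" => 62
notation "x_d" => 63
notation "x_tb" => 64
notation "x_v" => 65
notation "x_cb" => 66

infixl:65 " +ₑ " => Ex.op Op.add
infixl:65 " -ₑ " => Ex.op Op.sub
infixl:70 " *ₑ " => Ex.op Op.mul
infixl:70 " /ₑ " => Ex.op Op.div
infixl:70 " %ₑ " => Ex.op Op.mod
infix:50 " =ₑ " => Ex.op Op.eq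
infix:50 " <ₑ " => Ex.op Op.lt
infix:40 " ≔ " => St.assign
infixr:30 " ;ₛ " => St.seq
notation "‹" x "›" => Ex.var x

/-- The `j`-th entry of section `s` of the sketch whose words start at `z`. -/
def entry (z : ℕ) (j : Ex) (s : ℕ) : Ex := .load (‹z› +ₑ (.lit 16 *ₑ j +ₑ .lit s))

/-- Reading `len` coins from position `base` on, as a binary number. -/
def readCoins (dst base len : ℕ) : St :=
  dst ≔ .lit 0 ;ₛ
  .loop x_t len (dst ≔ .clamp (.lit 2 *ₑ ‹dst› +ₑ .coin (‹base› +ₑ ‹x_t›)) ‹x_big›)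

/-- The number of binary digits of `n`. -/
def codeLog : St :=
  .loop x_word x_len1 (.ite (.op .shr ‹x_n› ‹x_word›) (x_lg ≔ ‹x_word› +ₑ .lit 1) (x_lg ≔ ‹x_lg›))

/-- Word length, an upper bound for all intermediate results, and where the words are stored. -/
def codeInit : St :=
  x_W ≔ .lit 60 *ₑ ‹x_lg› ;ₛ
  x_b1 ≔ ‹x_n› +ₑ ‹x_n› ;ₛ
  x_b2 ≔ ‹x_b1› *ₑ ‹x_b1› ;ₛ
  x_b3 ≔ ‹x_b2› *ₑ ‹x_b2› ;ₛ
  x_b4 ≔ ‹x_b3› *ₑ ‹x_b3› ;ₛ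
  x_b5 ≔ ‹x_b4› *ₑ ‹x_b4› ;ₛ
  x_b6 ≔ ‹x_b5› *ₑ ‹x_b5› ;ₛ
  x_big ≔ ‹x_b6› *ₑ ‹x_b6› ;ₛ
  x_Z0 ≔ ‹x_len1› +ₑ ‹x_len2› ;ₛ
  x_NW ≔ ‹x_Z0› /ₑ ‹x_W› ;ₛ
  x_Z1 ≔ ‹x_Z0› +ₑ ‹x_len1› /ₑ ‹x_W›

/-- Packing the bits of the two sketches into words. -/
def codeUnpack : St :=
  .loop x_word x_NW (
    x_acc ≔ .lit 0 ;ₛ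
    .loop x_bit x_W (x_acc ≔ .clamp (.lit 2 *ₑ ‹x_acc› +ₑ
      .load (‹x_word› *ₑ ‹x_W› +ₑ ‹x_bit›)) ‹x_big›) ;ₛ
    .store (‹x_Z0› +ₑ ‹x_word›) ‹x_acc›)

/-- Reading the parameters from the header of the first sketch. -/
def codeHeader : St :=
  x_R ≔ entry x_Z0 (.lit 0) 0 ;ₛ
  x_L ≔ entry x_Z0 (.lit 1) 0 ;ₛ
  x_NG ≔ entry x_Z0 (.lit 2) 0 ;ₛ
  x_KC ≔ entry x_Z0 (.lit 3) 0 ;ₛ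
  x_B ≔ entry x_Z0 (.lit 4) 0 ;ₛ
  x_P ≔ entry x_Z0 (.lit 5) 0 ;ₛ
  x_E ≔ entry x_Z0 (.lit 6) 0 ;ₛ
  x_E2 ≔ entry x_Z0 (.lit 7) 0 ;ₛ
  x_KP ≔ entry x_Z0 (.lit 8) 0 ;ₛ
  x_MF ≔ entry x_Z0 (.lit 9) 0 ;ₛ
  x_FW ≔ entry x_Z0 (.lit 10) 0 ;ₛ
  x_beta ≔ entry x_Z0 (.lit 11) 0 ;ₛ
  x_VV ≔ entry x_Z0 (.lit 12) 0 ;ₛ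
  x_CB ≔ entry x_Z0 (.lit 13) 0 ;ₛ
  x_WB ≔ entry x_Z0 (.lit 14) 0 ;ₛ
  x_TB ≔ entry x_Z0 (.lit 15) 0 ;ₛ
  x_NC ≔ entry x_Z0 (.lit 16) 0 ;ₛ
  x_best ≔ ‹x_k› +ₑ .lit 1

/-- Adding the difference of the hash values `x_hn` and `x_ho` to the working cells of position
`x_i` in bucket `x_hb`. -/
def codeUpdate : St :=
  .loop x_p x_P (
    x_addr ≔ ‹x_WB› +ₑ ((‹x_hb› *ₑ ‹x_P› +ₑ ‹x_p›) *ₑ ‹x_P› +ₑ ‹x_i› %ₑ (‹x_p› +ₑ .lit 1)) ;ₛ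
    .store ‹x_addr› (.clamp ((.load ‹x_addr› +ₑ ‹x_hn› +ₑ ‹x_MF› -ₑ ‹x_ho›) %ₑ ‹x_MF›) ‹x_big›))

/-- Reading the bucket of position `x_i` and the hash values of `x_old` and `x_new`. -/
def codeHash : St :=
  x_cb ≔ ‹x_CB› +ₑ ‹x_i› *ₑ ‹x_beta› ;ₛ
  readCoins x_hb x_cb x_beta ;ₛ
  x_cb ≔ (‹x_i› *ₑ ‹x_VV› +ₑ ‹x_old›) *ₑ ‹x_FW› ;ₛ
  readCoins x_ho x_cb x_FW ;ₛ
  x_cb ≔ (‹x_i› *ₑ ‹x_VV› +ₑ ‹x_new›) *ₑ ‹x_FW› ;ₛ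
  readCoins x_hn x_cb x_FW

/-- Applying the `q`-th break of generator `g` to the working cells. -/
def codeBreak : St :=
  x_idx ≔ (‹x_tau› *ₑ ‹x_NG› +ₑ ‹x_g›) *ₑ ‹x_KC› +ₑ ‹x_q› ;ₛ
  x_j ≔ entry x_Z1 ‹x_idx› 4 ;ₛ
  x_old ≔ entry x_Z1 ‹x_idx› 5 ;ₛ
  x_new ≔ entry x_Z1 ‹x_idx› 6 ;ₛ
  x_i ≔ .clamp ((‹x_j› +ₑ ‹x_n› -ₑ ‹x_m›) %ₑ ‹x_n›) ‹x_big› ;ₛ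
  codeHash ;ₛ codeUpdate

/-- The working cells become the cells of the rotation of the second string that the mask encodes.
-/
def codeShift : St :=
  .loop x_c x_NC (.store (‹x_WB› +ₑ ‹x_c›) (entry x_Z1 (‹x_tau› *ₑ ‹x_NC› +ₑ ‹x_c›) 1)) ;ₛ
  x_m ≔ .lit 0 ;ₛ
  x_mask ≔ entry x_Z1 (‹x_tau› *ₑ ‹x_L› +ₑ ‹x_e›) 2 ;ₛ
  .loop x_g x_NG (.ite (.op .and (.op .shr ‹x_mask› ‹x_g›) (.lit 1))
    (.loop x_q x_KC codeBreak ;ₛ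
      x_m ≔ .clamp ((‹x_m› +ₑ entry x_Z1 (‹x_tau› *ₑ ‹x_NG› +ₑ ‹x_g›) 3) %ₑ ‹x_n›) ‹x_big›)
    (x_m ≔ ‹x_m›))

/-- Counting the residues modulo `x_p + 1` for which the cells of bucket `x_b` differ. -/
def codeCount : St :=
  x_cnt ≔ .lit 0 ;ₛ
  .loop x_s x_P (
    x_addr ≔ (‹x_b› *ₑ ‹x_P› +ₑ ‹x_p›) *ₑ ‹x_P› +ₑ ‹x_s› ;ₛ
    x_cnt ≔ .clamp (‹x_cnt› +ₑ (.lit 1 -ₑ (.load (‹x_WB› +ₑ ‹x_addr›) =ₑ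
      entry x_Z0 (‹x_tau› *ₑ ‹x_NC› +ₑ ‹x_addr›) 1))) ‹x_big›)

/-- The largest count for bucket `x_b`. -/
def codeMax : St :=
  x_mx ≔ .lit 0 ;ₛ
  .loop x_p x_P (codeCount ;ₛ x_mx ≔ .clamp (‹x_mx› +ₑ (‹x_cnt› -ₑ ‹x_mx›)) ‹x_big›)

/-- Comparing the working cells with the cells of the first string. -/
def codeEst : St :=
  x_est ≔ .lit 0 ;ₛ
  .loop x_b x_B (codeMax ;ₛ x_est ≔ .clamp (‹x_est› +ₑ ‹x_mx›) ‹x_big›)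

/-- `x_best` becomes the minimum of itself and `x_v`. -/
def codeMin (e : Ex) : St := x_v ≔ e ;ₛ x_best ≔ ‹x_best› -ₑ (‹x_best› -ₑ ‹x_v›)

/-- The difference of the positions of an exception of the first and one of the second string. -/
def codeDiff : St :=
  x_i ≔ entry x_Z0 (‹x_tau› *ₑ ‹x_E› +ₑ ‹x_x›) 8 ;ₛ
  x_j ≔ entry x_Z1 (‹x_tau› *ₑ ‹x_E› +ₑ ‹x_y›) 8 ;ₛ
  x_m ≔ .clamp ((‹x_j› +ₑ ‹x_n› -ₑ ‹x_i›) %ₑ ‹x_n›) ‹x_big› ;ₛ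
  x_addr ≔ ‹x_tb› +ₑ .lit 2 *ₑ ‹x_m›

/-- Counting the pairs of exceptions. -/
def codeTable : St :=
  .loop x_x x_E (.loop x_y x_E (
    codeDiff ;ₛ
    x_old ≔ entry x_Z0 (‹x_tau› *ₑ ‹x_E› +ₑ ‹x_x›) 9 ;ₛ
    x_new ≔ entry x_Z0 (‹x_tau› *ₑ ‹x_E› +ₑ ‹x_x›) 10 ;ₛ
    x_ho ≔ entry x_Z1 (‹x_tau› *ₑ ‹x_E› +ₑ ‹x_y›) 9 ;ₛ
    x_hn ≔ entry x_Z1 (‹x_tau› *ₑ ‹x_E› +ₑ ‹x_y›) 10 ;ₛ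
    .store ‹x_addr› (.clamp (.load ‹x_addr› +ₑ ((.lit 1 -ₑ (‹x_old› =ₑ ‹x_ho›)) +ₑ
      (.lit 1 -ₑ (‹x_new› =ₑ ‹x_hn›)))) ‹x_big›) ;ₛ
    .store (‹x_addr› +ₑ .lit 1) (.clamp (.load (‹x_addr› +ₑ .lit 1) +ₑ
      ((.lit 1 -ₑ (‹x_old› =ₑ ‹x_hn›)) +ₑ (.lit 1 -ₑ (‹x_new› =ₑ ‹x_ho›)))) ‹x_big›)))

/-- The distance for the rotation `x_m`, from the table of pairs. -/
def codeCand : St :=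
  codeMin ((‹x_est› +ₑ .load ‹x_addr› +ₑ .load (‹x_tb› +ₑ .lit 1)) -ₑ
    (.load (‹x_addr› +ₑ .lit 1) +ₑ .load ‹x_tb›))

/-- The least distance for the rotations in the subgroup. -/
def codeSubgroup : St :=
  x_tb ≔ ‹x_TB› +ₑ ‹x_tau› *ₑ (‹x_n› +ₑ ‹x_n›) ;ₛ
  codeTable ;ₛ
  .loop x_x x_E (.loop x_y x_E (codeDiff ;ₛ .ite (‹x_m› %ₑ ‹x_d›) (x_v ≔ ‹x_v›) codeCand)) ;ₛ
  .loop x_t x_E2 (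
    x_m ≔ .clamp ((‹x_t› *ₑ ‹x_d›) %ₑ ‹x_n›) ‹x_big› ;ₛ
    x_addr ≔ ‹x_tb› +ₑ .lit 2 *ₑ ‹x_m› ;ₛ
    codeCand)

/-- One repetition. -/
def codeRep : St :=
  .loop x_e x_L (codeShift ;ₛ codeEst ;ₛ codeMin ‹x_est›) ;ₛ
  x_d ≔ entry x_Z0 ‹x_tau› 7 ;ₛ
  .ite (‹x_d› *ₑ ((‹x_d› =ₑ entry x_Z1 ‹x_tau› 7) *ₑ (‹x_est› <ₑ (‹x_KP› +ₑ .lit 1))))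
    codeSubgroup (x_v ≔ ‹x_v›)

/-- All repetitions. -/
def codeMain : St := .loop x_tau x_R codeRep

/-- The result goes to the output register. -/
def codeOut : St := x_n ≔ ‹x_best›

/-- The degrees during the main part: some addresses and results may be large, all other values
are below `2 ^ (128 * l)`. -/
def degMain (x : ℕ) : ℕ :=
  if x = x_n ∨ x = x_best ∨ x = x_v then 140
  else if x = x_tb then 500
  else if (2 ≤ x ∧ x ≤ 5) ∨ (13 ≤ x ∧ x ≤ 17) ∨ x = x_idx ∨ x = x_addr ∨ x = x_cb then 1000
  else 128

/-- The degrees in the beginning, when `x_n` still holds `n`. -/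
def degInit (x : ℕ) : ℕ :=
  if x ≤ 1 then 1
  else if x = x_lg then 130
  else if x = x_W ∨ x = x_bit then 136
  else if 6 ≤ x ∧ x ≤ 12 then 2 ^ (x - 5)
  else if x = x_Z0 ∨ x = x_NW ∨ x = x_word then 129
  else if x = x_Z1 then 130
  else 128

/-! The parts of the program pass the static check, by evaluation: on words of `4000 * l` bits no
intermediate result overflows. -/

theorem ok_codeLog : codeLog.ok degInit 128 4000 codeLog.writes = true := by decide +kernel
theorem ok_codeInit : codeInit.ok degInit 128 4000 codeInit.writes = true := by decide +kernel
theorem ok_codeUnpack : codeUnpack.ok degInit 128 4000 codeUnpack.writes = true := by decide +kernel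
theorem ok_codeHeader : codeHeader.ok degMain 128 4000 codeHeader.writes = true := by decide +kernel
theorem ok_codeMain : codeMain.ok degMain 128 4000 codeMain.writes = true := by decide +kernel
theorem ok_codeOut : codeOut.ok degMain 128 4000 codeOut.writes = true := by decide +kernel

/-! ### Effect of the decoding program -/

@[simp] theorem State.reg_set (s : State) (x v y : ℕ) :
    (s.set x v).reg y = if y = x then v else s.reg y := by
  simp [State.set, Function.update_apply]

@[simp] theorem State.mem_set (s : State) (x v : ℕ) : (s.set x v).mem = s.mem := rfl

@[simp] theorem State.reg_write (s : State) (a v : ℕ) : (s.write a v).reg = s.reg := rfl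

@[simp] theorem State.mem_write (s : State) (a v b : ℕ) :
    (s.write a v).mem b = if b = a then v else s.mem b := by
  simp [State.write, Function.update_apply]

@[simp] theorem St.run_assign (ω : Coins) (x : ℕ) (e : Ex) (s : State) :
    (x ≔ e).run ω s = s.set x (e.eval ω s) := rfl

@[simp] theorem St.run_store (ω : Coins) (a e : Ex) (s : State) :
    (St.store a e).run ω s = s.write (a.eval ω s) (e.eval ω s) := rfl

@[simp] theorem St.run_seq (ω : Coins) (p q : St) (s : State) :
    (p ;ₛ q).run ω s = q.run ω (p.run ω s) := rfl

@[simp] theorem St.run_ite (ω : Coins) (e : Ex) (p q : St) (s : State) :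
    (St.ite e p q).run ω s = if e.eval ω s ≠ 0 then p.run ω s else q.run ω s := rfl

attribute [simp] Ex.eval Op.eval

/-- The rule for counting loops, in the form of a Hoare triple. -/
theorem St.loop_rule (ω : Coins) {x N : ℕ} {p : St} {s : State} {Q : State → Prop} (n : ℕ)
    (I : ℕ → State → Prop) (hs : s.reg N = n) (h0 : I 0 s)
    (hstep : ∀ i < n, ∀ u, I i u → I (i + 1) (p.run ω (u.set x i)))
    (hQ : ∀ u, I n u → Q (u.set x n)) : Q ((St.loop x N p).run ω s) := by
  subst hs
  obtain ⟨u, hu, hr⟩ := St.loop_inv ω I h0 hstep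
  rw [hr]
  exact hQ u hu

/-- Reading coins gives a binary number; the clamp has no effect if the number is at most `x_big`.
-/
theorem readCoins_run (ω : Coins) {dst base len : ℕ} {s : State} (h1 : dst ≠ x_t)
    (h2 : base ≠ x_t) (h4 : base ≠ dst) (h5 : len ≠ dst) (h6 : x_big ≠ dst)
    (hb : 2 ^ s.reg len ≤ s.reg x_big + 1) :
    (readCoins dst base len).run ω s =
      (s.set dst (bitsVal (fun t => ω (s.reg base + t)) (s.reg len))).set x_t (s.reg len) := by
  obtain ⟨u, hu, hr⟩ := St.loop_inv ω (x := x_t) (N := len)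
    (p := dst ≔ .clamp (.lit 2 *ₑ ‹dst› +ₑ .coin (‹base› +ₑ ‹x_t›)) ‹x_big›)
    (s := s.set dst 0)
    (fun i u => (∀ y, y ≠ x_t → u.reg y =
      (s.set dst (bitsVal (fun t => ω (s.reg base + t)) i)).reg y) ∧ u.mem = s.mem)
    (by simp [bitsVal, State.mem_set])
    (by
      rintro i hi u ⟨hr, hm⟩
      refine ⟨fun y hy => ?_, hm⟩
      have hi' : i + 1 ≤ s.reg len := by simpa [State.reg_set, h5] using hi
      have hlt : 2 * bitsVal (fun t => ω (s.reg base + t)) i + (ω (s.reg base + i)).toNat <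
          s.reg x_big + 1 :=
        (bitsVal_lt (fun t => ω (s.reg base + t)) (i + 1)).trans_le
          ((Nat.pow_le_pow_right (by norm_num) hi').trans hb)
      simp only [St.run, Ex.eval, Op.eval, State.reg_set, h1, h2, if_false, if_true, hr _ h1,
        hr _ h2, hr x_big (by decide), h4, h6]
      by_cases hyd : y = dst
      · simp only [hyd, if_true, bitsVal]
        exact Nat.mod_eq_of_lt hlt
      · simp [hyd, hy, hr, State.reg_set])
  have hlen : (s.set dst 0).reg len = s.reg len := by simp [State.reg_set, h5]
  rw [hlen] at hr hu
  have : (readCoins dst base len).run ω s =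
      (St.loop x_t len (dst ≔ .clamp (.lit 2 *ₑ ‹dst› +ₑ .coin (‹base› +ₑ ‹x_t›)) ‹x_big›)).run ω
        (s.set dst 0) := rfl
  rw [this, hr]
  obtain ⟨hu1, hu2⟩ := hu
  have : ∀ a b : State, a.reg = b.reg → a.mem = b.mem → a = b := by
    rintro ⟨_, _⟩ ⟨_, _⟩ rfl rfl; rfl
  refine this _ _ ?_ hu2
  funext y
  by_cases hy : y = x_t
  · simp [hy, State.reg_set]
  · simp [hy, hu1 y hy, State.reg_set]

/-- The parameters are in their registers, and the memory below the working area is as it was at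
the beginning. -/
structure Ctx (ρ μ : ℕ → ℕ) (s : State) : Prop where
  reg : ∀ x, x < 37 → s.reg x = ρ x
  mem : ∀ a, a < ρ x_WB → s.mem a = μ a

theorem Ctx.set {ρ μ : ℕ → ℕ} {s : State} (h : Ctx ρ μ s) {x : ℕ} (hx : 37 ≤ x) (v : ℕ) :
    Ctx ρ μ (s.set x v) := by
  refine ⟨fun y hy => ?_, h.mem⟩
  have : y ≠ x := by omega
  simp [State.reg_set, this, h.reg y hy]

theorem Ctx.write {ρ μ : ℕ → ℕ} {s : State} (h : Ctx ρ μ s) {a : ℕ} (ha : ρ x_WB ≤ a) (v : ℕ) :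
    Ctx ρ μ (s.write a v) := by
  refine ⟨h.reg, fun b hb => ?_⟩
  have : b ≠ a := by omega
  simp [State.mem_write, this, h.mem b hb]

/-- Relations between the parameters; `J` bounds the lengths of the sections of a sketch. -/
structure Layout (ρ : ℕ → ℕ) (J : ℕ) : Prop where
  n_pos : 0 < ρ x_n
  n_le : ρ x_n ≤ ρ x_big
  MF_eq : ρ x_MF = 2 ^ ρ x_FW
  MF_le : ρ x_MF ≤ ρ x_big
  B_eq : ρ x_B = 2 ^ ρ x_beta
  P_pos : 0 < ρ x_P
  L_pos : 0 < ρ x_L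
  BP_le : ρ x_B * ρ x_P ≤ ρ x_big
  EE_le : 2 * (ρ x_E * ρ x_E) ≤ ρ x_big
  NC_eq : ρ x_NC = ρ x_B * ρ x_P * ρ x_P
  E2_eq : ρ x_E2 = ρ x_E * ρ x_E + 1
  R_le : ρ x_R ≤ J
  RNC_le : ρ x_R * ρ x_NC ≤ J
  RL_le : ρ x_R * ρ x_L ≤ J
  RNG_le : ρ x_R * ρ x_NG ≤ J
  RNGKC_le : ρ x_R * ρ x_NG * ρ x_KC ≤ J
  RE_le : ρ x_R * ρ x_E ≤ J
  Z0_le : ρ x_Z0 + 16 * J ≤ ρ x_WB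
  Z1_le : ρ x_Z1 + 16 * J ≤ ρ x_WB
  TB_le : ρ x_WB + ρ x_NC ≤ ρ x_TB

/-- The `j`-th entry of section `s` of the sketch whose words start at `z`. -/
def sec (μ : ℕ → ℕ) (z s j : ℕ) : ℕ := μ (z + (16 * j + s))

theorem mul_add_lt_of_lt {τ R c N J : ℕ} (hτ : τ < R) (hc : c < N) (h : R * N ≤ J) :
    τ * N + c < J := by
  have : (τ + 1) * N ≤ R * N := Nat.mul_le_mul_right _ hτ
  nlinarith

/-- An entry of a section is read from the part of the memory that the main part leaves unchanged.
-/
theorem eval_entry {ρ μ : ℕ → ℕ} {J : ℕ} (hL : Layout ρ J) {u : State} (hc : Ctx ρ μ u) (ω : Coins)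
    {z s : ℕ} {e : Ex} (hz : z = x_Z0 ∨ z = x_Z1) (hs : s < 16) (he : e.eval ω u < J) :
    (entry z e s).eval ω u = sec μ (ρ z) s (e.eval ω u) := by
  have hz' : z < 37 := by omega
  have h1 := hL.Z0_le
  have h2 := hL.Z1_le
  simp only [entry, Ex.eval, Op.eval, hc.reg z hz', sec]
  refine hc.mem _ ?_
  rcases hz with rfl | rfl <;> omega

/-- Number of the cell for bucket `b`, modulus `p + 1` and residue `s`. -/
def cidx (P b p s : ℕ) : ℕ := (b * P + p) * P + s

theorem cidx_lt {B P b p s : ℕ} (hb : b < B) (hp : p < P) (hs : s < P) :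
    cidx P b p s < B * P * P := by
  unfold cidx
  have h1 : b * P + p < B * P := mul_add_lt_of_lt hb hp le_rfl
  exact mul_add_lt_of_lt h1 hs le_rfl

theorem cidx_inj {P b p s b' p' s' : ℕ} (hp : p < P) (hs : s < P) (hp' : p' < P) (hs' : s' < P)
    (h : cidx P b p s = cidx P b' p' s') : b = b' ∧ p = p' ∧ s = s' := by
  unfold cidx at h
  have hP : 0 < P := by omega
  have e1 : b * P + p = b' * P + p' := by
    have := congrArg (· / P) h
    simpa [Nat.mul_comm _ P, Nat.mul_add_div hP, Nat.div_eq_of_lt hs, Nat.div_eq_of_lt hs']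
      using this
  have e2 : b = b' := by
    have := congrArg (· / P) e1
    simpa [Nat.mul_comm _ P, Nat.mul_add_div hP, Nat.div_eq_of_lt hp, Nat.div_eq_of_lt hp']
      using this
  subst e2
  have e3 : p = p' := by omega
  subst e3
  exact ⟨rfl, rfl, by omega⟩

/-- In `x_cnt`: for one bucket and one modulus, the number of fingerprints that differ. -/
theorem codeCount_run {ρ μ : ℕ → ℕ} {J : ℕ} (hL : Layout ρ J) (ω : Coins) {u : State}
    (hc : Ctx ρ μ u) {τ b p : ℕ} (hτ : u.reg x_tau = τ) (hb : u.reg x_b = b) (hp : u.reg x_p = p)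
    (hτR : τ < ρ x_R) (hbB : b < ρ x_B) (hpP : p < ρ x_P) :
    Ctx ρ μ (codeCount.run ω u) ∧ (codeCount.run ω u).mem = u.mem ∧
    (codeCount.run ω u).reg x_cnt =
      ((Finset.range (ρ x_P)).filter fun s => u.mem (ρ x_WB + cidx (ρ x_P) b p s) ≠
        sec μ (ρ x_Z0) 1 (τ * ρ x_NC + cidx (ρ x_P) b p s)).card := by
  have hPb : ρ x_P ≤ ρ x_big := by
    refine le_trans ?_ hL.BP_le
    refine Nat.le_mul_of_pos_left _ ?_
    rw [hL.B_eq]; positivity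
  rw [codeCount, St.run_seq]
  refine St.loop_rule ω (Q := fun w => Ctx ρ μ w ∧ w.mem = u.mem ∧ w.reg x_cnt = _) (ρ x_P)
    (fun i v => Ctx ρ μ v ∧ v.mem = u.mem ∧ v.reg x_tau = τ ∧
    v.reg x_b = b ∧ v.reg x_p = p ∧ v.reg x_cnt =
      ((Finset.range i).filter fun s => u.mem (ρ x_WB + cidx (ρ x_P) b p s) ≠
        sec μ (ρ x_Z0) 1 (τ * ρ x_NC + cidx (ρ x_P) b p s)).card) ?_ ?_ ?_ ?_
  · simp [hc.reg]
  · exact ⟨hc.set (by decide) _, by simp [hτ, hb, hp]⟩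
  · rintro i hi v ⟨hcv, hm, h1, h2, h3, h4⟩
    have hcv' := (hcv.set (x := x_s) (by decide) i).set (x := x_addr) (by decide)
      (cidx (ρ x_P) b p i)
    have hlt : τ * ρ x_NC + cidx (ρ x_P) b p i < J := by
      refine mul_add_lt_of_lt hτR ?_ hL.RNC_le
      rw [hL.NC_eq]; exact cidx_lt hbB hpP hi
    have he := eval_entry hL hcv' ω (z := x_Z0) (s := 1) (e := ‹x_tau› *ₑ ‹x_NC› +ₑ ‹x_addr›)
      (Or.inl rfl) (by decide) (by simpa [h1, hcv.reg] using hlt)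
    have ha : (v.reg x_b * ρ x_P + v.reg x_p) * ρ x_P + i = cidx (ρ x_P) b p i := by
      simp [h2, h3, cidx]
    simp only [St.run_seq, St.run_assign]
    have ha' : ((‹x_b› *ₑ ‹x_P› +ₑ ‹x_p›) *ₑ ‹x_P› +ₑ ‹x_s›).eval ω (v.set x_s i) =
      cidx (ρ x_P) b p i := by simp [hcv.reg, ha]
    rw [ha']
    refine ⟨hcv'.set (by decide) _, by simp [hm], by simp [h1], by simp [h2], by simp [h3], ?_⟩
    have key : ((Finset.range (i + 1)).filter fun s => u.mem (ρ x_WB + cidx (ρ x_P) b p s) ≠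
        sec μ (ρ x_Z0) 1 (τ * ρ x_NC + cidx (ρ x_P) b p s)).card =
        v.reg x_cnt + (1 - if u.mem (ρ x_WB + cidx (ρ x_P) b p i) =
          sec μ (ρ x_Z0) 1 (τ * ρ x_NC + cidx (ρ x_P) b p i) then 1 else 0) := by
      rw [h4]
      simp only [Finset.range_add_one, Finset.filter_insert]
      split_ifs with h h' <;> simp_all
    simp only [State.reg_set, if_true]
    simp only [Ex.eval, Op.eval, he]
    simp only [State.reg_set, State.mem_set, hm, hcv.reg x_WB (by decide), hcv.reg x_NC (by decide), hcv.reg x_big (by decide), h1,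
      Nat.reduceEqDiff, if_true, if_false]
    rw [key]
    refine Nat.mod_eq_of_lt ?_
    rw [← key]
    have := (Finset.card_filter_le (Finset.range (i + 1)) fun s =>
      u.mem (ρ x_WB + cidx (ρ x_P) b p s) ≠
        sec μ (ρ x_Z0) 1 (τ * ρ x_NC + cidx (ρ x_P) b p s))
    rw [Finset.card_range] at this
    omega
  · rintro v ⟨hcv, hm, h1, h2, h3, h4⟩
    exact ⟨hcv.set (by decide) _, by simp [hm], by simp [h4]⟩

/-- In `x_mx`: for one bucket, the maximum of these numbers over the moduli. -/
theorem codeMax_run {ρ μ : ℕ → ℕ} {J : ℕ} (hL : Layout ρ J) (ω : Coins) {u : State}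
    (hc : Ctx ρ μ u) {τ b : ℕ} (hτ : u.reg x_tau = τ) (hb : u.reg x_b = b)
    (hτR : τ < ρ x_R) (hbB : b < ρ x_B) :
    Ctx ρ μ (codeMax.run ω u) ∧ (codeMax.run ω u).mem = u.mem ∧
    (codeMax.run ω u).reg x_mx = (Finset.range (ρ x_P)).sup fun p =>
      ((Finset.range (ρ x_P)).filter fun s => u.mem (ρ x_WB + cidx (ρ x_P) b p s) ≠
        sec μ (ρ x_Z0) 1 (τ * ρ x_NC + cidx (ρ x_P) b p s)).card := by
  have hPb : ρ x_P ≤ ρ x_big := by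
    refine le_trans ?_ hL.BP_le
    refine Nat.le_mul_of_pos_left _ ?_
    rw [hL.B_eq]; positivity
  rw [codeMax, St.run_seq]
  refine St.loop_rule ω (Q := fun w => Ctx ρ μ w ∧ w.mem = u.mem ∧ w.reg x_mx = _) (ρ x_P)
    (fun i v => Ctx ρ μ v ∧ v.mem = u.mem ∧ v.reg x_tau = τ ∧
    v.reg x_b = b ∧ v.reg x_mx = (Finset.range i).sup fun p =>
      ((Finset.range (ρ x_P)).filter fun s => u.mem (ρ x_WB + cidx (ρ x_P) b p s) ≠
        sec μ (ρ x_Z0) 1 (τ * ρ x_NC + cidx (ρ x_P) b p s)).card) ?_ ?_ ?_ ?_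
  · simp [hc.reg]
  · exact ⟨hc.set (by decide) _, by simp [hτ, hb]⟩
  · rintro i hi v ⟨hcv, hm, h1, h2, h4⟩
    obtain ⟨c1, m1, r1⟩ := codeCount_run hL ω (hcv.set (x := x_p) (by decide) i) (τ := τ)
      (b := b) (p := i) (by simp [h1]) (by simp [h2]) (by simp) hτR hbB hi
    have f1 : (codeCount.run ω (v.set x_p i)).reg x_tau = τ := by
      rw [St.run_frame ω (by decide)]; simp [h1]
    have f2 : (codeCount.run ω (v.set x_p i)).reg x_b = b := by
      rw [St.run_frame ω (by decide)]; simp [h2]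
    have f3 := St.run_frame ω (p := codeCount) (y := x_mx) (by decide) (v.set x_p i)
    simp only [State.mem_set, hm] at r1
    rw [St.run_seq]
    refine ⟨c1.set (by decide) _, by simpa [hm] using m1, by simp [f1], by simp [f2], ?_⟩
    simp only [St.run_assign, State.reg_set, if_true, Ex.eval, Op.eval, f3, r1,
      c1.reg x_big (by decide), Nat.reduceEqDiff, if_false, h4]
    rw [Finset.range_add_one, Finset.sup_insert, Nat.mod_eq_of_lt]
    · omega
    · have h5 : ∀ p, ((Finset.range (ρ x_P)).filter fun s =>
          u.mem (ρ x_WB + cidx (ρ x_P) b p s) ≠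
          sec μ (ρ x_Z0) 1 (τ * ρ x_NC + cidx (ρ x_P) b p s)).card ≤ ρ x_P := fun p =>
        (Finset.card_filter_le _ _).trans (by simp)
      have h6 := h5 i
      have h7 := Finset.sup_le (s := Finset.range i) fun p _ => h5 p
      omega
  · rintro v ⟨hcv, hm, h1, h2, h4⟩
    exact ⟨hcv.set (by decide) _, by simp [hm], by simp [h4]⟩

/-- In `x_est`: the estimate, with the fingerprints in the working area for the second string. -/
theorem codeEst_run {ρ μ : ℕ → ℕ} {J : ℕ} (hL : Layout ρ J) (ω : Coins) {u : State}
    (hc : Ctx ρ μ u) {τ : ℕ} (hτ : u.reg x_tau = τ) (hτR : τ < ρ x_R) :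
    Ctx ρ μ (codeEst.run ω u) ∧ (codeEst.run ω u).mem = u.mem ∧ (codeEst.run ω u).reg x_est =
      est (ρ x_B) (ρ x_P) (fun b p s => u.mem (ρ x_WB + cidx (ρ x_P) b p s))
        (fun b p s => sec μ (ρ x_Z0) 1 (τ * ρ x_NC + cidx (ρ x_P) b p s)) := by
  rw [codeEst, St.run_seq]
  refine St.loop_rule ω (Q := fun w => Ctx ρ μ w ∧ w.mem = u.mem ∧ w.reg x_est = _) (ρ x_B)
    (fun i v => Ctx ρ μ v ∧ v.mem = u.mem ∧ v.reg x_tau = τ ∧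
    v.reg x_est = est i (ρ x_P) (fun b p s => u.mem (ρ x_WB + cidx (ρ x_P) b p s))
        (fun b p s => sec μ (ρ x_Z0) 1 (τ * ρ x_NC + cidx (ρ x_P) b p s))) ?_ ?_ ?_ ?_
  · simp [hc.reg]
  · exact ⟨hc.set (by decide) _, by simp [hτ, est]⟩
  · rintro i hi v ⟨hcv, hm, h1, h4⟩
    obtain ⟨c1, m1, r1⟩ := codeMax_run hL ω (hcv.set (x := x_b) (by decide) i) (τ := τ)
      (b := i) (by simp [h1]) (by simp) hτR hi
    have f1 : (codeMax.run ω (v.set x_b i)).reg x_tau = τ := by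
      rw [St.run_frame ω (by decide)]; simp [h1]
    have f3 := St.run_frame ω (p := codeMax) (y := x_est) (by decide) (v.set x_b i)
    simp only [State.mem_set, hm] at r1
    rw [St.run_seq]
    refine ⟨c1.set (by decide) _, by simpa [hm] using m1, by simp [f1], ?_⟩
    simp only [St.run_assign, State.reg_set, if_true, Ex.eval, Op.eval, f3, r1,
      c1.reg x_big (by decide), Nat.reduceEqDiff, if_false, h4]
    have key : est (i + 1) (ρ x_P) (fun b p s => u.mem (ρ x_WB + cidx (ρ x_P) b p s))
        (fun b p s => sec μ (ρ x_Z0) 1 (τ * ρ x_NC + cidx (ρ x_P) b p s)) ≤ (i + 1) * ρ x_P := by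
      unfold est
      refine (Finset.sum_le_card_nsmul _ _ (ρ x_P) fun b _ => Finset.sup_le fun p _ =>
        (Finset.card_filter_le _ _).trans (by simp)).trans (by simp)
    have key2 : (i + 1) * ρ x_P ≤ ρ x_big := (Nat.mul_le_mul_right _ hi).trans hL.BP_le
    rw [Nat.mod_eq_of_lt]
    · rw [est, est, Finset.sum_range_succ]
    · rw [est, Finset.sum_range_succ, ← est] at key
      omega
  · rintro v ⟨hcv, hm, h1, h4⟩
    exact ⟨hcv.set (by decide) _, by simp [hm], by simp [h4]⟩

/-! ### Changing a character in the fingerprints -/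

/-- The bucket of a position, read from the public coins. -/
def coinBucket (ω : Coins) (CB β i : ℕ) : ℕ := bitsVal (fun t => ω (CB + i * β + t)) β

/-- The hash value of a character at a position, read from the public coins. -/
def coinHash (ω : Coins) (V F i a : ℕ) : ℕ := bitsVal (fun t => ω ((i * V + a) * F + t)) F

/-- The bucket of position `x_i`, and the hash values of `x_old` and `x_new` there. -/
theorem codeHash_run {ρ μ : ℕ → ℕ} {J : ℕ} (hL : Layout ρ J) (ω : Coins) {u : State}
    (hc : Ctx ρ μ u) :
    Ctx ρ μ (codeHash.run ω u) ∧ (codeHash.run ω u).mem = u.mem ∧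
    (codeHash.run ω u).reg x_hb = coinBucket ω (ρ x_CB) (ρ x_beta) (u.reg x_i) ∧
    (codeHash.run ω u).reg x_ho = coinHash ω (ρ x_VV) (ρ x_FW) (u.reg x_i) (u.reg x_old) ∧
    (codeHash.run ω u).reg x_hn = coinHash ω (ρ x_VV) (ρ x_FW) (u.reg x_i) (u.reg x_new) := by
  have hB : 2 ^ ρ x_beta ≤ ρ x_big + 1 := by
    rw [← hL.B_eq]
    have := hL.BP_le
    have := Nat.le_mul_of_pos_right (ρ x_B) hL.P_pos
    omega
  have hF : 2 ^ ρ x_FW ≤ ρ x_big + 1 := by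
    rw [← hL.MF_eq]; have := hL.MF_le; omega
  simp only [codeHash, St.run_seq, St.run_assign]
  rw [readCoins_run ω (dst := x_hb) (by decide) (by decide) (by decide) (by decide) (by decide)
    (by simpa [hc.reg] using hB)]
  rw [readCoins_run ω (dst := x_ho) (by decide) (by decide) (by decide) (by decide) (by decide)
    (by simpa [hc.reg] using hF)]
  rw [readCoins_run ω (dst := x_hn) (by decide) (by decide) (by decide) (by decide) (by decide)
    (by simpa [hc.reg] using hF)]
  refine ⟨?_, ?_, ?_, ?_, ?_⟩
  · refine Ctx.set (Ctx.set (Ctx.set (Ctx.set (Ctx.set (Ctx.set (Ctx.set (Ctx.set (Ctx.set hc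
      ?_ _) ?_ _) ?_ _) ?_ _) ?_ _) ?_ _) ?_ _) ?_ _) ?_ _ <;> decide
  · simp
  · simp [hc.reg, coinBucket]
  · simp [hc.reg, coinHash]
  · simp [hc.reg, coinHash]

/-- A changed character at position `x_i` affects, for each modulus, the fingerprint of its bucket
and its residue. -/
theorem codeUpdate_run {ρ μ : ℕ → ℕ} {J : ℕ} (hL : Layout ρ J) (ω : Coins) {u : State}
    (hc : Ctx ρ μ u) (hb : u.reg x_hb < ρ x_B) :
    Ctx ρ μ (codeUpdate.run ω u) ∧
    (∀ a, ρ x_WB + ρ x_NC ≤ a → (codeUpdate.run ω u).mem a = u.mem a) ∧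
    ∀ b p s, p < ρ x_P → s < ρ x_P →
      (codeUpdate.run ω u).mem (ρ x_WB + cidx (ρ x_P) b p s) =
        if b = u.reg x_hb ∧ u.reg x_i % (p + 1) = s then
          (u.mem (ρ x_WB + cidx (ρ x_P) b p s) + u.reg x_hn + ρ x_MF - u.reg x_ho) % ρ x_MF
        else u.mem (ρ x_WB + cidx (ρ x_P) b p s) := by
  rw [codeUpdate]
  refine St.loop_rule ω (Q := fun w => Ctx ρ μ w ∧ (∀ a, ρ x_WB + ρ x_NC ≤ a → w.mem a = u.mem a) ∧
    ∀ b p s, p < ρ x_P → s < ρ x_P → w.mem (ρ x_WB + cidx (ρ x_P) b p s) =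
        if b = u.reg x_hb ∧ u.reg x_i % (p + 1) = s then
          (u.mem (ρ x_WB + cidx (ρ x_P) b p s) + u.reg x_hn + ρ x_MF - u.reg x_ho) % ρ x_MF
        else u.mem (ρ x_WB + cidx (ρ x_P) b p s)) (ρ x_P)
    (fun i w => Ctx ρ μ w ∧ (∀ a, ρ x_WB + ρ x_NC ≤ a → w.mem a = u.mem a) ∧
      w.reg x_hb = u.reg x_hb ∧ w.reg x_i = u.reg x_i ∧ w.reg x_hn = u.reg x_hn ∧
      w.reg x_ho = u.reg x_ho ∧
      ∀ b p s, p < ρ x_P → s < ρ x_P → w.mem (ρ x_WB + cidx (ρ x_P) b p s) =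
        if p < i ∧ b = u.reg x_hb ∧ u.reg x_i % (p + 1) = s then
          (u.mem (ρ x_WB + cidx (ρ x_P) b p s) + u.reg x_hn + ρ x_MF - u.reg x_ho) % ρ x_MF
        else u.mem (ρ x_WB + cidx (ρ x_P) b p s)) ?_ ?_ ?_ ?_
  · exact hc.reg _ (by decide)
  · exact ⟨hc, fun _ _ => rfl, rfl, rfl, rfl, rfl, by simp⟩
  · rintro i hi v ⟨hcv, hm, h1, h2, h3, h4, h5⟩
    have hs : u.reg x_i % (i + 1) < ρ x_P := (Nat.mod_lt _ (Nat.succ_pos i)).trans_le hi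
    set c := ρ x_WB + cidx (ρ x_P) (u.reg x_hb) i (u.reg x_i % (i + 1)) with hcdef
    have hclt := cidx_lt hb hi hs
    rw [← hL.NC_eq] at hclt
    have ha : (‹x_WB› +ₑ ((‹x_hb› *ₑ ‹x_P› +ₑ ‹x_p›) *ₑ ‹x_P› +ₑ ‹x_i› %ₑ (‹x_p› +ₑ .lit 1))).eval ω
        (v.set x_p i) = c := by simp [hcv.reg, h1, h2, hcdef, cidx]
    have hvc : v.mem c = u.mem c := by
      rw [hcdef, h5 _ _ _ hi hs]; simp
    simp only [St.run_seq, St.run_assign, St.run_store, ha]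
    have hMF : 0 < ρ x_MF := by rw [hL.MF_eq]; positivity
    have hval : (Ex.clamp ((.load ‹x_addr› +ₑ ‹x_hn› +ₑ ‹x_MF› -ₑ ‹x_ho›) %ₑ ‹x_MF›) ‹x_big›).eval ω
        ((v.set x_p i).set x_addr c) = (u.mem c + u.reg x_hn + ρ x_MF - u.reg x_ho) % ρ x_MF := by
      simp only [Ex.eval, Op.eval, State.reg_set, State.mem_set, Nat.reduceEqDiff, if_true, if_false,
        hcv.reg x_MF (by decide), hcv.reg x_big (by decide), h3, h4, hvc]
      refine Nat.mod_eq_of_lt ?_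
      have := Nat.mod_lt (u.mem c + u.reg x_hn + ρ x_MF - u.reg x_ho) hMF
      have := hL.MF_le
      omega
    rw [hval]
    have hc' : (‹x_addr›).eval ω ((v.set x_p i).set x_addr c) = c := by simp
    rw [hc']
    refine ⟨?_, ?_, ?_, ?_, ?_, ?_, ?_⟩
    · exact Ctx.write ((hcv.set (by decide) _).set (by decide) _) (by omega) _
    · intro a hae
      have : a ≠ c := by omega
      simp [this, hm a hae]
    · simp [h1]
    · simp [h2]
    · simp [h3]
    · simp [h4]
    · intro b p s hp hs'
      rw [State.mem_write]
      by_cases hE : ρ x_WB + cidx (ρ x_P) b p s = c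
      · have := cidx_inj hp hs' hi hs
          (by omega : cidx (ρ x_P) b p s = cidx (ρ x_P) (u.reg x_hb) i (u.reg x_i % (i + 1)))
        obtain ⟨e1, e2, e3⟩ := this
        rw [if_pos hE, if_pos ⟨by omega, e1, by rw [e2, e3]⟩, hE]
      · rw [if_neg hE]
        simp only [State.mem_set]
        rw [h5 b p s hp hs']
        have : (p < i + 1 ∧ b = u.reg x_hb ∧ u.reg x_i % (p + 1) = s) ↔
            (p < i ∧ b = u.reg x_hb ∧ u.reg x_i % (p + 1) = s) := by
          constructor
          · rintro ⟨q1, q2, q3⟩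
            refine ⟨?_, q2, q3⟩
            rcases Nat.lt_succ_iff_lt_or_eq.1 q1 with q | q
            · exact q
            · exfalso; apply hE; rw [hcdef, q2, ← q3, q]
          · rintro ⟨q1, q2⟩
            exact ⟨by omega, q2⟩
        simp only [this]
  · rintro v ⟨hcv, hm, h1, h2, h3, h4, h5⟩
    refine ⟨hcv.set (by decide) _, hm, fun b p s hp hs => ?_⟩
    rw [State.mem_set, h5 b p s hp hs]
    simp [hp]

/-- The `q`-th break of a generator, at position `j` of the unrotated string, concerns position
`j - m` of the rotation by `m`. -/
theorem codeBreak_run {ρ μ : ℕ → ℕ} {J : ℕ} (hL : Layout ρ J) (ω : Coins) {u : State}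
    (hc : Ctx ρ μ u) {τ g q m idx i : ℕ} (hτ : u.reg x_tau = τ) (hg : u.reg x_g = g)
    (hq : u.reg x_q = q) (hm : u.reg x_m = m) (hidx : (τ * ρ x_NG + g) * ρ x_KC + q = idx)
    (hJ : idx < J) (hi : (sec μ (ρ x_Z1) 4 idx + ρ x_n - m) % ρ x_n = i) :
    Ctx ρ μ (codeBreak.run ω u) ∧
    (∀ a, ρ x_WB + ρ x_NC ≤ a → (codeBreak.run ω u).mem a = u.mem a) ∧
    ∀ b p s, p < ρ x_P → s < ρ x_P →
      (codeBreak.run ω u).mem (ρ x_WB + cidx (ρ x_P) b p s) =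
        if b = coinBucket ω (ρ x_CB) (ρ x_beta) i ∧ i % (p + 1) = s then
          (u.mem (ρ x_WB + cidx (ρ x_P) b p s) +
            coinHash ω (ρ x_VV) (ρ x_FW) i (sec μ (ρ x_Z1) 6 idx) + ρ x_MF -
            coinHash ω (ρ x_VV) (ρ x_FW) i (sec μ (ρ x_Z1) 5 idx)) % ρ x_MF
        else u.mem (ρ x_WB + cidx (ρ x_P) b p s) := by
  simp only [codeBreak, St.run_seq, St.run_assign]
  set u1 := u.set x_idx (((‹x_tau› *ₑ ‹x_NG› +ₑ ‹x_g›) *ₑ ‹x_KC› +ₑ ‹x_q›).eval ω u) with hu1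
  have hc1 : Ctx ρ μ u1 := hc.set (by decide) _
  have hx1 : u1.reg x_idx = idx := by simp [hu1, hc.reg, hτ, hg, hq, hidx]
  have hm1 : u1.reg x_m = m := by simp [hu1, hm]
  have hmem1 : u1.mem = u.mem := by simp [hu1]
  clear_value u1
  rw [eval_entry hL hc1 ω (Or.inr rfl) (by decide) (by simpa [hx1] using hJ)]
  set u2 := u1.set x_j (sec μ (ρ x_Z1) 4 ((‹x_idx›).eval ω u1)) with hu2
  have hc2 : Ctx ρ μ u2 := hc1.set (by decide) _
  have hx2 : u2.reg x_idx = idx := by simp [hu2, hx1]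
  have hm2 : u2.reg x_m = m := by simp [hu2, hm1]
  have hj2 : u2.reg x_j = sec μ (ρ x_Z1) 4 idx := by simp [hu2, hx1]
  have hmem2 : u2.mem = u.mem := by simp [hu2, hmem1]
  clear_value u2
  rw [eval_entry hL hc2 ω (Or.inr rfl) (by decide) (by simpa [hx2] using hJ)]
  set u3 := u2.set x_old (sec μ (ρ x_Z1) 5 ((‹x_idx›).eval ω u2)) with hu3
  have hc3 : Ctx ρ μ u3 := hc2.set (by decide) _
  have hx3 : u3.reg x_idx = idx := by simp [hu3, hx2]
  have hm3 : u3.reg x_m = m := by simp [hu3, hm2]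
  have hj3 : u3.reg x_j = sec μ (ρ x_Z1) 4 idx := by simp [hu3, hj2]
  have ho3 : u3.reg x_old = sec μ (ρ x_Z1) 5 idx := by simp [hu3, hx2]
  have hmem3 : u3.mem = u.mem := by simp [hu3, hmem2]
  clear_value u3
  rw [eval_entry hL hc3 ω (Or.inr rfl) (by decide) (by simpa [hx3] using hJ)]
  set u4 := (u3.set x_new (sec μ (ρ x_Z1) 6 ((‹x_idx›).eval ω u3))) with hu4
  have hc4 : Ctx ρ μ u4 := hc3.set (by decide) _
  have hi4 : (Ex.clamp ((‹x_j› +ₑ ‹x_n› -ₑ ‹x_m›) %ₑ ‹x_n›) ‹x_big›).eval ω u4 = i := by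
    simp only [Ex.eval, Op.eval, hc4.reg x_n (by decide), hc4.reg x_big (by decide)]
    have e1 : u4.reg x_j = sec μ (ρ x_Z1) 4 idx := by simp [hu4, hj3]
    have e2 : u4.reg x_m = m := by simp [hu4, hm3]
    rw [e1, e2, hi]
    refine Nat.mod_eq_of_lt ?_
    have := Nat.mod_lt (sec μ (ρ x_Z1) 4 idx + ρ x_n - m) hL.n_pos
    have := hL.n_le
    omega
  rw [hi4]
  have hc5 : Ctx ρ μ (u4.set x_i i) := hc4.set (by decide) _
  have ho5 : (u4.set x_i i).reg x_old = sec μ (ρ x_Z1) 5 idx := by simp [hu4, ho3]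
  have hn5 : (u4.set x_i i).reg x_new = sec μ (ρ x_Z1) 6 idx := by simp [hu4, hx3]
  have hi5 : (u4.set x_i i).reg x_i = i := by simp
  have hmem5 : (u4.set x_i i).mem = u.mem := by simp [hu4, hmem3]
  set u5 := u4.set x_i i
  clear_value u5
  obtain ⟨hc6, hmem6, hb6, ho6, hn6⟩ := codeHash_run hL ω hc5
  have hi6 : (codeHash.run ω u5).reg x_i = i := by
    rw [St.run_frame ω (by decide), hi5]
  rw [hi5] at hb6
  rw [hi5, ho5] at ho6
  rw [hi5, hn5] at hn6
  have hbB : (codeHash.run ω u5).reg x_hb < ρ x_B := by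
    rw [hb6, hL.B_eq]; exact bitsVal_lt _ _
  obtain ⟨hc7, hm7, hw7⟩ := codeUpdate_run hL ω hc6 hbB
  refine ⟨hc7, fun a ha => by rw [hm7 a ha, hmem6, hmem5], fun b p s hp hs => ?_⟩
  rw [hw7 b p s hp hs, hb6, hi6, ho6, hn6, hmem6, hmem5]

/-! ### Fingerprints of rotations -/

theorem cell_cast {n : ℕ} [NeZero n] (F : ℕ) (h : ZMod n → ℕ → ℕ) (bk : ZMod n → ℕ) (U : ZMod n → ℕ)
    (b p s : ℕ) : ((cell F h bk U b p s : ℕ) : ZMod (2 ^ F)) =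
      ∑ i, if bk i = b ∧ i.val % (p + 1) = s then (h i (U i) : ZMod (2 ^ F)) else 0 := by
  unfold cell
  rw [ZMod.natCast_mod, Nat.cast_sum, Finset.sum_filter]

/-- Applying the breaks of a generator to the fingerprints of a rotation gives the fingerprints of
another rotation. -/
theorem cell_shift_add {n : ℕ} [NeZero n] (F : ℕ) (h : ZMod n → ℕ → ℕ) (bk : ZMod n → ℕ)
    {U : ZMod n → ℕ} {m g : ZMod n} {K : ℕ} {pos : ℕ → ZMod n} {new old : ℕ → ℕ}
    (hl : Lists (shift g U) U K pos new old) (b p s : ℕ) :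
    ((cell F h bk (shift (m + g) U) b p s : ℕ) : ZMod (2 ^ F)) =
      (cell F h bk (shift m U) b p s : ℕ) + ∑ q ∈ Finset.range K,
        if b = bk (pos q - m) ∧ (pos q - m).val % (p + 1) = s then
          (h (pos q - m) (new q) : ZMod (2 ^ F)) - h (pos q - m) (old q) else 0 := by
  have e := hl (fun i a a' => if b = bk (i - m) ∧ (i - m).val % (p + 1) = s then
    (h (i - m) a : ℤ) - h (i - m) a' else 0) (by simp)
  have e' := congrArg (Int.cast : ℤ → ZMod (2 ^ F)) e
  push_cast at e'
  rw [← Equiv.sum_comp (Equiv.addRight m)] at e'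
  rw [cell_cast, cell_cast, e', ← Finset.sum_add_distrib]
  refine Finset.sum_congr rfl fun i _ => ?_
  simp only [Equiv.coe_addRight, add_sub_cancel_right, shift, add_assoc]
  by_cases hb : b = bk i ∧ i.val % (p + 1) = s
  · have hb' : bk i = b ∧ i.val % (p + 1) = s := ⟨hb.1.symm, hb.2⟩
    simp only [if_pos hb, if_pos hb']
    ring
  · have hb' : ¬ (bk i = b ∧ i.val % (p + 1) = s) := fun h => hb ⟨h.1.symm, h.2⟩
    simp only [if_neg hb, if_neg hb', add_zero]

theorem natCast_eq_of_lt {N a b : ℕ} (ha : a < N) (hb : b < N)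
    (h : (a : ZMod N) = (b : ZMod N)) : a = b := by
  rw [ZMod.natCast_eq_natCast_iff'] at h
  rwa [Nat.mod_eq_of_lt ha, Nat.mod_eq_of_lt hb] at h

theorem val_sub_eq_mod {n : ℕ} [NeZero n] (a b : ZMod n) :
    (a - b).val = (a.val + n - b.val) % n := by
  have hb := b.val_lt
  rw [← ZMod.val_natCast]
  congr 1
  rw [Nat.cast_sub (by omega)]
  simp

/-- The fingerprints with buckets and hash values from the public coins. -/
def coinCell (ω : Coins) (ρ : ℕ → ℕ) {n : ℕ} [NeZero n] (U : ZMod n → ℕ) (b p s : ℕ) : ℕ :=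
  cell (ρ x_FW) (fun i a => coinHash ω (ρ x_VV) (ρ x_FW) i.val a)
    (fun i => coinBucket ω (ρ x_CB) (ρ x_beta) i.val) U b p s

/-- The working area holds the fingerprints of `U`. -/
def Working (ω : Coins) (ρ : ℕ → ℕ) {n : ℕ} [NeZero n] (U : ZMod n → ℕ) (mem : ℕ → ℕ) : Prop :=
  ∀ b p s, b < ρ x_B → p < ρ x_P → s < ρ x_P →
    mem (ρ x_WB + cidx (ρ x_P) b p s) = coinCell ω ρ U b p s

/-- Applying all breaks of a generator turns the fingerprints of the rotation by `m` into those of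
the rotation by `m + gen`. -/
theorem codeBreaks_run {ρ μ : ℕ → ℕ} {J n : ℕ} [NeZero n] (hL : Layout ρ J) (hn : ρ x_n = n)
    (ω : Coins) {u : State} (hc : Ctx ρ μ u) {τ g : ℕ} {m gen : ZMod n} (hτ : u.reg x_tau = τ)
    (hg : u.reg x_g = g) (hm : u.reg x_m = m.val) (hτR : τ < ρ x_R) (hgN : g < ρ x_NG)
    {U : ZMod n → ℕ} {pos : ℕ → ZMod n} {new old : ℕ → ℕ}
    (hl : Lists (shift gen U) U (ρ x_KC) pos new old)
    (h4 : ∀ q < ρ x_KC, sec μ (ρ x_Z1) 4 ((τ * ρ x_NG + g) * ρ x_KC + q) = (pos q).val)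
    (h5 : ∀ q < ρ x_KC, sec μ (ρ x_Z1) 5 ((τ * ρ x_NG + g) * ρ x_KC + q) = old q)
    (h6 : ∀ q < ρ x_KC, sec μ (ρ x_Z1) 6 ((τ * ρ x_NG + g) * ρ x_KC + q) = new q)
    (hw : Working ω ρ (shift m U) u.mem) :
    Ctx ρ μ ((St.loop x_q x_KC codeBreak).run ω u) ∧
    (∀ a, ρ x_WB + ρ x_NC ≤ a → ((St.loop x_q x_KC codeBreak).run ω u).mem a = u.mem a) ∧
    Working ω ρ (shift (m + gen) U) ((St.loop x_q x_KC codeBreak).run ω u).mem := by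
  refine St.loop_rule ω (Q := fun w => Ctx ρ μ w ∧
    (∀ a, ρ x_WB + ρ x_NC ≤ a → w.mem a = u.mem a) ∧ Working ω ρ (shift (m + gen) U) w.mem)
    (ρ x_KC) (fun i w => Ctx ρ μ w ∧ (∀ a, ρ x_WB + ρ x_NC ≤ a → w.mem a = u.mem a) ∧
      w.reg x_tau = τ ∧ w.reg x_g = g ∧ w.reg x_m = m.val ∧
      ∀ b p s, b < ρ x_B → p < ρ x_P → s < ρ x_P →
        w.mem (ρ x_WB + cidx (ρ x_P) b p s) < 2 ^ ρ x_FW ∧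
        ((w.mem (ρ x_WB + cidx (ρ x_P) b p s) : ℕ) : ZMod (2 ^ ρ x_FW)) =
          (coinCell ω ρ (shift m U) b p s : ℕ) + ∑ q ∈ Finset.range i,
          if b = coinBucket ω (ρ x_CB) (ρ x_beta) (pos q - m).val ∧ (pos q - m).val % (p + 1) = s
          then (coinHash ω (ρ x_VV) (ρ x_FW) (pos q - m).val (new q) : ZMod (2 ^ ρ x_FW)) -
            coinHash ω (ρ x_VV) (ρ x_FW) (pos q - m).val (old q) else 0) ?_ ?_ ?_ ?_
  · exact hc.reg _ (by decide)
  · refine ⟨hc, fun _ _ => rfl, hτ, hg, hm, fun b p s hb hp hs => ?_⟩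
    rw [hw b p s hb hp hs]
    exact ⟨Nat.mod_lt _ (by positivity), by simp⟩
  · rintro i hi v ⟨hcv, hmm, e1, e2, e3, e4⟩
    have hJ : (τ * ρ x_NG + g) * ρ x_KC + i < J :=
      mul_add_lt_of_lt (mul_add_lt_of_lt hτR hgN le_rfl) hi hL.RNGKC_le
    obtain ⟨c1, m1, w1⟩ := codeBreak_run hL ω (hcv.set (x := x_q) (by decide) i) (τ := τ) (g := g)
      (q := i) (m := m.val) (by simp [e1]) (by simp [e2]) (by simp) (by simp [e3]) rfl hJ rfl
    rw [h4 i hi, h5 i hi, h6 i hi, hn, ← val_sub_eq_mod] at w1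
    refine ⟨c1, fun a ha => by rw [m1 a ha, State.mem_set, hmm a ha], ?_, ?_, ?_, ?_⟩
    · rw [St.run_frame ω (by decide)]; simp [e1]
    · rw [St.run_frame ω (by decide)]; simp [e2]
    · rw [St.run_frame ω (by decide)]; simp [e3]
    · intro b p s hb hp hs
      rw [w1 b p s hp hs, hL.MF_eq, Finset.sum_range_succ]
      obtain ⟨f1, f2⟩ := e4 b p s hb hp hs
      simp only [State.mem_set]
      split_ifs with hif
      · refine ⟨Nat.mod_lt _ (by positivity), ?_⟩
        rw [ZMod.natCast_mod, Nat.cast_sub, Nat.cast_add, Nat.cast_add, f2]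
        · simp only [CharP.cast_eq_zero, add_zero]
          ring
        · have := bitsVal_lt (fun t => ω (((pos i - m).val * ρ x_VV + old i) * ρ x_FW + t)) (ρ x_FW)
          unfold coinHash
          omega
      · exact ⟨f1, by rw [f2, add_zero]⟩
  · rintro v ⟨hcv, hmm, e1, e2, e3, e4⟩
    refine ⟨hcv.set (by decide) _, hmm, fun b p s hb hp hs => ?_⟩
    obtain ⟨f1, f2⟩ := e4 b p s hb hp hs
    refine natCast_eq_of_lt f1 (Nat.mod_lt _ (by positivity)) ?_
    rw [State.mem_set, f2]
    exact (cell_shift_add (ρ x_FW) (fun i a => coinHash ω (ρ x_VV) (ρ x_FW) i.val a)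
      (fun i => coinBucket ω (ρ x_CB) (ρ x_beta) i.val) (m := m) hl b p s).symm

/-- The rotation that a mask encodes. -/
def maskSum {A : Type} [AddCommMonoid A] (gen : ℕ → A) (mask N : ℕ) : A :=
  ∑ t ∈ Finset.range N, if mask.testBit t then gen t else 0

theorem and_shiftRight_ne_zero (x t : ℕ) : ((x >>> t) &&& 1 ≠ 0) ↔ x.testBit t = true := by
  unfold Nat.testBit
  rw [Nat.and_comm]
  simp

/-- The working area holds the fingerprints of the rotation that a mask encodes. -/
theorem codeShift_run {ρ μ : ℕ → ℕ} {J n : ℕ} [NeZero n] (hL : Layout ρ J) (hn : ρ x_n = n)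
    (ω : Coins) {u : State} (hc : Ctx ρ μ u) {τ e : ℕ} (hτ : u.reg x_tau = τ)
    (he : u.reg x_e = e) (hτR : τ < ρ x_R) (heL : e < ρ x_L) {U : ZMod n → ℕ}
    {gen : ℕ → ZMod n} {pos : ℕ → ℕ → ZMod n} {new old : ℕ → ℕ → ℕ}
    (hl : ∀ g < ρ x_NG, Lists (shift (gen g) U) U (ρ x_KC) (pos g) (new g) (old g))
    (h1 : ∀ b p s, b < ρ x_B → p < ρ x_P → s < ρ x_P →
      sec μ (ρ x_Z1) 1 (τ * ρ x_NC + cidx (ρ x_P) b p s) = coinCell ω ρ U b p s)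
    (h3 : ∀ g < ρ x_NG, sec μ (ρ x_Z1) 3 (τ * ρ x_NG + g) = (gen g).val)
    (h4 : ∀ g < ρ x_NG, ∀ q < ρ x_KC,
      sec μ (ρ x_Z1) 4 ((τ * ρ x_NG + g) * ρ x_KC + q) = (pos g q).val)
    (h5 : ∀ g < ρ x_NG, ∀ q < ρ x_KC,
      sec μ (ρ x_Z1) 5 ((τ * ρ x_NG + g) * ρ x_KC + q) = old g q)
    (h6 : ∀ g < ρ x_NG, ∀ q < ρ x_KC,
      sec μ (ρ x_Z1) 6 ((τ * ρ x_NG + g) * ρ x_KC + q) = new g q) :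
    Ctx ρ μ (codeShift.run ω u) ∧
    (∀ a, ρ x_WB + ρ x_NC ≤ a → (codeShift.run ω u).mem a = u.mem a) ∧
    Working ω ρ (shift (maskSum gen (sec μ (ρ x_Z1) 2 (τ * ρ x_L + e)) (ρ x_NG)) U)
      (codeShift.run ω u).mem := by
  rw [codeShift, St.run_seq]
  -- copying the cells
  obtain ⟨hc1, hm1, hw1, hτ1, he1⟩ : let w := (St.loop x_c x_NC (.store (‹x_WB› +ₑ ‹x_c›)
      (entry x_Z1 (‹x_tau› *ₑ ‹x_NC› +ₑ ‹x_c›) 1))).run ω u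
      Ctx ρ μ w ∧ (∀ a, ρ x_WB + ρ x_NC ≤ a → w.mem a = u.mem a) ∧
      (∀ c < ρ x_NC, w.mem (ρ x_WB + c) = sec μ (ρ x_Z1) 1 (τ * ρ x_NC + c)) ∧
      w.reg x_tau = τ ∧ w.reg x_e = e := by
    refine St.loop_rule ω (Q := fun w => Ctx ρ μ w ∧
      (∀ a, ρ x_WB + ρ x_NC ≤ a → w.mem a = u.mem a) ∧
      (∀ c < ρ x_NC, w.mem (ρ x_WB + c) = sec μ (ρ x_Z1) 1 (τ * ρ x_NC + c)) ∧
      w.reg x_tau = τ ∧ w.reg x_e = e) (ρ x_NC) (fun i w => Ctx ρ μ w ∧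
      (∀ a, ρ x_WB + ρ x_NC ≤ a → w.mem a = u.mem a) ∧
      (∀ c < i, w.mem (ρ x_WB + c) = sec μ (ρ x_Z1) 1 (τ * ρ x_NC + c)) ∧
      w.reg x_tau = τ ∧ w.reg x_e = e) (hc.reg _ (by decide)) ?_ ?_ ?_
    · exact ⟨hc, fun _ _ => rfl, by simp, hτ, he⟩
    · rintro i hi v ⟨hcv, hm, h, e1, e2⟩
      have hcv' := hcv.set (x := x_c) (by decide) i
      rw [St.run_store, eval_entry hL hcv' ω (Or.inr rfl) (by decide) (by
        simpa [hcv.reg, e1] using mul_add_lt_of_lt hτR hi hL.RNC_le)]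
      simp only [Ex.eval, Op.eval, State.reg_set, Nat.reduceEqDiff, if_true, if_false,
        hcv.reg x_WB (by decide), hcv.reg x_NC (by decide), e1]
      refine ⟨hcv'.write (by omega) _, ?_, ?_, by simp [e1], by simp [e2]⟩
      · intro a ha
        have : a ≠ ρ x_WB + i := by omega
        simp [this, hm a ha]
      · intro c hc
        by_cases hci : c = i
        · simp [hci]
        · simp [hci, h c (by omega)]
    · rintro v ⟨hcv, hm, h, e1, e2⟩
      exact ⟨hcv.set (by decide) _, hm, h, by simp [e1], by simp [e2]⟩
  set v1 := (St.loop x_c x_NC (.store (‹x_WB› +ₑ ‹x_c›)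
      (entry x_Z1 (‹x_tau› *ₑ ‹x_NC› +ₑ ‹x_c›) 1))).run ω u
  clear_value v1
  simp only [St.run_seq, St.run_assign]
  have hc2 : Ctx ρ μ (v1.set x_m ((Ex.lit 0).eval ω v1)) := hc1.set (by decide) _
  rw [eval_entry hL hc2 ω (Or.inr rfl) (by decide) (by
    simpa [hc1.reg, hτ1, he1] using mul_add_lt_of_lt hτR heL hL.RL_le)]
  have hidx : (‹x_tau› *ₑ ‹x_L› +ₑ ‹x_e›).eval ω (v1.set x_m ((Ex.lit 0).eval ω v1)) =
      τ * ρ x_L + e := by simp [hc1.reg, hτ1, he1]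
  rw [hidx]
  set mask := sec μ (ρ x_Z1) 2 (τ * ρ x_L + e) with hmask
  refine St.loop_rule ω (Q := fun w => Ctx ρ μ w ∧
    (∀ a, ρ x_WB + ρ x_NC ≤ a → w.mem a = u.mem a) ∧
    Working ω ρ (shift (maskSum gen mask (ρ x_NG)) U) w.mem) (ρ x_NG)
    (fun i w => Ctx ρ μ w ∧ (∀ a, ρ x_WB + ρ x_NC ≤ a → w.mem a = u.mem a) ∧
      w.reg x_tau = τ ∧ w.reg x_mask = mask ∧ w.reg x_m = (maskSum gen mask i).val ∧
      Working ω ρ (shift (maskSum gen mask i) U) w.mem) ?_ ?_ ?_ ?_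
  · simp [hc1.reg]
  · refine ⟨hc2.set (by decide) _, hm1, by simp [hτ1], by simp, by simp [maskSum], ?_⟩
    intro b p s hb hp hs
    simp only [maskSum, Finset.range_zero, Finset.sum_empty, shift_zero, State.mem_set]
    rw [hw1 _ (by rw [hL.NC_eq]; exact cidx_lt hb hp hs), h1 b p s hb hp hs]
  · rintro i hi v ⟨hcv, hm, e1, e2, e3, e4⟩
    have hcond : (Ex.op .and (.op .shr ‹x_mask› ‹x_g›) (.lit 1)).eval ω (v.set x_g i) =
        (mask >>> i) &&& 1 := by simp [e2]
    rw [St.run_ite, hcond]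
    have hsum : maskSum gen mask (i + 1) = maskSum gen mask i +
        if mask.testBit i then gen i else 0 := by
      simp only [maskSum, Finset.sum_range_succ]
    by_cases ht : mask.testBit i = true
    · rw [if_pos ((and_shiftRight_ne_zero _ _).2 ht), St.run_seq, St.run_assign]
      rw [if_pos ht] at hsum
      obtain ⟨c1, m1, w1⟩ := codeBreaks_run hL hn ω (hcv.set (x := x_g) (by decide) i) (τ := τ)
        (g := i) (m := maskSum gen mask i) (gen := gen i) (by simp [e1]) (by simp) (by simp [e3])
        hτR hi (hl i hi) (h4 i hi) (h5 i hi) (h6 i hi) e4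
      have f1 : ((St.loop x_q x_KC codeBreak).run ω (v.set x_g i)).reg x_tau = τ := by
        rw [St.run_frame ω (by decide)]; simp [e1]
      have f2 : ((St.loop x_q x_KC codeBreak).run ω (v.set x_g i)).reg x_mask = mask := by
        rw [St.run_frame ω (by decide)]; simp [e2]
      have f3 : ((St.loop x_q x_KC codeBreak).run ω (v.set x_g i)).reg x_m =
          (maskSum gen mask i).val := by
        rw [St.run_frame ω (by decide)]; simp [e3]
      have f4 : ((St.loop x_q x_KC codeBreak).run ω (v.set x_g i)).reg x_g = i := by
        rw [St.run_frame ω (by decide)]; simp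
      set v2 := (St.loop x_q x_KC codeBreak).run ω (v.set x_g i)
      clear_value v2
      have hval : (Ex.clamp ((‹x_m› +ₑ entry x_Z1 (‹x_tau› *ₑ ‹x_NG› +ₑ ‹x_g›) 3) %ₑ ‹x_n›)
          ‹x_big›).eval ω v2 = (maskSum gen mask (i + 1)).val := by
        have he := eval_entry hL c1 ω (z := x_Z1) (s := 3) (e := ‹x_tau› *ₑ ‹x_NG› +ₑ ‹x_g›)
          (Or.inr rfl) (by decide)
          (by simpa [c1.reg, f1, f4] using mul_add_lt_of_lt hτR hi hL.RNG_le)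
        simp only [Ex.eval, Op.eval, he]
        simp only [f1, f3, f4, c1.reg x_NG (by decide), c1.reg x_n (by decide),
          c1.reg x_big (by decide)]
        rw [h3 i hi, hn, ← ZMod.val_add, ← hsum]
        refine Nat.mod_eq_of_lt ?_
        have := (maskSum gen mask (i + 1)).val_lt
        have := hL.n_le
        omega
      rw [hval, hsum]
      refine ⟨c1.set (by decide) _, fun a ha => ?_, by simp [f1], by simp [f2], by simp, w1⟩
      rw [State.mem_set, m1 a ha, State.mem_set, hm a ha]
    · rw [if_neg (by rw [and_shiftRight_ne_zero]; exact ht), St.run_assign]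
      rw [if_neg ht, add_zero] at hsum
      rw [hsum]
      exact ⟨(hcv.set (by decide) _).set (by decide) _, hm, by simp [e1], by simp [e2],
        by simp [e3], e4⟩
  · rintro v ⟨hcv, hm, e1, e2, e3, e4⟩
    exact ⟨hcv.set (by decide) _, hm, e4⟩

/-! ### Estimates for the masks, and tables of exceptions -/

/-- What the sketch of a string contains for one repetition, in decoded form: the string rotated to
its anchor, subset-sum masks, generators of the near-periods with their breaks, the generator of the
subgroup of near-periods, and the exceptions from the template. -/
structure Rep (n : ℕ) where
  /-- The rotated string, with hashed characters. Only its fingerprints are in the sketch. -/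
  str : ZMod n → ℕ
  /-- The sets of generators, as the binary digits of numbers. -/
  mask : ℕ → ℕ
  /-- The generators. -/
  gen : ℕ → ZMod n
  /-- The positions at which the rotation by a generator changes the string. -/
  bpos : ℕ → ℕ → ZMod n
  /-- The characters of the string at these positions. -/
  bold : ℕ → ℕ → ℕ
  /-- The characters of the rotation at these positions. -/
  bnew : ℕ → ℕ → ℕ
  /-- The generator of the subgroup of near-periods; `0` if they do not form a subgroup. -/
  d : ℕ
  /-- The positions at which the string differs from its template. -/
  pos : ℕ → ZMod n
  /-- The characters of the string at these positions. -/
  val : ℕ → ℕ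
  /-- The characters of the template at these positions. -/
  tm : ℕ → ℕ

/-- The sections of the sketch at `z` hold the data of repetition `τ`. -/
structure Rep.Stored {n : ℕ} [NeZero n] (D : Rep n) (ω : Coins) (ρ μ : ℕ → ℕ) (z τ : ℕ) :
    Prop where
  cell : ∀ b p s, b < ρ x_B → p < ρ x_P → s < ρ x_P →
    sec μ z 1 (τ * ρ x_NC + cidx (ρ x_P) b p s) = coinCell ω ρ D.str b p s
  mask : ∀ e < ρ x_L, sec μ z 2 (τ * ρ x_L + e) = D.mask e
  gen : ∀ g < ρ x_NG, sec μ z 3 (τ * ρ x_NG + g) = (D.gen g).val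
  bpos : ∀ g < ρ x_NG, ∀ q < ρ x_KC,
    sec μ z 4 ((τ * ρ x_NG + g) * ρ x_KC + q) = (D.bpos g q).val
  bold : ∀ g < ρ x_NG, ∀ q < ρ x_KC, sec μ z 5 ((τ * ρ x_NG + g) * ρ x_KC + q) = D.bold g q
  bnew : ∀ g < ρ x_NG, ∀ q < ρ x_KC, sec μ z 6 ((τ * ρ x_NG + g) * ρ x_KC + q) = D.bnew g q
  d : sec μ z 7 τ = D.d
  pos : ∀ x < ρ x_E, sec μ z 8 (τ * ρ x_E + x) = (D.pos x).val
  val : ∀ x < ρ x_E, sec μ z 9 (τ * ρ x_E + x) = D.val x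
  tm : ∀ x < ρ x_E, sec μ z 10 (τ * ρ x_E + x) = D.tm x

theorem codeMin_run (ω : Coins) (e : Ex) (u : State) :
    (codeMin e).run ω u = (u.set x_v (e.eval ω u)).set x_best (min (u.reg x_best) (e.eval ω u)) := by
  simp only [codeMin, St.run_seq, St.run_assign]
  congr 1
  simp
  omega

theorem est_congr {B P : ℕ} {φ φ' ψ ψ' : ℕ → ℕ → ℕ → ℕ}
    (h : ∀ b p s, b < B → p < P → s < P → φ b p s = φ' b p s)
    (h' : ∀ b p s, b < B → p < P → s < P → ψ b p s = ψ' b p s) : est B P φ ψ = est B P φ' ψ' := by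
  unfold est
  refine Finset.sum_congr rfl fun b hb => Finset.sup_congr rfl fun p hp => ?_
  congr 1
  refine Finset.filter_congr fun s hs => ?_
  rw [Finset.mem_range] at hb hp hs
  rw [h b p s hb hp hs, h' b p s hb hp hs]

/-- The estimate for the distance of the first string and the rotation of the second one that the
`e`-th mask encodes. -/
def maskEst (ω : Coins) (ρ : ℕ → ℕ) {n : ℕ} [NeZero n] (D₁ D₂ : Rep n) (e : ℕ) : ℕ :=
  est (ρ x_B) (ρ x_P) (coinCell ω ρ (shift (maskSum D₂.gen (D₂.mask e) (ρ x_NG)) D₂.str))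
    (coinCell ω ρ D₁.str)

/-- The loop over the masks takes the minimum of `x_best` and all estimates; the last estimate
remains in `x_est`. -/
theorem codeMasks_run {ρ μ : ℕ → ℕ} {J n : ℕ} [NeZero n] (hL : Layout ρ J) (hn : ρ x_n = n)
    (ω : Coins) {u : State} (hc : Ctx ρ μ u) {τ : ℕ} (hτ : u.reg x_tau = τ) (hτR : τ < ρ x_R)
    {D₁ D₂ : Rep n} (h1 : D₁.Stored ω ρ μ (ρ x_Z0) τ) (h2 : D₂.Stored ω ρ μ (ρ x_Z1) τ)
    (hl : ∀ g < ρ x_NG, Lists (shift (D₂.gen g) D₂.str) D₂.str (ρ x_KC) (D₂.bpos g) (D₂.bnew g)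
      (D₂.bold g)) :
    let w := (St.loop x_e x_L (codeShift ;ₛ codeEst ;ₛ codeMin ‹x_est›)).run ω u
    Ctx ρ μ w ∧ (∀ a, ρ x_WB + ρ x_NC ≤ a → w.mem a = u.mem a) ∧ w.reg x_tau = τ ∧
      w.reg x_est = maskEst ω ρ D₁ D₂ (ρ x_L - 1) ∧
      ∀ z, z ≤ w.reg x_best ↔ z ≤ u.reg x_best ∧ ∀ e < ρ x_L, z ≤ maskEst ω ρ D₁ D₂ e := by
  refine St.loop_rule ω (Q := fun w => Ctx ρ μ w ∧ (∀ a, ρ x_WB + ρ x_NC ≤ a → w.mem a = u.mem a) ∧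
      w.reg x_tau = τ ∧ w.reg x_est = maskEst ω ρ D₁ D₂ (ρ x_L - 1) ∧
      ∀ z, z ≤ w.reg x_best ↔ z ≤ u.reg x_best ∧ ∀ e < ρ x_L, z ≤ maskEst ω ρ D₁ D₂ e) (ρ x_L)
    (fun i w => Ctx ρ μ w ∧ (∀ a, ρ x_WB + ρ x_NC ≤ a → w.mem a = u.mem a) ∧
      w.reg x_tau = τ ∧ (0 < i → w.reg x_est = maskEst ω ρ D₁ D₂ (i - 1)) ∧
      ∀ z, z ≤ w.reg x_best ↔ z ≤ u.reg x_best ∧ ∀ e < i, z ≤ maskEst ω ρ D₁ D₂ e) ?_ ?_ ?_ ?_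
  · exact hc.reg _ (by decide)
  · exact ⟨hc, fun _ _ => rfl, hτ, by simp, by simp⟩
  · rintro i hi v ⟨hcv, hm, e1, e2, e3⟩
    rw [St.run_seq, St.run_seq, codeMin_run]
    obtain ⟨c1, m1, w1⟩ := codeShift_run hL hn ω (hcv.set (x := x_e) (by decide) i) (τ := τ) (e := i)
      (by simp [e1]) (by simp) hτR hi hl h2.cell h2.gen h2.bpos h2.bold h2.bnew
    have f1 : (codeShift.run ω (v.set x_e i)).reg x_tau = τ := by
      rw [St.run_frame ω (by decide)]; simp [e1]
    have f2 : (codeShift.run ω (v.set x_e i)).reg x_best = v.reg x_best := by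
      rw [St.run_frame ω (by decide)]; simp
    set v1 := codeShift.run ω (v.set x_e i)
    clear_value v1
    obtain ⟨c2, m2, w2⟩ := codeEst_run hL ω c1 f1 hτR
    have f3 : (codeEst.run ω v1).reg x_tau = τ := by
      rw [St.run_frame ω (by decide), f1]
    have f4 : (codeEst.run ω v1).reg x_best = v.reg x_best := by
      rw [St.run_frame ω (by decide), f2]
    have hest : (codeEst.run ω v1).reg x_est = maskEst ω ρ D₁ D₂ i := by
      rw [w2, maskEst]
      refine est_congr ?_ h1.cell
      intro b p s hb hp hs
      rw [w1 b p s hb hp hs, h2.mask i hi]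
    simp only [Ex.eval, f4, hest]
    refine ⟨(c2.set (by decide) _).set (by decide) _, ?_, ?_, ?_, ?_⟩
    · intro a ha
      simp only [State.mem_set]
      rw [m2, m1 a ha, State.mem_set, hm a ha]
    · simp [f3]
    · simp [hest]
    · intro z
      simp only [State.reg_set, if_true, le_min_iff, e3, and_assoc, Nat.lt_succ_iff]
      constructor
      · rintro ⟨a, b, c⟩
        refine ⟨a, fun e he => ?_⟩
        rcases Nat.lt_or_eq_of_le he with h | h
        · exact b e h
        · rw [h]; exact c
      · rintro ⟨a, b⟩
        exact ⟨a, fun e he => b e he.le, b i le_rfl⟩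
  · rintro v ⟨hcv, hm, e1, e2, e3⟩
    exact ⟨hcv.set (by decide) _, hm, by simp [e1], by simp [e2 hL.L_pos], by simpa using e3⟩

/-- The number of mismatches among pairs of exceptions that are `m` apart, of the characters and of
the template characters. -/
def tabP {n : ℕ} (D₁ D₂ : Rep n) (E : ℕ) (m : ZMod n) : ℕ :=
  ∑ x ∈ Finset.range E, ∑ y ∈ Finset.range E,
    if D₂.pos y - D₁.pos x = m then neq (D₁.val x) (D₂.val y) + neq (D₁.tm x) (D₂.tm y) else 0

/-- The number of mismatches among pairs of exceptions that are `m` apart, of characters with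
template characters. -/
def tabM {n : ℕ} (D₁ D₂ : Rep n) (E : ℕ) (m : ZMod n) : ℕ :=
  ∑ x ∈ Finset.range E, ∑ y ∈ Finset.range E,
    if D₂.pos y - D₁.pos x = m then neq (D₁.val x) (D₂.tm y) + neq (D₁.tm x) (D₂.val y) else 0

/-- The offset of a pair of exceptions, and the address of its table entry. -/
theorem codeDiff_run {ρ μ : ℕ → ℕ} {J n : ℕ} [NeZero n] (hL : Layout ρ J) (hn : ρ x_n = n)
    (ω : Coins) {u : State} (hc : Ctx ρ μ u) {τ x y : ℕ} (hτ : u.reg x_tau = τ) (hτR : τ < ρ x_R)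
    {D₁ D₂ : Rep n} (h1 : D₁.Stored ω ρ μ (ρ x_Z0) τ) (h2 : D₂.Stored ω ρ μ (ρ x_Z1) τ)
    (hx : u.reg x_x = x) (hxE : x < ρ x_E) (hy : u.reg x_y = y) (hyE : y < ρ x_E) :
    let w := codeDiff.run ω u
    Ctx ρ μ w ∧ w.mem = u.mem ∧ w.reg x_m = (D₂.pos y - D₁.pos x).val ∧
      w.reg x_addr = u.reg x_tb + 2 * (D₂.pos y - D₁.pos x).val := by
  have hJx : τ * ρ x_E + x < J := mul_add_lt_of_lt hτR hxE hL.RE_le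
  have hJy : τ * ρ x_E + y < J := mul_add_lt_of_lt hτR hyE hL.RE_le
  simp only [codeDiff, St.run_seq, St.run_assign]
  rw [eval_entry hL hc ω (Or.inl rfl) (by decide) (by simpa [hc.reg, hτ, hx] using hJx)]
  have hi : (‹x_tau› *ₑ ‹x_E› +ₑ ‹x_x›).eval ω u = τ * ρ x_E + x := by simp [hc.reg, hτ, hx]
  rw [hi, h1.pos x hxE]
  set v := u.set x_i (D₁.pos x).val with hv
  have hcv : Ctx ρ μ v := hc.set (by decide) _
  rw [eval_entry hL hcv ω (Or.inr rfl) (by decide) (by simpa [hc.reg, hv, hτ, hy] using hJy)]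
  have hj : (‹x_tau› *ₑ ‹x_E› +ₑ ‹x_y›).eval ω v = τ * ρ x_E + y := by simp [hc.reg, hv, hτ, hy]
  rw [hj, h2.pos y hyE]
  set v' := v.set x_j (D₂.pos y).val with hv'
  have hm : (Ex.clamp ((‹x_j› +ₑ ‹x_n› -ₑ ‹x_i›) %ₑ ‹x_n›) ‹x_big›).eval ω v' =
      (D₂.pos y - D₁.pos x).val := by
    rw [val_sub_eq_mod]
    simp only [Ex.eval, Op.eval, hv', hv, State.reg_set, Nat.reduceEqDiff, if_true, if_false,
      hc.reg x_n (by decide), hc.reg x_big (by decide), hn]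
    refine Nat.mod_eq_of_lt ?_
    have := Nat.mod_lt ((D₂.pos y).val + n - (D₁.pos x).val) (NeZero.pos n)
    have := hL.n_le
    omega
  rw [hm]
  refine ⟨((hcv.set (by decide) _).set (by decide) _).set (by decide) _, rfl, by simp, ?_⟩
  simp [hv', hv]

theorem one_sub_ite_eq_neq (a b : ℕ) : 1 - (if a = b then 1 else 0) = neq a b := by
  unfold neq; split_ifs <;> simp_all

theorem neq_le_one (a b : ℕ) : neq a b ≤ 1 := by unfold neq; split_ifs <;> simp

/-- The table holds the two counts for every offset `m`, at the addresses `tb + 2 * m` and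
`tb + 2 * m + 1`; it starts out as zero, since each repetition has a table of its own. -/
theorem codeTable_run {ρ μ : ℕ → ℕ} {J n : ℕ} [NeZero n] (hL : Layout ρ J) (hn : ρ x_n = n)
    (ω : Coins) {u : State} (hc : Ctx ρ μ u) {τ tb : ℕ} (hτ : u.reg x_tau = τ) (hτR : τ < ρ x_R)
    {D₁ D₂ : Rep n} (h1 : D₁.Stored ω ρ μ (ρ x_Z0) τ) (h2 : D₂.Stored ω ρ μ (ρ x_Z1) τ)
    (htb : u.reg x_tb = tb) (htW : ρ x_WB ≤ tb) (h0 : ∀ a, tb ≤ a → u.mem a = 0) :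
    let w := codeTable.run ω u
    Ctx ρ μ w ∧ (∀ a, tb + 2 * n ≤ a → w.mem a = 0) ∧ w.reg x_tau = τ ∧ w.reg x_tb = tb ∧
      w.reg x_best = u.reg x_best ∧ w.reg x_est = u.reg x_est ∧ w.reg x_d = u.reg x_d ∧
      ∀ m : ZMod n, w.mem (tb + 2 * m.val) = tabP D₁ D₂ (ρ x_E) m ∧
        w.mem (tb + 2 * m.val + 1) = tabM D₁ D₂ (ρ x_E) m := by
  have fr : ∀ x ∉ codeTable.writes, (codeTable.run ω u).reg x = u.reg x := fun x hx =>
    St.run_frame ω hx u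
  suffices H : Ctx ρ μ (codeTable.run ω u) ∧
      (∀ a, tb + 2 * n ≤ a → (codeTable.run ω u).mem a = 0) ∧
      ∀ m : ZMod n, (codeTable.run ω u).mem (tb + 2 * m.val) = tabP D₁ D₂ (ρ x_E) m ∧
        (codeTable.run ω u).mem (tb + 2 * m.val + 1) = tabM D₁ D₂ (ρ x_E) m from
    ⟨H.1, H.2.1, by rw [fr _ (by decide), hτ], by rw [fr _ (by decide), htb], fr _ (by decide),
      fr _ (by decide), fr _ (by decide), H.2.2⟩
  set E := ρ x_E with hE
  let p : ℕ → ℕ → ZMod n → ℕ := fun x y m =>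
    if D₂.pos y - D₁.pos x = m then neq (D₁.val x) (D₂.val y) + neq (D₁.tm x) (D₂.tm y) else 0
  let q : ℕ → ℕ → ZMod n → ℕ := fun x y m =>
    if D₂.pos y - D₁.pos x = m then neq (D₁.val x) (D₂.tm y) + neq (D₁.tm x) (D₂.val y) else 0
  have hp2 : ∀ x y m, p x y m ≤ 2 := fun x y m => by
    simp only [p]
    have := neq_le_one (D₁.val x) (D₂.val y)
    have := neq_le_one (D₁.tm x) (D₂.tm y)
    split_ifs <;> omega
  have hq2 : ∀ x y m, q x y m ≤ 2 := fun x y m => by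
    simp only [q]
    have := neq_le_one (D₁.val x) (D₂.tm y)
    have := neq_le_one (D₁.tm x) (D₂.val y)
    split_ifs <;> omega
  let S : (ℕ → ℕ → ZMod n → ℕ) → ℕ → ℕ → ZMod n → ℕ := fun p x y m =>
    (∑ x' ∈ Finset.range x, ∑ y' ∈ Finset.range E, p x' y' m) + ∑ y' ∈ Finset.range y, p x y' m
  have hS : ∀ p : ℕ → ℕ → ZMod n → ℕ, (∀ x y m, p x y m ≤ 2) → ∀ x < E, ∀ y ≤ E, ∀ m,
      S p x y m ≤ ρ x_big := by
    intro p hp x hx y hy m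
    have b1 : (∑ x' ∈ Finset.range x, ∑ y' ∈ Finset.range E, p x' y' m) ≤ x * (E * 2) := by
      refine (Finset.sum_le_card_nsmul _ _ (E * 2) fun x' _ =>
        (Finset.sum_le_card_nsmul _ _ 2 fun y' _ => hp x' y' m).trans (by simp)).trans (by simp)
    have b2 : (∑ y' ∈ Finset.range y, p x y' m) ≤ y * 2 :=
      (Finset.sum_le_card_nsmul _ _ 2 fun y' _ => hp x y' m).trans (by simp)
    have b3 : (x + 1) * (E * 2) ≤ E * (E * 2) := Nat.mul_le_mul_right _ hx
    have := hL.EE_le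
    simp only [S]
    rw [← hE] at this
    nlinarith
  have hSs : ∀ (p : ℕ → ℕ → ZMod n → ℕ) x y m, S p x (y + 1) m = S p x y m + p x y m := by
    intro p x y m; simp only [S, Finset.sum_range_succ, add_assoc]
  have hSE : ∀ (p : ℕ → ℕ → ZMod n → ℕ) x m, S p x E m = S p (x + 1) 0 m := by
    intro p x m; simp only [S, Finset.sum_range_succ, Finset.sum_range_zero, add_zero]
  let I : ℕ → ℕ → State → Prop := fun x y w => Ctx ρ μ w ∧ (∀ a, tb + 2 * n ≤ a → w.mem a = 0) ∧
    w.reg x_tau = τ ∧ w.reg x_tb = tb ∧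
    ∀ m : ZMod n, w.mem (tb + 2 * m.val) = S p x y m ∧ w.mem (tb + 2 * m.val + 1) = S q x y m
  rw [codeTable]
  refine St.loop_rule ω (Q := fun w => Ctx ρ μ w ∧ (∀ a, tb + 2 * n ≤ a → w.mem a = 0) ∧
    ∀ m : ZMod n, w.mem (tb + 2 * m.val) = tabP D₁ D₂ E m ∧
        w.mem (tb + 2 * m.val + 1) = tabM D₁ D₂ E m) E (fun x w => I x 0 w)
    (hc.reg _ (by decide)) ?_ ?_ ?_
  · refine ⟨hc, fun a ha => h0 a (by omega), hτ, htb, fun m => ?_⟩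
    rw [h0 _ (by omega), h0 _ (by omega)]
    simp [S]
  · rintro x hx v ⟨hcv, a1, a2, a3, a4⟩
    refine St.loop_rule ω (Q := fun w => I (x + 1) 0 w) E (fun y w => I x y w ∧ w.reg x_x = x)
      (by simp [hcv.reg, hE]) ?_ ?_ ?_
    · exact ⟨⟨hcv.set (by decide) _, a1, by simp [a2], by simp [a3], a4⟩, by simp⟩
    · rintro y hy v ⟨⟨hcv, a1, a2, a3, a4⟩, hvx⟩
      simp only [St.run_seq, St.run_assign, St.run_store]
      obtain ⟨c1, m1, r1, r2⟩ := codeDiff_run hL hn ω (hcv.set (x := x_y) (by decide) y) (τ := τ)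
        (x := x) (y := y) (by simp [a2]) hτR h1 h2 (by simp [hvx]) hx (by simp) hy
      have f1 : (codeDiff.run ω (v.set x_y y)).reg x_tau = τ := by
        rw [St.run_frame ω (by decide)]; simp [a2]
      have f2 : (codeDiff.run ω (v.set x_y y)).reg x_tb = tb := by
        rw [St.run_frame ω (by decide)]; simp [a3]
      have f3 : (codeDiff.run ω (v.set x_y y)).reg x_x = x := by
        rw [St.run_frame ω (by decide)]; simp [hvx]
      have f4 : (codeDiff.run ω (v.set x_y y)).reg x_y = y := by
        rw [St.run_frame ω (by decide)]; simp
      have m1' : (codeDiff.run ω (v.set x_y y)).mem = v.mem := by simpa using m1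
      have r2' : (codeDiff.run ω (v.set x_y y)).reg x_addr =
        tb + 2 * (D₂.pos y - D₁.pos x).val := by rw [r2]; simp [a3]
      set w := codeDiff.run ω (v.set x_y y)
      clear_value w
      set dm := D₂.pos y - D₁.pos x with hdm
      have hJx : τ * ρ x_E + x < J := mul_add_lt_of_lt hτR hx hL.RE_le
      have hJy : τ * ρ x_E + y < J := mul_add_lt_of_lt hτR hy hL.RE_le
      rw [eval_entry hL c1 ω (Or.inl rfl) (by decide) (by simpa [c1.reg, f1, f3] using hJx)]
      have k1 : (‹x_tau› *ₑ ‹x_E› +ₑ ‹x_x›).eval ω w = τ * ρ x_E + x := by simp [c1.reg, f1, f3]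
      rw [k1, h1.val x hx]
      have c2 : Ctx ρ μ (w.set x_old (D₁.val x)) := c1.set (by decide) _
      rw [eval_entry hL c2 ω (Or.inl rfl) (by decide) (by simpa [c1.reg, f1, f3] using hJx)]
      have k2 : (‹x_tau› *ₑ ‹x_E› +ₑ ‹x_x›).eval ω (w.set x_old (D₁.val x)) = τ * ρ x_E + x := by
        simp [c1.reg, f1, f3]
      rw [k2, h1.tm x hx]
      have c3 := c2.set (x := x_new) (by decide) (D₁.tm x)
      rw [eval_entry hL c3 ω (Or.inr rfl) (by decide) (by simpa [c1.reg, f1, f4] using hJy)]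
      have k3 : (‹x_tau› *ₑ ‹x_E› +ₑ ‹x_y›).eval ω ((w.set x_old (D₁.val x)).set x_new (D₁.tm x)) =
        τ * ρ x_E + y := by simp [c1.reg, f1, f4]
      rw [k3, h2.val y hy]
      have c4 := c3.set (x := x_ho) (by decide) (D₂.val y)
      rw [eval_entry hL c4 ω (Or.inr rfl) (by decide) (by simpa [c1.reg, f1, f4] using hJy)]
      have k4 : (‹x_tau› *ₑ ‹x_E› +ₑ ‹x_y›).eval ω (((w.set x_old (D₁.val x)).set x_new
        (D₁.tm x)).set x_ho (D₂.val y)) = τ * ρ x_E + y := by simp [c1.reg, f1, f4]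
      rw [k4, h2.tm y hy]
      have c5 := c4.set (x := x_hn) (by decide) (D₂.tm y)
      set z := (((w.set x_old (D₁.val x)).set x_new (D₁.tm x)).set x_ho (D₂.val y)).set x_hn
        (D₂.tm y) with hz
      have z1 : z.reg x_addr = tb + 2 * dm.val := by simp [hz, r2']
      have z2 : z.reg x_old = D₁.val x := by simp [hz]
      have z3 : z.reg x_new = D₁.tm x := by simp [hz]
      have z4 : z.reg x_ho = D₂.val y := by simp [hz]
      have z5 : z.reg x_hn = D₂.tm y := by simp [hz]
      have z6 : z.mem = v.mem := by simp [hz, m1']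
      have z7 : z.reg x_tau = τ := by simp [hz, f1]
      have z8 : z.reg x_tb = tb := by simp [hz, f2]
      have z9 : z.reg x_x = x := by simp [hz, f3]
      clear_value z
      have hPv : p x y dm = neq (D₁.val x) (D₂.val y) + neq (D₁.tm x) (D₂.tm y) := by
        simp [p, hdm]
      have hQv : q x y dm = neq (D₁.val x) (D₂.tm y) + neq (D₁.tm x) (D₂.val y) := by
        simp [q, hdm]
      have v1 : (Ex.clamp (.load ‹x_addr› +ₑ ((.lit 1 -ₑ (‹x_old› =ₑ ‹x_ho›)) +ₑ
          (.lit 1 -ₑ (‹x_new› =ₑ ‹x_hn›)))) ‹x_big›).eval ω z = S p x (y + 1) dm := by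
        simp only [Ex.eval, Op.eval, z1, z2, z3, z4, z5, z6, c5.reg x_big (by decide),
          one_sub_ite_eq_neq]
        rw [(a4 dm).1, ← hPv, ← hSs]
        exact Nat.mod_eq_of_lt (Nat.lt_succ_of_le (hS p hp2 x hx (y + 1) hy dm))
      rw [v1]
      simp only [show (‹x_addr›).eval ω z = tb + 2 * dm.val from z1]
      have hdl := dm.val_lt
      have c6 := c5.write (a := tb + 2 * dm.val) (by omega) (S p x (y + 1) dm)
      have v2 : (Ex.clamp (.load (‹x_addr› +ₑ .lit 1) +ₑ
          ((.lit 1 -ₑ (‹x_old› =ₑ ‹x_hn›)) +ₑ (.lit 1 -ₑ (‹x_new› =ₑ ‹x_ho›)))) ‹x_big›).eval ω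
          (z.write (tb + 2 * dm.val) (S p x (y + 1) dm)) = S q x (y + 1) dm := by
        simp only [Ex.eval, Op.eval, State.reg_write, State.mem_write, z1, z2, z3, z4, z5, z6,
          c5.reg x_big (by decide), one_sub_ite_eq_neq]
        rw [if_neg (by omega), (a4 dm).2, ← hQv, ← hSs]
        exact Nat.mod_eq_of_lt (Nat.lt_succ_of_le (hS q hq2 x hx (y + 1) hy dm))
      rw [v2]
      have v3 : (‹x_addr› +ₑ .lit 1).eval ω (z.write (tb + 2 * dm.val) (S p x (y + 1) dm)) =
          tb + 2 * dm.val + 1 := by simp [z1]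
      rw [v3]
      refine ⟨⟨c6.write (by omega) _, ?_, by simp [z7], by simp [z8], ?_⟩, by simp [z9]⟩
      · intro a ha
        have n1 : a ≠ tb + 2 * dm.val := by omega
        have n2 : a ≠ tb + 2 * dm.val + 1 := by omega
        simp [n1, n2, z6, a1 a ha]
      · intro m
        by_cases hm : m = dm
        · subst hm
          simp
        · have hv : m.val ≠ dm.val := fun h => hm (ZMod.val_injective n h)
          have n1 : tb + 2 * m.val ≠ tb + 2 * dm.val := by omega
          have n2 : tb + 2 * m.val ≠ tb + 2 * dm.val + 1 := by omega
          have n3 : tb + 2 * m.val + 1 ≠ tb + 2 * dm.val := by omega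
          have n4 : tb + 2 * m.val + 1 ≠ tb + 2 * dm.val + 1 := by omega
          simp only [State.mem_write, if_neg n1, if_neg n2, if_neg n3, if_neg n4, z6, hSs]
          have hm' : ¬ D₂.pos y - D₁.pos x = m := fun h => hm h.symm
          rw [(a4 m).1, (a4 m).2]
          simp only [p, q, if_neg hm', add_zero, and_self]
    · rintro v ⟨⟨hcv, a1, a2, a3, a4⟩, hvx⟩
      exact ⟨hcv.set (by decide) _, a1, by simp [a2], by simp [a3], fun m => by
        rw [← hSE, ← hSE]; exact a4 m⟩
  · rintro v ⟨hcv, a1, a2, a3, a4⟩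
    refine ⟨hcv.set (by decide) _, a1, fun m => ?_⟩
    have e : ∀ p : ℕ → ℕ → ZMod n → ℕ, S p E 0 m =
        ∑ x ∈ Finset.range E, ∑ y ∈ Finset.range E, p x y m := fun p => by simp [S]
    exact ⟨(a4 m).1.trans (e p), (a4 m).2.trans (e q)⟩

/-! ### Rotations in the subgroup, and the result -/

/-- The value for the rotation `m` that is computed from an estimate for the rotation `0` and the
tables of pairs of exceptions. -/
def cand {n : ℕ} (D₁ D₂ : Rep n) (E est : ℕ) (m : ZMod n) : ℕ :=
  (est + tabP D₁ D₂ E m + tabM D₁ D₂ E 0) - (tabM D₁ D₂ E m + tabP D₁ D₂ E 0)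

/-- The result is described by its lower bounds `z`, so that minima become conjunctions. -/
theorem codeCand_run {n : ℕ} [NeZero n] (ω : Coins) {u : State} {tb E est : ℕ} {D₁ D₂ : Rep n}
    {m : ZMod n} (htb : u.reg x_tb = tb) (ha : u.reg x_addr = tb + 2 * m.val)
    (he : u.reg x_est = est) (ht : ∀ m : ZMod n, u.mem (tb + 2 * m.val) = tabP D₁ D₂ E m ∧
      u.mem (tb + 2 * m.val + 1) = tabM D₁ D₂ E m) :
    codeCand.run ω u = (u.set x_v (cand D₁ D₂ E est m)).set x_best
      (min (u.reg x_best) (cand D₁ D₂ E est m)) := by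
  have h0 := ht 0
  have hm := ht m
  rw [ZMod.val_zero, mul_zero, add_zero] at h0
  rw [codeCand, codeMin_run]
  simp only [Ex.eval, Op.eval, htb, ha, he, h0.1, h0.2, hm.1, hm.2, cand]

/-- The candidates are the offsets of pairs of exceptions that are divisible by `d`, and the first
multiples of `d`. -/
theorem codeSubgroup_run {ρ μ : ℕ → ℕ} {J n : ℕ} [NeZero n] (hL : Layout ρ J) (hn : ρ x_n = n)
    (ω : Coins) {u : State} (hc : Ctx ρ μ u) {τ est d : ℕ} (hτ : u.reg x_tau = τ) (hτR : τ < ρ x_R)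
    {D₁ D₂ : Rep n} (h1 : D₁.Stored ω ρ μ (ρ x_Z0) τ) (h2 : D₂.Stored ω ρ μ (ρ x_Z1) τ)
    (he : u.reg x_est = est) (hd : u.reg x_d = d)
    (h0 : ∀ a, ρ x_TB + τ * (2 * n) ≤ a → u.mem a = 0) :
    let w := codeSubgroup.run ω u
    Ctx ρ μ w ∧ (∀ a, ρ x_TB + (τ + 1) * (2 * n) ≤ a → w.mem a = 0) ∧ w.reg x_tau = τ ∧
      ∀ z, z ≤ w.reg x_best ↔ z ≤ u.reg x_best ∧
        (∀ x < ρ x_E, ∀ y < ρ x_E, d ∣ (D₂.pos y - D₁.pos x).val →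
          z ≤ cand D₁ D₂ (ρ x_E) est (D₂.pos y - D₁.pos x)) ∧
        ∀ t < ρ x_E2, z ≤ cand D₁ D₂ (ρ x_E) est ((t * d : ℕ) : ZMod n) := by
  simp only [codeSubgroup, St.run_seq]
  have htb : (x_tb ≔ ‹x_TB› +ₑ ‹x_tau› *ₑ (‹x_n› +ₑ ‹x_n›)).run ω u =
      u.set x_tb (ρ x_TB + τ * (2 * n)) := by
    rw [St.run_assign]
    congr 1
    simp only [Ex.eval, Op.eval, hc.reg x_TB (by decide), hc.reg x_n (by decide), hτ, hn]
    ring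
  rw [htb]
  set tb := ρ x_TB + τ * (2 * n) with htbd
  have htW : ρ x_WB ≤ tb := by have := hL.TB_le; omega
  obtain ⟨c1, m1, f1, f2, f3, f4, f5, f6⟩ := codeTable_run hL hn ω
    (hc.set (x := x_tb) (by decide) tb) (τ := τ) (tb := tb) (by simp [hτ]) hτR h1 h2 (by simp) htW h0
  simp only [State.reg_set, Nat.reduceEqDiff, if_false] at f3 f4 f5
  rw [he] at f4
  rw [hd] at f5
  set v := codeTable.run ω (u.set x_tb tb)
  clear_value v
  rw [← f3]
  clear f3
  set E := ρ x_E with hE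
  let I : ℕ → ℕ → State → Prop := fun x y w => Ctx ρ μ w ∧ w.mem = v.mem ∧ w.reg x_tau = τ ∧
    w.reg x_tb = tb ∧ w.reg x_est = est ∧ w.reg x_d = d ∧ ∀ z, z ≤ w.reg x_best ↔
      z ≤ v.reg x_best ∧ ∀ x' < E, ∀ y' < E, (x' < x ∨ x' = x ∧ y' < y) →
        d ∣ (D₂.pos y' - D₁.pos x').val → z ≤ cand D₁ D₂ E est (D₂.pos y' - D₁.pos x')
  -- the pairs of exceptions
  have hI : I E 0 ((St.loop x_x x_E (.loop x_y x_E (codeDiff ;ₛ .ite (‹x_m› %ₑ ‹x_d›) (x_v ≔ ‹x_v›)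
      codeCand))).run ω v) := by
    refine St.loop_rule ω (Q := fun w => I E 0 w) E (fun x w => I x 0 w)
      (c1.reg _ (by decide)) ?_ ?_ ?_
    · exact ⟨c1, rfl, f1, f2, f4, f5, by simp⟩
    · rintro x hx w ⟨cw, a1, a2, a3, a4, a5, a6⟩
      refine St.loop_rule ω (Q := fun w => I (x + 1) 0 w) E (fun y w => I x y w ∧ w.reg x_x = x)
        (by simp [cw.reg, hE]) ?_ ?_ ?_
      · exact ⟨⟨cw.set (by decide) _, a1, by simp [a2], by simp [a3], by simp [a4], by simp [a5],
          by simpa using a6⟩, by simp⟩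
      · rintro y hy w ⟨⟨cw, a1, a2, a3, a4, a5, a6⟩, hwx⟩
        rw [St.run_seq]
        obtain ⟨c2, m2, r1, r2⟩ := codeDiff_run hL hn ω (cw.set (x := x_y) (by decide) y) (τ := τ)
          (x := x) (y := y) (by simp [a2]) hτR h1 h2 (by simp [hwx]) hx (by simp) hy
        have g1 : (codeDiff.run ω (w.set x_y y)).reg x_tau = τ := by
          rw [St.run_frame ω (by decide)]; simp [a2]
        have g2 : (codeDiff.run ω (w.set x_y y)).reg x_tb = tb := by
          rw [St.run_frame ω (by decide)]; simp [a3]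
        have g3 : (codeDiff.run ω (w.set x_y y)).reg x_est = est := by
          rw [St.run_frame ω (by decide)]; simp [a4]
        have g4 : (codeDiff.run ω (w.set x_y y)).reg x_d = d := by
          rw [St.run_frame ω (by decide)]; simp [a5]
        have g5 : (codeDiff.run ω (w.set x_y y)).reg x_best = w.reg x_best := by
          rw [St.run_frame ω (by decide)]; simp
        have g6 : (codeDiff.run ω (w.set x_y y)).reg x_x = x := by
          rw [St.run_frame ω (by decide)]; simp [hwx]
        have m2' : (codeDiff.run ω (w.set x_y y)).mem = v.mem := by rw [m2]; simpa using a1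
        have r2' : (codeDiff.run ω (w.set x_y y)).reg x_addr =
          tb + 2 * (D₂.pos y - D₁.pos x).val := by rw [r2]; simp [a3]
        set w' := codeDiff.run ω (w.set x_y y)
        clear_value w'
        set dm := D₂.pos y - D₁.pos x with hdm
        have hstep : ∀ z b, (z ≤ b ↔ z ≤ w.reg x_best ∧ (d ∣ dm.val → z ≤ cand D₁ D₂ E est dm)) →
            (z ≤ b ↔ z ≤ v.reg x_best ∧ ∀ x' < E, ∀ y' < E, (x' < x ∨ x' = x ∧ y' < y + 1) →
              d ∣ (D₂.pos y' - D₁.pos x').val →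
                z ≤ cand D₁ D₂ E est (D₂.pos y' - D₁.pos x')) := by
          intro z b hb
          rw [hb, a6]
          constructor
          · rintro ⟨⟨b1, b2⟩, b3⟩
            refine ⟨b1, fun x' hx' y' hy' hxy hdv => ?_⟩
            by_cases hcase : x' < x ∨ x' = x ∧ y' < y
            · exact b2 x' hx' y' hy' hcase hdv
            · have e1 : x' = x := by omega
              have e2 : y' = y := by omega
              subst e1; subst e2
              exact b3 hdv
          · rintro ⟨b1, b2⟩
            exact ⟨⟨b1, fun x' hx' y' hy' hxy => b2 x' hx' y' hy' (by omega)⟩,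
              b2 x hx y hy (by omega)⟩
        have hcond : (‹x_m› %ₑ ‹x_d›).eval ω w' = dm.val % d := by simp [r1, g4]
        rw [St.run_ite, hcond]
        by_cases hdv : d ∣ dm.val
        · rw [if_neg (by simpa using Nat.mod_eq_zero_of_dvd hdv),
            codeCand_run ω (m := dm) g2 r2' g3 (by rw [m2']; exact f6)]
          refine ⟨⟨(c2.set (by decide) _).set (by decide) _, by simp [m2'], by simp [g1],
            by simp [g2], by simp [g3], by simp [g4], fun z => hstep z _ ?_⟩, by simp [g6]⟩
          simp [g5, hdv]
        · rw [if_pos (by rwa [ne_eq, ← Nat.dvd_iff_mod_eq_zero]), St.run_assign]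
          refine ⟨⟨c2.set (by decide) _, by simp [m2'], by simp [g1],
            by simp [g2], by simp [g3], by simp [g4], fun z => hstep z _ ?_⟩, by simp [g6]⟩
          simp [g5, hdv]
      · rintro w ⟨⟨cw, a1, a2, a3, a4, a5, a6⟩, hwx⟩
        refine ⟨cw.set (by decide) _, a1, by simp [a2], by simp [a3], by simp [a4], by simp [a5],
          fun z => ?_⟩
        simp only [State.reg_set, Nat.reduceEqDiff, if_false, a6]
        refine and_congr_right fun _ => forall_congr' fun x' => forall_congr' fun hx' =>
          forall_congr' fun y' => forall_congr' fun hy' => ?_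
        have : (x' < x ∨ x' = x ∧ y' < E) ↔ (x' < x + 1 ∨ x' = x + 1 ∧ y' < 0) := by omega
        rw [this]
    · rintro w ⟨cw, a1, a2, a3, a4, a5, a6⟩
      exact ⟨cw.set (by decide) _, a1, by simp [a2], by simp [a3], by simp [a4], by simp [a5],
        by simpa using a6⟩
  obtain ⟨c2, a1, a2, a3, a4, a5, a6⟩ := hI
  set v2 := (St.loop x_x x_E (.loop x_y x_E (codeDiff ;ₛ .ite (‹x_m› %ₑ ‹x_d›) (x_v ≔ ‹x_v›)
      codeCand))).run ω v
  clear_value v2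
  have a6' : ∀ z, z ≤ v2.reg x_best ↔ z ≤ v.reg x_best ∧ ∀ x' < E, ∀ y' < E,
      d ∣ (D₂.pos y' - D₁.pos x').val → z ≤ cand D₁ D₂ E est (D₂.pos y' - D₁.pos x') := by
    intro z
    rw [a6]
    refine and_congr_right fun _ => forall_congr' fun x' => forall_congr' fun hx' =>
      forall_congr' fun y' => forall_congr' fun hy' => ?_
    simp [hx']
  -- the first multiples of the generator
  refine St.loop_rule ω (Q := fun w => Ctx ρ μ w ∧
    (∀ a, ρ x_TB + (τ + 1) * (2 * n) ≤ a → w.mem a = 0) ∧ w.reg x_tau = τ ∧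
      ∀ z, z ≤ w.reg x_best ↔ z ≤ v.reg x_best ∧
        (∀ x < E, ∀ y < E, d ∣ (D₂.pos y - D₁.pos x).val →
          z ≤ cand D₁ D₂ E est (D₂.pos y - D₁.pos x)) ∧
        ∀ t < ρ x_E2, z ≤ cand D₁ D₂ E est ((t * d : ℕ) : ZMod n)) (ρ x_E2)
    (fun i w => Ctx ρ μ w ∧ w.mem = v.mem ∧ w.reg x_tau = τ ∧ w.reg x_tb = tb ∧
      w.reg x_est = est ∧ w.reg x_d = d ∧ ∀ z, z ≤ w.reg x_best ↔ z ≤ v2.reg x_best ∧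
        ∀ t < i, z ≤ cand D₁ D₂ E est ((t * d : ℕ) : ZMod n)) (c2.reg _ (by decide)) ?_ ?_ ?_
  · exact ⟨c2, a1, a2, a3, a4, a5, by simp⟩
  · rintro i hi w ⟨cw, b1, b2, b3, b4, b5, b6⟩
    simp only [St.run_seq, St.run_assign]
    have hm : (Ex.clamp ((‹x_t› *ₑ ‹x_d›) %ₑ ‹x_n›) ‹x_big›).eval ω (w.set x_t i) =
        ((i * d : ℕ) : ZMod n).val := by
      simp only [Ex.eval, Op.eval, State.reg_set, Nat.reduceEqDiff, if_true, if_false,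
        cw.reg x_n (by decide), cw.reg x_big (by decide), hn, b5, ZMod.val_natCast]
      refine Nat.mod_eq_of_lt ?_
      have := Nat.mod_lt (i * d) (NeZero.pos n)
      have := hL.n_le
      omega
    rw [hm]
    have ha : (‹x_tb› +ₑ .lit 2 *ₑ ‹x_m›).eval ω
        ((w.set x_t i).set x_m ((i * d : ℕ) : ZMod n).val) =
        tb + 2 * ((i * d : ℕ) : ZMod n).val := by simp [b3]
    rw [ha, codeCand_run ω (m := ((i * d : ℕ) : ZMod n)) (D₁ := D₁) (D₂ := D₂) (E := E) (est := est)
      (tb := tb) (by simp [b3]) (by simp) (by simp [b4]) (by simpa [b1] using f6)]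
    refine ⟨(((((cw.set (by decide) _).set (by decide) _).set (by decide) _).set (by decide)
      _).set (by decide) _), by simp [b1], by simp [b2], by simp [b3], by simp [b4], by simp [b5],
      fun z => ?_⟩
    simp only [State.reg_set, if_true, Nat.reduceEqDiff, if_false, le_min_iff, b6, and_assoc,
      Nat.lt_succ_iff]
    constructor
    · rintro ⟨a, b, c⟩
      refine ⟨a, fun e he => ?_⟩
      rcases Nat.lt_or_eq_of_le he with h | h
      · exact b e h
      · rw [h]; exact c
    · rintro ⟨a, b⟩
      exact ⟨a, fun e he => b e he.le, b i le_rfl⟩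
  · rintro w ⟨cw, b1, b2, b3, b4, b5, b6⟩
    refine ⟨cw.set (by decide) _, fun a ha => ?_, by simp [b2], fun z => ?_⟩
    · rw [State.mem_set, b1]
      refine m1 a ?_
      rw [htbd]
      linarith
    · simp only [State.reg_set, Nat.reduceEqDiff, if_false, b6, a6', and_assoc]

/-- The upper bounds on the result that one repetition gives. -/
def repBound (ω : Coins) (ρ : ℕ → ℕ) {n : ℕ} [NeZero n] (D₁ D₂ : Rep n) (z : ℕ) : Prop :=
  (∀ e < ρ x_L, z ≤ maskEst ω ρ D₁ D₂ e) ∧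
  (D₁.d ≠ 0 ∧ D₁.d = D₂.d ∧ maskEst ω ρ D₁ D₂ (ρ x_L - 1) ≤ ρ x_KP →
    (∀ x < ρ x_E, ∀ y < ρ x_E, D₁.d ∣ (D₂.pos y - D₁.pos x).val →
      z ≤ cand D₁ D₂ (ρ x_E) (maskEst ω ρ D₁ D₂ (ρ x_L - 1)) (D₂.pos y - D₁.pos x)) ∧
    ∀ t < ρ x_E2, z ≤ cand D₁ D₂ (ρ x_E) (maskEst ω ρ D₁ D₂ (ρ x_L - 1))
      ((t * D₁.d : ℕ) : ZMod n))

/-- One repetition: all masks, and the rotations in the subgroup if both strings have the same one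
and the last estimate, which is for the rotation by `0`, is within the capacity. -/
theorem codeRep_run {ρ μ : ℕ → ℕ} {J n : ℕ} [NeZero n] (hL : Layout ρ J) (hn : ρ x_n = n)
    (ω : Coins) {u : State} (hc : Ctx ρ μ u) {τ : ℕ} (hτ : u.reg x_tau = τ) (hτR : τ < ρ x_R)
    {D₁ D₂ : Rep n} (h1 : D₁.Stored ω ρ μ (ρ x_Z0) τ) (h2 : D₂.Stored ω ρ μ (ρ x_Z1) τ)
    (hl : ∀ g < ρ x_NG, Lists (shift (D₂.gen g) D₂.str) D₂.str (ρ x_KC) (D₂.bpos g) (D₂.bnew g)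
      (D₂.bold g))
    (h0 : ∀ a, ρ x_TB + τ * (2 * n) ≤ a → u.mem a = 0) :
    let w := codeRep.run ω u
    Ctx ρ μ w ∧ (∀ a, ρ x_TB + (τ + 1) * (2 * n) ≤ a → w.mem a = 0) ∧
      ∀ z, z ≤ w.reg x_best ↔ z ≤ u.reg x_best ∧ repBound ω ρ D₁ D₂ z := by
  obtain ⟨c1, m1, f1, f2, f3⟩ := codeMasks_run hL hn ω hc hτ hτR h1 h2 hl
  simp only [codeRep, St.run_seq, St.run_assign, St.run_ite]
  set v := (St.loop x_e x_L (codeShift ;ₛ codeEst ;ₛ codeMin ‹x_est›)).run ω u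
  clear_value v
  have hJ : τ < J := hτR.trans_le hL.R_le
  rw [eval_entry hL c1 ω (Or.inl rfl) (by decide) (by simpa [f1] using hJ)]
  have k1 : (‹x_tau›).eval ω v = τ := f1
  rw [k1, h1.d]
  have c2 : Ctx ρ μ (v.set x_d D₁.d) := c1.set (by decide) _
  have hcond : (‹x_d› *ₑ ((‹x_d› =ₑ entry x_Z1 ‹x_tau› 7) *ₑ (‹x_est› <ₑ (‹x_KP› +ₑ .lit 1)))).eval ω
      (v.set x_d D₁.d) ≠ 0 ↔
      D₁.d ≠ 0 ∧ D₁.d = D₂.d ∧ maskEst ω ρ D₁ D₂ (ρ x_L - 1) ≤ ρ x_KP := by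
    have he := eval_entry hL c2 ω (z := x_Z1) (s := 7) (e := ‹x_tau›) (Or.inr rfl) (by decide)
      (by simpa [f1] using hJ)
    simp only [Ex.eval, Op.eval, he]
    simp only [State.reg_set, Nat.reduceEqDiff, if_true, if_false, f1, h2.d, f2,
      c1.reg x_KP (by decide), Nat.lt_succ_iff, mul_ne_zero_iff, ne_eq, ite_eq_right_iff,
      one_ne_zero, imp_false, not_not]
  have hz : ∀ a, ρ x_TB + τ * (2 * n) ≤ a → v.mem a = 0 := fun a ha => by
    have := hL.TB_le
    rw [m1 a (by omega), h0 a ha]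
  by_cases h : D₁.d ≠ 0 ∧ D₁.d = D₂.d ∧ maskEst ω ρ D₁ D₂ (ρ x_L - 1) ≤ ρ x_KP
  · rw [if_pos (hcond.2 h)]
    obtain ⟨c3, m3, g1, g2⟩ := codeSubgroup_run hL hn ω c2 (τ := τ)
      (est := maskEst ω ρ D₁ D₂ (ρ x_L - 1)) (d := D₁.d) (by simp [f1]) hτR h1 h2 (by simp [f2])
      (by simp) hz
    refine ⟨c3, m3, fun z => ?_⟩
    rw [g2]
    simp only [State.reg_set, Nat.reduceEqDiff, if_false, f3, repBound, imp_iff_right h, and_assoc]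
  · rw [if_neg (by rw [hcond]; exact h)]
    refine ⟨c2.set (by decide) _, fun a ha => hz a (by linarith), fun z => ?_⟩
    simp only [State.reg_set, Nat.reduceEqDiff, if_false, f3, repBound, h, false_implies, and_true]

/-- The result of the decoding program. -/
theorem codeMain_run {ρ μ : ℕ → ℕ} {J n : ℕ} [NeZero n] (hL : Layout ρ J) (hn : ρ x_n = n)
    (ω : Coins) {u : State} (hc : Ctx ρ μ u) {D₁ D₂ : ℕ → Rep n}
    (h1 : ∀ τ < ρ x_R, (D₁ τ).Stored ω ρ μ (ρ x_Z0) τ)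
    (h2 : ∀ τ < ρ x_R, (D₂ τ).Stored ω ρ μ (ρ x_Z1) τ)
    (hl : ∀ τ < ρ x_R, ∀ g < ρ x_NG, Lists (shift ((D₂ τ).gen g) (D₂ τ).str) (D₂ τ).str (ρ x_KC)
      ((D₂ τ).bpos g) ((D₂ τ).bnew g) ((D₂ τ).bold g))
    (h0 : ∀ a, ρ x_TB ≤ a → u.mem a = 0) (z : ℕ) :
    z ≤ (codeMain.run ω u).reg x_best ↔ z ≤ u.reg x_best ∧
      ∀ τ < ρ x_R, repBound ω ρ (D₁ τ) (D₂ τ) z := by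
  refine St.loop_rule ω (Q := fun w => z ≤ w.reg x_best ↔ z ≤ u.reg x_best ∧
      ∀ τ < ρ x_R, repBound ω ρ (D₁ τ) (D₂ τ) z) (ρ x_R)
    (fun τ w => Ctx ρ μ w ∧ (∀ a, ρ x_TB + τ * (2 * n) ≤ a → w.mem a = 0) ∧
      (z ≤ w.reg x_best ↔ z ≤ u.reg x_best ∧ ∀ i < τ, repBound ω ρ (D₁ i) (D₂ i) z))
    (hc.reg _ (by decide)) ?_ ?_ ?_
  · exact ⟨hc, by simpa using h0, by simp⟩
  · rintro τ hτ w ⟨cw, m1, e1⟩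
    obtain ⟨c2, m2, e2⟩ := codeRep_run hL hn ω (cw.set (x := x_tau) (by decide) τ) (τ := τ) (by simp)
      hτ (h1 τ hτ) (h2 τ hτ) (hl τ hτ) m1
    refine ⟨c2, m2, ?_⟩
    rw [e2]
    simp only [State.reg_set, Nat.reduceEqDiff, if_false, e1, and_assoc, Nat.lt_succ_iff]
    constructor
    · rintro ⟨a, b, c⟩
      refine ⟨a, fun e he => ?_⟩
      rcases Nat.lt_or_eq_of_le he with h | h
      · exact b e h
      · rw [h]; exact c
    · rintro ⟨a, b⟩
      exact ⟨a, fun e he => b e he.le, b τ le_rfl⟩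
  · rintro w ⟨cw, m1, e1⟩
    simpa using e1

/-! ### The contents of a sketch -/

/-- The positive divisor `d` of `n` such that `p` holds for the multiples of `d`; `0` if there is
none. -/
noncomputable def subgroupGen (n : ℕ) (p : ZMod n → Prop) : ℕ :=
  open Classical in
  if h : ∃ d, 0 < d ∧ d ∣ n ∧ ∀ m : ZMod n, p m ↔ d ∣ m.val then h.choose else 0

/-- A nonzero value of `subgroupGen` has the defining property. -/
theorem subgroupGen_spec {n : ℕ} {p : ZMod n → Prop} (h : subgroupGen n p ≠ 0) :
    subgroupGen n p ∣ n ∧ ∀ m : ZMod n, p m ↔ subgroupGen n p ∣ m.val := by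
  unfold subgroupGen at h ⊢
  split_ifs at h ⊢ with h'
  · exact h'.choose_spec.2
  · exact absurd rfl h

/-- Subgroups of `ZMod n` are generated by divisors of `n`. -/
theorem subgroupGen_ne_zero {n : ℕ} [NeZero n] {p : ZMod n → Prop} (H : AddSubgroup (ZMod n))
    (hp : ∀ m, p m ↔ m ∈ H) : subgroupGen n p ≠ 0 := by
  have h : ∃ d, 0 < d ∧ d ∣ n ∧ ∀ m : ZMod n, p m ↔ d ∣ m.val := by
    obtain ⟨a, ha⟩ := Int.subgroup_cyclic (H.comap (Int.castAddHom (ZMod n)))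
    have key : ∀ z : ℤ, (z : ZMod n) ∈ H ↔ a ∣ z := by
      intro z
      have : z ∈ H.comap (Int.castAddHom (ZMod n)) ↔ z ∈ AddSubgroup.closure {a} := by rw [ha]
      rw [AddSubgroup.mem_comap] at this
      rw [← Int.mem_zmultiples_iff, AddSubgroup.zmultiples_eq_closure]
      exact this
    have hn : a ∣ (n : ℤ) := by
      rw [← key]; simp [H.zero_mem]
    refine ⟨a.natAbs, ?_, Int.natCast_dvd_natCast.1 (by simpa using hn), fun m => ?_⟩
    · rw [Int.natAbs_pos]
      rintro rfl
      have := zero_dvd_iff.1 hn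
      have := NeZero.ne n
      omega
    · rw [hp, ← Int.natCast_dvd_natCast, Int.natAbs_dvd, ← key]
      simp
  unfold subgroupGen
  rw [dif_pos h]
  exact h.choose_spec.1.ne'

/-- The properties of the data of one repetition for the string `D.str` that the decoder relies on:
if at most `16 * κ` rotations have at most `κ` changes, then each of them is encoded by a mask; if
the rotations with at most `6 * κ` changes form a subgroup, then the exceptions from a template that
is invariant under it are listed. -/
structure Rep.Valid {n : ℕ} [NeZero n] (D : Rep n) (κ : ℕ) : Prop where
  breaks : ∀ g < 2 * Nat.log 2 n,
    Lists (shift (D.gen g) D.str) D.str κ (D.bpos g) (D.bnew g) (D.bold g)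
  mask_last : D.mask (16 * κ) = 0
  mask_all : (Finset.univ.filter fun m => per D.str m ≤ κ).card ≤ 16 * κ → ∀ m, per D.str m ≤ κ →
    ∃ e < 16 * κ + 1, maskSum D.gen (D.mask e) (2 * Nat.log 2 n) = m
  d_eq : D.d = subgroupGen n fun m => per D.str m ≤ 6 * κ
  template : D.d ≠ 0 → ∃ Q : ZMod n → ℕ, (∀ h : ZMod n, D.d ∣ h.val → ∀ i, Q (i + h) = Q i) ∧
    Lists D.str Q (6 * κ) D.pos D.val D.tm

/-- The numbers in the data of one repetition are small. -/
structure Rep.Small {n : ℕ} (D : Rep n) (V : ℕ) : Prop where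
  mask : ∀ e, D.mask e < 2 ^ (2 * Nat.log 2 n)
  bold : ∀ g q, D.bold g q < V
  bnew : ∀ g q, D.bnew g q < V
  d : D.d ≤ n
  val : ∀ x, D.val x < V
  tm : ∀ x, D.tm x < V

/-- Every string has data with these properties: `gen` and `mask` come from `exists_generators`, the
breaks of a generator from its small number of changes, and the exceptions from `exists_template`.
-/
theorem exists_rep {n : ℕ} [NeZero n] (U : ZMod n → ℕ) {V κ : ℕ} (hU : ∀ i, U i < V) :
    ∃ D : Rep n, D.str = U ∧ D.Valid κ ∧ D.Small V := by
  classical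
  have hV : 0 < V := (Nat.zero_le _).trans_lt (hU 0)
  have hpc : ∀ g, (Finset.univ.filter fun i => shift g U i ≠ U i).card = per U g := by
    intro g; rw [per, hammingDist_comm]; rfl
  set G : Finset (ZMod n) := Finset.univ.filter fun m => per U m ≤ κ with hG
  obtain ⟨gen, hgen, hmask⟩ := exists_generators G (by simp [hG, per_zero])
    (fun g hg => by simpa [hG, per_neg] using hg)
  rw [ZMod.card] at hmask
  have hb : ∀ g, ∃ (pos : ℕ → ZMod n) (val tm : ℕ → ℕ), Lists (shift (gen g) U) U κ pos val tm ∧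
      ∀ x, val x < V ∧ tm x < V := by
    intro g
    obtain ⟨pos, val, tm, h1, h2⟩ := exists_lists (shift (gen g) U) U (E := κ)
      (by rw [hpc]; simpa [hG] using hgen g)
    refine ⟨pos, val, tm, h1, fun x => ?_⟩
    rcases h2 x with ⟨i, e1, e2⟩ | ⟨e1, e2⟩
    · rw [e1, e2]; exact ⟨hU _, hU _⟩
    · rw [e1, e2]; exact ⟨hV, hV⟩
  choose bpos bnew bold hb1 hb2 using hb
  choose! mk hmk1 hmk2 using hmask
  set d := subgroupGen n fun m => per U m ≤ 6 * κ with hd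
  have ht : ∃ (pos : ℕ → ZMod n) (val tm : ℕ → ℕ), (d ≠ 0 → ∃ Q : ZMod n → ℕ,
      (∀ h : ZMod n, d ∣ h.val → ∀ i, Q (i + h) = Q i) ∧ Lists U Q (6 * κ) pos val tm) ∧
      ∀ x, val x < V ∧ tm x < V := by
    by_cases h0 : d = 0
    · exact ⟨fun _ => 0, fun _ => 0, fun _ => 0, fun h => absurd h0 h, fun _ => ⟨hV, hV⟩⟩
    · obtain ⟨hdn, hdm⟩ := subgroupGen_spec (hd ▸ h0)
      rw [← hd] at hdn hdm
      -- the multiples of `d` form the kernel of the reduction modulo `d`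
      let H : AddSubgroup (ZMod n) := (ZMod.castHom hdn (ZMod d)).toAddMonoidHom.ker
      have hH : ∀ m : ZMod n, m ∈ H ↔ d ∣ m.val := by
        intro m
        rw [AddMonoidHom.mem_ker]
        have : ((ZMod.castHom hdn (ZMod d)).toAddMonoidHom m) = ((m.val : ℕ) : ZMod d) := by
          conv_lhs => rw [← ZMod.natCast_zmod_val m]
          simp
        rw [this, ZMod.natCast_eq_zero_iff]
      obtain ⟨Q, hQ1, hQ2, hQ3⟩ := exists_template U H (c := 6 * κ)
        (fun h hh => (hdm h).2 ((hH h).1 hh))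
      obtain ⟨pos, val, tm, h1, h2⟩ := exists_lists U Q hQ3
      refine ⟨pos, val, tm, fun _ => ⟨Q, fun h hh => hQ1 h ((hH h).2 hh), h1⟩, fun x => ?_⟩
      rcases h2 x with ⟨i, e1, e2⟩ | ⟨e1, e2⟩
      · obtain ⟨j, hj⟩ := hQ2 i
        rw [e1, e2, hj]; exact ⟨hU _, hU _⟩
      · rw [e1, e2]; exact ⟨hV, hV⟩
  obtain ⟨pos, val, tm, ht1, ht2⟩ := ht
  refine ⟨⟨U, fun e => if h : e < G.card ∧ G.card ≤ 16 * κ then mk (G.equivFin.symm ⟨e, h.1⟩) else 0,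
    gen, bpos, bold, bnew, d, pos, val, tm⟩, rfl, ⟨fun g _ => hb1 g, ?_, ?_, rfl, ht1⟩,
    ⟨?_, fun g q => (hb2 g q).2, fun g q => (hb2 g q).1, ?_, fun x => (ht2 x).1,
      fun x => (ht2 x).2⟩⟩
  · exact dif_neg (by omega)
  · intro hc m hm
    have hmG : m ∈ G := by simpa [hG] using hm
    have hlt := (G.equivFin ⟨m, hmG⟩).2
    refine ⟨(G.equivFin ⟨m, hmG⟩ : ℕ), by change G.card ≤ 16 * κ at hc; omega, ?_⟩
    simp only
    rw [dif_pos ⟨hlt, hc⟩]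
    simp only [Fin.eta, Equiv.symm_apply_apply]
    exact (hmk2 m hmG).symm
  · intro e
    simp only
    split_ifs with h
    · exact hmk1 _ (G.equivFin.symm ⟨e, h.1⟩).2
    · positivity
  · by_cases h0 : d = 0
    · simp [h0]
    · exact Nat.le_of_dvd (NeZero.pos n) (subgroupGen_spec (hd ▸ h0)).1

theorem maskSum_zero {A : Type} [AddCommMonoid A] (gen : ℕ → A) (N : ℕ) : maskSum gen 0 N = 0 := by
  simp [maskSum]

/-- For rotations that preserve both templates, the tables determine the distance. -/
theorem cand_eq {n : ℕ} [NeZero n] {D₁ D₂ : Rep n} {E : ℕ} {Q₁ Q₂ : ZMod n → ℕ}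
    (h1 : Lists D₁.str Q₁ E D₁.pos D₁.val D₁.tm) (h2 : Lists D₂.str Q₂ E D₂.pos D₂.val D₂.tm)
    {m : ZMod n} (hQ1 : ∀ i, Q₁ (i + m) = Q₁ i) (hQ2 : ∀ i, Q₂ (i + m) = Q₂ i) :
    cand D₁ D₂ E (hammingDist D₁.str D₂.str) m = hammingDist D₁.str (shift m D₂.str) := by
  have h := hammingDist_eq_of_lists h1 h2 hQ1 hQ2
  have e : ∀ m : ZMod n, (∑ x ∈ Finset.range E, ∑ y ∈ Finset.range E,
      if D₂.pos y - D₁.pos x = m then beta (D₁.val x) (D₁.tm x) (D₂.val y) (D₂.tm y) else 0) =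
      (tabP D₁ D₂ E m : ℤ) - tabM D₁ D₂ E m := by
    intro m
    unfold tabP tabM
    push_cast
    rw [← Finset.sum_sub_distrib]
    refine Finset.sum_congr rfl fun x _ => ?_
    rw [← Finset.sum_sub_distrib]
    refine Finset.sum_congr rfl fun y _ => ?_
    unfold beta
    split_ifs
    · ring
    · simp
  rw [e, e] at h
  unfold cand
  omega

/-- Among the multiples of `d`, those that are differences of exceptions and the first few multiples
determine all distances: any other multiple gives the same distance as one of the latter. -/
theorem forall_cand_iff {n : ℕ} [NeZero n] {D₁ D₂ : Rep n} {κ d : ℕ} (h1 : D₁.Valid κ)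
    (h2 : D₂.Valid κ) (hd1 : D₁.d = d) (hd2 : D₂.d = d) (hd : d ≠ 0) (z : ℕ) :
    ((∀ x < 6 * κ, ∀ y < 6 * κ, d ∣ (D₂.pos y - D₁.pos x).val →
        z ≤ cand D₁ D₂ (6 * κ) (hammingDist D₁.str D₂.str) (D₂.pos y - D₁.pos x)) ∧
      ∀ t < 6 * κ * (6 * κ) + 1,
        z ≤ cand D₁ D₂ (6 * κ) (hammingDist D₁.str D₂.str) ((t * d : ℕ) : ZMod n)) ↔
      ∀ m : ZMod n, d ∣ m.val → z ≤ hammingDist D₁.str (shift m D₂.str) := by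
  classical
  obtain ⟨Q₁, q1, l1⟩ := h1.template (by rw [hd1]; exact hd)
  obtain ⟨Q₂, q2, l2⟩ := h2.template (by rw [hd2]; exact hd)
  rw [hd1] at q1
  rw [hd2] at q2
  have hdn : d ∣ n := by
    have := h1.d_eq
    rw [hd1] at this
    rw [this] at hd ⊢
    exact (subgroupGen_spec hd).1
  set E := 6 * κ with hE
  have key : ∀ m : ZMod n, d ∣ m.val → cand D₁ D₂ E (hammingDist D₁.str D₂.str) m =
      hammingDist D₁.str (shift m D₂.str) := fun m hm => cand_eq l1 l2 (q1 m hm) (q2 m hm)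
  have hmul : ∀ t : ℕ, d ∣ ((t * d : ℕ) : ZMod n).val := by
    intro t
    rw [ZMod.val_natCast]
    exact (Nat.dvd_mod_iff hdn).2 (Dvd.intro_left t rfl)
  constructor
  · rintro ⟨hA, hB⟩ m hm
    let A : Finset (ZMod n) := ((Finset.range E) ×ˢ (Finset.range E)).image fun p =>
      D₂.pos p.2 - D₁.pos p.1
    have hAc : A.card ≤ E * E := Finset.card_image_le.trans (by simp)
    have hno : ∀ m ∉ A, tabP D₁ D₂ E m = 0 ∧ tabM D₁ D₂ E m = 0 := by
      intro m hm
      have : ∀ x ∈ Finset.range E, ∀ y ∈ Finset.range E, ¬ D₂.pos y - D₁.pos x = m := by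
        intro x hx y hy h
        exact hm (Finset.mem_image.2 ⟨(x, y), Finset.mem_product.2 ⟨hx, hy⟩, h⟩)
      constructor
      · exact Finset.sum_eq_zero fun x hx => Finset.sum_eq_zero fun y hy => if_neg (this x hx y hy)
      · exact Finset.sum_eq_zero fun x hx => Finset.sum_eq_zero fun y hy => if_neg (this x hx y hy)
    by_cases hmA : m ∈ A
    · obtain ⟨⟨x, y⟩, hxy, rfl⟩ := Finset.mem_image.1 hmA
      rw [Finset.mem_product, Finset.mem_range, Finset.mem_range] at hxy
      rw [← key _ hm]
      exact hA x hxy.1 y hxy.2 hm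
    · by_cases hex : ∃ t < E * E + 1, ((t * d : ℕ) : ZMod n) ∉ A
      · obtain ⟨t, ht, htA⟩ := hex
        have := hB t ht
        rw [← key m hm]
        unfold cand at this ⊢
        rw [(hno _ htA).1, (hno _ htA).2] at this
        rw [(hno _ hmA).1, (hno _ hmA).2]
        exact this
      · push Not at hex
        -- too many multiples for the differences, so the multiples repeat
        obtain ⟨t, ht, t', ht', hne, heq⟩ := Finset.exists_ne_map_eq_of_card_lt_of_maps_to
          (s := Finset.range (E * E + 1)) (t := A) (f := fun t : ℕ => ((t * d : ℕ) : ZMod n))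
          (by rw [Finset.card_range]; omega)
          (fun t ht => hex t (Finset.mem_range.1 ht))
        rw [Finset.mem_range] at ht ht'
        have hle : n ≤ (E * E) * d := by
          have hd0 : 0 < d := Nat.pos_of_ne_zero hd
          have aux : ∀ t t' : ℕ, t < t' → t' < E * E + 1 →
              ((t * d : ℕ) : ZMod n) = ((t' * d : ℕ) : ZMod n) → n ≤ (E * E) * d := by
            intro t t' h1 h2 h3
            rw [ZMod.natCast_eq_natCast_iff, Nat.modEq_iff_dvd' (Nat.mul_le_mul_right _ h1.le),
              ← Nat.sub_mul] at h3
            have h4 := Nat.le_of_dvd (Nat.mul_pos (by omega) hd0) h3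
            exact h4.trans (Nat.mul_le_mul_right _ (by omega))
          rcases lt_or_gt_of_ne hne with h | h
          · exact aux t t' h ht' heq
          · exact aux t' t h ht heq.symm
        obtain ⟨c, hc⟩ := hm
        have hcm : ((c * d : ℕ) : ZMod n) = m := by
          rw [mul_comm c d, ← hc, ZMod.natCast_zmod_val]
        have hclt : c < E * E + 1 := by
          have h1 := m.val_lt
          rw [hc] at h1
          have h2 : d * c < d * (E * E) := by linarith
          have := lt_of_mul_lt_mul_left h2 (Nat.zero_le d)
          omega
        have := hB c hclt
        rw [key _ (hmul c), hcm] at this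
        exact this
  · intro h
    refine ⟨fun x hx y hy hdv => ?_, fun t ht => ?_⟩
    · rw [key _ hdv]; exact h _ hdv
    · rw [key _ (hmul t)]; exact h _ (hmul t)

/-- The estimates for the rotations of the second string are not too small. -/
def GoodEst (ω : Coins) (ρ : ℕ → ℕ) {n : ℕ} [NeZero n] (U₁ U₂ : ZMod n → ℕ) : Prop :=
  ∀ m, min (hammingDist U₁ (shift m U₂)) (ρ x_KP + 1) ≤
    est (ρ x_B) (ρ x_P) (coinCell ω ρ (shift m U₂)) (coinCell ω ρ U₁)

/-- Estimates never exceed the distance, whatever the coins are. -/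
theorem est_coinCell_le (ω : Coins) (ρ : ℕ → ℕ) {n : ℕ} [NeZero n] (U₁ U₂ : ZMod n → ℕ) :
    est (ρ x_B) (ρ x_P) (coinCell ω ρ U₂) (coinCell ω ρ U₁) ≤ hammingDist U₁ U₂ := by
  rw [hammingDist_comm]
  exact est_le _ _ _ _ _ _ _

/-- The relations between the parameters that make decoding correct. -/
structure Design (ρ : ℕ → ℕ) (n k κ : ℕ) : Prop where
  L : ρ x_L = 16 * κ + 1
  NG : ρ x_NG = 2 * Nat.log 2 n
  E : ρ x_E = 6 * κ
  E2 : ρ x_E2 = 6 * κ * (6 * κ) + 1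
  KP : ρ x_KP + k = κ
  pos : 0 < κ

/-- The last mask is empty, so its estimate is for the rotation by `0`. -/
theorem maskEst_last {ω : Coins} {ρ : ℕ → ℕ} {n k κ : ℕ} [NeZero n] (hρ : Design ρ n k κ)
    {D₁ D₂ : Rep n} (h2 : D₂.Valid κ) : maskEst ω ρ D₁ D₂ (ρ x_L - 1) =
      est (ρ x_B) (ρ x_P) (coinCell ω ρ D₂.str) (coinCell ω ρ D₁.str) := by
  rw [maskEst, hρ.L, Nat.add_sub_cancel, h2.mask_last, maskSum_zero, shift_zero]

/-- If the estimate for the rotation by `0` is within the capacity, then it is exact. -/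
theorem maskEst_last_eq {ω : Coins} {ρ : ℕ → ℕ} {n k κ : ℕ} [NeZero n] (hρ : Design ρ n k κ)
    {D₁ D₂ : Rep n} (h2 : D₂.Valid κ) (hg : GoodEst ω ρ D₁.str D₂.str)
    (hK : maskEst ω ρ D₁ D₂ (ρ x_L - 1) ≤ ρ x_KP) :
    maskEst ω ρ D₁ D₂ (ρ x_L - 1) = hammingDist D₁.str D₂.str := by
  rw [maskEst_last hρ h2] at hK ⊢
  have h := hg 0
  rw [shift_zero] at h
  have h' := est_coinCell_le ω ρ D₁.str D₂.str
  omega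

/-- A repetition gives no value below the distances of the rotations (up to the capacity). -/
theorem repBound_of_forall {ω : Coins} {ρ : ℕ → ℕ} {n k κ : ℕ} [NeZero n] (hρ : Design ρ n k κ)
    {D₁ D₂ : Rep n} (h1 : D₁.Valid κ) (h2 : D₂.Valid κ) (hg : GoodEst ω ρ D₁.str D₂.str) {z : ℕ}
    (hz : ∀ m, z ≤ hammingDist D₁.str (shift m D₂.str)) (hzK : z ≤ ρ x_KP + 1) :
    repBound ω ρ D₁ D₂ z := by
  refine ⟨fun e _ => (le_min (hz _) hzK).trans (hg _), ?_⟩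
  rintro ⟨hd, hdd, hK⟩
  rw [maskEst_last_eq hρ h2 hg hK, hρ.E, hρ.E2]
  exact (forall_cand_iff h1 h2 rfl hdd.symm hd z).2 fun m _ => hz m

/-- If the anchors nearly align the strings, then a repetition gives a value that is at most the
distance for any similar rotation. Such a rotation `m` is a near-period of the second string; if
there are few near-periods, then some mask encodes `m`. Otherwise there is a gap, both strings have
the same subgroup of near-periods, it contains `m`, and the tables give the exact distance. -/
theorem le_of_repBound {ω : Coins} {ρ : ℕ → ℕ} {n k κ : ℕ} [NeZero n] (hρ : Design ρ n k κ)
    {D₁ D₂ : Rep n} (h1 : D₁.Valid κ) (h2 : D₂.Valid κ) (hg : GoodEst ω ρ D₁.str D₂.str) {z : ℕ}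
    (hb : repBound ω ρ D₁ D₂ z) (h0 : hammingDist D₁.str D₂.str ≤ ρ x_KP) {m : ZMod n}
    (hm : hammingDist D₁.str (shift m D₂.str) ≤ k) :
    z ≤ hammingDist D₁.str (shift m D₂.str) := by
  have hKP := hρ.KP
  have hper : per D₂.str m ≤ κ := by
    have := hammingDist_triangle D₂.str D₁.str (shift m D₂.str)
    rw [hammingDist_comm D₂.str D₁.str] at this
    unfold per
    omega
  by_cases hc : (Finset.univ.filter fun m => per D₂.str m ≤ κ).card ≤ 16 * κ
  · obtain ⟨e, he, hem⟩ := h2.mask_all hc m hper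
    refine (hb.1 e (by rw [hρ.L]; exact he)).trans ?_
    rw [maskEst, hρ.NG, hem]
    exact est_coinCell_le ω ρ D₁.str (shift m D₂.str)
  · have hgap := per_gap D₂.str hρ.pos (not_le.1 hc)
    obtain ⟨H, hH⟩ := exists_addSubgroup_of_gap D₂.str hρ.pos hgap
    have hmm : hammingDist D₂.str (shift (-m) D₁.str) ≤ k := by
      rw [← hammingDist_shift m, shift_shift, add_neg_cancel, shift_zero, hammingDist_comm]
      exact hm
    have hd2 : D₂.d ≠ 0 := by
      rw [h2.d_eq]
      refine subgroupGen_ne_zero H fun g => ?_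
      rw [hH]
      rcases hgap g with h | h <;> omega
    have hdd : D₁.d = D₂.d := by
      rw [h1.d_eq, h2.d_eq]
      congr 1
      funext g
      have a1 := per_le_per_add hm g
      have a2 := per_le_per_add hmm g
      have a3 := hρ.pos
      rw [eq_iff_iff]
      rcases hgap g with h | h <;> constructor <;> intro h' <;> omega
    have hK : maskEst ω ρ D₁ D₂ (ρ x_L - 1) ≤ ρ x_KP := by
      rw [maskEst_last hρ h2]
      exact (est_coinCell_le ω ρ D₁.str D₂.str).trans h0
    have hb2 := hb.2 ⟨hdd ▸ hd2, hdd, hK⟩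
    rw [maskEst_last_eq hρ h2 hg hK, hρ.E, hρ.E2] at hb2
    refine (forall_cand_iff h1 h2 rfl hdd.symm (hdd ▸ hd2) z).1 hb2 m ?_
    rw [hdd]
    have := h2.d_eq
    have hs := subgroupGen_spec (this ▸ hd2)
    rw [this]
    exact (hs.2 m).1 (by omega)

/-! ### The first part of the decoding program -/

/-- Shifting `n` by increasing amounts until nothing is left; the length of a sketch is a large
enough loop bound. -/
theorem codeLog_run (ω : Coins) {u : State} {n : ℕ} (hn : u.reg x_n = n) (hn0 : n ≠ 0)
    (h4 : u.reg x_lg = 0) (hlen : Nat.log 2 n < u.reg x_len1) :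
    (codeLog.run ω u).mem = u.mem ∧ (codeLog.run ω u).reg x_lg = Nat.log 2 n + 1 := by
  rw [codeLog]
  refine St.loop_rule ω (Q := fun w => w.mem = u.mem ∧ w.reg x_lg = Nat.log 2 n + 1)
    (u.reg x_len1) (fun i w => w.mem = u.mem ∧ w.reg x_n = n ∧
      w.reg x_lg = min i (Nat.log 2 n + 1)) rfl ?_ ?_ ?_
  · exact ⟨rfl, hn, by simp [h4]⟩
  · rintro i hi v ⟨h1, h2, h3⟩
    have hcond : (Ex.op .shr ‹x_n› ‹x_word›).eval ω (v.set x_word i) ≠ 0 ↔ i ≤ Nat.log 2 n := by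
      simp only [Ex.eval, Op.eval, State.reg_set, Nat.reduceEqDiff, if_true, if_false, h2,
        Nat.shiftRight_eq_div_pow, ne_eq, Nat.div_eq_zero_iff]
      rw [Nat.le_log_iff_pow_le (by norm_num) hn0]
      have : 2 ^ i ≠ 0 := by positivity
      omega
    rw [St.run_ite]
    by_cases hc : i ≤ Nat.log 2 n
    · rw [if_pos (hcond.2 hc), St.run_assign]
      refine ⟨h1, by simp [h2], ?_⟩
      simp
      omega
    · rw [if_neg (by rw [hcond]; exact hc), St.run_assign]
      refine ⟨h1, by simp [h2], ?_⟩
      simp [h3]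
      omega
  · rintro v ⟨h1, h2, h3⟩
    refine ⟨h1, ?_⟩
    simp [h3]
    omega

/-- Each word is the number with the given binary digits. -/
theorem codeUnpack_run (ω : Coins) {u : State} {f : ℕ → Bool} {Z W N : ℕ} (hZ : u.reg x_Z0 = Z)
    (hW : u.reg x_W = W) (hN : u.reg x_NW = N) (hZN : Z = N * W) (hb : 2 ^ W ≤ u.reg x_big + 1)
    (hm : ∀ a < Z, u.mem a = (f a).toNat) :
    (∀ a, Z + N ≤ a → (codeUnpack.run ω u).mem a = u.mem a) ∧
    ∀ j < N, (codeUnpack.run ω u).mem (Z + j) = bitsVal (fun t => f (j * W + t)) W := by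
  rw [codeUnpack]
  refine St.loop_rule ω (Q := fun w => (∀ a, Z + N ≤ a → w.mem a = u.mem a) ∧
    ∀ j < N, w.mem (Z + j) = bitsVal (fun t => f (j * W + t)) W) N (fun i w =>
      (∀ a, Z + N ≤ a → w.mem a = u.mem a) ∧
      (∀ j < i, w.mem (Z + j) = bitsVal (fun t => f (j * W + t)) W) ∧
      (∀ a < Z, w.mem a = (f a).toNat) ∧ w.reg x_Z0 = Z ∧ w.reg x_W = W ∧
      w.reg x_big = u.reg x_big) hN ?_ ?_ ?_
  · exact ⟨fun _ _ => rfl, by simp, hm, hZ, hW, rfl⟩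
  · rintro i hi v ⟨h1, h2, h3, h4, h5, h6⟩
    rw [St.run_seq, St.run_seq, St.run_assign]
    set w := (St.loop x_bit x_W (x_acc ≔ .clamp (.lit 2 *ₑ ‹x_acc› +ₑ
        .load (‹x_word› *ₑ ‹x_W› +ₑ ‹x_bit›)) ‹x_big›)).run ω
          ((v.set x_word i).set x_acc ((Ex.lit 0).eval ω (v.set x_word i))) with hw
    obtain ⟨g1, g2, g3, g4, g5, g6⟩ :
        w.mem = v.mem ∧ w.reg x_acc = bitsVal (fun t => f (i * W + t)) W ∧ w.reg x_word = i ∧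
        w.reg x_Z0 = Z ∧ w.reg x_W = W ∧ w.reg x_big = u.reg x_big := by
      rw [hw]
      refine St.loop_rule ω (Q := fun w => w.mem = v.mem ∧
        w.reg x_acc = bitsVal (fun t => f (i * W + t)) W ∧ w.reg x_word = i ∧
        w.reg x_Z0 = Z ∧ w.reg x_W = W ∧ w.reg x_big = u.reg x_big) W (fun r w => w.mem = v.mem ∧
        w.reg x_acc = bitsVal (fun t => f (i * W + t)) r ∧ w.reg x_word = i ∧
        w.reg x_Z0 = Z ∧ w.reg x_W = W ∧ w.reg x_big = u.reg x_big) (by simp [h5]) ?_ ?_ ?_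
      · simp [bitsVal, h4, h5, h6]
      · rintro r hr w ⟨k1, k2, k3, k4, k5, k6⟩
        refine ⟨by simp [k1], ?_, by simp [k3], by simp [k4], by simp [k5], by simp [k6]⟩
        have hlt : i * W + r < Z := by rw [hZN]; exact mul_add_lt_of_lt hi hr le_rfl
        simp only [St.run_assign, State.reg_set, if_true, Ex.eval, Op.eval, State.mem_set, k1, k2,
          k3, k5, k6, Nat.reduceEqDiff, if_false, h3 _ hlt, bitsVal]
        refine Nat.mod_eq_of_lt (Nat.lt_of_lt_of_le
          (bitsVal_lt (fun t => f (i * W + t)) (r + 1)) ?_)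
        exact (Nat.pow_le_pow_right (by norm_num) hr).trans hb
      · rintro w ⟨k1, k2, k3, k4, k5, k6⟩
        exact ⟨by simp [k1], by simp [k2], by simp [k3], by simp [k4], by simp [k5], by simp [k6]⟩
    clear_value w
    simp only [St.run_store, Ex.eval, Op.eval, g2, g3, g4]
    refine ⟨fun a ha => ?_, fun j hj => ?_, fun a ha => ?_, g4, g5, g6⟩
    · have : a ≠ Z + i := by omega
      simp [this, g1, h1 a ha]
    · by_cases hji : j = i
      · simp [hji]
      · simp [hji, g1, h2 j (by omega)]
    · have : a ≠ Z + i := by omega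
      simp [this, g1, h3 a ha]
  · rintro v ⟨h1, h2, h3, h4, h5, h6⟩
    exact ⟨h1, h2⟩

/-- The header entries are loaded into the registers from `x_R` on. -/
theorem codeHeader_run (ω : Coins) {u : State} :
    (codeHeader.run ω u).mem = u.mem ∧
    (∀ x < 20, (codeHeader.run ω u).reg x = u.reg x) ∧
    (∀ j < 17, (codeHeader.run ω u).reg (20 + j) = sec u.mem (u.reg x_Z0) 0 j) ∧
    (codeHeader.run ω u).reg x_best = u.reg x_k + 1 := by
  refine ⟨rfl, fun x hx => St.run_frame ω ?_ u, fun j hj => ?_, ?_⟩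
  · have : ∀ x < 20, x ∉ codeHeader.writes := by decide
    exact this x hx
  · simp only [codeHeader, St.run_seq, St.run_assign, entry, Ex.eval, Op.eval, State.reg_set,
      State.mem_set, Nat.reduceEqDiff, if_false, sec]
    interval_cases j <;> simp
  · simp [codeHeader]

theorem codeInit_run (ω : Coins) {u : State} {n l len : ℕ} (hn : u.reg x_n = n)
    (hl : u.reg x_lg = l) (h1 : u.reg x_len1 = len) (h2 : u.reg x_len2 = len) :
    let w := codeInit.run ω u
    w.mem = u.mem ∧ w.reg x_W = 60 * l ∧ w.reg x_big = (2 * n) ^ 64 ∧ w.reg x_Z0 = 2 * len ∧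
      w.reg x_NW = 2 * len / (60 * l) ∧ w.reg x_Z1 = 2 * len + len / (60 * l) := by
  refine ⟨rfl, ?_, ?_, ?_, ?_, ?_⟩
  · simp [codeInit, hl]
  · simp only [codeInit, St.run_seq, St.run_assign, Ex.eval, Op.eval, State.reg_set,
      Nat.reduceEqDiff, if_true, if_false, hn]
    ring
  · simp [codeInit, h1, h2]; ring
  · simp [codeInit, h1, h2, hl, two_mul]
  · simp [codeInit, h1, h2, hl, two_mul]

/-! ### Parameters -/

/-- The number of binary digits of `n`. -/
def lg (n : ℕ) : ℕ := Nat.log 2 n + 1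

/-- The distances up to this one are estimated exactly, and good anchors align similar strings up
to this distance. -/
def capa (n k : ℕ) : ℕ := 10 * lg n * 2 ^ (Nat.log 2 k + 4)

/-- The threshold for near-periods. -/
def kap (n k : ℕ) : ℕ := capa n k + k

/-- The number of repetitions. One repetition succeeds with probability at least `1 / 64`. -/
def reps (n : ℕ) : ℕ := 64 * (lg n + 2)

/-- The number of moduli, for `exists_mod_injOn` with at most `24 * lg n` mismatches in a bucket. -/
def modCount (n : ℕ) : ℕ := 2 * (lg n * (24 * lg n) ^ 2 + 4)

/-- The number of coins for a bucket; there are at least twice as many buckets as mismatches to be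
counted. -/
def bktBits (n k : ℕ) : ℕ := Nat.log 2 (capa n k + 1) + 2

/-- The number of fingerprints. -/
def cellCount (n k : ℕ) : ℕ := 2 ^ bktBits n k * modCount n * modCount n

/-- The length of a section of the sketch, in words. The longest section is much shorter than this
sum, in which each kind of section has a summand; the last one is for the header. All sections have
this length, so that an entry is found from its section and its index alone. -/
def secLen (n k : ℕ) : ℕ :=
  reps n * cellCount n k + reps n * (16 * kap n k + 1) +
    reps n * (2 * Nat.log 2 n) * kap n k + reps n * (2 * Nat.log 2 n) + reps n * (6 * kap n k) +
    reps n + 17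

/-- The length of the sketch: 16 sections with words of `60 * lg n` bits. -/
def skLen (n k : ℕ) : ℕ := 16 * secLen n k * (60 * lg n)

/-- The first coin that is used for buckets; the coins before are used for hash values, `50 * lg n`
for each position and each of the `2 ^ (5 * lg n)` characters. -/
def coinBase (n : ℕ) : ℕ := n * 2 ^ (5 * lg n) * (50 * lg n)

/-- The header of the sketch, as the contents of the registers from `x_R` on. -/
def par (n k x : ℕ) : ℕ :=
  ([reps n, 16 * kap n k + 1, 2 * Nat.log 2 n, kap n k, 2 ^ bktBits n k, modCount n, 6 * kap n k,
    6 * kap n k * (6 * kap n k) + 1, capa n k, 2 ^ (50 * lg n), 50 * lg n, bktBits n k,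
    2 ^ (5 * lg n), coinBase n, 2 * skLen n k + 32 * secLen n k,
    2 * skLen n k + 32 * secLen n k + cellCount n k, cellCount n k] : List ℕ).getD (x - 20) 0

section Bounds

variable {n k : ℕ}

theorem lg_le_two_pow : lg n ≤ 2 ^ Nat.log 2 n := Nat.lt_two_pow_self

theorem pow_log_le (hkn : k ≤ n) : 2 ^ Nat.log 2 k ≤ 2 ^ Nat.log 2 n :=
  Nat.pow_le_pow_right (by norm_num) (Nat.log_mono_right hkn)

theorem lt_two_mul_pow : n < 2 * 2 ^ Nat.log 2 n := by
  have := Nat.lt_pow_succ_log_self (b := 2) (by norm_num) n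
  rwa [pow_succ, mul_comm] at this

theorem capa_le (hkn : k ≤ n) : capa n k ≤ 160 * (2 ^ Nat.log 2 n) ^ 2 := by
  unfold capa
  calc 10 * lg n * 2 ^ (Nat.log 2 k + 4)
      ≤ 10 * 2 ^ Nat.log 2 n * (2 ^ Nat.log 2 n * 2 ^ 4) := by
        rw [pow_add]
        exact Nat.mul_le_mul (Nat.mul_le_mul_left _ lg_le_two_pow)
          (Nat.mul_le_mul_right _ (pow_log_le hkn))
    _ = _ := by ring

theorem kap_le (hkn : k ≤ n) : kap n k ≤ 162 * (2 ^ Nat.log 2 n) ^ 2 := by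
  unfold kap
  have h1 := capa_le hkn
  have h2 := lt_two_mul_pow (n := n)
  have h3 : 2 ^ Nat.log 2 n ≤ (2 ^ Nat.log 2 n) ^ 2 := Nat.le_self_pow (by norm_num) _
  omega

theorem reps_le : reps n ≤ 192 * 2 ^ Nat.log 2 n := by
  unfold reps
  have := lg_le_two_pow (n := n)
  have : 1 ≤ 2 ^ Nat.log 2 n := Nat.one_le_two_pow
  omega

theorem modCount_le : modCount n ≤ 1160 * (2 ^ Nat.log 2 n) ^ 3 := by
  unfold modCount
  have h := Nat.pow_le_pow_left (lg_le_two_pow (n := n)) 3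
  have h1 : 1 ≤ (2 ^ Nat.log 2 n) ^ 3 := Nat.one_le_pow _ _ (by positivity)
  calc 2 * (lg n * (24 * lg n) ^ 2 + 4) = 1152 * lg n ^ 3 + 8 := by ring
    _ ≤ _ := by omega

theorem two_pow_bktBits_le (hkn : k ≤ n) : 2 ^ bktBits n k ≤ 644 * (2 ^ Nat.log 2 n) ^ 2 := by
  unfold bktBits
  rw [pow_add]
  have h := Nat.pow_log_le_self 2 (x := capa n k + 1) (by omega)
  have h1 := capa_le hkn
  have h2 : 1 ≤ (2 ^ Nat.log 2 n) ^ 2 := Nat.one_le_pow _ _ (by positivity)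
  omega

theorem cellCount_le (hkn : k ≤ n) : cellCount n k ≤ 2 ^ 30 * (2 ^ Nat.log 2 n) ^ 8 := by
  unfold cellCount
  calc _ ≤ 644 * (2 ^ Nat.log 2 n) ^ 2 * (1160 * (2 ^ Nat.log 2 n) ^ 3) *
        (1160 * (2 ^ Nat.log 2 n) ^ 3) :=
        Nat.mul_le_mul (Nat.mul_le_mul (two_pow_bktBits_le hkn) modCount_le) modCount_le
    _ = 866566400 * (2 ^ Nat.log 2 n) ^ 8 := by ring
    _ ≤ _ := Nat.mul_le_mul_right _ (by norm_num)

theorem secLen_le (hkn : k ≤ n) : secLen n k ≤ 2 ^ 39 * (2 ^ Nat.log 2 n) ^ 9 := by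
  have hR := reps_le (n := n)
  have hκ := kap_le hkn
  have hC := cellCount_le hkn
  have hl : Nat.log 2 n ≤ 2 ^ Nat.log 2 n := by
    have := lg_le_two_pow (n := n); unfold lg at this; omega
  unfold secLen
  generalize 2 ^ Nat.log 2 n = T at *
  generalize Nat.log 2 n = b at *
  rcases Nat.eq_zero_or_pos T with rfl | hT
  · have : reps n = 0 := by omega
    unfold reps at this; omega
  have e1 : T ≤ T ^ 9 := Nat.le_self_pow (by norm_num) _
  have e2 : T ^ 2 ≤ T ^ 9 := Nat.pow_le_pow_right hT (by norm_num)
  have e3 : T ^ 3 ≤ T ^ 9 := Nat.pow_le_pow_right hT (by norm_num)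
  have e4 : T ^ 4 ≤ T ^ 9 := Nat.pow_le_pow_right hT (by norm_num)
  have f1 : reps n * cellCount n k ≤ 192 * T * (2 ^ 30 * T ^ 8) := Nat.mul_le_mul hR hC
  have f2 : reps n * (16 * kap n k + 1) ≤ 192 * T * (2593 * T ^ 2) := by
    refine Nat.mul_le_mul hR ?_
    have : 1 ≤ T ^ 2 := Nat.one_le_pow _ _ hT
    omega
  have f4 : reps n * (2 * b) ≤ 192 * T * (2 * T) := Nat.mul_le_mul hR (Nat.mul_le_mul_left _ hl)
  have f3 : reps n * (2 * b) * kap n k ≤ 192 * T * (2 * T) * (162 * T ^ 2) :=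
    Nat.mul_le_mul f4 hκ
  have f5 : reps n * (6 * kap n k) ≤ 192 * T * (6 * (162 * T ^ 2)) :=
    Nat.mul_le_mul hR (Nat.mul_le_mul_left _ hκ)
  have g1 : 192 * T * (2 ^ 30 * T ^ 8) = 206158430208 * T ^ 9 := by ring
  have g2 : 192 * T * (2593 * T ^ 2) = 497856 * T ^ 3 := by ring
  have g3 : 192 * T * (2 * T) * (162 * T ^ 2) = 62208 * T ^ 4 := by ring
  have g4 : 192 * T * (2 * T) = 384 * T ^ 2 := by ring
  have g5 : 192 * T * (6 * (162 * T ^ 2)) = 186624 * T ^ 3 := by ring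
  have g6 : 1 ≤ T ^ 9 := Nat.one_le_pow _ _ hT
  omega

theorem skLen_le (hkn : k ≤ n) : skLen n k ≤ 2 ^ 49 * (2 ^ Nat.log 2 n) ^ 10 := by
  unfold skLen
  calc _ ≤ 16 * (2 ^ 39 * (2 ^ Nat.log 2 n) ^ 9) * (60 * 2 ^ Nat.log 2 n) :=
        Nat.mul_le_mul (Nat.mul_le_mul_left _ (secLen_le hkn)) (Nat.mul_le_mul_left _ lg_le_two_pow)
    _ = 960 * 2 ^ 39 * (2 ^ Nat.log 2 n) ^ 10 := by ring
    _ ≤ _ := Nat.mul_le_mul_right _ (by norm_num)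

/-- Polynomials in `n` are bounded by powers of `2 ^ lg n`. -/
theorem mul_pow_le_two_pow {a b c : ℕ} (hb : b ≤ a) (h : a ≤ c) :
    2 ^ a * (2 ^ Nat.log 2 n) ^ b ≤ 2 ^ (c * lg n) := by
  rw [← pow_mul, ← pow_add]
  refine Nat.pow_le_pow_right (by norm_num) ?_
  unfold lg
  have h1 : Nat.log 2 n * b ≤ c * Nat.log 2 n := by
    rw [mul_comm]; exact Nat.mul_le_mul_right _ (by omega)
  rw [mul_add]
  omega

theorem lt_two_pow_lg : n < 2 ^ lg n := Nat.lt_pow_succ_log_self (by norm_num) n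

theorem two_pow_lg_le (hn : n ≠ 0) : 2 ^ lg n ≤ 2 * n := by
  unfold lg
  rw [pow_succ, mul_comm]
  exact Nat.mul_le_mul_left _ (Nat.pow_log_le_self 2 hn)

/-- The bound for intermediate results that the decoder computes from `n` by repeated squaring is
large enough. -/
theorem two_pow_le_big (hn : n ≠ 0) : 2 ^ (64 * lg n) ≤ (2 * n) ^ 64 := by
  rw [mul_comm, pow_mul]
  exact Nat.pow_le_pow_left (two_pow_lg_le hn) 64

theorem two_pow_mul_le {a b : ℕ} (h : a ≤ b) : 2 ^ (a * lg n) ≤ 2 ^ (b * lg n) :=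
  Nat.pow_le_pow_right (by norm_num) (Nat.mul_le_mul_right _ h)

theorem coinBase_add_lt (hkn : k ≤ n) : coinBase n + n * bktBits n k < 2 ^ (59 * lg n) := by
  have h1 : coinBase n ≤ 2 ^ lg n * 2 ^ (5 * lg n) * 2 ^ (50 * lg n) := by
    unfold coinBase
    exact Nat.mul_le_mul (Nat.mul_le_mul_right _ lt_two_pow_lg.le) Nat.lt_two_pow_self.le
  have h2 : n * bktBits n k ≤ 2 ^ lg n * 2 ^ (12 * lg n) := by
    refine Nat.mul_le_mul lt_two_pow_lg.le ?_
    refine (Nat.lt_two_pow_self.le.trans (two_pow_bktBits_le hkn)).trans ?_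
    have h3 : 644 * (2 ^ Nat.log 2 n) ^ 2 ≤ 2 ^ 10 * (2 ^ Nat.log 2 n) ^ 2 :=
      Nat.mul_le_mul_right _ (by norm_num)
    exact h3.trans (mul_pow_le_two_pow (by norm_num) (by norm_num))
  have e1 : 2 ^ lg n * 2 ^ (5 * lg n) * 2 ^ (50 * lg n) = 2 ^ (56 * lg n) := by
    rw [← pow_add, ← pow_add]; exact congrArg (2 ^ ·) (by ring)
  have e2 : 2 ^ lg n * 2 ^ (12 * lg n) = 2 ^ (13 * lg n) := by
    rw [← pow_add]; exact congrArg (2 ^ ·) (by ring)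
  have e3 := two_pow_mul_le (n := n) (show 13 ≤ 56 by norm_num)
  have e4 : 2 ^ (56 * lg n) * 2 ^ (3 * lg n) = 2 ^ (59 * lg n) := by
    rw [← pow_add]; exact congrArg (2 ^ ·) (by ring)
  have e5 : 2 ^ 3 ≤ 2 ^ (3 * lg n) := Nat.pow_le_pow_right (by norm_num) (by unfold lg; omega)
  have e6 : 0 < 2 ^ (56 * lg n) := by positivity
  nlinarith

/-- All addresses are small. -/
theorem areaEnd_lt (hkn : k ≤ n) :
    2 * skLen n k + 32 * secLen n k + cellCount n k < 2 ^ (60 * lg n) := by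
  have h1 := skLen_le hkn
  have h2 := secLen_le hkn
  have h3 := cellCount_le hkn
  have h4 : 2 ^ 52 * (2 ^ Nat.log 2 n) ^ 10 ≤ 2 ^ (60 * lg n) :=
    mul_pow_le_two_pow (by norm_num) (by norm_num)
  generalize 2 ^ Nat.log 2 n = T at *
  rcases Nat.eq_zero_or_pos T with rfl | hT
  · have : 0 < 2 ^ (60 * lg n) := by positivity
    simp only [ne_eq, OfNat.ofNat_ne_zero, not_false_eq_true, zero_pow, mul_zero] at h1 h2 h3
    omega
  have e1 : T ^ 9 ≤ T ^ 10 := Nat.pow_le_pow_right hT (by norm_num)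
  have e2 : T ^ 8 ≤ T ^ 10 := Nat.pow_le_pow_right hT (by norm_num)
  have e3 : 1 ≤ T ^ 10 := Nat.one_le_pow _ _ hT
  omega

theorem two_mul_EE_le (hkn : k ≤ n) :
    2 * (6 * kap n k * (6 * kap n k)) + 2 ≤ 2 ^ (30 * lg n) := by
  have h := kap_le hkn
  have h1 : 6 * kap n k * (6 * kap n k) ≤
      6 * (162 * (2 ^ Nat.log 2 n) ^ 2) * (6 * (162 * (2 ^ Nat.log 2 n) ^ 2)) :=
    Nat.mul_le_mul (Nat.mul_le_mul_left _ h) (Nat.mul_le_mul_left _ h)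
  have h2 : 6 * (162 * (2 ^ Nat.log 2 n) ^ 2) * (6 * (162 * (2 ^ Nat.log 2 n) ^ 2)) =
      944784 * (2 ^ Nat.log 2 n) ^ 4 := by ring
  have h3 : 1 ≤ (2 ^ Nat.log 2 n) ^ 4 := Nat.one_le_pow _ _ (by positivity)
  have h4 : 2 ^ 30 * (2 ^ Nat.log 2 n) ^ 4 ≤ 2 ^ (30 * lg n) :=
    mul_pow_le_two_pow (by norm_num) (by norm_num)
  omega

theorem bkt_mul_mod_le (hkn : k ≤ n) : 2 ^ bktBits n k * modCount n ≤ 2 ^ (30 * lg n) := by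
  calc _ ≤ 644 * (2 ^ Nat.log 2 n) ^ 2 * (1160 * (2 ^ Nat.log 2 n) ^ 3) :=
        Nat.mul_le_mul (two_pow_bktBits_le hkn) modCount_le
    _ = 747040 * (2 ^ Nat.log 2 n) ^ 5 := by ring
    _ ≤ 2 ^ 30 * (2 ^ Nat.log 2 n) ^ 5 := Nat.mul_le_mul_right _ (by norm_num)
    _ ≤ _ := mul_pow_le_two_pow (by norm_num) (by norm_num)

theorem modCount_pos : 0 < modCount n := by unfold modCount; omega

/-- All header entries fit into the words of the sketch. -/
theorem par_lt (hkn : k ≤ n) (x : ℕ) : par n k x < 2 ^ (60 * lg n) := by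
  have hA := areaEnd_lt hkn
  have hC := coinBase_add_lt hkn
  have hE := two_mul_EE_le hkn
  have hB := bkt_mul_mod_le hkn
  have hs : secLen n k ≤ 32 * secLen n k := by omega
  have q1 := two_pow_mul_le (n := n) (show 30 ≤ 59 by norm_num)
  have q2 : 2 ^ (59 * lg n) < 2 ^ (60 * lg n) :=
    Nat.pow_lt_pow_right (by norm_num) (by unfold lg; omega)
  have q3 := two_pow_mul_le (n := n) (show 50 ≤ 59 by norm_num)
  have q4 := two_pow_mul_le (n := n) (show 5 ≤ 59 by norm_num)
  have hR : reps n + (16 * kap n k + 1) + 2 * Nat.log 2 n + kap n k + 6 * kap n k ≤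
      2 ^ (59 * lg n) := by
    have h1 := reps_le (n := n)
    have h2 := kap_le hkn
    have h3 := lg_le_two_pow (n := n)
    unfold lg at h3
    have h4 : 2 ^ 30 * (2 ^ Nat.log 2 n) ^ 2 ≤ 2 ^ (59 * lg n) :=
      mul_pow_le_two_pow (by norm_num) (by norm_num)
    have h5 : 2 ^ Nat.log 2 n ≤ (2 ^ Nat.log 2 n) ^ 2 := Nat.le_self_pow (by norm_num) _
    have h6 : 1 ≤ 2 ^ Nat.log 2 n := Nat.one_le_two_pow
    omega
  have hm : modCount n ≤ 2 ^ bktBits n k * modCount n := Nat.le_mul_of_pos_left _ (by positivity)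
  have hb : 2 ^ bktBits n k ≤ 2 ^ bktBits n k * modCount n := Nat.le_mul_of_pos_right _ modCount_pos
  have hb2 : bktBits n k < 2 ^ bktBits n k := Nat.lt_two_pow_self
  have hc : capa n k ≤ kap n k := by unfold kap; omega
  have hF : 50 * lg n < 2 ^ (50 * lg n) := Nat.lt_two_pow_self
  unfold par
  generalize x - 20 = j
  by_cases hj : j < 17
  · interval_cases j <;> simp only [List.getD_cons_zero, List.getD_cons_succ] <;> omega
  · rw [List.getD_eq_default _ _ (by simp; omega)]
    positivity

end Bounds

/-- The threshold for near-periods is `kap n k = capa n k + k`: if the distance for the rotation by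
`0` is at most `capa n k` and that for the rotation by `m` at most `k`, then `m` is a near-period.
-/
theorem design_par {n k : ℕ} (hk : 1 ≤ k) : Design (par n k) n k (kap n k) :=
  ⟨rfl, rfl, rfl, rfl, rfl, by unfold kap; omega⟩

/-- Registers with the header loaded satisfy the relations between the parameters. -/
theorem layout_of_eq {n k : ℕ} (hn : n ≠ 0) (hkn : k ≤ n) {ρ : ℕ → ℕ}
    (hρ : ∀ x, 20 ≤ x → ρ x = par n k x) (h0 : ρ x_n = n) (hbig : ρ x_big = (2 * n) ^ 64)
    (hZ0 : ρ x_Z0 = 2 * skLen n k) (hZ1 : ρ x_Z1 = 2 * skLen n k + 16 * secLen n k) :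
    Layout ρ (secLen n k) := by
  have hB64 := two_pow_le_big hn
  have q1 := two_pow_mul_le (n := n) (show 30 ≤ 64 by norm_num)
  have q2 := two_pow_mul_le (n := n) (show 50 ≤ 64 by norm_num)
  have q3 := two_mul_EE_le hkn
  have q4 := bkt_mul_mod_le hkn
  have p20 : ρ x_R = reps n := hρ _ (by decide)
  have p21 : ρ x_L = 16 * kap n k + 1 := hρ _ (by decide)
  have p22 : ρ x_NG = 2 * Nat.log 2 n := hρ _ (by decide)
  have p23 : ρ x_KC = kap n k := hρ _ (by decide)
  have p24 : ρ x_B = 2 ^ bktBits n k := hρ _ (by decide)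
  have p25 : ρ x_P = modCount n := hρ _ (by decide)
  have p26 : ρ x_E = 6 * kap n k := hρ _ (by decide)
  have p27 : ρ x_E2 = 6 * kap n k * (6 * kap n k) + 1 := hρ _ (by decide)
  have p29 : ρ x_MF = 2 ^ (50 * lg n) := hρ _ (by decide)
  have p30 : ρ x_FW = 50 * lg n := hρ _ (by decide)
  have p31 : ρ x_beta = bktBits n k := hρ _ (by decide)
  have p34 : ρ x_WB = 2 * skLen n k + 32 * secLen n k := hρ _ (by decide)
  have p35 : ρ x_TB = 2 * skLen n k + 32 * secLen n k + cellCount n k := hρ _ (by decide)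
  have p36 : ρ x_NC = cellCount n k := hρ _ (by decide)
  have hpow : n ≤ (2 * n) ^ 64 := (by omega : n ≤ 2 * n).trans (Nat.le_self_pow (by norm_num) _)
  constructor
  · omega
  · rw [h0, hbig]; exact hpow
  · rw [p29, p30]
  · rw [p29, hbig]; omega
  · rw [p24, p31]
  · rw [p25]; exact modCount_pos
  · rw [p21]; omega
  · rw [p24, p25, hbig]; omega
  · rw [p26, hbig]; omega
  · rw [p36, p24, p25]; rfl
  · rw [p27, p26]
  · rw [p20]; unfold secLen; omega
  · rw [p20, p36]; unfold secLen; omega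
  · rw [p20, p21]; unfold secLen; omega
  · rw [p20, p22]; unfold secLen; omega
  · rw [p20, p22, p23]; unfold secLen; omega
  · rw [p20, p26]; unfold secLen; omega
  · rw [hZ0, p34]; omega
  · rw [hZ1, p34]; omega
  · rw [p34, p36, p35]

/-! ### Encoding -/

section Encoding

variable {n : ℕ} [NeZero n]

/-- The entry `j` of section `s` of the sketch with the data `D`: header, fingerprints, masks,
generators, their breaks (positions, old and new characters), subgroups, and exceptions (positions,
characters of the string and of the template). Within a section the repetitions follow each other.
-/
def secEntry (ω : Coins) (k : ℕ) (D : ℕ → Rep n) (s j : ℕ) : ℕ :=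
  let NC := cellCount n k
  let P := modCount n
  let L := 16 * kap n k + 1
  let NG := 2 * Nat.log 2 n
  let K := kap n k
  let E := 6 * kap n k
  match s with
  | 0 => par n k (20 + j)
  | 1 => coinCell ω (par n k) (D (j / NC)).str (j % NC / P / P) (j % NC / P % P) (j % NC % P)
  | 2 => (D (j / L)).mask (j % L)
  | 3 => ((D (j / NG)).gen (j % NG)).val
  | 4 => ((D (j / K / NG)).bpos (j / K % NG) (j % K)).val
  | 5 => (D (j / K / NG)).bold (j / K % NG) (j % K)
  | 6 => (D (j / K / NG)).bnew (j / K % NG) (j % K)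
  | 7 => (D j).d
  | 8 => ((D (j / E)).pos (j % E)).val
  | 9 => (D (j / E)).val (j % E)
  | 10 => (D (j / E)).tm (j % E)
  | _ => 0

/-- The words of the sketch: the sections are interleaved. -/
def sketchWord (ω : Coins) (k : ℕ) (D : ℕ → Rep n) (o : ℕ) : ℕ :=
  secEntry ω k D (o % 16) (o / 16)

/-- The binary digits of `N` words of `W` bits, the most significant ones first. -/
def toBits (W N : ℕ) (f : ℕ → ℕ) : List Bool :=
  (List.range (N * W)).map fun i => (f (i / W)).testBit (W - 1 - i % W)

/-- The sketch with the data `D`. -/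
def encode (ω : Coins) (k : ℕ) (D : ℕ → Rep n) : List Bool :=
  toBits (60 * lg n) (16 * secLen n k) (sketchWord ω k D)

theorem length_encode (ω : Coins) (k : ℕ) (D : ℕ → Rep n) :
    (encode ω k D).length = skLen n k := by
  simp [encode, toBits, skLen]

theorem mul_add_div_of_lt {a b N : ℕ} (h : b < N) : (a * N + b) / N = a := by
  rw [mul_comm, Nat.mul_add_div (by omega), Nat.div_eq_of_lt h, add_zero]

theorem mul_add_mod_of_lt {a b N : ℕ} (h : b < N) : (a * N + b) % N = b := by
  rw [mul_comm, Nat.mul_add_mod, Nat.mod_eq_of_lt h]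

/-- All entries fit into the words of the sketch. -/
theorem secEntry_lt {ω : Coins} {k : ℕ} (hkn : k ≤ n) {D : ℕ → Rep n}
    (hD : ∀ τ, (D τ).Small (2 ^ (5 * lg n))) (s j : ℕ) : secEntry ω k D s j < 2 ^ (60 * lg n) := by
  have h5 := two_pow_mul_le (n := n) (show 5 ≤ 60 by norm_num)
  have h50 := two_pow_mul_le (n := n) (show 50 ≤ 60 by norm_num)
  have h2 := two_pow_mul_le (n := n) (show 2 ≤ 60 by norm_num)
  have h1 := two_pow_mul_le (n := n) (show 1 ≤ 60 by norm_num)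
  have hn := lt_two_pow_lg (n := n)
  rw [one_mul] at h1
  have hval : ∀ x : ZMod n, x.val < 2 ^ (60 * lg n) := fun x => by
    have := x.val_lt; omega
  unfold secEntry
  split
  · exact par_lt hkn _
  · exact (Nat.mod_lt _ (by positivity)).trans_le h50
  · refine ((hD _).mask _).trans_le (le_trans ?_ h2)
    exact Nat.pow_le_pow_right (by norm_num) (by unfold lg; omega)
  · exact hval _
  · exact hval _
  · exact ((hD _).bold _ _).trans_le h5
  · exact ((hD _).bnew _ _).trans_le h5
  · exact (hD j).d.trans_lt (hn.trans_le h1)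
  · exact hval _
  · exact ((hD _).val _).trans_le h5
  · exact ((hD _).tm _).trans_le h5
  · positivity

/-- Memory that holds the words of a sketch holds the data of all repetitions. -/
theorem stored_of_sketchWord {ω : Coins} {k : ℕ} {D : ℕ → Rep n} {μ ρ : ℕ → ℕ} {z : ℕ}
    (hρ : ∀ x, 20 ≤ x → ρ x = par n k x) (h : ∀ o < 16 * secLen n k, μ (z + o) = sketchWord ω k D o)
    {τ : ℕ} (hτ : τ < ρ x_R) : (D τ).Stored ω ρ μ z τ := by
  have p20 : ρ x_R = reps n := hρ _ (by decide)
  have p21 : ρ x_L = 16 * kap n k + 1 := hρ _ (by decide)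
  have p22 : ρ x_NG = 2 * Nat.log 2 n := hρ _ (by decide)
  have p23 : ρ x_KC = kap n k := hρ _ (by decide)
  have p24 : ρ x_B = 2 ^ bktBits n k := hρ _ (by decide)
  have p25 : ρ x_P = modCount n := hρ _ (by decide)
  have p26 : ρ x_E = 6 * kap n k := hρ _ (by decide)
  have p36 : ρ x_NC = cellCount n k := hρ _ (by decide)
  have hs : ∀ s < 16, ∀ j < secLen n k, sec μ z s j = secEntry ω k D s j := by
    intro s hs j hj
    rw [sec, h _ (by omega), sketchWord]
    congr 1 <;> omega
  rw [p20] at hτ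
  have l1 : ∀ N, reps n * N ≤ secLen n k → ∀ c < N, τ * N + c < secLen n k := fun N hN c hc =>
    mul_add_lt_of_lt hτ hc hN
  have b1 : reps n * cellCount n k ≤ secLen n k := by unfold secLen; omega
  have b2 : reps n * (16 * kap n k + 1) ≤ secLen n k := by unfold secLen; omega
  have b3 : reps n * (2 * Nat.log 2 n) ≤ secLen n k := by unfold secLen; omega
  have b4 : reps n * (2 * Nat.log 2 n) * kap n k ≤ secLen n k := by unfold secLen; omega
  have b5 : reps n * (6 * kap n k) ≤ secLen n k := by unfold secLen; omega
  have b6 : reps n ≤ secLen n k := by unfold secLen; omega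
  have l4 : ∀ g < 2 * Nat.log 2 n, ∀ q < kap n k,
      (τ * (2 * Nat.log 2 n) + g) * kap n k + q < secLen n k := fun g hg q hq =>
    mul_add_lt_of_lt (mul_add_lt_of_lt hτ hg le_rfl) hq b4
  constructor
  · intro b p s hb hp hs'
    rw [p24] at hb
    rw [p25] at hp hs' ⊢
    rw [p36]
    have hc : cidx (modCount n) b p s < cellCount n k := cidx_lt hb hp hs'
    rw [hs 1 (by norm_num) _ (l1 _ b1 _ hc)]
    simp only [secEntry, mul_add_div_of_lt hc, mul_add_mod_of_lt hc]
    unfold cidx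
    rw [mul_add_div_of_lt hs', mul_add_mod_of_lt hs', mul_add_div_of_lt hp, mul_add_mod_of_lt hp]
    have f30 : ρ x_FW = par n k x_FW := hρ _ (by decide)
    have f31 : ρ x_beta = par n k x_beta := hρ _ (by decide)
    have f32 : ρ x_VV = par n k x_VV := hρ _ (by decide)
    have f33 : ρ x_CB = par n k x_CB := hρ _ (by decide)
    simp only [coinCell, f30, f31, f32, f33]
  · intro e he
    rw [p21] at he ⊢
    rw [hs 2 (by norm_num) _ (l1 _ b2 _ he)]
    simp only [secEntry, mul_add_div_of_lt he, mul_add_mod_of_lt he]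
  · intro g hg
    rw [p22] at hg ⊢
    rw [hs 3 (by norm_num) _ (l1 _ b3 _ hg)]
    simp only [secEntry, mul_add_div_of_lt hg, mul_add_mod_of_lt hg]
  · intro g hg q hq
    rw [p22] at hg ⊢
    rw [p23] at hq ⊢
    rw [hs 4 (by norm_num) _ (l4 g hg q hq)]
    simp only [secEntry, mul_add_div_of_lt hq, mul_add_mod_of_lt hq, mul_add_div_of_lt hg,
      mul_add_mod_of_lt hg]
  · intro g hg q hq
    rw [p22] at hg ⊢
    rw [p23] at hq ⊢
    rw [hs 5 (by norm_num) _ (l4 g hg q hq)]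
    simp only [secEntry, mul_add_div_of_lt hq, mul_add_mod_of_lt hq, mul_add_div_of_lt hg,
      mul_add_mod_of_lt hg]
  · intro g hg q hq
    rw [p22] at hg ⊢
    rw [p23] at hq ⊢
    rw [hs 6 (by norm_num) _ (l4 g hg q hq)]
    simp only [secEntry, mul_add_div_of_lt hq, mul_add_mod_of_lt hq, mul_add_div_of_lt hg,
      mul_add_mod_of_lt hg]
  · rw [hs 7 (by norm_num) _ (hτ.trans_le b6)]
    rfl
  · intro x hx
    rw [p26] at hx ⊢
    rw [hs 8 (by norm_num) _ (l1 _ b5 _ hx)]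
    simp only [secEntry, mul_add_div_of_lt hx, mul_add_mod_of_lt hx]
  · intro x hx
    rw [p26] at hx ⊢
    rw [hs 9 (by norm_num) _ (l1 _ b5 _ hx)]
    simp only [secEntry, mul_add_div_of_lt hx, mul_add_mod_of_lt hx]
  · intro x hx
    rw [p26] at hx ⊢
    rw [hs 10 (by norm_num) _ (l1 _ b5 _ hx)]
    simp only [secEntry, mul_add_div_of_lt hx, mul_add_mod_of_lt hx]

/-- The bits of a sketch are the digits of its words. -/
theorem getD_toBits {W N : ℕ} {f : ℕ → ℕ} {j t : ℕ} (hj : j < N) (ht : t < W) :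
    (toBits W N f).getD (j * W + t) false = (f j).testBit (W - 1 - t) := by
  have h : j * W + t < N * W := mul_add_lt_of_lt hj ht le_rfl
  rw [List.getD_eq_getElem _ _ (by simpa [toBits] using h)]
  simp [toBits, mul_add_div_of_lt ht, mul_add_mod_of_lt ht]

/-- The state after the first part of the decoding program. -/
def preludeRun (ω : Coins) (s : State) : State :=
  codeHeader.run ω (codeUnpack.run ω (codeInit.run ω (codeLog.run ω s)))

/-- After the first part of the decoding program the header is in the registers, the words of the
two sketches are in memory behind their bits, and the rest of the memory is zero. -/
theorem preludeRun_spec (ω ω' : Coins) {k w : ℕ} (hkn : k ≤ n) (hw : 60 * lg n ≤ w) {D₁ D₂ : ℕ → Rep n}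
    (hD₁ : ∀ τ, (D₁ τ).Small (2 ^ (5 * lg n))) (hD₂ : ∀ τ, (D₂ τ).Small (2 ^ (5 * lg n))) :
    let s := preludeRun ω (initState w n k (encode ω' k D₁) (encode ω' k D₂))
    let Z := 2 * skLen n k
    s.reg x_n = n ∧ s.reg x_big = (2 * n) ^ 64 ∧ s.reg x_Z0 = Z ∧
      s.reg x_Z1 = Z + 16 * secLen n k ∧ (∀ j < 17, s.reg (20 + j) = par n k (20 + j)) ∧
      s.reg x_best = k + 1 ∧ (∀ o < 16 * secLen n k, s.mem (Z + o) = sketchWord ω' k D₁ o) ∧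
      (∀ o < 16 * secLen n k, s.mem (Z + 16 * secLen n k + o) = sketchWord ω' k D₂ o) ∧
      (∀ a, Z + 32 * secLen n k ≤ a → s.mem a = 0) ∧ s.reg x_W = 60 * lg n ∧
      s.reg x_NW = 32 * secLen n k := by
  have hn0 : n ≠ 0 := NeZero.ne n
  have hlg : 0 < lg n := by unfold lg; omega
  have hJ : 17 ≤ secLen n k := by unfold secLen; omega
  have hkw : n < 2 ^ w := by
    refine (lt_two_pow_lg (n := n)).trans_le (Nat.pow_le_pow_right (by norm_num) ?_)
    omega
  have hskw : skLen n k < 2 ^ w := by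
    refine lt_of_lt_of_le ?_ (Nat.pow_le_pow_right (by norm_num) hw)
    have := areaEnd_lt hkn
    omega
  have h1w : 1 < 2 ^ w := by
    have : 2 ^ 1 ≤ 2 ^ w := Nat.pow_le_pow_right (by norm_num) (by omega)
    omega
  set s0 := initState w n k (encode ω' k D₁) (encode ω' k D₂) with hs0
  set f : ℕ → Bool := fun i => (encode ω' k D₁ ++ encode ω' k D₂).getD i false with hf
  have i0 : s0.reg x_n = n := by simp [hs0, initState, Nat.mod_eq_of_lt hkw]
  have i1 : s0.reg x_k = k := by
    simp [hs0, initState, Nat.mod_eq_of_lt (lt_of_le_of_lt hkn hkw)]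
  have i2 : s0.reg x_len1 = skLen n k := by
    simp [hs0, initState, length_encode, Nat.mod_eq_of_lt hskw]
  have i3 : s0.reg x_len2 = skLen n k := by
    simp [hs0, initState, length_encode, Nat.mod_eq_of_lt hskw]
  have i4 : s0.reg x_lg = 0 := by simp [hs0, initState]
  have im : ∀ a, s0.mem a = (f a).toNat := by
    intro a
    change (f a).toNat % 2 ^ w = _
    exact Nat.mod_eq_of_lt ((Bool.toNat_lt _).trans_le h1w)
  have hlog : Nat.log 2 n < skLen n k := by
    have : lg n ≤ skLen n k := by
      unfold skLen
      exact (by omega : lg n ≤ 60 * lg n).trans (Nat.le_mul_of_pos_left _ (by omega))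
    unfold lg at this
    omega
  clear_value s0
  -- the word length
  obtain ⟨m1, l1⟩ := codeLog_run ω i0 hn0 i4 (by rw [i2]; exact hlog)
  have j0 : (codeLog.run ω s0).reg x_n = n := by rw [St.run_frame ω (by decide), i0]
  have j1 : (codeLog.run ω s0).reg x_k = k := by rw [St.run_frame ω (by decide), i1]
  have j2 : (codeLog.run ω s0).reg x_len1 = skLen n k := by rw [St.run_frame ω (by decide), i2]
  have j3 : (codeLog.run ω s0).reg x_len2 = skLen n k := by rw [St.run_frame ω (by decide), i3]
  set s1 := codeLog.run ω s0 with hs1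
  clear_value s1
  obtain ⟨m2, a1, a2, a3, a4, a5⟩ := codeInit_run ω j0 (l := lg n) l1 j2 j3
  have k0 : (codeInit.run ω s1).reg x_n = n := by rw [St.run_frame ω (by decide), j0]
  have k1 : (codeInit.run ω s1).reg x_k = k := by rw [St.run_frame ω (by decide), j1]
  set s2 := codeInit.run ω s1 with hs2
  clear_value s2
  have hdiv : skLen n k / (60 * lg n) = 16 * secLen n k := by
    unfold skLen; exact Nat.mul_div_cancel _ (by omega)
  have hdiv2 : 2 * skLen n k / (60 * lg n) = 32 * secLen n k := by
    have : 2 * skLen n k = 32 * secLen n k * (60 * lg n) := by unfold skLen; ring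
    rw [this]; exact Nat.mul_div_cancel _ (by omega)
  rw [hdiv2] at a4
  rw [hdiv] at a5
  -- unpacking
  obtain ⟨u1, u2⟩ := codeUnpack_run ω (f := f) a3 a1 a4 (by unfold skLen; ring)
    (by
      rw [a2]
      have := two_pow_le_big hn0
      have := two_pow_mul_le (n := n) (show 60 ≤ 64 by norm_num)
      omega)
    (fun a _ => by rw [m2, m1, im])
  have n0 : (codeUnpack.run ω s2).reg x_n = n := by rw [St.run_frame ω (by decide), k0]
  have n1 : (codeUnpack.run ω s2).reg x_k = k := by rw [St.run_frame ω (by decide), k1]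
  have n2 : (codeUnpack.run ω s2).reg x_big = (2 * n) ^ 64 := by
    rw [St.run_frame ω (by decide), a2]
  have n3 : (codeUnpack.run ω s2).reg x_Z0 = 2 * skLen n k := by
    rw [St.run_frame ω (by decide), a3]
  have n4 : (codeUnpack.run ω s2).reg x_Z1 = 2 * skLen n k + 16 * secLen n k := by
    rw [St.run_frame ω (by decide), a5]
  have n5 : (codeUnpack.run ω s2).reg x_W = 60 * lg n := by rw [St.run_frame ω (by decide), a1]
  have n6 : (codeUnpack.run ω s2).reg x_NW = 32 * secLen n k := by
    rw [St.run_frame ω (by decide), a4]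
  set s3 := codeUnpack.run ω s2 with hs3
  clear_value s3
  have hword : ∀ (D : ℕ → Rep n), (∀ τ, (D τ).Small (2 ^ (5 * lg n))) → ∀ o < 16 * secLen n k,
      bitsVal (fun t => (encode ω' k D).getD (o * (60 * lg n) + t) false) (60 * lg n) =
        sketchWord ω' k D o := by
    intro D hD o ho
    unfold encode
    rw [bitsVal_congr (g := fun t => (sketchWord ω' k D o).testBit (60 * lg n - 1 - t)) fun t ht =>
      getD_toBits ho ht, bitsVal_testBit]
    exact Nat.mod_eq_of_lt (secEntry_lt hkn hD _ _)
  have w1 : ∀ o < 16 * secLen n k, s3.mem (2 * skLen n k + o) = sketchWord ω' k D₁ o := by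
    intro o ho
    rw [u2 o (by omega), ← hword D₁ hD₁ o ho]
    refine bitsVal_congr fun t ht => ?_
    simp only [hf]
    refine List.getD_append _ _ _ _ ?_
    rw [length_encode]
    exact mul_add_lt_of_lt ho ht le_rfl
  have w2 : ∀ o < 16 * secLen n k, s3.mem (2 * skLen n k + 16 * secLen n k + o) =
      sketchWord ω' k D₂ o := by
    intro o ho
    rw [add_assoc, u2 _ (by omega), ← hword D₂ hD₂ o ho]
    refine bitsVal_congr fun t ht => ?_
    simp only [hf]
    have e : (16 * secLen n k + o) * (60 * lg n) + t = skLen n k + (o * (60 * lg n) + t) := by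
      unfold skLen; ring
    rw [e, List.getD_append_right _ _ _ _ (by rw [length_encode]; omega), length_encode,
      Nat.add_sub_cancel_left]
  obtain ⟨h1, h2, h3, h4⟩ := codeHeader_run ω (u := s3)
  refine ⟨?_, ?_, ?_, ?_, ?_, ?_, ?_, ?_, ?_, ?_, ?_⟩
  · rw [preludeRun, ← hs1, ← hs2, ← hs3, h2 _ (by decide), n0]
  · rw [preludeRun, ← hs1, ← hs2, ← hs3, h2 _ (by decide), n2]
  · rw [preludeRun, ← hs1, ← hs2, ← hs3, h2 _ (by decide), n3]
  · rw [preludeRun, ← hs1, ← hs2, ← hs3, h2 _ (by decide), n4]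
  · intro j hj
    rw [preludeRun, ← hs1, ← hs2, ← hs3, h3 j hj, n3, sec, w1 _ (by omega), sketchWord]
    have e1 : (16 * j + 0) % 16 = 0 := by omega
    have e2 : (16 * j + 0) / 16 = j := by omega
    rw [e1, e2]
    rfl
  · rw [preludeRun, ← hs1, ← hs2, ← hs3, h4, n1]
  · rw [preludeRun, ← hs1, ← hs2, ← hs3, h1]; exact w1
  · rw [preludeRun, ← hs1, ← hs2, ← hs3, h1]; exact w2
  · intro a ha
    rw [preludeRun, ← hs1, ← hs2, ← hs3, h1, u1 a (by omega), m2, m1, im]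
    simp only [hf]
    rw [List.getD_eq_default]
    · rfl
    · rw [List.length_append, length_encode, length_encode]
      omega
  · rw [preludeRun, ← hs1, ← hs2, ← hs3, h2 _ (by decide), n5]
  · rw [preludeRun, ← hs1, ← hs2, ← hs3, h2 _ (by decide), n6]

/-- The output of the decoding program, in terms of the data in the sketches. -/
theorem le_decode_iff (ω : Coins) {k w : ℕ} (hkn : k ≤ n) (hw : 60 * lg n ≤ w)
    {D₁ D₂ : ℕ → Rep n} (hD₁ : ∀ τ, (D₁ τ).Small (2 ^ (5 * lg n)))
    (hD₂ : ∀ τ, (D₂ τ).Small (2 ^ (5 * lg n))) (hv : ∀ τ, (D₂ τ).Valid (kap n k)) (z : ℕ) :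
    z ≤ (codeOut.run ω (codeMain.run ω (preludeRun ω
        (initState w n k (encode ω k D₁) (encode ω k D₂))))).reg x_n ↔
      z ≤ k + 1 ∧ ∀ τ < reps n, repBound ω (par n k) (D₁ τ) (D₂ τ) z := by
  obtain ⟨h1, h2, h3, h4, h5, h6, h7, h8, h9, -, -⟩ := preludeRun_spec ω ω hkn hw hD₁ hD₂
  set s := preludeRun ω (initState w n k (encode ω k D₁) (encode ω k D₂))
  clear_value s
  let ρ : ℕ → ℕ := fun x => if 20 ≤ x then par n k x else s.reg x
  have hρ : ∀ x, 20 ≤ x → ρ x = par n k x := fun x hx => if_pos hx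
  have hL : Layout ρ (secLen n k) := layout_of_eq (NeZero.ne n) hkn hρ h1 h2 h3 h4
  have hc : Ctx ρ s.mem s := by
    refine ⟨fun x hx => ?_, fun _ _ => rfl⟩
    by_cases hx' : 20 ≤ x
    · rw [hρ x hx']
      have := h5 (x - 20) (by omega)
      rwa [Nat.add_sub_cancel' hx'] at this
    · exact (if_neg hx').symm
  have hz0 : ρ x_Z0 = 2 * skLen n k := h3
  have hz1 : ρ x_Z1 = 2 * skLen n k + 16 * secLen n k := h4
  have key := codeMain_run hL (n := n) h1 ω hc (D₁ := D₁) (D₂ := D₂)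
    (fun τ hτ => stored_of_sketchWord hρ (by rw [hz0]; exact h7) hτ)
    (fun τ hτ => stored_of_sketchWord hρ (by rw [hz1]; exact h8) hτ)
    (fun τ _ => (hv τ).breaks)
    (fun a ha => h9 a (le_trans (Nat.le_add_right _ _) ha)) z
  rw [h6] at key
  exact key

end Encoding

/-! ### Running time -/

/-- The registers that hold the loop bounds of a statement. -/
def St.bounds : St → List ℕ
  | assign _ _ => []
  | store _ _ => []
  | seq p q => p.bounds ++ q.bounds
  | ite _ p q => p.bounds ++ q.bounds
  | loop _ N p => N :: p.bounds

/-- If each loop bound `N` is at most `c N * (k ^ (a N) * l ^ (b N))`, then a triple `(C, A, B)`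
such that the running time is at most `C * (k ^ A * l ^ B)`. -/
def St.polyCost (c a b : ℕ → ℕ) : St → ℕ × ℕ × ℕ
  | assign _ e => (e.cost + 1, 0, 0)
  | store a' e => (a'.cost + e.cost + 1, 0, 0)
  | seq p q => ((p.polyCost c a b).1 + (q.polyCost c a b).1,
      max (p.polyCost c a b).2.1 (q.polyCost c a b).2.1,
      max (p.polyCost c a b).2.2 (q.polyCost c a b).2.2)
  | ite e p q => (e.cost + 1 + ((p.polyCost c a b).1 + (q.polyCost c a b).1),
      max (p.polyCost c a b).2.1 (q.polyCost c a b).2.1,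
      max (p.polyCost c a b).2.2 (q.polyCost c a b).2.2)
  | loop _ N p => (c N * ((p.polyCost c a b).1 + 4) + 3, a N + (p.polyCost c a b).2.1,
      b N + (p.polyCost c a b).2.2)

theorem mono_le {k l A B A' B' : ℕ} (hk : 1 ≤ k) (hl : 1 ≤ l) (hA : A ≤ A') (hB : B ≤ B') :
    k ^ A * l ^ B ≤ k ^ A' * l ^ B' :=
  Nat.mul_le_mul (Nat.pow_le_pow_right hk hA) (Nat.pow_le_pow_right hl hB)

/-- The triple computed by `St.polyCost` bounds the running time, if every register that serves as a
loop bound obeys its bound. -/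
theorem St.cost_le {ρ c a b : ℕ → ℕ} {k l : ℕ} (hk : 1 ≤ k) (hl : 1 ≤ l) : ∀ {p : St},
    (∀ N ∈ p.bounds, ρ N ≤ c N * (k ^ a N * l ^ b N)) → p.cost ρ ≤ (p.polyCost c a b).1 *
      (k ^ (p.polyCost c a b).2.1 * l ^ (p.polyCost c a b).2.2) := by
  intro p
  induction p with
  | assign x e => intro _; simp [St.cost, St.polyCost]
  | store a' e => intro _; simp [St.cost, St.polyCost]
  | seq p q ihp ihq =>
    intro h
    simp only [St.bounds, List.mem_append] at h
    simp only [St.cost, St.polyCost, add_mul]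
    exact add_le_add
      ((ihp fun N hN => h N (Or.inl hN)).trans (Nat.mul_le_mul_left _
        (mono_le hk hl (le_max_left _ _) (le_max_left _ _))))
      ((ihq fun N hN => h N (Or.inr hN)).trans (Nat.mul_le_mul_left _
        (mono_le hk hl (le_max_right _ _) (le_max_right _ _))))
  | ite e p q ihp ihq =>
    intro h
    simp only [St.bounds, List.mem_append] at h
    simp only [St.cost, St.polyCost, add_mul]
    refine add_le_add ?_ (add_le_add
      ((ihp fun N hN => h N (Or.inl hN)).trans (Nat.mul_le_mul_left _
        (mono_le hk hl (le_max_left _ _) (le_max_left _ _))))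
      ((ihq fun N hN => h N (Or.inr hN)).trans (Nat.mul_le_mul_left _
        (mono_le hk hl (le_max_right _ _) (le_max_right _ _)))))
    rw [← add_mul]
    exact Nat.le_mul_of_pos_right _ (by positivity)
  | loop x N p ih =>
    intro h
    simp only [St.bounds, List.mem_cons, forall_eq_or_imp] at h
    simp only [St.cost, St.polyCost]
    have h1 := ih h.2
    set K := (p.polyCost c a b).1
    set A := (p.polyCost c a b).2.1
    set B := (p.polyCost c a b).2.2
    have h2 : 1 ≤ k ^ A * l ^ B := Nat.mul_pos (by positivity) (by positivity)
    have h3 : 1 ≤ k ^ (a N + A) * l ^ (b N + B) := Nat.mul_pos (by positivity) (by positivity)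
    have h4 : p.cost ρ + 4 ≤ (K + 4) * (k ^ A * l ^ B) := by rw [add_mul]; omega
    have h5 : ρ N * (p.cost ρ + 4) ≤
        c N * (k ^ a N * l ^ b N) * ((K + 4) * (k ^ A * l ^ B)) := Nat.mul_le_mul h.1 h4
    have h6 : c N * (k ^ a N * l ^ b N) * ((K + 4) * (k ^ A * l ^ B)) =
        c N * (K + 4) * (k ^ (a N + A) * l ^ (b N + B)) := by ring
    rw [add_mul]
    omega

section

variable {n k : ℕ}

theorem lg_pos : 1 ≤ lg n := by unfold lg; omega

theorem capa_le_mul (hk : 1 ≤ k) : capa n k ≤ 160 * (k * lg n) := by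
  unfold capa
  have := Nat.pow_log_le_self 2 (x := k) (by omega)
  calc 10 * lg n * 2 ^ (Nat.log 2 k + 4) = 160 * (2 ^ Nat.log 2 k * lg n) := by ring
    _ ≤ _ := Nat.mul_le_mul_left _ (Nat.mul_le_mul_right _ this)

theorem kap_le_mul (hk : 1 ≤ k) : kap n k ≤ 161 * (k * lg n) := by
  unfold kap
  have h1 := capa_le_mul (n := n) hk
  have h2 : k ≤ k * lg n := Nat.le_mul_of_pos_right _ lg_pos
  omega

theorem reps_le_mul : reps n ≤ 192 * lg n := by
  unfold reps; have := lg_pos (n := n); omega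

theorem modCount_le_mul : modCount n ≤ 1160 * lg n ^ 3 := by
  unfold modCount
  have h1 : 1 ≤ lg n ^ 3 := Nat.one_le_pow _ _ lg_pos
  calc 2 * (lg n * (24 * lg n) ^ 2 + 4) = 1152 * lg n ^ 3 + 8 := by ring
    _ ≤ _ := by omega

theorem two_pow_bktBits_le_mul (hk : 1 ≤ k) : 2 ^ bktBits n k ≤ 644 * (k * lg n) := by
  unfold bktBits
  rw [pow_add]
  have h := Nat.pow_log_le_self 2 (x := capa n k + 1) (by omega)
  have h1 := capa_le_mul (n := n) hk
  have h2 : 1 ≤ k * lg n := Nat.mul_pos hk lg_pos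
  omega

theorem bktBits_le_mul (hkn : k ≤ n) : bktBits n k ≤ 12 * lg n := by
  have h := two_pow_bktBits_le hkn
  have h1 : 644 * (2 ^ Nat.log 2 n) ^ 2 ≤ 2 ^ 10 * (2 ^ Nat.log 2 n) ^ 2 :=
    Nat.mul_le_mul_right _ (by norm_num)
  have h2 := mul_pow_le_two_pow (n := n) (show 2 ≤ 10 by norm_num) (show 10 ≤ 12 by norm_num)
  exact (Nat.pow_le_pow_iff_right (by norm_num : 1 < 2)).1 (h.trans (h1.trans h2))

theorem cellCount_le_mul (hk : 1 ≤ k) : cellCount n k ≤ 866566400 * (k * lg n ^ 7) := by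
  unfold cellCount
  calc _ ≤ 644 * (k * lg n) * (1160 * lg n ^ 3) * (1160 * lg n ^ 3) :=
        Nat.mul_le_mul (Nat.mul_le_mul (two_pow_bktBits_le_mul hk) modCount_le_mul) modCount_le_mul
    _ = _ := by ring

theorem secLen_le_mul (hk : 1 ≤ k) : secLen n k ≤ 2 ^ 39 * (k * lg n ^ 8) := by
  have hR := reps_le_mul (n := n)
  have hκ := kap_le_mul (n := n) hk
  have hC := cellCount_le_mul (n := n) hk
  have hl : Nat.log 2 n ≤ lg n := by unfold lg; omega
  have hl1 := lg_pos (n := n)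
  unfold secLen
  generalize lg n = l at *
  generalize Nat.log 2 n = b at *
  have e1 : l ≤ k * l ^ 8 :=
    (Nat.le_self_pow (by norm_num) _).trans (Nat.le_mul_of_pos_left _ hk)
  have e2 : k * l ^ 2 ≤ k * l ^ 8 :=
    Nat.mul_le_mul_left _ (Nat.pow_le_pow_right hl1 (by norm_num))
  have e3 : k * l ^ 3 ≤ k * l ^ 8 :=
    Nat.mul_le_mul_left _ (Nat.pow_le_pow_right hl1 (by norm_num))
  have e4 : l ^ 2 ≤ k * l ^ 8 :=
    (Nat.pow_le_pow_right hl1 (by norm_num)).trans (Nat.le_mul_of_pos_left _ hk)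
  have e5 : 1 ≤ k * l ^ 8 := Nat.mul_pos hk (by positivity)
  have f1 : reps n * cellCount n k ≤ 192 * l * (866566400 * (k * l ^ 7)) := Nat.mul_le_mul hR hC
  have f2 : reps n * (16 * kap n k + 1) ≤ 192 * l * (2577 * (k * l)) := by
    refine Nat.mul_le_mul hR ?_
    have : 1 ≤ k * l := Nat.mul_pos hk hl1
    omega
  have f4 : reps n * (2 * b) ≤ 192 * l * (2 * l) := Nat.mul_le_mul hR (Nat.mul_le_mul_left _ hl)
  have f3 : reps n * (2 * b) * kap n k ≤ 192 * l * (2 * l) * (161 * (k * l)) :=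
    Nat.mul_le_mul f4 hκ
  have f5 : reps n * (6 * kap n k) ≤ 192 * l * (6 * (161 * (k * l))) :=
    Nat.mul_le_mul hR (Nat.mul_le_mul_left _ hκ)
  have g1 : 192 * l * (866566400 * (k * l ^ 7)) = 166380748800 * (k * l ^ 8) := by ring
  have g2 : 192 * l * (2577 * (k * l)) = 494784 * (k * l ^ 2) := by ring
  have g3 : 192 * l * (2 * l) * (161 * (k * l)) = 61824 * (k * l ^ 3) := by ring
  have g4 : 192 * l * (2 * l) = 384 * l ^ 2 := by ring
  have g5 : 192 * l * (6 * (161 * (k * l))) = 185472 * (k * l ^ 2) := by ring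
  omega

theorem skLen_le_mul (hk : 1 ≤ k) : skLen n k ≤ 2 ^ 49 * (k * lg n ^ 9) := by
  unfold skLen
  calc _ ≤ 16 * (2 ^ 39 * (k * lg n ^ 8)) * (60 * lg n) :=
        Nat.mul_le_mul_right _ (Nat.mul_le_mul_left _ (secLen_le_mul hk))
    _ = 960 * 2 ^ 39 * (k * lg n ^ 9) := by ring
    _ ≤ _ := Nat.mul_le_mul_right _ (by norm_num)

end

/-- The loop bounds are at most `2 ^ 49` times these powers of `k` and of `lg n`: first the exponent
of `k`. -/
def boundK (x : ℕ) : ℕ :=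
  if x = x_R ∨ x = x_NG ∨ x = x_P ∨ x = x_FW ∨ x = x_beta ∨ x = x_W then 0
  else if x = x_E2 then 2 else 1

/-- The exponent of `lg n` in the bound for a loop bound. -/
def boundL (x : ℕ) : ℕ :=
  if x = x_len1 then 9 else if x = x_NW then 8 else if x = x_NC then 7
  else if x = x_P then 3 else if x = x_E2 then 2 else 1

/-- The decoding program. -/
def decoder : Prog :=
  .seq codeLog.compile (.seq codeInit.compile (.seq codeUnpack.compile (.seq codeHeader.compile
    (.seq codeMain.compile codeOut.compile))))

/-- The constant factor in the bounds for size and time. -/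
def costConst : ℕ :=
  let f := fun p : St => (p.polyCost (fun _ => 2 ^ 49) boundK boundL).1
  2 ^ 49 + (f codeLog + (f codeInit + (f codeUnpack + (f codeHeader + (f codeMain + f codeOut)))))

/-- The time is at most quadratic in `k`, as at most two loops with bounds of order `k` are nested.
-/
theorem polyCost_exponents : ∀ p ∈ [codeLog, codeInit, codeUnpack, codeHeader, codeMain, codeOut],
    (p.polyCost (fun _ => 2 ^ 49) boundK boundL).2.1 ≤ 2 ∧
    (p.polyCost (fun _ => 2 ^ 49) boundK boundL).2.2 ≤ 9 := by decide +kernel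

/-- The values left by the first part obey the degrees of the main part. -/
theorem degInit_le_degMain (x : ℕ) : degInit x ≤ degMain x := by
  by_cases h : x < 67
  · have : ∀ x < 67, degInit x ≤ degMain x := by decide +kernel
    exact this x h
  · unfold degInit degMain
    split_ifs <;> omega

/-- The result of the decoding program on `w`-bit words. -/
def decode (ω : Coins) (n k w : ℕ) (x y : List Bool) : ℕ :=
  (codeOut.run ω (codeMain.run ω (preludeRun ω (initState w n k x y)))).reg x_n

/-- The decoding program on a RAM with words of `4000 * lg n` bits, for sketches of two strings: the
static checks give correctness, and the loop bounds in the header give the running time. -/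
theorem exec_decoder {n : ℕ} [NeZero n] {k : ℕ} (hk : 1 ≤ k) (hkn : k ≤ n) {ω ω' ω'' : Coins}
    (hω : ∀ i < 2 ^ (4000 * lg n), ω' i = ω i) {D₁ D₂ : ℕ → Rep n}
    (hD₁ : ∀ τ, (D₁ τ).Small (2 ^ (5 * lg n))) (hD₂ : ∀ τ, (D₂ τ).Small (2 ^ (5 * lg n))) :
    ∃ u t, Exec (4000 * lg n) ω decoder
        (initState (4000 * lg n) n k (encode ω'' k D₁) (encode ω'' k D₂)) u t ∧
      t ≤ costConst * k ^ 2 * lg n ^ 9 ∧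
      u.reg 0 = decode ω' n k (4000 * lg n) (encode ω'' k D₁) (encode ω'' k D₂) := by
  have hl := lg_pos (n := n)
  obtain ⟨-, -, -, -, r5, -, -, -, -, rW, rNW⟩ := preludeRun_spec ω' ω'' (w := 4000 * lg n) hkn
    (Nat.mul_le_mul_right _ (by norm_num)) hD₁ hD₂
  have hskw : skLen n k < 2 ^ (128 * lg n) := by
    have := areaEnd_lt hkn
    have := two_pow_mul_le (n := n) (show 60 ≤ 128 by norm_num)
    omega
  have hnl := lt_two_pow_lg (n := n)
  have i2 : (initState (4000 * lg n) n k (encode ω'' k D₁) (encode ω'' k D₂)).reg x_len1 ≤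
      skLen n k := by
    simp only [initState, List.getD_cons_succ, List.getD_cons_zero, length_encode]
    exact Nat.mod_le _ _
  have hfit : (initState (4000 * lg n) n k (encode ω'' k D₁) (encode ω'' k D₂)).Fits degInit 128
      (lg n) := by
    constructor
    · intro x _
      refine (Nat.mod_le _ _).trans_lt ?_
      have e0 : degInit 0 = 1 := by decide
      have e1 : degInit 1 = 1 := by decide
      have e2 : degInit 2 = 128 := by decide
      have e3 : degInit 3 = 128 := by decide
      rcases x with _ | _ | _ | _ | x
      · simpa [e0] using hnl
      · simpa [e1] using lt_of_le_of_lt hkn hnl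
      · simpa [e2, length_encode] using hskw
      · simpa [e3, length_encode] using hskw
      · simp
    · intro a
      refine (Nat.mod_le _ _).trans_lt ?_
      refine (Bool.toNat_lt _).trans_le ?_
      calc 2 = 2 ^ 1 := rfl
        _ ≤ 2 ^ (128 * lg n) := Nat.pow_le_pow_right (by norm_num) (by omega)
  have hp : ∀ p ∈ [codeLog, codeInit, codeUnpack, codeHeader, codeMain, codeOut], ∀ ρ : ℕ → ℕ,
      (∀ N ∈ p.bounds, ρ N ≤ 2 ^ 49 * (k ^ boundK N * lg n ^ boundL N)) →
      p.cost ρ ≤ (p.polyCost (fun _ => 2 ^ 49) boundK boundL).1 * (k ^ 2 * lg n ^ 9) := by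
    intro p hp ρ hρ
    obtain ⟨h1, h2⟩ := polyCost_exponents p hp
    exact (St.cost_le (c := fun _ => 2 ^ 49) hk hl hρ).trans
      (Nat.mul_le_mul_left _ (mono_le hk hl h1 h2))
  unfold decode
  unfold preludeRun at r5 rW rNW ⊢
  set s0 := initState (4000 * lg n) n k (encode ω'' k D₁) (encode ω'' k D₂)
  clear_value s0
  obtain ⟨v1, t1, x1, c1, m1, f1, -⟩ := St.exec_compile (ρ := s0.reg) hl le_rfl hω ok_codeLog s0 s0
    hfit (fun _ _ => rfl) ⟨fun _ _ => rfl, rfl⟩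
  obtain ⟨v2, t2, x2, c2, m2, f2, -⟩ := St.exec_compile (ρ := (codeLog.run ω' s0).reg) hl le_rfl hω
    ok_codeInit _ v1 f1 (fun _ _ => rfl) m1
  set s2 := codeInit.run ω' (codeLog.run ω' s0) with hs2
  obtain ⟨v3, t3, x3, c3, m3, f3, -⟩ := St.exec_compile (ρ := s2.reg) hl le_rfl hω ok_codeUnpack _ v2
    f2 (fun _ _ => rfl) m2
  set s3 := codeUnpack.run ω' s2 with hs3
  have f3' : s3.Fits degMain 128 (lg n) := by
    refine ⟨fun x hx => (f3.reg x hx).trans_le (Nat.pow_le_pow_right (by norm_num)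
      (Nat.mul_le_mul_right _ (degInit_le_degMain x))), f3.mem⟩
  obtain ⟨v4, t4, x4, c4, m4, f4, -⟩ := St.exec_compile (ρ := s3.reg) hl le_rfl hω ok_codeHeader _ v3
    f3' (fun _ _ => rfl) m3
  set s4 := codeHeader.run ω' s3 with hs4
  obtain ⟨v5, t5, x5, c5, m5, f5, -⟩ := St.exec_compile (ρ := s4.reg) hl le_rfl hω ok_codeMain _ v4
    f4 (fun _ _ => rfl) m4
  obtain ⟨v6, t6, x6, c6, m6, f6, -⟩ := St.exec_compile (ρ := (codeMain.run ω' s4).reg) hl le_rfl hω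
    ok_codeOut _ v5 f5 (fun _ _ => rfl) m5
  refine ⟨v6, _, Exec.seq x1 (Exec.seq x2 (Exec.seq x3 (Exec.seq x4 (Exec.seq x5 x6)))), ?_,
    m6.reg 0 (by decide)⟩
  have frW : s2.reg x_W = 60 * lg n := by
    rw [hs4, St.run_frame ω' (by decide), hs3, St.run_frame ω' (by decide)] at rW
    exact rW
  have frNW : s2.reg x_NW = 32 * secLen n k := by
    rw [hs4, St.run_frame ω' (by decide), hs3, St.run_frame ω' (by decide)] at rNW
    exact rNW
  have hκ := kap_le_mul (n := n) hk
  have d1 := c1.trans (hp codeLog (by simp) _ (by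
    intro N hN
    have : N = x_len1 := by simpa [codeLog, St.bounds] using hN
    subst this
    refine i2.trans ((skLen_le_mul hk).trans (le_of_eq ?_))
    rw [show boundK x_len1 = 1 by decide, show boundL x_len1 = 9 by decide, pow_one]))
  have d2 := c2.trans (hp codeInit (by simp) _ (by
    intro N hN
    simp [codeInit, St.bounds] at hN))
  have d3 := c3.trans (hp codeUnpack (by simp) _ (by
    intro N hN
    have : N = x_NW ∨ N = x_W := by simpa [codeUnpack, St.bounds] using hN
    rcases this with rfl | rfl
    · rw [frNW, show boundK x_NW = 1 by decide, show boundL x_NW = 8 by decide, pow_one]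
      have := secLen_le_mul (n := n) hk
      omega
    · rw [frW, show boundK x_W = 0 by decide, show boundL x_W = 1 by decide, pow_one, pow_zero]
      omega))
  have d4 := c4.trans (hp codeHeader (by simp) _ (by
    intro N hN
    simp [codeHeader, St.bounds] at hN))
  have hpar : ∀ x, 20 ≤ x → x < 37 → s4.reg x = par n k x := by
    intro x h1 h2
    have := r5 (x - 20) (by omega)
    rwa [Nat.add_sub_cancel' h1] at this
  have d5 := c5.trans (hp codeMain (by simp) _ (by
    have hb : ∀ N ∈ codeMain.bounds, N ∈ [x_R, x_L, x_NC, x_NG, x_KC, x_beta, x_FW, x_P, x_B, x_E,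
        x_E2] := by decide +kernel
    intro N hN
    have hkl : 1 ≤ k * lg n := Nat.mul_pos hk hl
    have hN' := hb N hN
    simp only [List.mem_cons, List.not_mem_nil, or_false] at hN'
    rcases hN' with rfl | rfl | rfl | rfl | rfl | rfl | rfl | rfl | rfl | rfl | rfl
    · rw [hpar _ (by decide) (by decide), show boundK x_R = 0 by decide,
        show boundL x_R = 1 by decide, pow_one, pow_zero]
      change reps n ≤ _
      have := reps_le_mul (n := n)
      omega
    · rw [hpar _ (by decide) (by decide), show boundK x_L = 1 by decide,
        show boundL x_L = 1 by decide, pow_one, pow_one]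
      change 16 * kap n k + 1 ≤ _
      omega
    · rw [hpar _ (by decide) (by decide), show boundK x_NC = 1 by decide,
        show boundL x_NC = 7 by decide, pow_one]
      change cellCount n k ≤ _
      have := cellCount_le_mul (n := n) hk
      omega
    · rw [hpar _ (by decide) (by decide), show boundK x_NG = 0 by decide,
        show boundL x_NG = 1 by decide, pow_one, pow_zero]
      change 2 * Nat.log 2 n ≤ _
      unfold lg
      omega
    · rw [hpar _ (by decide) (by decide), show boundK x_KC = 1 by decide,
        show boundL x_KC = 1 by decide, pow_one, pow_one]
      change kap n k ≤ _
      omega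
    · rw [hpar _ (by decide) (by decide), show boundK x_beta = 0 by decide,
        show boundL x_beta = 1 by decide, pow_one, pow_zero]
      change bktBits n k ≤ _
      have := bktBits_le_mul hkn
      omega
    · rw [hpar _ (by decide) (by decide), show boundK x_FW = 0 by decide,
        show boundL x_FW = 1 by decide, pow_one, pow_zero]
      change 50 * lg n ≤ _
      omega
    · rw [hpar _ (by decide) (by decide), show boundK x_P = 0 by decide,
        show boundL x_P = 3 by decide, pow_zero]
      change modCount n ≤ _
      have := modCount_le_mul (n := n)
      omega
    · rw [hpar _ (by decide) (by decide), show boundK x_B = 1 by decide,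
        show boundL x_B = 1 by decide, pow_one, pow_one]
      change 2 ^ bktBits n k ≤ _
      have := two_pow_bktBits_le_mul (n := n) hk
      omega
    · rw [hpar _ (by decide) (by decide), show boundK x_E = 1 by decide,
        show boundL x_E = 1 by decide, pow_one, pow_one]
      change 6 * kap n k ≤ _
      omega
    · rw [hpar _ (by decide) (by decide), show boundK x_E2 = 2 by decide,
        show boundL x_E2 = 2 by decide]
      change 6 * kap n k * (6 * kap n k) + 1 ≤ _
      have h1 : 6 * kap n k * (6 * kap n k) ≤ 6 * (161 * (k * lg n)) * (6 * (161 * (k * lg n))) :=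
        Nat.mul_le_mul (by omega) (by omega)
      have h2 : 6 * (161 * (k * lg n)) * (6 * (161 * (k * lg n))) =
          933156 * (k ^ 2 * lg n ^ 2) := by ring
      have h3 : 1 ≤ k ^ 2 * lg n ^ 2 := Nat.mul_pos (by positivity) (by positivity)
      omega))
  have d6 := c6.trans (hp codeOut (by simp) _ (by
    intro N hN
    simp [codeOut, St.bounds] at hN))
  rw [costConst, mul_assoc]
  simp only [add_mul]
  omega

/-! ### Randomness -/

/-- Events whose probability is small for any values of some of the coins, by Fubini's theorem. -/
theorem coinMeasure_le_of_forall {I J : Type} [Fintype I] [DecidableEq I] [Fintype J]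
    [DecidableEq J] (f : I → ℕ) (g : J → ℕ) (hf : Function.Injective f) (hg : Function.Injective g)
    (hfg : ∀ i j, f i ≠ g j) (φ : (I → Bool) → (J → Bool) → Prop) {ε : ℝ}
    (h : ∀ a, pr (φ a) ≤ ε) :
    coinMeasure {ω | φ (fun i => ω (f i)) fun j => ω (g j)} ≤ ENNReal.ofReal ε := by
  have h1 := coinMeasure_eq_pr (Sum.elim f g) (hf.sumElim hg hfg)
    fun x => φ (fun i => x (Sum.inl i)) fun j => x (Sum.inr j)
  refine h1.le.trans (ENNReal.ofReal_le_ofReal ?_)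
  exact (pr_equiv (Equiv.sumArrowEquivProdArrow I J Bool) fun x => φ x.1 x.2).le.trans
    (pr_prod_le h)

/-- A function of finitely many coins is measurable. -/
theorem measurableSet_of_dependsOn {α : Type*} {N : ℕ} {f : Coins → α}
    (h : ∀ ω ω' : Coins, (∀ i < N, ω i = ω' i) → f ω = f ω') (x : α) :
    MeasurableSet {ω | f ω = x} := by
  have hm : Measurable fun (ω : Coins) (i : Fin N) => ω i :=
    measurable_pi_lambda _ fun i => measurable_pi_apply _
  have : {ω : Coins | f ω = x} = (fun (ω : Coins) (i : Fin N) => ω i) ⁻¹'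
      {g | f (fun i => if hi : i < N then g ⟨i, hi⟩ else false) = x} := by
    ext ω
    simp only [Set.mem_ofPred_eq, Set.mem_preimage]
    have e := h ω (fun i => if hi : i < N then ω i else false) fun i hi => by
      rw [dif_pos hi]
    exact ⟨fun hx => e ▸ hx, fun hx => e.trans hx⟩
  rw [this]
  exact hm (MeasurableSet.of_discrete)

/-- The coins that the decoding program can read. -/
def readable (n : ℕ) (ω : Coins) : Coins := fun i => decide (i < 2 ^ (4000 * lg n)) && ω i

theorem readable_of_lt {n : ℕ} {ω : Coins} {i : ℕ} (h : i < 2 ^ (4000 * lg n)) :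
    readable n ω i = ω i := by simp [readable, h]

theorem readable_congr {n : ℕ} {ω ω' : Coins} (h : ∀ i < 2 ^ (4000 * lg n), ω i = ω' i) :
    readable n ω = readable n ω' := by
  funext i
  unfold readable
  by_cases hi : i < 2 ^ (4000 * lg n)
  · rw [h i hi]
  · simp [hi]

section Distances

variable {n : ℕ} [NeZero n]

/-- The coins for the buckets and for the hash values. -/
abbrev HashCoin (n k : ℕ) : Type :=
  (ZMod n × Fin (bktBits n k)) ⊕ ((ZMod n × Fin (2 ^ (5 * lg n))) × Fin (50 * lg n))

/-- The positions of these coins in the public random string. -/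
def hashPos (n k : ℕ) : HashCoin n k → ℕ :=
  Sum.elim (fun x => coinBase n + x.1.val * bktBits n k + x.2)
    fun x => (x.1.1.val * 2 ^ (5 * lg n) + x.1.2) * (50 * lg n) + x.2

theorem mul_add_inj {a b a' b' N : ℕ} (hb : b < N) (hb' : b' < N) (h : a * N + b = a' * N + b') :
    a = a' ∧ b = b' := by
  have h1 := mul_add_div_of_lt (a := a) hb
  have h2 := mul_add_mod_of_lt (a := a) hb
  rw [h, mul_add_div_of_lt hb'] at h1
  rw [h, mul_add_mod_of_lt hb'] at h2
  exact ⟨h1.symm, h2.symm⟩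

theorem hashPos_inr_lt (k : ℕ) (x : (ZMod n × Fin (2 ^ (5 * lg n))) × Fin (50 * lg n)) :
    hashPos n k (Sum.inr x) < coinBase n :=
  mul_add_lt_of_lt (mul_add_lt_of_lt x.1.1.val_lt x.1.2.2 le_rfl) x.2.2 le_rfl

theorem hashPos_lt (k : ℕ) (x : HashCoin n k) : hashPos n k x < coinBase n + n * bktBits n k := by
  rcases x with x | x
  · have := mul_add_lt_of_lt x.1.val_lt x.2.2 le_rfl
    change coinBase n + x.1.val * bktBits n k + x.2 < _
    omega
  · have := hashPos_inr_lt k x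
    omega

theorem hashPos_injective (k : ℕ) : Function.Injective (hashPos n k) := by
  refine Function.Injective.sumElim ?_ ?_ fun x y => ?_
  · rintro ⟨i, t⟩ ⟨i', t'⟩ h
    obtain ⟨h1, h2⟩ := mul_add_inj t.2 t'.2
      (show i.val * bktBits n k + t = i'.val * bktBits n k + t' by
        have : coinBase n + i.val * bktBits n k + t = coinBase n + i'.val * bktBits n k + t' := h
        omega)
    exact Prod.ext (ZMod.val_injective n h1) (Fin.ext h2)
  · rintro ⟨⟨i, a⟩, t⟩ ⟨⟨i', a'⟩, t'⟩ h
    obtain ⟨h1, h2⟩ := mul_add_inj t.2 t'.2 h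
    obtain ⟨h3, h4⟩ := mul_add_inj a.2 a'.2 h1
    exact Prod.ext (Prod.ext (ZMod.val_injective n h3) (Fin.ext h4)) (Fin.ext h2)
  · have := hashPos_inr_lt k y
    change hashPos n k (Sum.inr y) < _ at this
    intro h
    have h' : coinBase n + x.1.val * bktBits n k + x.2 = hashPos n k (Sum.inr y) := h
    omega

/-- The tables of buckets and of hash values given by coins. -/
def hashTables {k : ℕ} (c : HashCoin n k → Bool) :
    (ZMod n → Fin (bktBits n k) → Bool) × (ZMod n × Fin (2 ^ (5 * lg n)) → Fin (50 * lg n) → Bool) :=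
  (fun i t => c (Sum.inl (i, t)), fun x t => c (Sum.inr (x, t)))

/-- The bijection between coins and tables. -/
def hashEquiv (n k : ℕ) : (HashCoin n k → Bool) ≃
    (ZMod n → Fin (bktBits n k) → Bool) × (ZMod n × Fin (2 ^ (5 * lg n)) → Fin (50 * lg n) → Bool) :=
  (Equiv.sumArrowEquivProdArrow _ _ _).trans
    (Equiv.prodCongr (Equiv.curry _ _ _) (Equiv.curry _ _ _))

theorem coinCell_eq {k : ℕ} (hkn : k ≤ n) (ω : Coins) {U : ZMod n → ℕ}
    (hU : ∀ i, U i < 2 ^ (5 * lg n)) :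
    coinCell (readable n ω) (par n k) U =
      cell (50 * lg n) (hashOf (hashTables fun x => ω (hashPos n k x)).2)
        (fun i => vecVal ((hashTables fun x => ω (hashPos n k x)).1 i)) U := by
  have hpos : ∀ x : HashCoin n k, readable n ω (hashPos n k x) = ω (hashPos n k x) := fun x => by
    refine readable_of_lt ((hashPos_lt k x).trans ((coinBase_add_lt hkn).trans_le ?_))
    exact two_pow_mul_le (by norm_num)
  have hb : ∀ i : ZMod n, coinBucket (readable n ω) (coinBase n) (bktBits n k) i.val =
      vecVal ((hashTables fun x => ω (hashPos n k x)).1 i) := by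
    intro i
    unfold coinBucket
    rw [← vecVal_apply]
    refine congrArg vecVal (funext fun t => ?_)
    have e := hpos (Sum.inl (i, t))
    simp only [hashPos, Sum.elim_inl] at e
    simp only [hashTables, hashPos, Sum.elim_inl]
    exact e
  have hh : ∀ i : ZMod n, coinHash (readable n ω) (2 ^ (5 * lg n)) (50 * lg n) i.val (U i) =
      hashOf (hashTables fun x => ω (hashPos n k x)).2 i (U i) := by
    intro i
    unfold coinHash hashOf
    rw [dif_pos (hU i), ← vecVal_apply]
    refine congrArg vecVal (funext fun t => ?_)
    have e := hpos (Sum.inr ((i, ⟨U i, hU i⟩), t))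
    simp only [hashPos, Sum.elim_inr] at e
    simp only [hashTables, hashPos, Sum.elim_inr]
    exact e
  funext b p s
  change (∑ i ∈ Finset.univ.filter fun i : ZMod n => coinBucket (readable n ω) (coinBase n)
    (bktBits n k) i.val = b ∧ i.val % (p + 1) = s, coinHash (readable n ω) (2 ^ (5 * lg n))
    (50 * lg n) i.val (U i)) % 2 ^ (50 * lg n) = _
  unfold cell
  simp only [hb, hh]

/-- The estimates for the rotations of the second string are not too small, for tables of buckets
and of hash values. -/
def GoodTables (k : ℕ) (U₁ U₂ : ZMod n → ℕ)
    (x : (ZMod n → Fin (bktBits n k) → Bool) ×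
      (ZMod n × Fin (2 ^ (5 * lg n)) → Fin (50 * lg n) → Bool)) : Prop :=
  ∀ m, min (hammingDist (shift m U₂) U₁) (capa n k + 1) ≤ est (2 ^ bktBits n k) (modCount n)
    (cell (50 * lg n) (hashOf x.2) (fun i => vecVal (x.1 i)) (shift m U₂))
    (cell (50 * lg n) (hashOf x.2) (fun i => vecVal (x.1 i)) U₁)

theorem goodEst_iff {k : ℕ} (hkn : k ≤ n) (ω : Coins) {U₁ U₂ : ZMod n → ℕ}
    (h1 : ∀ i, U₁ i < 2 ^ (5 * lg n)) (h2 : ∀ i, U₂ i < 2 ^ (5 * lg n)) :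
    GoodEst (readable n ω) (par n k) U₁ U₂ ↔
      GoodTables k U₁ U₂ (hashTables fun x => ω (hashPos n k x)) := by
  unfold GoodEst GoodTables
  refine forall_congr' fun m => ?_
  rw [coinCell_eq hkn ω h1, coinCell_eq hkn ω (U := shift m U₂) fun i => h2 _, hammingDist_comm]
  exact Iff.rfl

theorem two_mul_capa_le (k : ℕ) : 2 * (capa n k + 1) ≤ 2 ^ bktBits n k := by
  unfold bktBits
  have := Nat.lt_pow_succ_log_self (b := 2) (by norm_num) (capa n k + 1)
  rw [pow_succ] at this ⊢
  rw [pow_succ]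
  omega

/-- Union bound over the rotations. -/
theorem pr_not_goodTables_le (k : ℕ) {U₁ U₂ : ZMod n → ℕ} (h2 : ∀ i, U₂ i < 2 ^ (5 * lg n)) :
    pr (fun x => ¬ GoodTables k U₁ U₂ x) ≤ n * (2 ^ bktBits n k / 2 ^ (24 * lg n + 1) +
      2 ^ bktBits n k * (modCount n : ℝ) ^ 2 / 2 ^ (50 * lg n)) := by
  classical
  set q := fun (m : ZMod n) (x : (ZMod n → Fin (bktBits n k) → Bool) ×
      (ZMod n × Fin (2 ^ (5 * lg n)) → Fin (50 * lg n) → Bool)) =>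
    est (2 ^ bktBits n k) (modCount n)
      (cell (50 * lg n) (hashOf x.2) (fun i => vecVal (x.1 i)) (shift m U₂))
      (cell (50 * lg n) (hashOf x.2) (fun i => vecVal (x.1 i)) U₁) <
        min (hammingDist (shift m U₂) U₁) (capa n k + 1) with hq
  have h : ∀ m, pr (q m) ≤ 2 ^ bktBits n k / 2 ^ (24 * lg n + 1) +
      2 ^ bktBits n k * (modCount n : ℝ) ^ 2 / 2 ^ (50 * lg n) := fun m =>
    pr_est_lt_le (fun i => h2 (i + m)) lt_two_pow_lg.le le_rfl (two_mul_capa_le k)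
  refine (pr_mono (q := fun x => ∃ m ∈ (Finset.univ : Finset (ZMod n)), q m x) fun x hx => ?_).trans
    ((pr_exists_le_card_mul _ _ fun m _ => h m).trans (le_of_eq ?_))
  · unfold GoodTables at hx
    push Not at hx
    obtain ⟨m, hm⟩ := hx
    exact ⟨m, Finset.mem_univ _, hm⟩
  · rw [Finset.card_univ, ZMod.card]

/-- The numerical bound behind the union bound over repetitions and rotations. -/
theorem est_error_le {k : ℕ} (hkn : k ≤ n) :
    (reps n : ℝ) * (n * (2 ^ bktBits n k / 2 ^ (24 * lg n + 1) +
      2 ^ bktBits n k * (modCount n : ℝ) ^ 2 / 2 ^ (50 * lg n))) ≤ 1 / 2 ^ (lg n + 2) := by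
  have hT : n ≤ 2 * 2 ^ Nat.log 2 n := lt_two_mul_pow.le
  have h1 : reps n * n * 2 ^ bktBits n k ≤ 2 ^ (18 * lg n) := by
    calc reps n * n * 2 ^ bktBits n k
        ≤ 192 * 2 ^ Nat.log 2 n * (2 * 2 ^ Nat.log 2 n) * (644 * (2 ^ Nat.log 2 n) ^ 2) :=
          Nat.mul_le_mul (Nat.mul_le_mul reps_le hT) (two_pow_bktBits_le hkn)
      _ = 247296 * (2 ^ Nat.log 2 n) ^ 4 := by ring
      _ ≤ 2 ^ 18 * (2 ^ Nat.log 2 n) ^ 4 := Nat.mul_le_mul_right _ (by norm_num)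
      _ ≤ _ := mul_pow_le_two_pow (by norm_num) le_rfl
  have h2 : reps n * n * 2 ^ bktBits n k * modCount n ^ 2 ≤ 2 ^ (39 * lg n) := by
    calc reps n * n * 2 ^ bktBits n k * modCount n ^ 2
        ≤ 192 * 2 ^ Nat.log 2 n * (2 * 2 ^ Nat.log 2 n) * (644 * (2 ^ Nat.log 2 n) ^ 2) *
          (1160 * (2 ^ Nat.log 2 n) ^ 3) ^ 2 :=
          Nat.mul_le_mul (Nat.mul_le_mul (Nat.mul_le_mul reps_le hT) (two_pow_bktBits_le hkn))
            (Nat.pow_le_pow_left modCount_le 2)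
      _ = 332761497600 * (2 ^ Nat.log 2 n) ^ 10 := by ring
      _ ≤ 2 ^ 39 * (2 ^ Nat.log 2 n) ^ 10 := Nat.mul_le_mul_right _ (by norm_num)
      _ ≤ _ := mul_pow_le_two_pow (by norm_num) le_rfl
  have hl : 1 ≤ lg n := lg_pos
  have h3 : (reps n * n * 2 ^ bktBits n k : ℝ) ≤ 2 ^ (18 * lg n) := by exact_mod_cast h1
  have h4 : (reps n * n * 2 ^ bktBits n k * (modCount n : ℝ) ^ 2 : ℝ) ≤ 2 ^ (39 * lg n) := by
    exact_mod_cast h2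
  have e1 : (2:ℝ) ^ (18 * lg n) / 2 ^ (24 * lg n + 1) ≤ 1 / 2 ^ (lg n + 3) := by
    rw [div_le_div_iff₀ (by positivity) (by positivity), one_mul, ← pow_add]
    exact pow_le_pow_right₀ (by norm_num) (by omega)
  have e2 : (2:ℝ) ^ (39 * lg n) / 2 ^ (50 * lg n) ≤ 1 / 2 ^ (lg n + 3) := by
    rw [div_le_div_iff₀ (by positivity) (by positivity), one_mul, ← pow_add]
    exact pow_le_pow_right₀ (by norm_num) (by omega)
  calc _ = reps n * n * 2 ^ bktBits n k / 2 ^ (24 * lg n + 1) +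
        reps n * n * 2 ^ bktBits n k * (modCount n : ℝ) ^ 2 / 2 ^ (50 * lg n) := by ring
    _ ≤ 2 ^ (18 * lg n) / 2 ^ (24 * lg n + 1) + 2 ^ (39 * lg n) / 2 ^ (50 * lg n) := by gcongr
    _ ≤ 1 / 2 ^ (lg n + 3) + 1 / 2 ^ (lg n + 3) := add_le_add e1 e2
    _ = 1 / 2 ^ (lg n + 2) := by
        rw [show lg n + 3 = lg n + 2 + 1 by omega, pow_succ (2:ℝ) (lg n + 2)]; ring

end Distances

section Encoder

variable {n : ℕ} [NeZero n]

/-- The coins of one repetition of the encoder: those for sampling positions, and those for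
selecting contents. -/
abbrev AnchorCoin (n k σ : ℕ) [NeZero n] : Type :=
  (ZMod n × Fin (Nat.log 2 k + 4)) ⊕
    (((ZMod n → Option (Fin σ)) × Fin (Fintype.card (ZMod n))) × Fin (lg n + 2))

/-- The coins of the encoder: those for the hash values of characters, and those for the anchors in
all repetitions. -/
abbrev EncoderCoin (n k σ : ℕ) [NeZero n] : Type :=
  (Fin σ × Fin (5 * lg n)) ⊕ (Fin (reps n) × AnchorCoin n k σ)

/-- The positions of the encoder's coins in the public random string: behind the coins that are used
for hash values and buckets. -/
noncomputable def encoderPos (n k σ : ℕ) [NeZero n] (x : EncoderCoin n k σ) : ℕ :=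
  coinBase n + n * bktBits n k + Fintype.equivFin (EncoderCoin n k σ) x

theorem encoderPos_injective (k σ : ℕ) : Function.Injective (encoderPos n k σ) := fun _ _ h =>
  (Fintype.equivFin _).injective (Fin.ext (Nat.add_left_cancel h))

/-- The random numbers for the characters. -/
def symbolHash {k σ : ℕ} (c : EncoderCoin n k σ → Bool) (a : Fin σ) : ℕ :=
  vecVal fun t => c (Sum.inl (a, t))

theorem symbolHash_lt {k σ : ℕ} (c : EncoderCoin n k σ → Bool) (a : Fin σ) :
    symbolHash c a < 2 ^ (5 * lg n) := vecVal_lt _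

/-- The anchor of a string for one repetition. -/
noncomputable def anchorOf {k σ : ℕ} (c : AnchorCoin n k σ → Bool) (S : ZMod n → Fin σ) : ZMod n :=
  anchor (fun i => allZero fun t => c (Sum.inl (i, t))) (fun z => allZero fun t => c (Sum.inr (z, t)))
    S

/-- The anchor in repetition `τ`; only the values for `τ < reps n` matter. -/
noncomputable def repAnchor {k σ : ℕ} (c : EncoderCoin n k σ → Bool) (S : ZMod n → Fin σ) (τ : ℕ) :
    ZMod n :=
  if h : τ < reps n then anchorOf (fun x => c (Sum.inr (⟨τ, h⟩, x))) S else 0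

/-- The hash values of the characters of the rotation of a string by its anchor. -/
noncomputable def repStr {k σ : ℕ} (c : EncoderCoin n k σ → Bool) (S : ZMod n → Fin σ) (τ : ℕ) :
    ZMod n → ℕ :=
  fun i => symbolHash c (shift (repAnchor c S τ) S i)

/-- Union bound over the at most `n ^ 2` pairs of different characters, with `5 * lg n` bits for
each character. -/
theorem pr_symbolHash_le {σ : ℕ} (S₁ S₂ : ZMod n → Fin σ) :
    pr (fun f : Fin σ → Fin (5 * lg n) → Bool =>
      ∃ z ∈ (Finset.univ : Finset (ZMod n × ZMod n)), S₁ z.1 ≠ S₂ z.2 ∧ f (S₁ z.1) = f (S₂ z.2)) ≤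
      1 / 2 ^ (lg n + 2) := by
  have hl : 1 ≤ lg n := lg_pos
  refine (pr_exists_le_card_mul _ _ (ε := 1 / 2 ^ (5 * lg n)) ?_).trans ?_
  · rintro ⟨i, j⟩ _
    have hcard : ((Fintype.card (Fin (5 * lg n) → Bool) : ℕ) : ℝ) = 2 ^ (5 * lg n) := by simp
    rw [← hcard]
    refine pr_fun_le_of_unique (S₁ i) ?_
    rintro f y y' ⟨hne, h1⟩ ⟨-, h2⟩
    rw [Function.update_self, Function.update_of_ne hne.symm] at h1 h2
    rw [h1, h2]
  · rw [Finset.card_univ, Fintype.card_prod, ZMod.card, mul_one_div,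
      div_le_div_iff₀ (by positivity) (by positivity), one_mul]
    have h1 : n * n * 2 ^ (lg n + 2) ≤ 2 ^ (5 * lg n) := by
      calc n * n * 2 ^ (lg n + 2) ≤ 2 ^ lg n * 2 ^ lg n * 2 ^ (lg n + 2) :=
            Nat.mul_le_mul_right _ (Nat.mul_le_mul lt_two_pow_lg.le lt_two_pow_lg.le)
        _ = 2 ^ (lg n + lg n + (lg n + 2)) := by rw [← pow_add, ← pow_add]
        _ ≤ _ := Nat.pow_le_pow_right (by norm_num) (by omega)
    exact_mod_cast h1

/-- The symbol hashes fail to separate the characters of two strings with small probability. -/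
theorem coinMeasure_symbolHash_le (k : ℕ) {σ : ℕ} (S₁ S₂ : ZMod n → Fin σ) :
    coinMeasure {ω | ¬ ∀ i j, S₁ i ≠ S₂ j → symbolHash (fun x => ω (encoderPos n k σ x)) (S₁ i) ≠
      symbolHash (fun x => ω (encoderPos n k σ x)) (S₂ j)} ≤ ENNReal.ofReal (1 / 2 ^ (lg n + 2)) := by
  have h := coinMeasure_eq_pr (I := Fin σ × Fin (5 * lg n)) (fun x => encoderPos n k σ (Sum.inl x))
    (fun x y hxy => Sum.inl_injective (encoderPos_injective k σ hxy)) fun c =>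
      ∃ z ∈ (Finset.univ : Finset (ZMod n × ZMod n)), S₁ z.1 ≠ S₂ z.2 ∧
        Equiv.curry _ _ _ c (S₁ z.1) = Equiv.curry _ _ _ c (S₂ z.2)
  rw [pr_equiv (Equiv.curry (Fin σ) (Fin (5 * lg n)) Bool) fun f =>
    ∃ z ∈ (Finset.univ : Finset (ZMod n × ZMod n)), S₁ z.1 ≠ S₂ z.2 ∧ f (S₁ z.1) = f (S₂ z.2)] at h
  refine (MeasureTheory.measure_mono fun ω hω => ?_).trans
    (h.le.trans (ENNReal.ofReal_le_ofReal (pr_symbolHash_le S₁ S₂)))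
  simp only [Set.mem_ofPred_eq] at hω ⊢
  push Not at hω
  obtain ⟨i, j, hne, heq⟩ := hω
  exact ⟨(i, j), Finset.mem_univ _, hne, vecVal_injective heq⟩

/-- Decidable equality only serves to speak of finite sets of coins, so it is taken classically. -/
noncomputable instance (k σ : ℕ) : DecidableEq (AnchorCoin n k σ) := Classical.decEq _

/-- One repetition fails to align similar strings with probability at most `63 / 64`. -/
theorem pr_anchorOf_le {k σ : ℕ} {S₁ S₂ : ZMod n → Fin σ} {m : ZMod n}
    (hm : hammingDist S₁ (shift m S₂) ≤ k) :
    pr (fun c : AnchorCoin n k σ → Bool => ¬ hammingDist (shift (anchorOf c S₁) S₁)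
      (shift (anchorOf c S₂) S₂) ≤ capa n k) ≤ 63 / 64 := by
  have h8 : 8 * k ≤ 2 ^ (Nat.log 2 k + 4) := by
    have := Nat.lt_pow_succ_log_self (b := 2) (by norm_num) k
    rw [show Nat.log 2 k + 4 = Nat.log 2 k + 1 + 3 by omega, pow_add _ _ 3]
    omega
  have h := le_pr_anchor hm h8 (l := lg n) (by rw [ZMod.card]; exact lt_two_pow_lg)
    (by rw [ZMod.card]; exact two_pow_lg_le (NeZero.ne n)) (K := capa n k) le_rfl
  rw [← pr_equiv ((Equiv.sumArrowEquivProdArrow _ _ _).trans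
    (Equiv.prodCongr (Equiv.curry _ _ _) (Equiv.curry _ _ _)))] at h
  rw [pr_not]
  have h' : (1:ℝ) / 64 ≤ pr (fun c : AnchorCoin n k σ → Bool =>
    hammingDist (shift (anchorOf c S₁) S₁) (shift (anchorOf c S₂) S₂) ≤ capa n k) := h
  linarith

/-- All repetitions fail with small probability, since `(63 / 64) ^ 64 ≤ 1 / 2`. -/
theorem pow_reps_le : (63 / 64 : ℝ) ^ reps n ≤ 1 / 2 ^ (lg n + 2) := by
  unfold reps
  rw [pow_mul, ← one_div_pow]
  gcongr
  norm_num

/-- If the strings have similar rotations, then in some repetition the anchors nearly align the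
strings, except with small probability. -/
theorem coinMeasure_repAnchor_le {k σ : ℕ} {S₁ S₂ : ZMod n → Fin σ} {m : ZMod n}
    (hm : hammingDist S₁ (shift m S₂) ≤ k) :
    coinMeasure {ω | ¬ ∃ τ < reps n,
      hammingDist (shift (repAnchor (fun x => ω (encoderPos n k σ x)) S₁ τ) S₁)
        (shift (repAnchor (fun x => ω (encoderPos n k σ x)) S₂ τ) S₂) ≤ capa n k} ≤
      ENNReal.ofReal (1 / 2 ^ (lg n + 2)) := by
  have h := coinMeasure_eq_pr (I := Fin (reps n) × AnchorCoin n k σ)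
    (fun x => encoderPos n k σ (Sum.inr x))
    (fun x y hxy => Sum.inr_injective (encoderPos_injective k σ hxy)) fun c =>
      ∀ τ, ¬ hammingDist (shift (anchorOf (Equiv.curry _ _ _ c τ) S₁) S₁)
        (shift (anchorOf (Equiv.curry _ _ _ c τ) S₂) S₂) ≤ capa n k
  rw [pr_equiv (Equiv.curry (Fin (reps n)) (AnchorCoin n k σ) Bool) fun f =>
    ∀ τ, ¬ hammingDist (shift (anchorOf (f τ) S₁) S₁) (shift (anchorOf (f τ) S₂) S₂) ≤ capa n k,
    pr_pi_forall fun c => ¬ hammingDist (shift (anchorOf c S₁) S₁) (shift (anchorOf c S₂) S₂) ≤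
      capa n k, Fintype.card_fin] at h
  refine (MeasureTheory.measure_mono fun ω hω => ?_).trans
    (h.le.trans (ENNReal.ofReal_le_ofReal ((pow_le_pow_left₀ (pr_nonneg _) (pr_anchorOf_le hm)
      _).trans pow_reps_le)))
  simp only [Set.mem_ofPred_eq] at hω ⊢
  push Not at hω
  intro τ
  have := hω τ τ.2
  unfold repAnchor at this
  rw [dif_pos τ.2, dif_pos τ.2] at this
  exact not_le.2 this

/-- All estimates are good, except with small probability. -/
theorem coinMeasure_goodEst_le {k σ : ℕ} (hkn : k ≤ n) (S₁ S₂ : ZMod n → Fin σ) :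
    coinMeasure {ω | ¬ ∀ τ < reps n, GoodEst (readable n ω) (par n k)
      (repStr (fun x => ω (encoderPos n k σ x)) S₁ τ)
      (repStr (fun x => ω (encoderPos n k σ x)) S₂ τ)} ≤ ENNReal.ofReal (1 / 2 ^ (lg n + 2)) := by
  classical
  have h := coinMeasure_le_of_forall (encoderPos n k σ) (hashPos n k) (encoderPos_injective k σ)
    (hashPos_injective k) (fun x y hxy => by
      have h1 := hashPos_lt k y
      unfold encoderPos at hxy
      omega)
    (fun a b => ∃ τ ∈ Finset.range (reps n), ¬ GoodTables k (repStr a S₁ τ) (repStr a S₂ τ)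
      (hashTables b)) (ε := 1 / 2 ^ (lg n + 2)) (fun a => by
      refine (pr_exists_le_card_mul _ _ fun τ _ => ?_).trans
        ((by rw [Finset.card_range] : _ = _).le.trans (est_error_le hkn))
      exact (pr_equiv (hashEquiv n k) fun x =>
        ¬ GoodTables k (repStr a S₁ τ) (repStr a S₂ τ) x).le.trans
        (pr_not_goodTables_le k fun i => symbolHash_lt a _))
  refine (MeasureTheory.measure_mono fun ω hω => ?_).trans h
  simp only [Set.mem_ofPred_eq] at hω ⊢
  push Not at hω
  obtain ⟨τ, hτ, hg⟩ := hω
  refine ⟨τ, Finset.mem_range.2 hτ, ?_⟩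
  exact fun hg' => hg ((goodEst_iff hkn ω (fun i => symbolHash_lt _ _)
    fun i => symbolHash_lt _ _).2 hg')

end Encoder

/-! ### The sketch -/

section Sketch

variable {n σ : ℕ} [NeZero n]

/-- A string as a function on the integers modulo `n`. -/
def cyclic (S : Str n σ) : ZMod n → Fin σ := fun i => S ((ZMod.finEquiv n).symm i)

theorem hammingDist_cyclic (S₁ S₂ : Str n σ) :
    hammingDist (cyclic S₁) (cyclic S₂) = hammingDist S₁ S₂ := by
  unfold hammingDist cyclic
  exact Finset.card_equiv (ZMod.finEquiv n).symm.toEquiv (by simp)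

theorem cyclic_cyc (S : Str n σ) : cyclic (cyc S) = shift 1 (cyclic S) := by
  obtain ⟨n, rfl⟩ := Nat.exists_eq_succ_of_ne_zero (NeZero.ne n)
  funext i
  change cyc S _ = S _
  rw [cyc_apply, finRotate_apply, map_add, map_one]

/-- Cyclic shifts are rotations by residues modulo `n`. -/
theorem cyclic_cyc_zpow (m : ℤ) (S : Str n σ) :
    cyclic ((cyc ^ m) S) = shift (m : ZMod n) (cyclic S) := by
  have hinv : ∀ S : Str n σ, cyclic (cyc⁻¹ S) = shift (-1) (cyclic S) := by
    intro S
    have h := cyclic_cyc (cyc⁻¹ S)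
    rw [show cyc (cyc⁻¹ S) = S from cyc.apply_symm_apply S] at h
    rw [h, shift_shift, neg_add_cancel, shift_zero]
  induction m using Int.induction_on generalizing S with
  | zero => simp [shift_zero]
  | succ m ih =>
    rw [zpow_add_one, Equiv.Perm.mul_apply, ih, cyclic_cyc, shift_shift]
    push_cast
    rfl
  | pred m ih =>
    rw [zpow_sub_one, Equiv.Perm.mul_apply, ih, hinv, shift_shift]
    push_cast
    rw [sub_eq_add_neg]

/-- The shift distance is a lower bound for the distances of the rotations. -/
theorem sh_le (S₁ S₂ : Str n σ) (m : ZMod n) :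
    sh S₁ S₂ ≤ hammingDist (cyclic S₁) (shift m (cyclic S₂)) := by
  have h := cyclic_cyc_zpow (m.val : ℤ) S₂
  rw [Int.cast_natCast, ZMod.natCast_zmod_val] at h
  rw [← h, hammingDist_cyclic]
  exact ciInf_le (OrderBot.bddBelow _) _

/-- The shift distance is attained. -/
theorem exists_sh_eq (S₁ S₂ : Str n σ) :
    ∃ m : ZMod n, hammingDist (cyclic S₁) (shift m (cyclic S₂)) = sh S₁ S₂ := by
  obtain ⟨m, hm⟩ := Nat.sInf_mem (Set.range_nonempty fun m : ℤ => hammingDist S₁ ((cyc ^ m) S₂))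
  refine ⟨m, ?_⟩
  rw [← cyclic_cyc_zpow, hammingDist_cyclic]
  exact hm

/-- The data of all repetitions in the sketch of a string. -/
noncomputable def sketchData (k : ℕ) (c : EncoderCoin n k σ → Bool) (S : Str n σ) (τ : ℕ) : Rep n :=
  (exists_rep (κ := kap n k) (repStr c (cyclic S) τ) fun _ => symbolHash_lt c _).choose

theorem sketchData_spec (k : ℕ) (c : EncoderCoin n k σ → Bool) (S : Str n σ) (τ : ℕ) :
    (sketchData k c S τ).str = repStr c (cyclic S) τ ∧ (sketchData k c S τ).Valid (kap n k) ∧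
      (sketchData k c S τ).Small (2 ^ (5 * lg n)) :=
  (exists_rep (κ := kap n k) (repStr c (cyclic S) τ) fun _ => symbolHash_lt c _).choose_spec

/-- The sketch of a string. -/
noncomputable def sketch (k : ℕ) (ω : Coins) (S : Str n σ) : List Bool :=
  encode (readable n ω) k (sketchData k (fun x => ω (encoderPos n k σ x)) S)

theorem measurableSet_sketch (k : ℕ) (S : Str n σ) (x : List Bool) :
    MeasurableSet {ω | sketch k ω S = x} := by
  refine measurableSet_of_dependsOn (N := 2 ^ (4000 * lg n) + (coinBase n + n * bktBits n k +
    Fintype.card (EncoderCoin n k σ))) (fun ω ω' h => ?_) x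
  unfold sketch
  rw [readable_congr fun i hi => h i (by omega)]
  congr 2
  funext y
  refine h _ ?_
  exact (Nat.add_lt_add_left (Fintype.equivFin (EncoderCoin n k σ) y).2 _).trans_le
    (Nat.le_add_left _ _)

theorem measurableSet_decode (k : ℕ) (x y : List Bool) (v : ℕ) :
    MeasurableSet {ω | decode (readable n ω) n k (4000 * lg n) x y = v} :=
  measurableSet_of_dependsOn (N := 2 ^ (4000 * lg n)) (fun _ _ h => by rw [readable_congr h]) v

/-- If the symbol hashes separate the characters of two strings, then the distances of the rotations
of the hashed strings are distances of rotations of the strings. -/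
theorem hammingDist_repStr {k : ℕ} {c : EncoderCoin n k σ → Bool} {S₁ S₂ : ZMod n → Fin σ}
    (hc : ∀ i j, S₁ i ≠ S₂ j → symbolHash c (S₁ i) ≠ symbolHash c (S₂ j)) (τ : ℕ) (m : ZMod n) :
    hammingDist (repStr c S₁ τ) (shift m (repStr c S₂ τ)) =
      hammingDist S₁ (shift (m + repAnchor c S₂ τ - repAnchor c S₁ τ) S₂) := by
  have h1 : hammingDist (repStr c S₁ τ) (shift m (repStr c S₂ τ)) =
      hammingDist (shift (repAnchor c S₁ τ) S₁) (shift m (shift (repAnchor c S₂ τ) S₂)) := by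
    unfold hammingDist
    congr 1
    ext i
    simp only [Finset.mem_filter, Finset.mem_univ, true_and]
    exact ⟨fun h h' => h (congrArg (symbolHash c) h'), fun h => hc _ _ h⟩
  rw [h1, shift_shift, ← hammingDist_shift (repAnchor c S₁ τ) S₁, shift_shift]
  congr 2
  abel

/-- Decoding succeeds if the symbol hashes separate characters, one of the repetitions nearly aligns
strings with similar rotations, and all estimates are good. -/
theorem decode_sketch {k : ℕ} (hk : 1 ≤ k) (hkn : k ≤ n) {ω : Coins} {S₁ S₂ : Str n σ}
    (hc : ∀ i j, cyclic S₁ i ≠ cyclic S₂ j →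
      symbolHash (fun x => ω (encoderPos n k σ x)) (cyclic S₁ i) ≠
        symbolHash (fun x => ω (encoderPos n k σ x)) (cyclic S₂ j))
    (ha : sh S₁ S₂ ≤ k → ∃ τ < reps n,
      hammingDist (shift (repAnchor (fun x => ω (encoderPos n k σ x)) (cyclic S₁) τ) (cyclic S₁))
        (shift (repAnchor (fun x => ω (encoderPos n k σ x)) (cyclic S₂) τ) (cyclic S₂)) ≤ capa n k)
    (hg : ∀ τ < reps n, GoodEst (readable n ω) (par n k)
      (repStr (fun x => ω (encoderPos n k σ x)) (cyclic S₁) τ)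
      (repStr (fun x => ω (encoderPos n k σ x)) (cyclic S₂) τ)) :
    decode (readable n ω) n k (4000 * lg n) (sketch k ω S₁) (sketch k ω S₂) =
      min (sh S₁ S₂) (k + 1) := by
  set c : EncoderCoin n k σ → Bool := fun x => ω (encoderPos n k σ x) with hcdef
  have s1 := sketchData_spec k c S₁
  have s2 := sketchData_spec k c S₂
  have key := le_decode_iff (readable n ω) (w := 4000 * lg n) hkn
    (Nat.mul_le_mul_right _ (by norm_num)) (fun τ => (s1 τ).2.2) (fun τ => (s2 τ).2.2)
    fun τ => (s2 τ).2.1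
  change ∀ z, z ≤ decode (readable n ω) n k (4000 * lg n) (sketch k ω S₁) (sketch k ω S₂) ↔ _ at key
  generalize decode (readable n ω) n k (4000 * lg n) (sketch k ω S₁) (sketch k ω S₂) = z at key
  have hd := design_par (n := n) hk
  have hg' : ∀ τ < reps n, GoodEst (readable n ω) (par n k) (sketchData k c S₁ τ).str
      (sketchData k c S₂ τ).str := fun τ hτ => by
    rw [(s1 τ).1, (s2 τ).1]; exact hg τ hτ
  apply le_antisymm
  · obtain ⟨h1, h2⟩ := (key z).1 le_rfl
    refine le_min ?_ h1
    rcases lt_or_ge k (sh S₁ S₂) with hlt | hle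
    · omega
    obtain ⟨τ, hτ, hτa⟩ := ha hle
    obtain ⟨m, hm⟩ := exists_sh_eq S₁ S₂
    have hdist := hammingDist_repStr hc τ (m + repAnchor c (cyclic S₁) τ - repAnchor c (cyclic S₂) τ)
    rw [show m + repAnchor c (cyclic S₁) τ - repAnchor c (cyclic S₂) τ + repAnchor c (cyclic S₂) τ -
      repAnchor c (cyclic S₁) τ = m by abel, hm, ← (s1 τ).1, ← (s2 τ).1] at hdist
    rw [← hdist]
    refine le_of_repBound hd (s1 τ).2.1 (s2 τ).2.1 (hg' τ hτ) (h2 τ hτ) ?_ (hdist ▸ hle)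
    have h0 := hammingDist_repStr hc τ 0
    rw [shift_zero, ← (s1 τ).1, ← (s2 τ).1] at h0
    rw [h0]
    refine le_trans (le_of_eq ?_) hτa
    rw [← hammingDist_shift (repAnchor c (cyclic S₁) τ) (cyclic S₁), shift_shift]
    congr 2
    abel
  · refine (key _).2 ⟨min_le_right _ _, fun τ hτ => ?_⟩
    refine repBound_of_forall hd (s1 τ).2.1 (s2 τ).2.1 (hg' τ hτ) (fun m => ?_) ?_
    · rw [(s1 τ).1, (s2 τ).1, hammingDist_repStr hc]
      exact (min_le_left _ _).trans (sh_le _ _ _)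
    · refine (min_le_right _ _).trans (Nat.succ_le_succ ?_)
      change k ≤ capa n k
      have h1 := Nat.lt_pow_succ_log_self (b := 2) (by norm_num) k
      have h2 : 2 ^ (Nat.log 2 k + 1) ≤ 2 ^ (Nat.log 2 k + 4) :=
        Nat.pow_le_pow_right (by norm_num) (by omega)
      have h3 : 2 ^ (Nat.log 2 k + 4) ≤ capa n k :=
        Nat.le_mul_of_pos_left _ (Nat.mul_pos (by norm_num) lg_pos)
      omega

/-- Union bound over the three failures: of the symbol hashes, of all anchors, and of some estimate.
Each has probability at most `1 / 2 ^ (lg n + 2)`. -/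
theorem isESDS_sketch {k : ℕ} (hk : 1 ≤ k) (hkn : k ≤ n) :
    IsESDS (n := n) (σ := σ) 1 k (fun ω S => sketch k ω S)
      fun ω x y => decode (readable n ω) n k (4000 * lg n) x y := by
  refine ⟨measurableSet_sketch k, measurableSet_decode k, fun S₁ S₂ => ?_⟩
  have hε : (0:ℝ) ≤ 1 / 2 ^ (lg n + 2) := by positivity
  have b1 := coinMeasure_symbolHash_le k (cyclic S₁) (cyclic S₂)
  have b3 := coinMeasure_goodEst_le hkn (cyclic S₁) (cyclic S₂)
  have b2 : coinMeasure {ω | ¬ (sh S₁ S₂ ≤ k → ∃ τ < reps n,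
      hammingDist (shift (repAnchor (fun x => ω (encoderPos n k σ x)) (cyclic S₁) τ) (cyclic S₁))
        (shift (repAnchor (fun x => ω (encoderPos n k σ x)) (cyclic S₂) τ) (cyclic S₂)) ≤
          capa n k)} ≤ ENNReal.ofReal (1 / 2 ^ (lg n + 2)) := by
    by_cases hle : sh S₁ S₂ ≤ k
    · obtain ⟨m, hm⟩ := exists_sh_eq S₁ S₂
      simpa only [hle, true_imp_iff] using coinMeasure_repAnchor_le (hm.le.trans hle)
    · simp [hle]
  refine (MeasureTheory.measure_mono fun ω hω => ?_).trans
    (((MeasureTheory.measure_union_le _ _).trans (add_le_add ((MeasureTheory.measure_union_le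
      _ _).trans (add_le_add b1 b2)) b3)).trans ?_)
  · by_contra hcon
    simp only [Set.mem_union, Set.mem_ofPred_eq, not_or, not_not] at hcon
    have h := decode_sketch hk hkn hcon.1.1 hcon.1.2 hcon.2
    exact hω ⟨fun hle => by rw [h]; omega, fun hlt => by rw [h]; omega⟩
  · rw [← ENNReal.ofReal_add hε hε, ← ENNReal.ofReal_add (add_nonneg hε hε) hε]
    refine ENNReal.ofReal_le_ofReal ?_
    have hn : (0:ℝ) < n := by exact_mod_cast Nat.pos_of_ne_zero (NeZero.ne n)
    rw [Real.rpow_neg hn.le, Real.rpow_one, ← one_div]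
    have h1 : (n : ℝ) ≤ 2 ^ lg n := by exact_mod_cast lt_two_pow_lg.le
    calc (1:ℝ) / 2 ^ (lg n + 2) + 1 / 2 ^ (lg n + 2) + 1 / 2 ^ (lg n + 2) =
          3 / 4 * (1 / 2 ^ lg n) := by rw [pow_add]; ring
      _ ≤ 1 * (1 / 2 ^ lg n) := by gcongr; norm_num
      _ ≤ 1 / n := by rw [one_mul]; exact one_div_le_one_div_of_le hn h1

/-- All sketches for the same `n` and `k` have the same length, so the bound holds with certainty.
-/
theorem hasSize_sketch {k : ℕ} (hk : 1 ≤ k) :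
    HasSize (n := n) (σ := σ) 1 (fun ω S => sketch k ω S) (costConst * k * lg n ^ 9) := by
  intro S
  have h : ∀ ω : Coins, (sketch k ω S).length ≤ costConst * k * lg n ^ 9 := by
    intro ω
    rw [sketch, length_encode, mul_assoc]
    exact (skLen_le_mul hk).trans (Nat.mul_le_mul_right _ (Nat.le_add_right _ _))
  simp [WithHighProb, h]

theorem hasDecodingTime_sketch {k : ℕ} (hk : 1 ≤ k) (hkn : k ≤ n) :
    HasDecodingTime decoder (4000 * lg n) (n := n) (σ := σ) k (fun ω S => sketch k ω S)
      (fun ω x y => decode (readable n ω) n k (4000 * lg n) x y)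
      (costConst * k ^ 2 * lg n ^ 9) := fun _ S₁ S₂ =>
  exec_decoder hk hkn (fun _ hi => readable_of_lt hi) (fun τ => (sketchData_spec k _ S₁ τ).2.2)
    fun τ => (sketchData_spec k _ S₂ τ).2.2

end Sketch

end ShiftSketch

theorem mainTheorem4 :
    ∃ (P : ShiftSketch.Prog) (a C d : ℕ) (c : ℝ), 0 < c ∧
      ∀ n k σ : ℕ, 1 ≤ k → k ≤ n →
        ∃ (sk : ShiftSketch.Coins → ShiftSketch.Str n σ → List Bool)
          (dec : ShiftSketch.Coins → List Bool → List Bool → ℕ),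
          ShiftSketch.IsESDS c k sk dec ∧
          ShiftSketch.HasSize c sk (C * k * (Nat.log 2 n + 1) ^ d) ∧
          ShiftSketch.HasDecodingTime P (a * (Nat.log 2 n + 1)) k sk dec
            (C * k ^ 2 * (Nat.log 2 n + 1) ^ d) := by
  refine ⟨ShiftSketch.decoder, 4000, ShiftSketch.costConst, 9, 1, one_pos,
    fun n k σ hk hkn => ?_⟩
  have : NeZero n := ⟨by omega⟩
  exact ⟨_, _, ShiftSketch.isESDS_sketch hk hkn, ShiftSketch.hasSize_sketch hk,
    ShiftSketch.hasDecodingTime_sketch hk hkn⟩
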